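/- Let $d\in\mathbb N$, $\alpha\in(0,2)$ with $\alpha<d$, let $\Omega\subset\mathbb R^d$ be open, and let $K:\mathbb R^d\times\mathbb R^d\to[0,\infty]$ be a measurable kernel with $K_s(x,y)=\frac12(K(x,y)+K(y,x))$, $K_a(x,y)=\frac12(K(x,y)-K(y,x))$, such that $x\mapsto\int_{\mathbb R^d}(|x-y|^2\wedge1)K_s(x,y)\,dy$ is in $L^1_{loc}(\mathbb R^d)$. For a symmetric kernel $k$ and $M\subset\mathbb R^d$ write $\mathcal E^k_M(v,v)=\int_M\int_M(v(x)-v(y))^2k(x,y)\,dy\,dx$. All balls are open, and $B_r=B_r(x_0)$ when no centre is written. Assumptions. * $(K^{\le}_{loc})$: there is $c>0$ such that $K(x,y)\le c|x-y|^{-d-\alpha}$ for all $x,y\in B_{2r}(z)$ and every ball $B_{2r}(z)\subset\Omega$ with $r\le1$. * (Cutoff) for a symmetric kernel $k$: there is $c>0$ such that for all $0<\rho\le r\le1$ and $z\in\Omega$ with $B_{r+\rho}(z)\subset\Omega$ there is a function $\tau$, radially decreasing about $z$, with $\operatorname{supp}\tau\subset\overline{B_{r+\rho}(z)}$, $0\le\tau\le1$,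 $\tau=1$ on $B_r(z)$, $|\nabla\tau|\le\frac32\rho^{-1}$, and $\sup_{x\in B_{r+\rho}(z)}\int_{\mathbb R^d}(\tau(x)-\tau(y))^2k(x,y)\,dy\le c\rho^{-\alpha}$. * (Sob): there is $c>0$ such that for every ball $B_{r+\rho}(z)\subset\Omega$ with $0<\rho\le r\le1$ and every $v\in L^2(B_{r+\rho}(z))$, $\|v^2\|_{L^{d/(d-\alpha)}(B_r(z))}\le c\,\mathcal E^{K_s}_{B_{r+\rho}(z)}(v,v)+c\rho^{-\alpha}\|v^2\|_{L^1(B_{r+\rho}(z))}$. * $(K1_{loc})$ with exponent $\theta$: there are a symmetric measurable kernel $J:\mathbb R^d\times\mathbb R^d\to[0,\infty]$ satisfying (Cutoff) and $C>0$ such that, for every ball $B=B_{2r}(z)\subset\Omega$ with $r\le1$, $\big\|\int_B\frac{|K_a(\cdot,y)|^2}{J(\cdot,y)}dy\big\|_{L^\theta(B)}\le C$ and $\mathcal E^J_B(v,v)\le C\mathcal E^{K_s}_B(v,v)$ for all $v\in L^2(B)$. * $(K1_{glob})$ with exponent $\theta$: the same with the first estimate replaced by $\big\|\int_{\mathbb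 R^d}\frac{|K_a(\cdot,y)|^2}{J(\cdot,y)}dy\big\|_{L^\theta(\mathbb R^d)}\le C$. Forms and subsolutions. Let $\mathcal E(u,v)=\iint(u(x)-u(y))(v(x)-v(y))K_s(x,y)\,dy\,dx+\iint(u(x)-u(y))(v(x)+v(y))K_a(x,y)\,dy\,dx$ and $\widehat{\mathcal E}(u,v)=\mathcal E(v,u)$. For an open set $D$ let $V(D|\mathbb R^d)$ be the space of measurable $v:\mathbb R^d\to\mathbb R$ with $\|v\|_{L^2(D)}^2+\int_D\int_{\mathbb R^d}(v(x)-v(y))^2K_s(x,y)\,dy\,dx<\infty$, and $H_D(\mathbb R^d)=\{v\in V(\mathbb R^d|\mathbb R^d):v=0\text{ on }\mathbb R^d\setminus D\}$. Let $I$ be a bounded open interval, $D$ bounded and $f\in L^\infty(I\times D)$. A function $u\in L^2_{loc}(I;V(D|\mathbb R^d))$ is a weak subsolution to $\partial_tu-Lu=f$ in $I\times D$ if the weak $L^2(D)$-derivative $\partial_tu\in L^1_{loc}(I;L^2(D))$ exists and, for a.e. $t\in I$, $(\partial_tu(t),\phi)_{L^2(D)}+\mathcal E(u(t),\phi)\le(f(t),\phi)_{L^2(D)}$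 for all $\phi\in H_D(\mathbb R^d)$ with $\phi\ge0$ for which $\mathcal E(u(t),\phi)$ converges absolutely. A weak subsolution to the dual equation $\partial_tu-\widehat Lu=f$ is defined in the same way with $\widehat{\mathcal E}$ instead of $\mathcal E$ and $u\in L^2_{loc}(I;V(D|\mathbb R^d)\cap L^{2\theta'}(\mathbb R^d))$, where $\frac1\theta+\frac1{\theta'}=1$. Nonnegative means $u\ge0$ a.e. in $I\times\mathbb R^d$. Put $I^\ominus_R=(t_0-R^\alpha,t_0)$ and $$\mathrm{Tail}_{K,\alpha}(v,R)=R^\alpha\int_{B_{2R}\setminus B_{R/2}}\frac{|v(y)|}{|x_0-y|^{d+\alpha}}dy+\sup_{x\in B_{3R/2}}\int_{\mathbb R^d\setminus B_{2R}}|v(y)|K(x,y)\,dy,$$ and let $\widehat{\mathrm{Tail}}_{K,\alpha}$ be defined with $K(y,x)$ instead of $K(x,y)$. Suprema of $u$ and suprema in $t$ are essential suprema; norms of $f$ are taken over $I_R^\ominus\times B_{2R}$; right-hand sides may be $+\infty$. Theorem. Assume $(K^{\le}_{loc})$, (Cutoff) for $K_s$, and (Sob). (i) Assume $(K1_{loc})$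 for some $\theta\in[\frac d\alpha,\infty]$. Let $A=\Omega$ if $\theta>\frac d\alpha$, and let $A$ be any compact subset of $\Omega$ if $\theta=\frac d\alpha$. Then there is $c>0$ such that for all $x_0\in A$, $t_0\in\mathbb R$, $0<R\le1$ with $B_{2R}\subset\Omega$, all $\delta\in(0,1]$, all $f\in L^\infty(I_R^\ominus\times B_{2R})$ and every nonnegative weak subsolution $u$ to $\partial_tu-Lu=f$ in $I_R^\ominus\times B_{2R}$, $$\sup_{I^\ominus_{R/8}\times B_{R/2}}u\le c\,\delta^{-\frac{d+\alpha}{2\alpha}}\Big(\frac1{|I^\ominus_{R/4}|}\int_{I^\ominus_{R/4}}\frac1{|B_R|}\int_{B_R}u^2(t,x)\,dx\,dt\Big)^{1/2}+\delta\sup_{t\in I^\ominus_{R/4}}\mathrm{Tail}_{K,\alpha}(u(t),R)+\delta R^\alpha\|f\|_{L^\infty}.$$ (ii) Assume $(K1_{glob})$ for some $\theta\in(\frac d\alpha,\infty]$. Put $\widetilde\kappa=1+\frac\alpha d-\frac1\theta>1$ and $\widetilde\kappa'=\frac{\widetilde\kappa}{\widetilde\kappa-1}$. Then there is $c>0$ such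 that for all $x_0\in\mathbb R^d$, $t_0\in\mathbb R$, $0<R\le1$ with $B_{2R}\subset\Omega$, all $\delta\in(0,1]$, all $f\in L^\infty(I_R^\ominus\times B_{2R})$ and every nonnegative weak subsolution $u$ to $\partial_tu-\widehat Lu=f$ in $I_R^\ominus\times B_{2R}$, $$\sup_{I^\ominus_{R/8}\times B_{R/2}}u\le c\,\delta^{-\frac{\widetilde\kappa'}2}\Big(\frac1{|I^\ominus_{R/4}|}\int_{I^\ominus_{R/4}}\Big(\frac1{|B_R|}\int_{B_R}u^{2\theta'}(t,x)\,dx\Big)^{\frac1{\theta'}}dt\Big)^{1/2}+\delta\sup_{t\in I^\ominus_{R/4}}\widehat{\mathrm{Tail}}_{K,\alpha}(u(t),R)+\delta R^\alpha\|f\|_{L^\infty}.$$ -/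

import Mathlib

open MeasureTheory Set
open scoped ENNReal NNReal

namespace NonlocalParabolic

/-- The Euclidean space `ℝ^d`. -/
abbrev Eu (d : ℕ) : Type := EuclideanSpace ℝ (Fin d)

variable {d : ℕ}

/-! ### Jumping kernels `K : ℝ^d × ℝ^d → [0, ∞]` -/

/-- The symmetric part `K_s(x,y) = (K(x,y) + K(y,x)) / 2`. -/
noncomputable def symPart (K : Eu d → Eu d → ℝ≥0∞) (x y : Eu d) : ℝ≥0∞ :=
  (K x y + K y x) / 2

/-- The antisymmetric part `K_a(x,y) = (K(x,y) - K(y,x)) / 2`, as a real number. (A kernel with the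
Lévy integrability below is finite almost everywhere on `ℝ^d × ℝ^d`, so that the conversion of
the value `∞` to a real number plays no role.) -/
noncomputable def antiPart (K : Eu d → Eu d → ℝ≥0∞) (x y : Eu d) : ℝ :=
  ((K x y).toReal - (K y x).toReal) / 2

/-- Lévy integrability: `x ↦ ∫ (|x - y|² ∧ 1) K_s(x,y) dy` belongs to `L¹_loc(ℝ^d)`. -/
def LevyIntegrable (K : Eu d → Eu d → ℝ≥0∞) : Prop :=
  ∀ C : Set (Eu d), IsCompact C →
    ∫⁻ x in C, ∫⁻ y, ENNReal.ofReal (min (dist x y ^ 2) 1) * symPart K x y < ∞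

/-- The energy `∫_A ∫_B (v(x) - v(y))² k(x,y) dy dx ∈ [0, ∞]` of a symmetric kernel `k`. -/
noncomputable def energy (k : Eu d → Eu d → ℝ≥0∞) (A B : Set (Eu d)) (v : Eu d → ℝ) : ℝ≥0∞ :=
  ∫⁻ x in A, ∫⁻ y in B, ENNReal.ofReal ((v x - v y) ^ 2) * k x y

/-- The carré du champ `Γ^k(τ,τ)(x) = ∫ (τ(x) - τ(y))² k(x,y) dy`. -/
noncomputable def carreDuChamp (k : Eu d → Eu d → ℝ≥0∞) (τ : Eu d → ℝ) (x : Eu d) : ℝ≥0∞ :=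
  ∫⁻ y, ENNReal.ofReal ((τ x - τ y) ^ 2) * k x y

/-! ### Assumptions on the kernel -/

/-- `τ` is a radially decreasing cutoff function between `B_r(z)` and `B_{r+ρ}(z)`, with
`|∇ τ| ≤ (3/2) ρ⁻¹`. -/
structure IsCutoff (z : Eu d) (r ρ : ℝ) (τ : Eu d → ℝ) : Prop where
  radial : ∃ g : ℝ → ℝ, AntitoneOn g (Ici 0) ∧ ∀ x, τ x = g (dist x z)
  support_subset : tsupport τ ⊆ closure (Metric.ball z (r + ρ))
  nonneg : ∀ x, 0 ≤ τ x
  le_one : ∀ x, τ x ≤ 1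
  eq_one : ∀ x ∈ Metric.ball z r, τ x = 1
  lipschitz : LipschitzWith (Real.toNNReal (3 / 2 * ρ⁻¹)) τ

/-- The assumption (Cutoff), for a symmetric kernel `k`. -/
def CutoffCondition (k : Eu d → Eu d → ℝ≥0∞) (Ω : Set (Eu d)) (α : ℝ) : Prop :=
  ∃ c : ℝ, 0 < c ∧ ∀ (r ρ : ℝ) (z : Eu d), 0 < ρ → ρ ≤ r → r ≤ 1 → z ∈ Ω →
    Metric.ball z (r + ρ) ⊆ Ω →
    ∃ τ : Eu d → ℝ, IsCutoff z r ρ τ ∧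
      ∀ x ∈ Metric.ball z (r + ρ), carreDuChamp k τ x ≤ ENNReal.ofReal (c * ρ ^ (-α))

/-- The Sobolev inequality (Sob). -/
def SobolevCondition (K : Eu d → Eu d → ℝ≥0∞) (Ω : Set (Eu d)) (α : ℝ) : Prop :=
  ∃ c : ℝ, 0 < c ∧ ∀ (r ρ : ℝ) (z : Eu d), 0 < ρ → ρ ≤ r → r ≤ 1 →
    Metric.ball z (r + ρ) ⊆ Ω →
    ∀ v : Eu d → ℝ, MemLp v 2 (volume.restrict (Metric.ball z (r + ρ))) →
      eLpNorm (fun x => v x ^ 2) (ENNReal.ofReal (d / (d - α)))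
          (volume.restrict (Metric.ball z r)) ≤
        ENNReal.ofReal c *
            energy (symPart K) (Metric.ball z (r + ρ)) (Metric.ball z (r + ρ)) v +
          ENNReal.ofReal (c * ρ ^ (-α)) *
            eLpNorm (fun x => v x ^ 2) 1 (volume.restrict (Metric.ball z (r + ρ)))

/-- The local upper bound `K(x,y) ≤ c |x-y|^{-d-α}` (the right-hand side is `∞` if `x = y`). -/
def KernelUpperLoc (K : Eu d → Eu d → ℝ≥0∞) (Ω : Set (Eu d)) (α : ℝ) : Prop :=
  ∃ c : ℝ, 0 < c ∧ ∀ (r : ℝ) (z : Eu d), 0 < r → r ≤ 1 → Metric.ball z (2 * r) ⊆ Ω →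
    ∀ x ∈ Metric.ball z (2 * r), ∀ y ∈ Metric.ball z (2 * r),
      K x y ≤ ENNReal.ofReal c * edist x y ^ (-(d : ℝ) - α)

/-- `∫_B |K_a(x,y)|² / J(x,y) dy`, with `0 / 0 = 0`. -/
noncomputable def driftDensity (K J : Eu d → Eu d → ℝ≥0∞) (B : Set (Eu d)) (x : Eu d) : ℝ≥0∞ :=
  ∫⁻ y in B, ‖antiPart K x y‖ₑ ^ 2 / J x y

/-- `J` is a symmetric jumping kernel satisfying (Cutoff). -/
structure IsSymmetricCutoffKernel (J : Eu d → Eu d → ℝ≥0∞) (Ω : Set (Eu d)) (α : ℝ) : Prop where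
  measurable : Measurable (Function.uncurry J)
  symm : ∀ x y, J x y = J y x
  cutoff : CutoffCondition J Ω α

/-- The assumption (K1_loc). -/
def K1Loc (K : Eu d → Eu d → ℝ≥0∞) (Ω : Set (Eu d)) (α : ℝ) (θ : ℝ≥0∞) : Prop :=
  ∃ J : Eu d → Eu d → ℝ≥0∞, IsSymmetricCutoffKernel J Ω α ∧
    ∃ C : ℝ, 0 < C ∧ ∀ (r : ℝ) (z : Eu d), 0 < r → r ≤ 1 → Metric.ball z (2 * r) ⊆ Ω →
      eLpNorm (driftDensity K J (Metric.ball z (2 * r))) θ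
          (volume.restrict (Metric.ball z (2 * r))) ≤ ENNReal.ofReal C ∧
      ∀ v : Eu d → ℝ, MemLp v 2 (volume.restrict (Metric.ball z (2 * r))) →
        energy J (Metric.ball z (2 * r)) (Metric.ball z (2 * r)) v ≤
          ENNReal.ofReal C *
            energy (symPart K) (Metric.ball z (2 * r)) (Metric.ball z (2 * r)) v

/-- The assumption (K1_glob). -/
def K1Glob (K : Eu d → Eu d → ℝ≥0∞) (Ω : Set (Eu d)) (α : ℝ) (θ : ℝ≥0∞) : Prop :=
  ∃ J : Eu d → Eu d → ℝ≥0∞, IsSymmetricCutoffKernel J Ω α ∧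
    ∃ C : ℝ, 0 < C ∧ ∀ (r : ℝ) (z : Eu d), 0 < r → r ≤ 1 → Metric.ball z (2 * r) ⊆ Ω →
      eLpNorm (driftDensity K J univ) θ volume ≤ ENNReal.ofReal C ∧
      ∀ v : Eu d → ℝ, MemLp v 2 (volume.restrict (Metric.ball z (2 * r))) →
        energy J (Metric.ball z (2 * r)) (Metric.ball z (2 * r)) v ≤
          ENNReal.ofReal C *
            energy (symPart K) (Metric.ball z (2 * r)) (Metric.ball z (2 * r)) v

/-! ### Function spaces, the bilinear form, weak subsolutions -/

/-- The square of the norm of `V(D|ℝ^d)`. -/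
noncomputable def normSqV (K : Eu d → Eu d → ℝ≥0∞) (D : Set (Eu d)) (v : Eu d → ℝ) : ℝ≥0∞ :=
  eLpNorm v 2 (volume.restrict D) ^ 2 + energy (symPart K) D univ v

/-- `v ∈ V(D|ℝ^d)`. -/
def MemV (K : Eu d → Eu d → ℝ≥0∞) (D : Set (Eu d)) (v : Eu d → ℝ) : Prop :=
  AEMeasurable v ∧ normSqV K D v < ∞

/-- `v ∈ H_D(ℝ^d)`: `v ∈ V(ℝ^d|ℝ^d)` and `v = 0` outside `D`. -/
def MemH (K : Eu d → Eu d → ℝ≥0∞) (D : Set (Eu d)) (v : Eu d → ℝ) : Prop :=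
  MemV K univ v ∧ ∀ x ∉ D, v x = 0

/-- The integrand `(u(x) - u(y)) (v(x) - v(y)) K_s(x,y)`. -/
noncomputable def symIntegrand (K : Eu d → Eu d → ℝ≥0∞) (u v : Eu d → ℝ) (p : Eu d × Eu d) : ℝ :=
  (u p.1 - u p.2) * (v p.1 - v p.2) * (symPart K p.1 p.2).toReal

/-- The integrand `(u(x) - u(y)) (v(x) + v(y)) K_a(x,y)`. -/
noncomputable def antiIntegrand (K : Eu d → Eu d → ℝ≥0∞) (u v : Eu d → ℝ) (p : Eu d × Eu d) : ℝ :=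
  (u p.1 - u p.2) * (v p.1 + v p.2) * antiPart K p.1 p.2

/-- `ℰ(u,v)` is well defined: the integrals `ℰ^{K_s}(u,v)` and `ℰ^{K_a}(u,v)` converge
absolutely. -/
def FormDefined (K : Eu d → Eu d → ℝ≥0∞) (u v : Eu d → ℝ) : Prop :=
  Integrable (symIntegrand K u v) ∧ Integrable (antiIntegrand K u v)

/-- The bilinear form `ℰ(u,v) = ℰ^{K_s}(u,v) + ℰ^{K_a}(u,v)`. The dual form is
`(u,v) ↦ ℰ(v,u)`. -/
noncomputable def form (K : Eu d → Eu d → ℝ≥0∞) (u v : Eu d → ℝ) : ℝ :=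
  (∫ p, symIntegrand K u v p) + ∫ p, antiIntegrand K u v p

/-- `u ∈ L²_loc(I; V(D|ℝ^d))`. -/
def MemL2locV (K : Eu d → Eu d → ℝ≥0∞) (I : Set ℝ) (D : Set (Eu d)) (u : ℝ → Eu d → ℝ) : Prop :=
  AEMeasurable (Function.uncurry u) ((volume.restrict I).prod volume) ∧
    ∀ I' : Set ℝ, IsCompact I' → I' ⊆ I → ∫⁻ t in I', normSqV K D (u t) < ∞

/-- `g` is the weak `L²(D)`-derivative `∂_t u` on `I`, and `g ∈ L¹_loc(I; L²(D))`. The identity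
`∫ η' u dt = - ∫ η g dt` in `L²(D)` is written out as an identity at almost every `x ∈ D`. -/
def IsWeakTimeDeriv (I : Set ℝ) (D : Set (Eu d)) (u g : ℝ → Eu d → ℝ) : Prop :=
  AEMeasurable (Function.uncurry g) ((volume.restrict I).prod (volume.restrict D)) ∧
    (∀ I' : Set ℝ, IsCompact I' → I' ⊆ I →
      ∫⁻ t in I', eLpNorm (g t) 2 (volume.restrict D) < ∞) ∧
    ∀ η : ℝ → ℝ, ContDiff ℝ (⊤ : ℕ∞) η → HasCompactSupport η → tsupport η ⊆ I →
      ∀ᵐ x ∂(volume.restrict D), ∫ t in I, deriv η t * u t x = - ∫ t in I, η t * g t x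

/-- `u` is a weak subsolution to `∂_t u - L u = f` in `I × D`. The inequality is required for
all nonnegative test functions for which `ℰ(u(t), φ)` is well defined. -/
def IsWeakSubsolution (K : Eu d → Eu d → ℝ≥0∞) (I : Set ℝ) (D : Set (Eu d))
    (f u : ℝ → Eu d → ℝ) : Prop :=
  MemL2locV K I D u ∧
    ∃ g : ℝ → Eu d → ℝ, IsWeakTimeDeriv I D u g ∧
      ∀ᵐ t ∂(volume.restrict I), ∀ φ : Eu d → ℝ, MemH K D φ → (∀ x, 0 ≤ φ x) →
        FormDefined K (u t) φ →
        (∫ x in D, g t x * φ x) + form K (u t) φ ≤ ∫ x in D, f t x * φ x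

/-- `u` is a weak subsolution to the dual equation `∂_t u - L̂ u = f` in `I × D`, where
`u ∈ L²_loc(I; V(D|ℝ^d) ∩ L^{2θ'}(ℝ^d))`. -/
def IsWeakSubsolutionDual (K : Eu d → Eu d → ℝ≥0∞) (θ : ℝ≥0∞) (I : Set ℝ) (D : Set (Eu d))
    (f u : ℝ → Eu d → ℝ) : Prop :=
  MemL2locV K I D u ∧
    (∀ I' : Set ℝ, IsCompact I' → I' ⊆ I →
      ∫⁻ t in I', eLpNorm (u t) (2 * θ.conjExponent) volume ^ 2 < ∞) ∧
    ∃ g : ℝ → Eu d → ℝ, IsWeakTimeDeriv I D u g ∧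
      ∀ᵐ t ∂(volume.restrict I), ∀ φ : Eu d → ℝ, MemH K D φ → (∀ x, 0 ≤ φ x) →
        FormDefined K φ (u t) →
        (∫ x in D, g t x * φ x) + form K φ (u t) ≤ ∫ x in D, f t x * φ x

/-! ### Cylinders and tails -/

/-- The interval `I_R^⊖(t₀) = (t₀ - R^α, t₀)`. -/
def pastInterval (α t₀ R : ℝ) : Set ℝ := Ioo (t₀ - R ^ α) t₀

/-- The nonlocal tail `Tail_{K,α}(v, R, x₀)`. The dual tail is that of `(x,y) ↦ K(y,x)`. -/
noncomputable def tail (K : Eu d → Eu d → ℝ≥0∞) (α : ℝ) (v : Eu d → ℝ) (R : ℝ) (x₀ : Eu d) :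
    ℝ≥0∞ :=
  ENNReal.ofReal (R ^ α) *
      (∫⁻ y in Metric.ball x₀ (2 * R) \ Metric.ball x₀ (R / 2),
        ‖v y‖ₑ / edist x₀ y ^ ((d : ℝ) + α)) +
    ⨆ x ∈ Metric.ball x₀ (3 * R / 2), ∫⁻ y in (Metric.ball x₀ (2 * R))ᶜ, ‖v y‖ₑ * K x y

end NonlocalParabolic

namespace NonlocalParabolic

/-! ### Elementary facts on jumping kernels -/

section Kernel

variable {d : ℕ}

theorem symPart_comm (K : Eu d → Eu d → ℝ≥0∞) (x y : Eu d) : symPart K x y = symPart K y x := by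
  simp only [symPart, add_comm]

theorem antiPart_comm (K : Eu d → Eu d → ℝ≥0∞) (x y : Eu d) : antiPart K x y = -antiPart K y x := by
  simp only [antiPart]; ring

theorem measurable_swap_kernel {K : Eu d → Eu d → ℝ≥0∞} (hK : Measurable (Function.uncurry K)) :
    Measurable (Function.uncurry fun x y => K y x) :=
  hK.comp measurable_swap

theorem measurable_symPart {K : Eu d → Eu d → ℝ≥0∞} (hK : Measurable (Function.uncurry K)) :
    Measurable (Function.uncurry (symPart K)) :=
  (hK.add (measurable_swap_kernel hK)).div_const 2

theorem measurable_antiPart {K : Eu d → Eu d → ℝ≥0∞} (hK : Measurable (Function.uncurry K)) :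
    Measurable (Function.uncurry (antiPart K)) :=
  (hK.ennreal_toReal.sub (measurable_swap_kernel hK).ennreal_toReal).div_const 2

theorem toReal_symPart {K : Eu d → Eu d → ℝ≥0∞} {x y : Eu d} (h : K x y ≠ ∞) (h' : K y x ≠ ∞) :
    (symPart K x y).toReal = ((K x y).toReal + (K y x).toReal) / 2 := by
  rw [symPart, ENNReal.toReal_div, ENNReal.toReal_add h h']
  norm_num

theorem symPart_ne_top {K : Eu d → Eu d → ℝ≥0∞} {x y : Eu d} (h : K x y ≠ ∞) (h' : K y x ≠ ∞) :
    symPart K x y ≠ ∞ :=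
  ENNReal.div_ne_top (ENNReal.add_ne_top.2 ⟨h, h'⟩) (by norm_num)

theorem abs_antiPart_le {K : Eu d → Eu d → ℝ≥0∞} {x y : Eu d} (h : K x y ≠ ∞) (h' : K y x ≠ ∞) :
    |antiPart K x y| ≤ (symPart K x y).toReal := by
  rw [toReal_symPart h h', antiPart, abs_le]
  have h1 : 0 ≤ (K x y).toReal := ENNReal.toReal_nonneg
  have h2 : 0 ≤ (K y x).toReal := ENNReal.toReal_nonneg
  constructor <;> linarith

theorem enorm_antiPart_le (K : Eu d → Eu d → ℝ≥0∞) (x y : Eu d) :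
    ‖antiPart K x y‖ₑ ≤ symPart K x y := by
  by_cases h : K x y = ∞
  · simp [symPart, h, ENNReal.top_div]
  by_cases h' : K y x = ∞
  · simp [symPart, h', ENNReal.top_div]
  rw [Real.enorm_eq_ofReal_abs]
  exact ENNReal.ofReal_le_of_le_toReal (abs_antiPart_le h h')

/-- A Lévy integrable kernel is finite almost everywhere. -/
theorem LevyIntegrable.ae_ne_top {K : Eu d → Eu d → ℝ≥0∞} (hd : 0 < d)
    (hK : Measurable (Function.uncurry K)) (h : LevyIntegrable K) :
    ∀ᵐ p : Eu d × Eu d, K p.1 p.2 ≠ ∞ ∧ K p.2 p.1 ≠ ∞ := by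
  have : Nonempty (Fin d) := ⟨⟨0, hd⟩⟩
  have hs := measurable_symPart hK
  have hmin : Measurable fun p : Eu d × Eu d => ENNReal.ofReal (min (dist p.1 p.2 ^ 2) 1) := by
    fun_prop
  have hm : Measurable fun p : Eu d × Eu d =>
      ENNReal.ofReal (min (dist p.1 p.2 ^ 2) 1) * symPart K p.1 p.2 := hmin.mul hs
  have key : ∀ᵐ x : Eu d, ∀ᵐ y : Eu d, K x y ≠ ∞ ∧ K y x ≠ ∞ := by
    have h1 : ∀ n : ℕ, ∀ᵐ x : Eu d, x ∈ Metric.closedBall (0 : Eu d) n →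
        ∫⁻ y, ENNReal.ofReal (min (dist x y ^ 2) 1) * symPart K x y < ∞ := by
      intro n
      have := h _ (isCompact_closedBall (0 : Eu d) n)
      exact (ae_restrict_iff' measurableSet_closedBall).1
        (ae_lt_top hm.lintegral_prod_right' this.ne)
    filter_upwards [ae_all_iff.2 h1] with x hx
    obtain ⟨n, hn⟩ := exists_nat_ge ‖x‖
    have h2 := ae_lt_top (hm.comp measurable_prodMk_left) (hx n (by simpa using hn)).ne
    have h3 : ∀ᵐ y : Eu d, y ≠ x := by
      rw [ae_iff]; simp
    filter_upwards [h2, h3] with y hy hyx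
    have hpos : ENNReal.ofReal (min (dist x y ^ 2) 1) ≠ 0 := by
      have : 0 < dist x y := dist_pos.2 hyx.symm
      rw [Ne, ENNReal.ofReal_eq_zero, not_le]; positivity
    have h4 : symPart K x y ≠ ∞ := by
      intro htop
      have hy' : ENNReal.ofReal (min (dist x y ^ 2) 1) * symPart K x y < ∞ := hy
      rw [htop, ENNReal.mul_top hpos] at hy'
      exact lt_irrefl _ hy'
    constructor
    · intro htop; exact h4 (by simp [symPart, htop, ENNReal.top_div])
    · intro htop; exact h4 (by simp [symPart, htop, ENNReal.top_div])
  refine (Measure.ae_prod_iff_ae_ae ?_).2 key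
  have hK' := measurable_swap_kernel hK
  exact ((hK (measurableSet_singleton ∞)).compl).inter ((hK' (measurableSet_singleton ∞)).compl)

theorem measurable_drift {K J : Eu d → Eu d → ℝ≥0∞} (hK : Measurable (Function.uncurry K))
    (hJ : Measurable (Function.uncurry J)) :
    Measurable fun p : Eu d × Eu d => ‖antiPart K p.1 p.2‖ₑ ^ 2 / J p.1 p.2 :=
  ((measurable_antiPart hK).enorm.pow_const 2).div hJ

theorem measurable_driftDensity {K J : Eu d → Eu d → ℝ≥0∞} (hK : Measurable (Function.uncurry K))
    (hJ : Measurable (Function.uncurry J)) (B : Set (Eu d)) : Measurable (driftDensity K J B) :=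
  (measurable_drift hK hJ).lintegral_prod_right'

theorem driftDensity_mono (K J : Eu d → Eu d → ℝ≥0∞) {B B' : Set (Eu d)} (h : B ⊆ B') (x : Eu d) :
    driftDensity K J B x ≤ driftDensity K J B' x :=
  lintegral_mono_set h

theorem measurable_energyIntegrand {k : Eu d → Eu d → ℝ≥0∞} (hk : Measurable (Function.uncurry k))
    {v : Eu d → ℝ} (hv : Measurable v) :
    Measurable fun p : Eu d × Eu d => ENNReal.ofReal ((v p.1 - v p.2) ^ 2) * k p.1 p.2 :=
  Measurable.mul (by fun_prop) hk

theorem energy_eq_lintegral {k : Eu d → Eu d → ℝ≥0∞} (hk : Measurable (Function.uncurry k))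
    {v : Eu d → ℝ} (hv : Measurable v) (A B : Set (Eu d)) :
    energy k A B v = ∫⁻ p in A ×ˢ B, ENNReal.ofReal ((v p.1 - v p.2) ^ 2) * k p.1 p.2 := by
  rw [energy, Measure.volume_eq_prod, ← Measure.prod_restrict,
    lintegral_prod _ (measurable_energyIntegrand hk hv).aemeasurable]

/-! ### The carré du champ of a cutoff function -/

theorem integrable_min_sq_one_mul_rpow (hd : 0 < d) {α : ℝ} (hα0 : 0 < α) (hα2 : α < 2) :
    Integrable fun h : Eu d => min (‖h‖ ^ 2) 1 * ‖h‖ ^ (-(d : ℝ) - α) := by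
  have : Nonempty (Fin d) := ⟨⟨0, hd⟩⟩
  have : Nontrivial (Eu d) := inferInstance
  rw [integrable_fun_norm_addHaar volume (f := fun y : ℝ => min (y ^ 2) 1 * y ^ (-(d : ℝ) - α))]
  have hdim : Module.finrank ℝ (Eu d) = d := by simp
  rw [hdim]
  have hpow : ∀ y : ℝ, 0 < y → y ^ (d - 1) = y ^ ((d : ℝ) - 1) := by
    intro y hy
    rw [← Real.rpow_natCast, Nat.cast_sub hd, Nat.cast_one]
  have hu : Ioi (0 : ℝ) = Ioc 0 1 ∪ Ioi 1 := (Ioc_union_Ioi_eq_Ioi zero_le_one).symm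
  rw [hu]
  refine IntegrableOn.union ?_ ?_
  · have h1 : IntegrableOn (fun y : ℝ => y ^ (1 - α)) (Ioc 0 1) := by
      rw [← intervalIntegrable_iff_integrableOn_Ioc_of_le zero_le_one]
      exact intervalIntegral.intervalIntegrable_rpow' (by linarith)
    refine h1.congr_fun (fun y hy => ?_) measurableSet_Ioc
    have hy0 : 0 < y := hy.1
    have : min (y ^ 2) 1 = y ^ (2 : ℝ) := by
      rw [min_eq_left (pow_le_one₀ hy0.le hy.2), Real.rpow_two]
    simp only [smul_eq_mul]
    rw [this, hpow y hy0, ← Real.rpow_add hy0, ← Real.rpow_add hy0]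
    congr 1; ring
  · have h1 : IntegrableOn (fun y : ℝ => y ^ (-1 - α)) (Ioi 1) :=
      integrableOn_Ioi_rpow_of_lt (by linarith) zero_lt_one
    refine h1.congr_fun (fun y hy => ?_) measurableSet_Ioi
    have hy1 : (1 : ℝ) < y := hy
    have hy0 : 0 < y := by linarith
    have : min (y ^ 2) 1 = 1 := min_eq_right (one_le_pow₀ hy1.le)
    simp only [smul_eq_mul]
    rw [this, hpow y hy0, one_mul, ← Real.rpow_add hy0]
    congr 1; ring

theorem exists_lintegral_min_sq_one_le (hd : 0 < d) {α : ℝ} (hα0 : 0 < α) (hα2 : α < 2) :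
    ∃ c : ℝ, 0 < c ∧ ∀ (A : ℝ), 0 < A → ∀ x : Eu d,
      ∫⁻ y, ENNReal.ofReal (min ((A * dist x y) ^ 2) 1) * edist x y ^ (-(d : ℝ) - α) ≤
        ENNReal.ofReal (c * A ^ α) := by
  have hint := integrable_min_sq_one_mul_rpow hd hα0 hα2
  set F : Eu d → ℝ := fun h => min (‖h‖ ^ 2) 1 * ‖h‖ ^ (-(d : ℝ) - α) with hF
  have hFnn : ∀ h, 0 ≤ F h := fun h => by positivity
  refine ⟨(∫ h, F h) + 1, by have : 0 ≤ ∫ h, F h := integral_nonneg hFnn; positivity, ?_⟩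
  intro A hA x
  have hne : -(d : ℝ) - α ≠ 0 := by
    have : (0 : ℝ) < d := by exact_mod_cast hd
    linarith
  have hpt : ∀ y : Eu d, ENNReal.ofReal (min ((A * dist x y) ^ 2) 1) *
      edist x y ^ (-(d : ℝ) - α) = ENNReal.ofReal (A ^ ((d : ℝ) + α) * F (A • (x - y))) := by
    intro y
    rcases eq_or_ne x y with rfl | hxy
    · simp [hF]
    · have hpos : 0 < ‖x - y‖ := norm_pos_iff.2 (sub_ne_zero.2 hxy)
      rw [edist_dist, ENNReal.ofReal_rpow_of_pos (by rwa [dist_eq_norm]),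
        ← ENNReal.ofReal_mul (by positivity)]
      congr 1
      simp only [hF, norm_smul, Real.norm_eq_abs, abs_of_pos hA, dist_eq_norm]
      rw [Real.mul_rpow hA.le hpos.le, show -(d : ℝ) - α = -((d : ℝ) + α) by ring,
        Real.rpow_neg hA.le]
      have : A ^ ((d : ℝ) + α) ≠ 0 := by positivity
      field_simp
  simp_rw [hpt]
  have hint2 : Integrable fun y : Eu d => A ^ ((d : ℝ) + α) * F (A • (x - y)) := by
    have := (hint.comp_smul hA.ne').comp_sub_left x
    exact this.const_mul _
  rw [← ofReal_integral_eq_lintegral_ofReal hint2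
    (Filter.Eventually.of_forall fun y => mul_nonneg (by positivity) (hFnn _))]
  apply ENNReal.ofReal_le_ofReal
  rw [integral_const_mul, integral_sub_left_eq_self (fun y => F (A • y)) volume x,
    Measure.integral_comp_smul]
  have hdim : Module.finrank ℝ (Eu d) = d := by simp
  rw [hdim, abs_of_pos (by positivity), smul_eq_mul, ← mul_assoc, Real.rpow_add hA,
    Real.rpow_natCast]
  have : A ^ d ≠ 0 := by positivity
  rw [show A ^ d * A ^ α * (A ^ d)⁻¹ = A ^ α by field_simp, mul_comm]
  have : 0 ≤ A ^ α := by positivity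
  nlinarith

theorem IsCutoff.eq_zero {z : Eu d} {r ρ : ℝ} {τ : Eu d → ℝ} (h : IsCutoff z r ρ τ)
    (hr : 0 < r + ρ) {x : Eu d} (hx : x ∉ Metric.ball z (r + ρ)) : τ x = 0 := by
  have hx' : r + ρ ≤ dist x z := by simpa using hx
  have hxz : 0 < dist x z := hr.trans_le hx'
  have hcont : Continuous τ := h.lipschitz.continuous
  have hz : ∀ n : ℕ, τ (x + (1 / ((n : ℝ) + 1)) • (x - z)) = 0 := by
    intro n
    by_contra hne
    have hmem := h.support_subset (subset_tsupport _ hne)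
    have := Metric.closure_ball_subset_closedBall hmem
    have hn : (0 : ℝ) < 1 / ((n : ℝ) + 1) := by positivity
    rw [Metric.mem_closedBall, dist_eq_norm,
      show x + (1 / ((n : ℝ) + 1)) • (x - z) - z = (1 + 1 / ((n : ℝ) + 1)) • (x - z) by module,
      norm_smul, Real.norm_eq_abs, abs_of_pos (by positivity), ← dist_eq_norm] at this
    nlinarith
  have hlim : Filter.Tendsto (fun n : ℕ => x + (1 / ((n : ℝ) + 1)) • (x - z)) Filter.atTop
      (nhds (x + (0 : ℝ) • (x - z))) :=
    tendsto_const_nhds.add (tendsto_one_div_add_atTop_nhds_zero_nat.smul_const _)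
  rw [zero_smul, add_zero] at hlim
  have h2 := (hcont.tendsto x).comp hlim
  exact tendsto_nhds_unique h2 (tendsto_const_nhds.congr fun n => (hz n).symm)

theorem exists_lintegral_compl_ball_le {K : Eu d → Eu d → ℝ≥0∞} {Ω : Set (Eu d)} {α : ℝ}
    (hCutoff : CutoffCondition (symPart K) Ω α) :
    ∃ c : ℝ, 0 < c ∧ ∀ (x₀ : Eu d) (R : ℝ), 0 < R → R ≤ 1 → Metric.ball x₀ (2 * R) ⊆ Ω →
      ∀ x ∈ Metric.ball x₀ R, ∫⁻ y in (Metric.ball x₀ (2 * R))ᶜ, symPart K x y ≤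
        ENNReal.ofReal (c * R ^ (-α)) := by
  obtain ⟨c, hc, H⟩ := hCutoff
  refine ⟨c, hc, fun x₀ R hR hR1 hsub x hx => ?_⟩
  rw [two_mul] at hsub ⊢
  obtain ⟨τ, hτ, hΓ⟩ := H R R x₀ hR le_rfl hR1 (hsub (Metric.mem_ball_self (by positivity))) hsub
  have hx2 : x ∈ Metric.ball x₀ (R + R) := Metric.ball_subset_ball (by linarith) hx
  refine le_trans ?_ (hΓ x hx2)
  rw [carreDuChamp]
  refine le_trans ?_ (setLIntegral_le_lintegral (Metric.ball x₀ (R + R))ᶜ _)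
  refine setLIntegral_mono' measurableSet_ball.compl fun y hy => ?_
  rw [hτ.eq_one x hx, hτ.eq_zero (by linarith) hy]
  simp

/-- Every Lipschitz function with values in `[0,1]` has the right carré du champ bound with
respect to `K_s` in the interior of a ball. -/
theorem exists_carreDuChamp_symPart_le {K : Eu d → Eu d → ℝ≥0∞} {Ω : Set (Eu d)} {α : ℝ}
    (hd : 0 < d) (hα0 : 0 < α) (hα2 : α < 2) (hUpper : KernelUpperLoc K Ω α)
    (hCutoff : CutoffCondition (symPart K) Ω α) :
    ∃ c : ℝ, 0 < c ∧ ∀ (x₀ : Eu d) (R ρ : ℝ) (τ : Eu d → ℝ), 0 < R → R ≤ 1 →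
      Metric.ball x₀ (2 * R) ⊆ Ω → 0 < ρ → ρ ≤ R →
      LipschitzWith (Real.toNNReal (3 / 2 * ρ⁻¹)) τ → (∀ x, 0 ≤ τ x) → (∀ x, τ x ≤ 1) →
      ∀ x ∈ Metric.ball x₀ R, carreDuChamp (symPart K) τ x ≤ ENNReal.ofReal (c * ρ ^ (-α)) := by
  obtain ⟨c₁, hc₁, H₁⟩ := hUpper
  obtain ⟨c₂, hc₂, H₂⟩ := exists_lintegral_compl_ball_le hCutoff
  obtain ⟨c₃, hc₃, H₃⟩ := exists_lintegral_min_sq_one_le hd hα0 hα2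
  refine ⟨c₁ * (c₃ * (3 / 2) ^ α) + c₂, by positivity, ?_⟩
  intro x₀ R ρ τ hR hR1 hsub hρ hρR hlip h0 h1 x hx
  have hxB : x ∈ Metric.ball x₀ (2 * R) := Metric.ball_subset_ball (by linarith) hx
  have hsq : ∀ y, (τ x - τ y) ^ 2 ≤ min ((3 / 2 * ρ⁻¹ * dist x y) ^ 2) 1 := by
    intro y
    refine le_min ?_ ?_
    · have := hlip.dist_le_mul x y
      rw [Real.coe_toNNReal _ (by positivity), Real.dist_eq] at this
      rw [← sq_abs]
      exact pow_le_pow_left₀ (abs_nonneg _) this 2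
    · rw [← sq_abs]
      refine pow_le_one₀ (abs_nonneg _) ?_
      rw [abs_le]
      constructor <;> linarith [h0 x, h0 y, h1 x, h1 y]
  rw [carreDuChamp, ← lintegral_add_compl _ (measurableSet_ball (x := x₀) (ε := 2 * R))]
  have hin : ∫⁻ y in Metric.ball x₀ (2 * R), ENNReal.ofReal ((τ x - τ y) ^ 2) * symPart K x y ≤
      ENNReal.ofReal (c₁ * (c₃ * (3 / 2) ^ α) * ρ ^ (-α)) := by
    calc _ ≤ ∫⁻ y in Metric.ball x₀ (2 * R), ENNReal.ofReal c₁ *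
          (ENNReal.ofReal (min ((3 / 2 * ρ⁻¹ * dist x y) ^ 2) 1) *
            edist x y ^ (-(d : ℝ) - α)) := by
          refine setLIntegral_mono' measurableSet_ball fun y hy => ?_
          have hk : symPart K x y ≤ ENNReal.ofReal c₁ * edist x y ^ (-(d : ℝ) - α) := by
            rw [symPart, ENNReal.div_le_iff (by norm_num) (by norm_num), mul_two]
            refine add_le_add (H₁ R x₀ hR hR1 hsub x hxB y hy) ?_
            rw [edist_comm]
            exact H₁ R x₀ hR hR1 hsub y hy x hxB
          calc _ ≤ ENNReal.ofReal (min ((3 / 2 * ρ⁻¹ * dist x y) ^ 2) 1) *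
                (ENNReal.ofReal c₁ * edist x y ^ (-(d : ℝ) - α)) := by
                gcongr; exact hsq y
            _ = _ := by ring
      _ ≤ ENNReal.ofReal c₁ * ENNReal.ofReal (c₃ * (3 / 2 * ρ⁻¹) ^ α) := by
          rw [lintegral_const_mul' _ _ ENNReal.ofReal_ne_top]
          gcongr
          exact (setLIntegral_le_lintegral _ _).trans (H₃ _ (by positivity) x)
      _ = _ := by
          rw [← ENNReal.ofReal_mul hc₁.le, Real.mul_rpow (by norm_num) (by positivity),
            Real.inv_rpow hρ.le, ← Real.rpow_neg hρ.le]
          congr 1; ring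
  have hout : ∫⁻ y in (Metric.ball x₀ (2 * R))ᶜ, ENNReal.ofReal ((τ x - τ y) ^ 2) * symPart K x y ≤
      ENNReal.ofReal (c₂ * ρ ^ (-α)) := by
    calc _ ≤ ∫⁻ y in (Metric.ball x₀ (2 * R))ᶜ, symPart K x y := by
          refine lintegral_mono fun y => ?_
          refine mul_le_of_le_one_left' ?_
          rw [← ENNReal.ofReal_one]
          exact ENNReal.ofReal_le_ofReal ((hsq y).trans (min_le_right _ _))
      _ ≤ _ := H₂ x₀ R hR hR1 hsub x hx
      _ ≤ _ := by
          gcongr ENNReal.ofReal (c₂ * ?_)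
          exact Real.rpow_le_rpow_of_nonpos hρ hρR (by linarith)
  refine (add_le_add hin hout).trans (le_of_eq ?_)
  rw [← ENNReal.ofReal_add (by positivity) (by positivity)]
  congr 1; ring

end Kernel

/-! ### Pointwise lower bounds for the integrand of the form -/

section Pointwise

/-- The error in the pointwise lower bound for the integrand of the form, tested with
`τ² (u - k)₊`. -/
noncomputable def pointwiseError (kk a b s t σ κ : ℝ) : ℝ :=
  a * b * (s - t) ^ 2 * σ + |s * a - t * b| * (s * a + t * b) * |κ| +
    a * b * (|s - t| * (s + t)) * |κ| + kk * |s * a - t * b| * (s + t) * |κ| +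
    kk * |s - t| * (s * a + t * b) * |κ|

theorem primal_pointwise_le {u v k s t σ κ : ℝ} (hs : 0 ≤ s) (ht : 0 ≤ t) (hκ : |κ| ≤ σ) :
    (s * max (u - k) 0 - t * max (v - k) 0) ^ 2 * σ ≤
      (u - v) * (s ^ 2 * max (u - k) 0 - t ^ 2 * max (v - k) 0) * σ +
        (u - v) * (s ^ 2 * max (u - k) 0 + t ^ 2 * max (v - k) 0) * κ +
      pointwiseError 0 (max (u - k) 0) (max (v - k) 0) s t σ κ := by
  obtain ⟨h1, h2⟩ := abs_le.1 hκ
  have hstep : (max (u - k) 0 - max (v - k) 0) *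
        (s ^ 2 * max (u - k) 0 - t ^ 2 * max (v - k) 0) * σ +
        (max (u - k) 0 - max (v - k) 0) *
          (s ^ 2 * max (u - k) 0 + t ^ 2 * max (v - k) 0) * κ ≤
      (u - v) * (s ^ 2 * max (u - k) 0 - t ^ 2 * max (v - k) 0) * σ +
        (u - v) * (s ^ 2 * max (u - k) 0 + t ^ 2 * max (v - k) 0) * κ := by
    rcases le_total u k with hu | hu <;> rcases le_total v k with hv | hv
    · rw [max_eq_right (by linarith : u - k ≤ 0), max_eq_right (by linarith : v - k ≤ 0)]; simp
    · rw [max_eq_right (by linarith : u - k ≤ 0), max_eq_left (by linarith : 0 ≤ v - k)]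
      have h3 : 0 ≤ (k - u) * (t ^ 2 * (v - k)) * (σ - κ) :=
        mul_nonneg (mul_nonneg (by linarith) (mul_nonneg (by positivity) (by linarith)))
          (by linarith)
      nlinarith
    · rw [max_eq_left (by linarith : 0 ≤ u - k), max_eq_right (by linarith : v - k ≤ 0)]
      have h3 : 0 ≤ (k - v) * (s ^ 2 * (u - k)) * (σ + κ) :=
        mul_nonneg (mul_nonneg (by linarith) (mul_nonneg (by positivity) (by linarith)))
          (by linarith)
      nlinarith
    · rw [max_eq_left (by linarith : 0 ≤ u - k), max_eq_left (by linarith : 0 ≤ v - k)]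
      apply le_of_eq; ring
  have ha : 0 ≤ max (u - k) 0 := le_max_right _ _
  have hb : 0 ≤ max (v - k) 0 := le_max_right _ _
  generalize max (u - k) 0 = a at *
  generalize max (v - k) 0 = b at *
  have e1 : -(|s * a - t * b| * (s * a + t * b) * |κ|) ≤ (s * a - t * b) * (s * a + t * b) * κ := by
    have := neg_abs_le ((s * a - t * b) * (s * a + t * b) * κ)
    rwa [abs_mul, abs_mul, abs_of_nonneg (by positivity : 0 ≤ s * a + t * b)] at this
  have e2 : a * b * (s - t) * (s + t) * κ ≤ a * b * (|s - t| * (s + t)) * |κ| := by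
    have := le_abs_self (a * b * (s - t) * (s + t) * κ)
    rw [abs_mul, abs_mul, abs_mul, abs_of_nonneg (by positivity : 0 ≤ s + t),
      abs_of_nonneg (by positivity : 0 ≤ a * b)] at this
    linarith
  rw [pointwiseError]
  nlinarith

theorem dual_pointwise_le {u v k s t σ κ : ℝ} (hk : 0 ≤ k) (hs : 0 ≤ s) (ht : 0 ≤ t)
    (hκ : |κ| ≤ σ) :
    (s * max (u - k) 0 - t * max (v - k) 0) ^ 2 * σ ≤
      (s ^ 2 * max (u - k) 0 - t ^ 2 * max (v - k) 0) * (u - v) * σ +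
        (s ^ 2 * max (u - k) 0 - t ^ 2 * max (v - k) 0) * (u + v) * κ +
      pointwiseError k (max (u - k) 0) (max (v - k) 0) s t σ κ := by
  obtain ⟨h1, h2⟩ := abs_le.1 hκ
  have hstep : (s ^ 2 * max (u - k) 0 - t ^ 2 * max (v - k) 0) *
        (max (u - k) 0 - max (v - k) 0) * σ +
        (s ^ 2 * max (u - k) 0 - t ^ 2 * max (v - k) 0) *
          (max (u - k) 0 + max (v - k) 0 + 2 * k) * κ ≤
      (s ^ 2 * max (u - k) 0 - t ^ 2 * max (v - k) 0) * (u - v) * σ +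
        (s ^ 2 * max (u - k) 0 - t ^ 2 * max (v - k) 0) * (u + v) * κ := by
    rcases le_total u k with hu | hu <;> rcases le_total v k with hv | hv
    · rw [max_eq_right (by linarith : u - k ≤ 0), max_eq_right (by linarith : v - k ≤ 0)]; simp
    · rw [max_eq_right (by linarith : u - k ≤ 0), max_eq_left (by linarith : 0 ≤ v - k)]
      have h3 : 0 ≤ (k - u) * (t ^ 2 * (v - k)) * (σ + κ) :=
        mul_nonneg (mul_nonneg (by linarith) (mul_nonneg (by positivity) (by linarith)))
          (by linarith)
      nlinarith
    · rw [max_eq_left (by linarith : 0 ≤ u - k), max_eq_right (by linarith : v - k ≤ 0)]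
      have h3 : 0 ≤ (k - v) * (s ^ 2 * (u - k)) * (σ - κ) :=
        mul_nonneg (mul_nonneg (by linarith) (mul_nonneg (by positivity) (by linarith)))
          (by linarith)
      nlinarith
    · rw [max_eq_left (by linarith : 0 ≤ u - k), max_eq_left (by linarith : 0 ≤ v - k)]
      apply le_of_eq; ring
  have ha : 0 ≤ max (u - k) 0 := le_max_right _ _
  have hb : 0 ≤ max (v - k) 0 := le_max_right _ _
  generalize max (u - k) 0 = a at *
  generalize max (v - k) 0 = b at *
  have hsat : 0 ≤ s * a + t * b := by positivity
  have hst : 0 ≤ s + t := by positivity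
  have hab : 0 ≤ a * b := by positivity
  have e1 : -(|s * a - t * b| * (s * a + t * b) * |κ|) ≤ (s * a - t * b) * (s * a + t * b) * κ := by
    have := neg_abs_le ((s * a - t * b) * (s * a + t * b) * κ)
    rwa [abs_mul, abs_mul, abs_of_nonneg hsat] at this
  have e2 : -(a * b * (|s - t| * (s + t)) * |κ|) ≤ a * b * (s - t) * (s + t) * κ := by
    have := neg_abs_le (a * b * (s - t) * (s + t) * κ)
    rw [abs_mul, abs_mul, abs_mul, abs_of_nonneg hst, abs_of_nonneg hab] at this
    linarith
  have e3 : -(k * |s * a - t * b| * (s + t) * |κ|) ≤ k * (s * a - t * b) * (s + t) * κ := by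
    have := neg_abs_le (k * (s * a - t * b) * (s + t) * κ)
    rwa [abs_mul, abs_mul, abs_mul, abs_of_nonneg hst, abs_of_nonneg hk] at this
  have e4 : -(k * |s - t| * (s * a + t * b) * |κ|) ≤ k * (s - t) * (s * a + t * b) * κ := by
    have := neg_abs_le (k * (s - t) * (s * a + t * b) * κ)
    rwa [abs_mul, abs_mul, abs_mul, abs_of_nonneg hsat, abs_of_nonneg hk] at this
  rw [pointwiseError]
  have key : (s ^ 2 * a - t ^ 2 * b) * (a - b) * σ +
      (s ^ 2 * a - t ^ 2 * b) * (a + b + 2 * k) * κ =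
      (s * a - t * b) ^ 2 * σ - a * b * (s - t) ^ 2 * σ + (s * a - t * b) * (s * a + t * b) * κ +
      a * b * (s - t) * (s + t) * κ + k * (s * a - t * b) * (s + t) * κ +
      k * (s - t) * (s * a + t * b) * κ := by ring
  linarith

/-- Weighted Young inequality with a weight `J ∈ [0, ∞]`. -/
theorem ofReal_mul_abs_le {X Y κ ε : ℝ} {J : ℝ≥0∞} (hX : 0 ≤ X) (hY : 0 ≤ Y) (hε : 0 < ε) :
    ENNReal.ofReal (X * Y * |κ|) ≤
      ENNReal.ofReal (ε * X ^ 2) * J + ENNReal.ofReal (Y ^ 2 / ε) * (‖κ‖ₑ ^ 2 / J) := by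
  rcases eq_or_lt_of_le hX with rfl | hX'
  · simp
  rcases eq_or_lt_of_le hY with rfl | hY'
  · simp
  rcases eq_or_ne κ 0 with rfl | hκ
  · simp
  have hX2 : ENNReal.ofReal (ε * X ^ 2) ≠ 0 := by
    rw [Ne, ENNReal.ofReal_eq_zero, not_le]; positivity
  have hY2 : ENNReal.ofReal (Y ^ 2 / ε) ≠ 0 := by
    rw [Ne, ENNReal.ofReal_eq_zero, not_le]; positivity
  rcases eq_or_ne J ∞ with rfl | hJ
  · rw [ENNReal.mul_top hX2, top_add]; exact le_top
  rcases eq_or_ne J 0 with rfl | hJ0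
  · rw [ENNReal.div_zero (by simpa using hκ), ENNReal.mul_top hY2, add_top]; exact le_top
  obtain ⟨j, rfl⟩ : ∃ j : ℝ, J = ENNReal.ofReal j := ⟨J.toReal, (ENNReal.ofReal_toReal hJ).symm⟩
  have hj : 0 < j := by
    rw [Ne, ENNReal.ofReal_eq_zero, not_le] at hJ0; exact hJ0
  rw [Real.enorm_eq_ofReal_abs, ← ENNReal.ofReal_pow (abs_nonneg _),
    ← ENNReal.ofReal_div_of_pos hj, ← ENNReal.ofReal_mul (by positivity),
    ← ENNReal.ofReal_mul (by positivity), ← ENNReal.ofReal_add (by positivity) (by positivity)]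
  apply ENNReal.ofReal_le_ofReal
  have h := sq_nonneg (ε * X * j - Y * |κ|)
  have h2 : 0 ≤ X * Y * |κ| * (ε * j) := by positivity
  rw [show ε * X ^ 2 * j + Y ^ 2 / ε * (|κ| ^ 2 / j) =
    ((ε * X * j) ^ 2 + (Y * |κ|) ^ 2) / (ε * j) by field_simp, le_div_iff₀ (by positivity)]
  nlinarith

theorem ofReal_add_ofReal_neg_le {P I n : ℝ} (hP : 0 ≤ P) (h : P ≤ I + n) :
    ENNReal.ofReal P + ENNReal.ofReal (-I) ≤ ENNReal.ofReal n + ENNReal.ofReal I := by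
  rcases le_total 0 I with hI | hI
  · rw [ENNReal.ofReal_of_nonpos (by linarith : -I ≤ 0), add_zero, add_comm]
    exact (ENNReal.ofReal_le_ofReal h).trans ENNReal.ofReal_add_le
  · rw [ENNReal.ofReal_of_nonpos hI, add_zero, ← ENNReal.ofReal_add hP (by linarith)]
    exact ENNReal.ofReal_le_ofReal (by linarith)

/-- The part of the error which is localized at `x`. -/
noncomputable def driftWeight (kk W : ℝ) : ℝ≥0∞ :=
  ENNReal.ofReal (W ^ 2) + if W = 0 then 0 else ENNReal.ofReal (kk ^ 2)

theorem drift_term_le {kk a b s t κ ε : ℝ} {J : ℝ≥0∞} (hkk : 0 ≤ kk) (ha : 0 ≤ a) (hb : 0 ≤ b)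
    (hs : 0 ≤ s) (ht : 0 ≤ t) (hs1 : s ≤ 1) (ht1 : t ≤ 1) (hε : 0 < ε) :
    ENNReal.ofReal (|s * a - t * b| * (s * a + t * b) * |κ|) +
      ENNReal.ofReal (kk * |s * a - t * b| * (s + t) * |κ|) ≤
    2 * ENNReal.ofReal ε * (ENNReal.ofReal ((s * a - t * b) ^ 2) * J) +
      ENNReal.ofReal (4 / ε) * (driftWeight kk (s * a) + driftWeight kk (t * b)) *
        (‖κ‖ₑ ^ 2 / J) := by
  have h1 := ofReal_mul_abs_le (J := J) (κ := κ) (abs_nonneg (s * a - t * b))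
    (by positivity : 0 ≤ s * a + t * b) hε
  have h2 : ENNReal.ofReal (kk * |s * a - t * b| * (s + t) * |κ|) ≤
      ENNReal.ofReal ε * (ENNReal.ofReal ((s * a - t * b) ^ 2) * J) + ENNReal.ofReal (4 / ε) *
        ((if s * a = 0 then 0 else ENNReal.ofReal (kk ^ 2)) +
          (if t * b = 0 then 0 else ENNReal.ofReal (kk ^ 2))) * (‖κ‖ₑ ^ 2 / J) := by
    by_cases hz : s * a = 0 ∧ t * b = 0
    · simp [hz.1, hz.2]
    have h3 := ofReal_mul_abs_le (J := J) (κ := κ) (abs_nonneg (s * a - t * b))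
      (by positivity : 0 ≤ kk * (s + t)) hε
    rw [show |s * a - t * b| * (kk * (s + t)) * |κ| = kk * |s * a - t * b| * (s + t) * |κ| by ring,
      sq_abs, ENNReal.ofReal_mul hε.le, mul_assoc (ENNReal.ofReal ε)] at h3
    refine h3.trans ?_
    gcongr
    calc ENNReal.ofReal ((kk * (s + t)) ^ 2 / ε) ≤ ENNReal.ofReal (4 / ε * kk ^ 2) := by
          apply ENNReal.ofReal_le_ofReal
          rw [mul_pow, div_mul_eq_mul_div, mul_comm]
          gcongr
          nlinarith
      _ = ENNReal.ofReal (4 / ε) * ENNReal.ofReal (kk ^ 2) := ENNReal.ofReal_mul (by positivity)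
      _ ≤ _ := by
          gcongr
          by_cases hsa : s * a = 0
          · have : t * b ≠ 0 := fun h => hz ⟨hsa, h⟩
            rw [if_neg this]; exact le_add_self
          · rw [if_neg hsa]; exact le_self_add
  have h4 : ENNReal.ofReal ((s * a + t * b) ^ 2 / ε) ≤
      ENNReal.ofReal (4 / ε) * (ENNReal.ofReal ((s * a) ^ 2) + ENNReal.ofReal ((t * b) ^ 2)) := by
    rw [← ENNReal.ofReal_add (by positivity) (by positivity), ← ENNReal.ofReal_mul (by positivity)]
    apply ENNReal.ofReal_le_ofReal
    rw [div_mul_eq_mul_div]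
    gcongr
    nlinarith [sq_nonneg (s * a - t * b), sq_nonneg (s * a), sq_nonneg (t * b)]
  rw [sq_abs, ENNReal.ofReal_mul hε.le, mul_assoc (ENNReal.ofReal ε)] at h1
  calc _ ≤ (ENNReal.ofReal ε * (ENNReal.ofReal ((s * a - t * b) ^ 2) * J) +
        ENNReal.ofReal (4 / ε) * (ENNReal.ofReal ((s * a) ^ 2) + ENNReal.ofReal ((t * b) ^ 2)) *
          (‖κ‖ₑ ^ 2 / J)) + _ := by
        refine add_le_add (h1.trans ?_) h2
        gcongr
    _ = _ := by simp only [driftWeight]; ring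

theorem cutoff_term_le {kk a s t κ : ℝ} {J : ℝ≥0∞} (hkk : 0 ≤ kk) (ha : 0 ≤ a)
    (hs : 0 ≤ s) (hs1 : s ≤ 1) :
    ENNReal.ofReal (kk * |s - t| * (s * a) * |κ|) ≤
      ENNReal.ofReal (a ^ 2 * (s - t) ^ 2) * J + driftWeight kk (s * a) * (‖κ‖ₑ ^ 2 / J) := by
  by_cases hz : s * a = 0
  · simp [hz]
  have h := ofReal_mul_abs_le (J := J) (κ := κ) (by positivity : 0 ≤ s * a * |s - t|) hkk one_pos
  rw [show s * a * |s - t| * kk * |κ| = kk * |s - t| * (s * a) * |κ| by ring] at h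
  refine h.trans (add_le_add ?_ ?_)
  · rw [one_mul, mul_pow, sq_abs]
    gcongr ENNReal.ofReal (?_ * _) * _
    exact pow_le_pow_left₀ (by positivity) (mul_le_of_le_one_left ha hs1) 2
  · gcongr
    rw [driftWeight, if_neg hz, div_one]
    exact le_add_self

theorem ofReal_add₅_le (a b c d e : ℝ) : ENNReal.ofReal (a + b + c + d + e) ≤
    ENNReal.ofReal a + ENNReal.ofReal b + ENNReal.ofReal c + ENNReal.ofReal d +
      ENNReal.ofReal e := by
  refine ENNReal.ofReal_add_le.trans (add_le_add_left (ENNReal.ofReal_add_le.trans ?_) _)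
  refine add_le_add_left (ENNReal.ofReal_add_le.trans ?_) _
  exact add_le_add_left ENNReal.ofReal_add_le _

theorem ofReal_pointwiseError_le {kk a b s t σ κ ε : ℝ} {J : ℝ≥0∞} (hkk : 0 ≤ kk) (ha : 0 ≤ a)
    (hb : 0 ≤ b) (hs : 0 ≤ s) (ht : 0 ≤ t) (hs1 : s ≤ 1) (ht1 : t ≤ 1) (hε : 0 < ε) (hε1 : ε ≤ 1)
    (hσ : 0 ≤ σ) :
    ENNReal.ofReal (pointwiseError kk a b s t σ κ) ≤
      2 * ENNReal.ofReal ε * (ENNReal.ofReal ((s * a - t * b) ^ 2) * J) +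
      (2 * (ENNReal.ofReal (a ^ 2 * (s - t) ^ 2) * ENNReal.ofReal σ) +
        2 * (ENNReal.ofReal (a ^ 2 * (s - t) ^ 2) * J) +
        ENNReal.ofReal (6 / ε) * driftWeight kk (s * a) * (‖κ‖ₑ ^ 2 / J)) +
      (2 * (ENNReal.ofReal (b ^ 2 * (t - s) ^ 2) * ENNReal.ofReal σ) +
        2 * (ENNReal.ofReal (b ^ 2 * (t - s) ^ 2) * J) +
        ENNReal.ofReal (6 / ε) * driftWeight kk (t * b) * (‖κ‖ₑ ^ 2 / J)) := by
  have hts : (t - s) ^ 2 = (s - t) ^ 2 := by ring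
  rw [hts]
  have h1 : ENNReal.ofReal (a * b * (s - t) ^ 2 * σ) ≤
      ENNReal.ofReal (a ^ 2 * (s - t) ^ 2) * ENNReal.ofReal σ +
        ENNReal.ofReal (b ^ 2 * (s - t) ^ 2) * ENNReal.ofReal σ := by
    rw [← ENNReal.ofReal_mul (by positivity), ← ENNReal.ofReal_mul (by positivity),
      ← ENNReal.ofReal_add (by positivity) (by positivity)]
    apply ENNReal.ofReal_le_ofReal
    have : 0 ≤ (s - t) ^ 2 * σ := by positivity
    nlinarith [mul_nonneg this (sq_nonneg (a - b)), mul_nonneg this (sq_nonneg a),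
      mul_nonneg this (sq_nonneg b)]
  have h2 := drift_term_le (J := J) (κ := κ) hkk ha hb hs ht hs1 ht1 hε
  have h3a := ofReal_mul_abs_le (J := J) (κ := κ) (by positivity : 0 ≤ b * |s - t|)
    (by positivity : 0 ≤ s * a) one_pos
  have h3b := ofReal_mul_abs_le (J := J) (κ := κ) (by positivity : 0 ≤ a * |s - t|)
    (by positivity : 0 ≤ t * b) one_pos
  have h3 : ENNReal.ofReal (a * b * (|s - t| * (s + t)) * |κ|) ≤
      ENNReal.ofReal (b ^ 2 * (s - t) ^ 2) * J + ENNReal.ofReal (a ^ 2 * (s - t) ^ 2) * J +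
        (driftWeight kk (s * a) + driftWeight kk (t * b)) * (‖κ‖ₑ ^ 2 / J) := by
    rw [show a * b * (|s - t| * (s + t)) * |κ| =
      b * |s - t| * (s * a) * |κ| + a * |s - t| * (t * b) * |κ| by ring]
    refine ENNReal.ofReal_add_le.trans ((add_le_add h3a h3b).trans ?_)
    rw [one_mul, one_mul, mul_pow b, mul_pow a, sq_abs, div_one, div_one]
    calc _ ≤ (ENNReal.ofReal (b ^ 2 * (s - t) ^ 2) * J +
          driftWeight kk (s * a) * (‖κ‖ₑ ^ 2 / J)) + (ENNReal.ofReal (a ^ 2 * (s - t) ^ 2) * J +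
          driftWeight kk (t * b) * (‖κ‖ₑ ^ 2 / J)) := by
          gcongr <;> exact le_self_add
      _ = _ := by ring
  have h5a := cutoff_term_le (J := J) (κ := κ) (t := t) hkk ha hs hs1
  have h5b := cutoff_term_le (J := J) (κ := κ) (t := s) hkk hb ht ht1
  have h5 : ENNReal.ofReal (kk * |s - t| * (s * a + t * b) * |κ|) ≤
      (ENNReal.ofReal (a ^ 2 * (s - t) ^ 2) * J + driftWeight kk (s * a) * (‖κ‖ₑ ^ 2 / J)) +
      (ENNReal.ofReal (b ^ 2 * (s - t) ^ 2) * J + driftWeight kk (t * b) * (‖κ‖ₑ ^ 2 / J)) := by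
    rw [hts, abs_sub_comm t s] at h5b
    rw [show kk * |s - t| * (s * a + t * b) * |κ| =
      kk * |s - t| * (s * a) * |κ| + kk * |s - t| * (t * b) * |κ| by ring]
    exact ENNReal.ofReal_add_le.trans (add_le_add h5a h5b)
  have h6 : ENNReal.ofReal (4 / ε) + 2 ≤ ENNReal.ofReal (6 / ε) := by
    rw [← ENNReal.ofReal_ofNat 2, ← ENNReal.ofReal_add (by positivity) (by norm_num)]
    apply ENNReal.ofReal_le_ofReal
    rw [div_add' _ _ _ hε.ne', div_le_div_iff_of_pos_right hε]
    linarith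
  rw [pointwiseError]
  calc _ ≤ _ := ofReal_add₅_le _ _ _ _ _
    _ ≤ (ENNReal.ofReal (a ^ 2 * (s - t) ^ 2) * ENNReal.ofReal σ +
        ENNReal.ofReal (b ^ 2 * (s - t) ^ 2) * ENNReal.ofReal σ) +
        (2 * ENNReal.ofReal ε * (ENNReal.ofReal ((s * a - t * b) ^ 2) * J) +
          ENNReal.ofReal (4 / ε) * (driftWeight kk (s * a) + driftWeight kk (t * b)) *
            (‖κ‖ₑ ^ 2 / J)) +
        (ENNReal.ofReal (b ^ 2 * (s - t) ^ 2) * J + ENNReal.ofReal (a ^ 2 * (s - t) ^ 2) * J +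
          (driftWeight kk (s * a) + driftWeight kk (t * b)) * (‖κ‖ₑ ^ 2 / J)) +
        ((ENNReal.ofReal (a ^ 2 * (s - t) ^ 2) * J + driftWeight kk (s * a) * (‖κ‖ₑ ^ 2 / J)) +
        (ENNReal.ofReal (b ^ 2 * (s - t) ^ 2) * J + driftWeight kk (t * b) * (‖κ‖ₑ ^ 2 / J))) := by
        rw [show ∀ p q r v w : ℝ≥0∞, p + q + r + v + w = p + (q + v) + r + w by intros; ring]
        gcongr
    _ = 2 * ENNReal.ofReal ε * (ENNReal.ofReal ((s * a - t * b) ^ 2) * J) +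
      (1 * (ENNReal.ofReal (a ^ 2 * (s - t) ^ 2) * ENNReal.ofReal σ) +
        2 * (ENNReal.ofReal (a ^ 2 * (s - t) ^ 2) * J) +
        (ENNReal.ofReal (4 / ε) + 2) * driftWeight kk (s * a) * (‖κ‖ₑ ^ 2 / J)) +
      (1 * (ENNReal.ofReal (b ^ 2 * (s - t) ^ 2) * ENNReal.ofReal σ) +
        2 * (ENNReal.ofReal (b ^ 2 * (s - t) ^ 2) * J) +
        (ENNReal.ofReal (4 / ε) + 2) * driftWeight kk (t * b) * (‖κ‖ₑ ^ 2 / J)) := by ring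
    _ ≤ _ := by
        gcongr <;> norm_num

theorem ofReal_pointwiseError_zero_le {kk a b s σ κ ε : ℝ} {J : ℝ≥0∞} (hkk : 0 ≤ kk) (ha : 0 ≤ a)
    (hb : 0 ≤ b) (hs : 0 ≤ s) (hs1 : s ≤ 1) (hε : 0 < ε) (hε1 : ε ≤ 1) (hκ : |κ| ≤ σ) :
    ENNReal.ofReal (pointwiseError kk a b s 0 σ κ) ≤
      2 * ENNReal.ofReal ε * (ENNReal.ofReal ((s * a - 0 * b) ^ 2) * J) +
      2 * (ENNReal.ofReal (s ^ 2 * a * b) * ENNReal.ofReal σ) +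
        2 * (ENNReal.ofReal (a ^ 2 * (s - 0) ^ 2) * J) +
        ENNReal.ofReal (6 / ε) * driftWeight kk (s * a) * (‖κ‖ₑ ^ 2 / J) := by
  have hσ : 0 ≤ σ := (abs_nonneg κ).trans hκ
  have h1 : ENNReal.ofReal (a * b * (s - 0) ^ 2 * σ) =
      ENNReal.ofReal (s ^ 2 * a * b) * ENNReal.ofReal σ := by
    rw [← ENNReal.ofReal_mul (by positivity)]; congr 1; ring
  have h3 : ENNReal.ofReal (a * b * (|s - 0| * (s + 0)) * |κ|) ≤
      ENNReal.ofReal (s ^ 2 * a * b) * ENNReal.ofReal σ := by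
    rw [← ENNReal.ofReal_mul (by positivity), sub_zero, add_zero, abs_of_nonneg hs]
    apply ENNReal.ofReal_le_ofReal
    calc a * b * (s * s) * |κ| = s ^ 2 * a * b * |κ| := by ring
      _ ≤ _ := by gcongr
  have h2 := drift_term_le (J := J) (κ := κ) (b := b) hkk ha hb hs le_rfl hs1 zero_le_one hε
  have h5 := cutoff_term_le (J := J) (κ := κ) (t := 0) hkk ha hs hs1
  have h6 : ENNReal.ofReal (4 / ε) + 1 ≤ ENNReal.ofReal (6 / ε) := by
    rw [← ENNReal.ofReal_one, ← ENNReal.ofReal_add (by positivity) (by norm_num)]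
    apply ENNReal.ofReal_le_ofReal
    rw [div_add' _ _ _ hε.ne', div_le_div_iff_of_pos_right hε]
    linarith
  have hdw : driftWeight kk (0 * b) = 0 := by simp [driftWeight]
  rw [hdw, add_zero (driftWeight kk (s * a))] at h2
  rw [pointwiseError]
  calc _ ≤ _ := ofReal_add₅_le _ _ _ _ _
    _ ≤ (ENNReal.ofReal (s ^ 2 * a * b) * ENNReal.ofReal σ) +
        (2 * ENNReal.ofReal ε * (ENNReal.ofReal ((s * a - 0 * b) ^ 2) * J) +
          ENNReal.ofReal (4 / ε) * driftWeight kk (s * a) * (‖κ‖ₑ ^ 2 / J)) +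
        (ENNReal.ofReal (s ^ 2 * a * b) * ENNReal.ofReal σ) +
        (ENNReal.ofReal (a ^ 2 * (s - 0) ^ 2) * J + driftWeight kk (s * a) * (‖κ‖ₑ ^ 2 / J)) := by
        rw [show ∀ p q r v w : ℝ≥0∞, p + q + r + v + w = p + (q + v) + r + w by intros; ring]
        exact add_le_add (add_le_add (add_le_add h1.le h2) h3)
          (by rwa [zero_mul, add_zero])
    _ = 2 * ENNReal.ofReal ε * (ENNReal.ofReal ((s * a - 0 * b) ^ 2) * J) +
      2 * (ENNReal.ofReal (s ^ 2 * a * b) * ENNReal.ofReal σ) +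
        1 * (ENNReal.ofReal (a ^ 2 * (s - 0) ^ 2) * J) +
        (ENNReal.ofReal (4 / ε) + 1) * driftWeight kk (s * a) * (‖κ‖ₑ ^ 2 / J) := by ring
    _ ≤ _ := by gcongr; norm_num

end Pointwise

/-! ### Integrated lower bounds for the form -/

section FormBound

theorem lintegral_add_ofReal_neg_integral_le {X : Type*} [MeasurableSpace X] {μ : Measure X}
    {I : X → ℝ} {P N : X → ℝ≥0∞} (hI : Integrable I μ) (hN : Measurable N)
    (h : ∀ᵐ p ∂μ, P p + ENNReal.ofReal (-I p) ≤ N p + ENNReal.ofReal (I p)) :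
    ∫⁻ p, P p ∂μ + ENNReal.ofReal (-∫ p, I p ∂μ) ≤
      ∫⁻ p, N p ∂μ + ENNReal.ofReal (∫ p, I p ∂μ) := by
  have h1 : ∫⁻ p, P p ∂μ + ∫⁻ p, ENNReal.ofReal (-I p) ∂μ ≤
      ∫⁻ p, N p ∂μ + ∫⁻ p, ENNReal.ofReal (I p) ∂μ := by
    rw [← lintegral_add_left hN]
    rw [← lintegral_add_right' _ (show AEMeasurable (fun p => ENNReal.ofReal (-I p)) μ from
      hI.1.aemeasurable.neg.ennreal_ofReal)]
    exact lintegral_mono_ae h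
  have hp : ∫⁻ p, ENNReal.ofReal (I p) ∂μ ≠ ∞ := hI.lintegral_lt_top.ne
  have hn : ∫⁻ p, ENNReal.ofReal (-I p) ∂μ ≠ ∞ := hI.neg.lintegral_lt_top.ne
  rw [integral_eq_lintegral_pos_part_sub_lintegral_neg_part hI]
  generalize ∫⁻ p, ENNReal.ofReal (I p) ∂μ = a at *
  generalize ∫⁻ p, ENNReal.ofReal (-I p) ∂μ = b at *
  generalize ∫⁻ p, P p ∂μ = P' at *
  generalize ∫⁻ p, N p ∂μ = N' at *
  by_cases hN' : N' = ∞
  · simp [hN']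
  have hP' : P' ≠ ∞ := by
    intro h; rw [h, top_add, top_le_iff] at h1
    exact (ENNReal.add_ne_top.2 ⟨hN', hp⟩) h1
  lift a to ℝ≥0 using hp
  lift b to ℝ≥0 using hn
  lift P' to ℝ≥0 using hP'
  lift N' to ℝ≥0 using hN'
  have h2 : (P' : ℝ) + b ≤ N' + a := by exact_mod_cast h1
  have h3 := ofReal_add_ofReal_neg_le (P := P') (I := a - b) (n := N') P'.2 (by linarith)
  simpa using h3

theorem lintegral_add₅ {X : Type*} [MeasurableSpace X] {μ : Measure X}
    {f₁ f₂ f₃ f₄ f₅ : X → ℝ≥0∞} (h₂ : Measurable f₂) (h₃ : Measurable f₃) (h₄ : Measurable f₄)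
    (h₅ : Measurable f₅) :
    ∫⁻ x, (f₁ x + f₂ x + f₃ x + f₄ x + f₅ x) ∂μ = ∫⁻ x, f₁ x ∂μ + ∫⁻ x, f₂ x ∂μ +
      ∫⁻ x, f₃ x ∂μ + ∫⁻ x, f₄ x ∂μ + ∫⁻ x, f₅ x ∂μ := by
  rw [lintegral_add_right _ h₅, lintegral_add_right _ h₄, lintegral_add_right _ h₃,
    lintegral_add_right _ h₂]

variable {d : ℕ}

/-- The error in the lower bound for the form tested with `τ² (u - k)₊`, localized at `x`. -/
noncomputable def errorDensity (K J Kt : Eu d → Eu d → ℝ≥0∞) (B S S' : Set (Eu d))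
    (τ u : Eu d → ℝ) (k kk ε : ℝ) (x : Eu d) : ℝ≥0∞ :=
  2 * S'.indicator (fun x => ENNReal.ofReal (max (u x - k) 0 ^ 2) *
      carreDuChamp (symPart K) τ x) x +
    2 * S.indicator (fun x => ENNReal.ofReal (max (u x - k) 0 ^ 2) * carreDuChamp J τ x) x +
    ENNReal.ofReal (6 / ε) * driftWeight kk (τ x * max (u x - k) 0) * driftDensity K J B x +
    2 * ENNReal.ofReal (τ x ^ 2 * max (u x - k) 0) *
      (∫⁻ y in B \ S', ENNReal.ofReal (max (u y - k) 0) * symPart K x y) +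
    ENNReal.ofReal (τ x ^ 2 * max (u x - k) 0) * ∫⁻ y in Bᶜ, ENNReal.ofReal (u y) * Kt x y

/-- The integrand of `errorDensity`. -/
noncomputable def errorIntegrand (K J Kt : Eu d → Eu d → ℝ≥0∞) (B S S' : Set (Eu d))
    (τ u : Eu d → ℝ) (k kk ε : ℝ) (p : Eu d × Eu d) : ℝ≥0∞ :=
  2 * S'.indicator (fun x => ENNReal.ofReal (max (u x - k) 0 ^ 2)) p.1 *
      (ENNReal.ofReal ((τ p.1 - τ p.2) ^ 2) * symPart K p.1 p.2) +
    2 * S.indicator (fun x => ENNReal.ofReal (max (u x - k) 0 ^ 2)) p.1 *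
      (ENNReal.ofReal ((τ p.1 - τ p.2) ^ 2) * J p.1 p.2) +
    ENNReal.ofReal (6 / ε) * driftWeight kk (τ p.1 * max (u p.1 - k) 0) *
      B.indicator (fun y => ‖antiPart K p.1 y‖ₑ ^ 2 / J p.1 y) p.2 +
    2 * ENNReal.ofReal (τ p.1 ^ 2 * max (u p.1 - k) 0) *
      (B \ S').indicator (fun y => ENNReal.ofReal (max (u y - k) 0) * symPart K p.1 y) p.2 +
    ENNReal.ofReal (τ p.1 ^ 2 * max (u p.1 - k) 0) *
      Bᶜ.indicator (fun y => ENNReal.ofReal (u y) * Kt p.1 y) p.2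

theorem measurable_driftWeight (kk : ℝ) : Measurable (driftWeight kk) := by
  have h : Measurable fun W : ℝ => if W = 0 then 0 else ENNReal.ofReal (kk ^ 2) :=
    Measurable.ite (measurableSet_singleton 0) measurable_const measurable_const
  have h' : Measurable fun W : ℝ => ENNReal.ofReal (W ^ 2) := by fun_prop
  exact h'.add h

variable {K J Kt : Eu d → Eu d → ℝ≥0∞} {B S S' : Set (Eu d)} {τ u : Eu d → ℝ} {k kk ε : ℝ}

theorem measurable_indicator_snd {B : Set (Eu d)} (hB : MeasurableSet B)
    {f : Eu d × Eu d → ℝ≥0∞} (hf : Measurable f) :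
    Measurable fun p : Eu d × Eu d => B.indicator (fun y => f (p.1, y)) p.2 :=
  hf.indicator (measurable_snd hB)

theorem measurable_errorIntegrand (hK : Measurable (Function.uncurry K))
    (hJ : Measurable (Function.uncurry J)) (hKt : Measurable (Function.uncurry Kt))
    (hB : MeasurableSet B) (hS : MeasurableSet S) (hS' : MeasurableSet S')
    (hτ : Measurable τ) (hu : Measurable u) :
    Measurable (errorIntegrand K J Kt B S S' τ u k kk ε) := by
  have hs := measurable_symPart hK
  have hDW := measurable_driftWeight kk
  have h1 : Measurable fun p : Eu d × Eu d => ENNReal.ofReal ((τ p.1 - τ p.2) ^ 2) := by fun_prop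
  have h2 : ∀ T : Set (Eu d), MeasurableSet T → Measurable fun p : Eu d × Eu d =>
      2 * T.indicator (fun x => ENNReal.ofReal (max (u x - k) 0 ^ 2)) p.1 := fun T hT =>
    (Measurable.comp (g := T.indicator fun x => ENNReal.ofReal (max (u x - k) 0 ^ 2))
      (Measurable.indicator (by fun_prop) hT) measurable_fst).const_mul 2
  have h3 : Measurable fun p : Eu d × Eu d => ENNReal.ofReal (τ p.1 ^ 2 * max (u p.1 - k) 0) := by
    fun_prop
  have h4 : Measurable fun p : Eu d × Eu d => driftWeight kk (τ p.1 * max (u p.1 - k) 0) :=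
    hDW.comp (by fun_prop)
  refine ((((h2 S' hS').mul (h1.mul hs)).add ((h2 S hS).mul (h1.mul hJ))).add
    ((h4.const_mul _).mul (measurable_indicator_snd hB (measurable_drift hK hJ)))).add
    ((h3.const_mul 2).mul (measurable_indicator_snd (hB.diff hS')
      (f := fun p => ENNReal.ofReal (max (u p.2 - k) 0) * symPart K p.1 p.2) ?_)) |>.add
    (h3.mul (measurable_indicator_snd hB.compl
      (f := fun p => ENNReal.ofReal (u p.2) * Kt p.1 p.2) ?_))
  · exact Measurable.mul (by fun_prop) hs
  · exact Measurable.mul (by fun_prop) hKt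

theorem lintegral_errorIntegrand (hK : Measurable (Function.uncurry K))
    (hJ : Measurable (Function.uncurry J)) (hKt : Measurable (Function.uncurry Kt))
    (hB : MeasurableSet B) (hS : MeasurableSet S) (hS' : MeasurableSet S')
    (hτ : Measurable τ) (hu : Measurable u) :
    ∫⁻ p, errorIntegrand K J Kt B S S' τ u k kk ε p =
      ∫⁻ x, errorDensity K J Kt B S S' τ u k kk ε x := by
  rw [Measure.volume_eq_prod, lintegral_prod _
    (measurable_errorIntegrand hK hJ hKt hB hS hS' hτ hu).aemeasurable]
  refine lintegral_congr fun x => ?_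
  have hs : Measurable (symPart K x) := (measurable_symPart hK).of_uncurry_left
  have hJx : Measurable (J x) := hJ.of_uncurry_left
  have hKx : Measurable (Kt x) := hKt.of_uncurry_left
  have hdr : Measurable fun y => ‖antiPart K x y‖ₑ ^ 2 / J x y :=
    ((measurable_antiPart hK).of_uncurry_left.enorm.pow_const 2).div hJx
  have h1 : Measurable fun y => ENNReal.ofReal ((τ x - τ y) ^ 2) :=
    ((hτ.const_sub (τ x)).pow_const 2).ennreal_ofReal
  have h2 : Measurable fun y => ENNReal.ofReal (max (u y - k) 0) * symPart K x y :=
    ((hu.sub_const k).max measurable_const).ennreal_ofReal.mul hs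
  have h3 : Measurable fun y => ENNReal.ofReal (u y) * Kt x y := hu.ennreal_ofReal.mul hKx
  have m1 := (h1.mul hs).const_mul
    (2 * S'.indicator (fun x => ENNReal.ofReal (max (u x - k) 0 ^ 2)) x)
  have m2 := (h1.mul hJx).const_mul
    (2 * S.indicator (fun x => ENNReal.ofReal (max (u x - k) 0 ^ 2)) x)
  have m3 := (hdr.indicator hB).const_mul
    (ENNReal.ofReal (6 / ε) * driftWeight kk (τ x * max (u x - k) 0))
  have m4 := (h2.indicator (hB.diff hS')).const_mul
    (2 * ENNReal.ofReal (τ x ^ 2 * max (u x - k) 0))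
  have m5 := (h3.indicator hB.compl).const_mul
    (ENNReal.ofReal (τ x ^ 2 * max (u x - k) 0))
  refine (lintegral_add₅ m2 m3 m4 m5).trans ?_
  have e1 : ∀ (T : Set (Eu d)) (g h : Eu d → ℝ≥0∞),
      2 * T.indicator g x * h x = 2 * T.indicator (fun x => g x * h x) x := by
    intro T g h
    by_cases hx : x ∈ T <;> simp [hx, mul_assoc]
  refine congr_arg₂ (· + ·) (congr_arg₂ (· + ·) (congr_arg₂ (· + ·) (congr_arg₂ (· + ·) ?_ ?_) ?_)
    ?_) ?_
  · exact (lintegral_const_mul _ (h1.mul hs)).trans (e1 _ _ (carreDuChamp (symPart K) τ))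
  · exact (lintegral_const_mul _ (h1.mul hJx)).trans (e1 _ _ (carreDuChamp J τ))
  · exact (lintegral_const_mul _ (hdr.indicator hB)).trans
      (congr_arg _ (lintegral_indicator hB _))
  · exact (lintegral_const_mul _ (h2.indicator (hB.diff hS'))).trans
      (congr_arg _ (lintegral_indicator (hB.diff hS') _))
  · exact (lintegral_const_mul _ (h3.indicator hB.compl)).trans
      (congr_arg _ (lintegral_indicator hB.compl _))

/-- A function `I` behaves like the integrand of the form at `(u, τ² (u - k)₊)` or of the dual
form. -/
structure IsFormIntegrand (K Kt : Eu d → Eu d → ℝ≥0∞) (τ u : Eu d → ℝ) (k kk : ℝ)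
    (I : Eu d × Eu d → ℝ) : Prop where
  swap : ∀ p, I p.swap = I p
  le : ∀ p : Eu d × Eu d, K p.1 p.2 ≠ ∞ → K p.2 p.1 ≠ ∞ →
    (τ p.1 * max (u p.1 - k) 0 - τ p.2 * max (u p.2 - k) 0) ^ 2 * (symPart K p.1 p.2).toReal ≤
      I p + pointwiseError kk (max (u p.1 - k) 0) (max (u p.2 - k) 0) (τ p.1) (τ p.2)
        (symPart K p.1 p.2).toReal (antiPart K p.1 p.2)
  neg_le : ∀ p : Eu d × Eu d, K p.1 p.2 ≠ ∞ → K p.2 p.1 ≠ ∞ → τ p.2 = 0 →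
    -I p ≤ τ p.1 ^ 2 * max (u p.1 - k) 0 * u p.2 * (Kt p.1 p.2).toReal

theorem isFormIntegrand_primal (hτ : ∀ x, 0 ≤ τ x) (hu : ∀ x, 0 ≤ u x) :
    IsFormIntegrand K K τ u k 0 fun p =>
      symIntegrand K u (fun x => τ x ^ 2 * max (u x - k) 0) p +
        antiIntegrand K u (fun x => τ x ^ 2 * max (u x - k) 0) p where
  swap p := by
    simp only [symIntegrand, antiIntegrand, Prod.fst_swap, Prod.snd_swap]
    rw [symPart_comm, antiPart_comm]; ring
  le p h h' := by
    simp only [symIntegrand, antiIntegrand]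
    exact primal_pointwise_le (hτ _) (hτ _) (abs_antiPart_le h h')
  neg_le p h h' h0 := by
    simp only [symIntegrand, antiIntegrand, h0]
    rw [toReal_symPart h h', antiPart]
    have h1 : 0 ≤ τ p.1 ^ 2 * max (u p.1 - k) 0 * u p.1 * (K p.1 p.2).toReal := by
      have := hu p.1
      have : 0 ≤ max (u p.1 - k) 0 := le_max_right _ _
      positivity
    linarith

theorem isFormIntegrand_dual (hτ : ∀ x, 0 ≤ τ x) (hu : ∀ x, 0 ≤ u x) (hk : 0 ≤ k) :
    IsFormIntegrand K (fun x y => K y x) τ u k k fun p =>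
      symIntegrand K (fun x => τ x ^ 2 * max (u x - k) 0) u p +
        antiIntegrand K (fun x => τ x ^ 2 * max (u x - k) 0) u p where
  swap p := by
    simp only [symIntegrand, antiIntegrand, Prod.fst_swap, Prod.snd_swap]
    rw [symPart_comm, antiPart_comm]; ring
  le p h h' := by
    simp only [symIntegrand, antiIntegrand]
    exact dual_pointwise_le hk (hτ _) (hτ _) (abs_antiPart_le h h')
  neg_le p h h' h0 := by
    simp only [symIntegrand, antiIntegrand, h0]
    rw [toReal_symPart h h', antiPart]
    have h1 : 0 ≤ τ p.1 ^ 2 * max (u p.1 - k) 0 * u p.1 * (K p.1 p.2).toReal := by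
      have := hu p.1
      have : 0 ≤ max (u p.1 - k) 0 := le_max_right _ _
      positivity
    linarith

theorem IsFormIntegrand.pointwise {I : Eu d × Eu d → ℝ} (hI : IsFormIntegrand K Kt τ u k kk I)
    (hJs : ∀ x y, J x y = J y x) (hSS' : S ⊆ S') (hS'B : S' ⊆ B)
    (hτ0 : ∀ x, 0 ≤ τ x) (hτ1 : ∀ x, τ x ≤ 1) (hτS : ∀ x ∉ S, τ x = 0) (hu : ∀ x, 0 ≤ u x)
    (hkk : 0 ≤ kk) (hε : 0 < ε) (hε1 : ε ≤ 1) (p : Eu d × Eu d) (hp : K p.1 p.2 ≠ ∞)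
    (hp' : K p.2 p.1 ≠ ∞) :
    (B ×ˢ B).indicator (fun p => ENNReal.ofReal
        ((τ p.1 * max (u p.1 - k) 0 - τ p.2 * max (u p.2 - k) 0) ^ 2) * symPart K p.1 p.2) p +
      ENNReal.ofReal (-I p) ≤
    2 * ENNReal.ofReal ε * (B ×ˢ B).indicator (fun p => ENNReal.ofReal
        ((τ p.1 * max (u p.1 - k) 0 - τ p.2 * max (u p.2 - k) 0) ^ 2) * J p.1 p.2) p +
      (errorIntegrand K J Kt B S S' τ u k kk ε p +
        errorIntegrand K J Kt B S S' τ u k kk ε p.swap) + ENNReal.ofReal (I p) := by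
  have key : ∀ x y : Eu d, K x y ≠ ∞ → K y x ≠ ∞ → y ∉ S →
      (B ×ˢ B).indicator (fun p => ENNReal.ofReal
        ((τ p.1 * max (u p.1 - k) 0 - τ p.2 * max (u p.2 - k) 0) ^ 2) * symPart K p.1 p.2) (x, y) +
      ENNReal.ofReal (-I (x, y)) ≤
    2 * ENNReal.ofReal ε * (B ×ˢ B).indicator (fun p => ENNReal.ofReal
        ((τ p.1 * max (u p.1 - k) 0 - τ p.2 * max (u p.2 - k) 0) ^ 2) * J p.1 p.2) (x, y) +
      (errorIntegrand K J Kt B S S' τ u k kk ε (x, y) +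
        errorIntegrand K J Kt B S S' τ u k kk ε (y, x)) + ENNReal.ofReal (I (x, y)) := by
    intro x y hxy hyx hyS
    have hσ := symPart_ne_top hxy hyx
    have hκ := abs_antiPart_le hxy hyx
    have ha : 0 ≤ max (u x - k) 0 := le_max_right _ _
    have hb : 0 ≤ max (u y - k) 0 := le_max_right _ _
    have ht := hτS y hyS
    by_cases hxS : x ∈ S
    · have hxS' := hSS' hxS
      have hxB := hS'B hxS'
      by_cases hyB : y ∈ B
      · have h0 := ofReal_add_ofReal_neg_le (by positivity) (hI.le (x, y) hxy hyx)
        rw [ENNReal.ofReal_mul (by positivity), ENNReal.ofReal_toReal hσ] at h0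
        have hmem : (x, y) ∈ B ×ˢ B := ⟨hxB, hyB⟩
        rw [indicator_of_mem hmem, indicator_of_mem hmem]
        refine h0.trans (add_le_add_left ?_ _)
        simp only [ht]
        refine (ofReal_pointwiseError_zero_le (J := J x y) hkk ha hb (hτ0 x) (hτ1 x) hε hε1
          hκ).trans ?_
        rw [ENNReal.ofReal_toReal hσ]
        by_cases hyS' : y ∈ S'
        · have hmain : 2 * (ENNReal.ofReal (τ x ^ 2 * max (u x - k) 0 * max (u y - k) 0) *
              symPart K x y) ≤
              2 * ENNReal.ofReal (max (u x - k) 0 ^ 2) *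
                (ENNReal.ofReal ((τ x - 0) ^ 2) * symPart K x y) +
              2 * ENNReal.ofReal (max (u y - k) 0 ^ 2) *
                (ENNReal.ofReal ((0 - τ x) ^ 2) * symPart K x y) := by
            rw [← mul_assoc (2 * _), ← mul_assoc (2 * _), mul_assoc 2 (ENNReal.ofReal _),
              mul_assoc 2 (ENNReal.ofReal _), ← ENNReal.ofReal_mul (by positivity),
              ← ENNReal.ofReal_mul (by positivity), ← add_mul, ← mul_add, ← mul_assoc,
              ← ENNReal.ofReal_add (by positivity) (by positivity)]
            gcongr
            have h5 : 0 ≤ τ x ^ 2 := by positivity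
            nlinarith [mul_nonneg h5 (sq_nonneg (max (u x - k) 0 - max (u y - k) 0)),
              mul_nonneg h5 (sq_nonneg (max (u x - k) 0)),
              mul_nonneg h5 (sq_nonneg (max (u y - k) 0))]
          simp only [errorIntegrand, ht, indicator_of_mem hxS', indicator_of_mem hxS,
            indicator_of_mem hyB, indicator_of_mem hyS']
          rw [symPart_comm K y x]
          calc _ ≤ 2 * ENNReal.ofReal ε * (ENNReal.ofReal ((τ x * max (u x - k) 0 -
                0 * max (u y - k) 0) ^ 2) * J x y) + (2 * ENNReal.ofReal (max (u x - k) 0 ^ 2) *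
                (ENNReal.ofReal ((τ x - 0) ^ 2) * symPart K x y) +
              2 * ENNReal.ofReal (max (u y - k) 0 ^ 2) *
                (ENNReal.ofReal ((0 - τ x) ^ 2) * symPart K x y)) + 2 * (ENNReal.ofReal
                (max (u x - k) 0 ^ 2 * (τ x - 0) ^ 2) * J x y) + _ := by gcongr
            _ = 2 * ENNReal.ofReal ε * (ENNReal.ofReal ((τ x * max (u x - k) 0 -
                0 * max (u y - k) 0) ^ 2) * J x y) + ((2 * ENNReal.ofReal (max (u x - k) 0 ^ 2) *
                (ENNReal.ofReal ((τ x - 0) ^ 2) * symPart K x y) +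
                2 * ENNReal.ofReal (max (u x - k) 0 ^ 2) *
                (ENNReal.ofReal ((τ x - 0) ^ 2) * J x y) + ENNReal.ofReal (6 / ε) *
                driftWeight kk (τ x * max (u x - k) 0) *
                (‖antiPart K x y‖ₑ ^ 2 / J x y)) +
                (2 * ENNReal.ofReal (max (u y - k) 0 ^ 2) *
                (ENNReal.ofReal ((0 - τ x) ^ 2) * symPart K x y))) := by
                rw [ENNReal.ofReal_mul (by positivity)]; ring
            _ ≤ _ := by
                exact add_le_add le_rfl (add_le_add (le_add_right le_self_add)
                  (le_add_right (le_add_right (le_add_right le_self_add))))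
        · have hyBS : y ∈ B \ S' := ⟨hyB, hyS'⟩
          simp only [errorIntegrand, ht, indicator_of_mem hxS', indicator_of_mem hxS,
            indicator_of_mem hyB, indicator_of_mem hyBS]
          calc _ = 2 * ENNReal.ofReal ε * (ENNReal.ofReal ((τ x * max (u x - k) 0 -
                0 * max (u y - k) 0) ^ 2) * J x y) + (2 * ENNReal.ofReal (max (u x - k) 0 ^ 2) *
                (ENNReal.ofReal ((τ x - 0) ^ 2) * J x y) + ENNReal.ofReal (6 / ε) *
                driftWeight kk (τ x * max (u x - k) 0) *
                (‖antiPart K x y‖ₑ ^ 2 / J x y) +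
                2 * ENNReal.ofReal (τ x ^ 2 * max (u x - k) 0) *
                (ENNReal.ofReal (max (u y - k) 0) * symPart K x y)) := by
                rw [ENNReal.ofReal_mul (p := max (u x - k) 0 ^ 2) (by positivity),
                  ENNReal.ofReal_mul (p := τ x ^ 2 * max (u x - k) 0) (by positivity)]; ring
            _ ≤ _ := by
                exact add_le_add le_rfl (le_add_right (le_add_right
                  (add_le_add (add_le_add le_add_self le_rfl) le_rfl)))
      · have hnot : (x, y) ∉ B ×ˢ B := fun h => hyB h.2
        rw [indicator_of_notMem hnot, zero_add]
        have h1 := hI.neg_le (x, y) hxy hyx ht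
        refine le_add_right (le_add_left (le_add_right ?_))
        simp only [errorIntegrand]
        refine le_add_left ?_
        rw [indicator_of_mem (show y ∈ Bᶜ from hyB)]
        refine (ENNReal.ofReal_le_ofReal h1).trans ?_
        have := hu y
        simp only
        rw [ENNReal.ofReal_mul (by positivity), ENNReal.ofReal_mul (by positivity), mul_assoc]
        gcongr
        exact ENNReal.ofReal_toReal_le
    · have hs := hτS x hxS
      have h1 := hI.neg_le (x, y) hxy hyx ht
      simp only [hs] at h1
      have h2 : ENNReal.ofReal (-I (x, y)) = 0 := by
        rw [ENNReal.ofReal_eq_zero]; simpa using h1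
      rw [h2, add_zero]
      refine le_trans (le_of_eq ?_) zero_le
      simp [indicator, hs, ht]
  obtain ⟨x, y⟩ := p
  by_cases hy : y ∈ S
  swap
  · exact key x y hp hp' hy
  by_cases hx : x ∈ S
  swap
  · have h := key y x hp' hp hx
    have hm : (y, x) ∈ B ×ˢ B ↔ (x, y) ∈ B ×ˢ B := by simp [and_comm]
    have hi1 : (B ×ˢ B).indicator (fun p => ENNReal.ofReal
        ((τ p.1 * max (u p.1 - k) 0 - τ p.2 * max (u p.2 - k) 0) ^ 2) * symPart K p.1 p.2) (y, x) =
        (B ×ˢ B).indicator (fun p => ENNReal.ofReal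
        ((τ p.1 * max (u p.1 - k) 0 - τ p.2 * max (u p.2 - k) 0) ^ 2) * symPart K p.1 p.2)
          (x, y) := by
      by_cases hxy : (x, y) ∈ B ×ˢ B
      · rw [indicator_of_mem hxy, indicator_of_mem (hm.2 hxy)]
        simp only [symPart_comm K y x]
        rw [← neg_sub, neg_sq]
      · rw [indicator_of_notMem hxy, indicator_of_notMem (mt hm.1 hxy)]
    have hi2 : (B ×ˢ B).indicator (fun p => ENNReal.ofReal
        ((τ p.1 * max (u p.1 - k) 0 - τ p.2 * max (u p.2 - k) 0) ^ 2) * J p.1 p.2) (y, x) =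
        (B ×ˢ B).indicator (fun p => ENNReal.ofReal
        ((τ p.1 * max (u p.1 - k) 0 - τ p.2 * max (u p.2 - k) 0) ^ 2) * J p.1 p.2) (x, y) := by
      by_cases hxy : (x, y) ∈ B ×ˢ B
      · rw [indicator_of_mem hxy, indicator_of_mem (hm.2 hxy)]
        simp only [hJs y x]
        rw [← neg_sub, neg_sq]
      · rw [indicator_of_notMem hxy, indicator_of_notMem (mt hm.1 hxy)]
    have hsw : I (y, x) = I (x, y) := hI.swap (x, y)
    rw [hi1, hi2, hsw, add_comm (errorIntegrand K J Kt B S S' τ u k kk ε (y, x))] at h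
    exact h
  have hσ := symPart_ne_top hp hp'
  have ha : 0 ≤ max (u x - k) 0 := le_max_right _ _
  have hb : 0 ≤ max (u y - k) 0 := le_max_right _ _
  have hxB := hS'B (hSS' hx)
  have hyB := hS'B (hSS' hy)
  have h0 := ofReal_add_ofReal_neg_le (by positivity) (hI.le (x, y) hp hp')
  rw [ENNReal.ofReal_mul (by positivity), ENNReal.ofReal_toReal hσ] at h0
  have hmem : (x, y) ∈ B ×ˢ B := ⟨hxB, hyB⟩
  rw [indicator_of_mem hmem, indicator_of_mem hmem]
  refine h0.trans (add_le_add_left ?_ _)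
  refine (ofReal_pointwiseError_le (J := J x y) hkk ha hb (hτ0 x) (hτ0 y) (hτ1 x) (hτ1 y) hε hε1
    ENNReal.toReal_nonneg).trans ?_
  rw [ENNReal.ofReal_toReal hσ]
  simp only [errorIntegrand, Prod.fst_swap, Prod.snd_swap, indicator_of_mem (hSS' hx),
    indicator_of_mem (hSS' hy), indicator_of_mem hx, indicator_of_mem hy, indicator_of_mem hxB,
    indicator_of_mem hyB]
  rw [symPart_comm K y x, hJs y x, antiPart_comm K y x, enorm_neg]
  rw [ENNReal.ofReal_mul (p := max (u x - k) 0 ^ 2) (by positivity),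
    ENNReal.ofReal_mul (p := max (u y - k) 0 ^ 2) (by positivity)]
  simp only [mul_assoc]
  exact (le_of_eq (add_assoc _ _ _)).trans (add_le_add le_rfl
    (add_le_add (le_add_right le_self_add) (le_add_right le_self_add)))

theorem IsFormIntegrand.lintegral_le {I : Eu d × Eu d → ℝ}
    (hI : IsFormIntegrand K Kt τ u k kk I) (hint : Integrable I)
    (hK : Measurable (Function.uncurry K)) (hJ : Measurable (Function.uncurry J))
    (hKt : Measurable (Function.uncurry Kt)) (hfin : ∀ᵐ p : Eu d × Eu d, K p.1 p.2 ≠ ∞ ∧ K p.2 p.1 ≠ ∞)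
    (hB : MeasurableSet B) (hS : MeasurableSet S) (hS' : MeasurableSet S')
    (hτ : Measurable τ) (hum : Measurable u)
    (hJs : ∀ x y, J x y = J y x) (hSS' : S ⊆ S') (hS'B : S' ⊆ B)
    (hτ0 : ∀ x, 0 ≤ τ x) (hτ1 : ∀ x, τ x ≤ 1) (hτS : ∀ x ∉ S, τ x = 0) (hu : ∀ x, 0 ≤ u x)
    (hkk : 0 ≤ kk) (hε : 0 < ε) (hε1 : ε ≤ 1) :
    energy (symPart K) B B (fun x => τ x * max (u x - k) 0) + ENNReal.ofReal (-∫ p, I p) ≤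
      2 * ENNReal.ofReal ε * energy J B B (fun x => τ x * max (u x - k) 0) +
        2 * (∫⁻ x, errorDensity K J Kt B S S' τ u k kk ε x) + ENNReal.ofReal (∫ p, I p) := by
  have hW : Measurable fun x => τ x * max (u x - k) 0 := by fun_prop
  have hE := measurable_errorIntegrand (k := k) (kk := kk) (ε := ε) hK hJ hKt hB hS hS' hτ hum
  have hJm := (measurable_energyIntegrand hJ hW).indicator (hB.prod hB)
  have h := lintegral_add_ofReal_neg_integral_le hint
    ((hJm.const_mul (2 * ENNReal.ofReal ε)).add (hE.add (hE.comp measurable_swap)))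
    (hfin.mono fun p hp =>
      hI.pointwise hJs hSS' hS'B hτ0 hτ1 hτS hu hkk hε hε1 p hp.1 hp.2)
  have hsw : ∫⁻ p : Eu d × Eu d, errorIntegrand K J Kt B S S' τ u k kk ε p.swap =
      ∫⁻ p, errorIntegrand K J Kt B S S' τ u k kk ε p := by
    rw [Measure.volume_eq_prod]
    exact lintegral_prod_swap (μ := volume) (ν := volume)
      (errorIntegrand K J Kt B S S' τ u k kk ε)
  rw [energy_eq_lintegral (measurable_symPart hK) hW, energy_eq_lintegral hJ hW,
    ← lintegral_errorIntegrand hK hJ hKt hB hS hS' hτ hum]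
  rw [lintegral_indicator (hB.prod hB)] at h
  refine h.trans (le_of_eq ?_)
  congr 1
  simp only [Pi.add_apply, Function.comp_apply]
  rw [lintegral_add_left (hJm.const_mul _), lintegral_const_mul _ hJm,
    lintegral_indicator (hB.prod hB), lintegral_add_left hE, hsw, two_mul (∫⁻ _, _)]

end FormBound

/-! ### Admissibility of the test function -/

section TestFunction

variable {d : ℕ}

theorem sq_mul_sub_mul_le {s t a b : ℝ} (ht0 : 0 ≤ t) (ht1 : t ≤ 1) :
    (s * a - t * b) ^ 2 ≤ 2 * (a - b) ^ 2 + 2 * (a ^ 2 * (s - t) ^ 2) := by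
  have h1 : (t * (a - b)) ^ 2 ≤ (a - b) ^ 2 := by
    rw [mul_pow]; exact mul_le_of_le_one_left (sq_nonneg _) (pow_le_one₀ ht0 ht1)
  have h2 : s * a - t * b = t * (a - b) + a * (s - t) := by ring
  rw [h2, ← mul_pow a]
  nlinarith [sq_nonneg (t * (a - b) - a * (s - t))]

theorem sq_max_sub_max_le (u v k : ℝ) : (max (u - k) 0 - max (v - k) 0) ^ 2 ≤ (u - v) ^ 2 := by
  rw [← sq_abs, ← sq_abs (u - v)]
  refine pow_le_pow_left₀ (abs_nonneg _) ?_ 2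
  have := abs_max_sub_max_le_abs (u - k) (v - k) 0
  rwa [sub_sub_sub_cancel_right] at this

theorem lintegral_prod_symm_le {f g : Eu d × Eu d → ℝ≥0∞} (hg : Measurable g)
    (h : ∀ p, f p ≤ g p + g p.swap) : ∫⁻ p, f p ≤ 2 * ∫⁻ p, g p := by
  have hsw : ∫⁻ p : Eu d × Eu d, g p.swap = ∫⁻ p, g p := by
    rw [Measure.volume_eq_prod]
    exact lintegral_prod_swap (μ := volume) (ν := volume) g
  calc _ ≤ ∫⁻ p, (g p + g p.swap) := lintegral_mono h
    _ = 2 * ∫⁻ p, g p := by rw [lintegral_add_left hg, hsw, two_mul]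

theorem measurable_energyIntegrand_slice {k : Eu d → Eu d → ℝ≥0∞}
    (hk : Measurable (Function.uncurry k)) {v : Eu d → ℝ} (hv : Measurable v) (x : Eu d) :
    Measurable fun y => ENNReal.ofReal ((v x - v y) ^ 2) * k x y :=
  ((hv.const_sub (v x)).pow_const 2).ennreal_ofReal.mul hk.of_uncurry_left

theorem measurable_weighted_energyIntegrand {k : Eu d → Eu d → ℝ≥0∞}
    (hk : Measurable (Function.uncurry k)) {w τ : Eu d → ℝ} (hw : Measurable w)
    (hτ : Measurable τ) : Measurable fun p : Eu d × Eu d =>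
      ENNReal.ofReal (w p.1 ^ 2) * (ENNReal.ofReal ((τ p.1 - τ p.2) ^ 2) * k p.1 p.2) :=
  ((hw.comp measurable_fst).pow_const 2).ennreal_ofReal.mul (measurable_energyIntegrand hk hτ)

theorem lintegral_weighted_energyIntegrand {k : Eu d → Eu d → ℝ≥0∞}
    (hk : Measurable (Function.uncurry k)) {w τ : Eu d → ℝ} (hw : Measurable w)
    (hτ : Measurable τ) (S : Set (Eu d)) :
    ∫⁻ p in S ×ˢ univ, ENNReal.ofReal (w p.1 ^ 2) *
      (ENNReal.ofReal ((τ p.1 - τ p.2) ^ 2) * k p.1 p.2) =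
    ∫⁻ x in S, ENNReal.ofReal (w x ^ 2) * carreDuChamp k τ x := by
  rw [Measure.volume_eq_prod, ← Measure.prod_restrict, Measure.restrict_univ,
    lintegral_prod _ (measurable_weighted_energyIntegrand hk hw hτ).aemeasurable]
  exact lintegral_congr fun x =>
    lintegral_const_mul (ENNReal.ofReal (w x ^ 2)) (measurable_energyIntegrand_slice hk hτ x)

theorem energy_le_of_localized {k : Eu d → Eu d → ℝ≥0∞} (hk : Measurable (Function.uncurry k))
    (hks : ∀ x y, k x y = k y x) {S : Set (Eu d)} (hS : MeasurableSet S)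
    {ψ u w τ : Eu d → ℝ} (hψ : Measurable ψ) (hu : Measurable u) (hw : Measurable w)
    (hτ : Measurable τ) (hψS : ∀ x ∉ S, ψ x = 0)
    (h : ∀ x ∈ S, ∀ y, (ψ x - ψ y) ^ 2 ≤ 2 * (u x - u y) ^ 2 + 8 * (w x ^ 2 * (τ x - τ y) ^ 2)) :
    energy k univ univ ψ ≤
      4 * energy k S univ u + 16 * ∫⁻ x in S, ENNReal.ofReal (w x ^ 2) * carreDuChamp k τ x := by
  rw [energy_eq_lintegral hk hψ, univ_prod_univ, Measure.restrict_univ]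
  have m1 := (measurable_energyIntegrand hk hu).const_mul 2
  have m2 := (measurable_weighted_energyIntegrand hk hw hτ).const_mul 8
  set g : Eu d × Eu d → ℝ≥0∞ := (S ×ˢ univ).indicator fun p =>
    2 * (ENNReal.ofReal ((u p.1 - u p.2) ^ 2) * k p.1 p.2) +
      8 * (ENNReal.ofReal (w p.1 ^ 2) * (ENNReal.ofReal ((τ p.1 - τ p.2) ^ 2) * k p.1 p.2)) with hg
  have hgm : Measurable g := (m1.add m2).indicator (hS.prod MeasurableSet.univ)
  have hone : ∀ x ∈ S, ∀ y, ENNReal.ofReal ((ψ x - ψ y) ^ 2) * k x y ≤ g (x, y) := by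
    intro x hx y
    have hmem : (x, y) ∈ S ×ˢ (univ : Set (Eu d)) := ⟨hx, mem_univ y⟩
    rw [hg, indicator_of_mem hmem]
    calc _ ≤ (2 * ENNReal.ofReal ((u x - u y) ^ 2) + 8 * (ENNReal.ofReal (w x ^ 2) *
          ENNReal.ofReal ((τ x - τ y) ^ 2))) * k x y := by
          gcongr
          refine (ENNReal.ofReal_le_ofReal (h x hx y)).trans (le_of_eq ?_)
          rw [ENNReal.ofReal_add (by positivity) (by positivity), ENNReal.ofReal_mul (by norm_num),
            ENNReal.ofReal_mul (by norm_num), ENNReal.ofReal_mul (by positivity)]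
          simp
      _ = _ := by ring
  refine (lintegral_prod_symm_le hgm ?_).trans (le_of_eq ?_)
  · rintro ⟨x, y⟩
    by_cases hx : x ∈ S
    · exact le_add_right (hone x hx y)
    by_cases hy : y ∈ S
    · refine le_add_left ?_
      have := hone y hy x
      rw [← neg_sub, neg_sq] at this
      rw [hks]
      exact this
    · simp [hψS x hx, hψS y hy]
  · rw [hg, lintegral_indicator (hS.prod MeasurableSet.univ), lintegral_add_left m1,
      lintegral_const_mul _ (measurable_energyIntegrand hk hu),
      lintegral_const_mul _ (measurable_weighted_energyIntegrand hk hw hτ),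
      lintegral_weighted_energyIntegrand hk hw hτ, ← energy_eq_lintegral hk hu]
    ring

/-- A cutoff function between `S` and its complement with controlled carré du champ. -/
structure AdmissibleCutoff (K J : Eu d → Eu d → ℝ≥0∞) (B S S' : Set (Eu d)) (Λ : ℝ≥0∞)
    (τ : Eu d → ℝ) : Prop where
  measurable : Measurable τ
  nonneg : ∀ x, 0 ≤ τ x
  le_one : ∀ x, τ x ≤ 1
  eq_zero : ∀ x ∉ S, τ x = 0
  measurableSet_B : MeasurableSet B
  measurableSet_S : MeasurableSet S
  measurableSet_S' : MeasurableSet S'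
  subset : S ⊆ S'
  subset' : S' ⊆ B
  ne_top : Λ ≠ ∞
  gamma_symPart_le : ∀ x ∈ S', carreDuChamp (symPart K) τ x ≤ Λ
  gamma_le : ∀ x ∈ S, carreDuChamp J τ x ≤ Λ

variable {K J Kt : Eu d → Eu d → ℝ≥0∞} {B S S' : Set (Eu d)} {Λ : ℝ≥0∞} {τ u : Eu d → ℝ}
  {k kk ε : ℝ}

theorem lintegral_sq_eq {v : Eu d → ℝ} (μ : Measure (Eu d)) :
    eLpNorm v 2 μ ^ 2 = ∫⁻ x, ENNReal.ofReal (v x ^ 2) ∂μ := by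
  rw [eLpNorm_eq_lintegral_rpow_enorm_toReal (by norm_num) (by norm_num), ENNReal.toReal_ofNat,
    ← ENNReal.rpow_natCast, ← ENNReal.rpow_mul]
  norm_num
  refine lintegral_congr fun x => ?_
  rw [Real.enorm_eq_ofReal_abs, ← ENNReal.ofReal_pow (abs_nonneg _), sq_abs]

theorem sq_posPart_le {u k : ℝ} (hu : 0 ≤ u) (hk : 0 ≤ k) : max (u - k) 0 ^ 2 ≤ u ^ 2 :=
  pow_le_pow_left₀ (le_max_right _ _) (max_le (by linarith) hu) 2

theorem lintegral_sq_lt_top_of_normSqV (h : normSqV K B u < ∞) :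
    ∫⁻ x in B, ENNReal.ofReal (u x ^ 2) < ∞ := by
  rw [normSqV, lintegral_sq_eq] at h
  exact lt_of_le_of_lt le_self_add h

theorem energy_lt_top_of_normSqV (h : normSqV K B u < ∞) : energy (symPart K) B univ u < ∞ :=
  lt_of_le_of_lt le_add_self h

theorem energy_mono {k : Eu d → Eu d → ℝ≥0∞} {A A' B B' : Set (Eu d)} (hA : A ⊆ A') (hB : B ⊆ B')
    (v : Eu d → ℝ) : energy k A B v ≤ energy k A' B' v :=
  (lintegral_mono fun _ => lintegral_mono_set hB).trans (lintegral_mono_set hA)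

/-- The energy of a localized function which is pointwise controlled by `u`. -/
theorem AdmissibleCutoff.energy_lt_top (hτ : AdmissibleCutoff K J B S S' Λ τ)
    (hK : Measurable (Function.uncurry K)) (hum : Measurable u) (hu : ∀ x, 0 ≤ u x) (hk : 0 ≤ k)
    (hV : normSqV K B u < ∞) {ψ : Eu d → ℝ} (hψ : Measurable ψ) (hψS : ∀ x ∉ S, ψ x = 0)
    (h : ∀ x ∈ S, ∀ y, (ψ x - ψ y) ^ 2 ≤
      2 * (u x - u y) ^ 2 + 8 * (max (u x - k) 0 ^ 2 * (τ x - τ y) ^ 2)) :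
    energy (symPart K) univ univ ψ < ∞ := by
  refine lt_of_le_of_lt (energy_le_of_localized (measurable_symPart hK) (symPart_comm K)
    hτ.measurableSet_S hψ hum (w := fun x => max (u x - k) 0) (by fun_prop) hτ.measurable hψS h) ?_
  have h1 : energy (symPart K) S univ u < ∞ :=
    (energy_mono (hτ.subset.trans hτ.subset') le_rfl u).trans_lt (energy_lt_top_of_normSqV hV)
  have h2 : ∫⁻ x in S, ENNReal.ofReal (max (u x - k) 0 ^ 2) * carreDuChamp (symPart K) τ x < ∞ := by
    calc _ ≤ ∫⁻ x in S, ENNReal.ofReal (u x ^ 2) * Λ := by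
          refine setLIntegral_mono' hτ.measurableSet_S fun x hx => ?_
          exact mul_le_mul' (ENNReal.ofReal_le_ofReal (sq_posPart_le (hu x) hk))
            (hτ.gamma_symPart_le x (hτ.subset hx))
      _ = (∫⁻ x in S, ENNReal.ofReal (u x ^ 2)) * Λ := lintegral_mul_const' _ _ hτ.ne_top
      _ ≤ (∫⁻ x in B, ENNReal.ofReal (u x ^ 2)) * Λ := by
          gcongr; exact hτ.subset.trans hτ.subset'
      _ < ∞ := ENNReal.mul_lt_top (lintegral_sq_lt_top_of_normSqV hV) hτ.ne_top.lt_top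
  exact ENNReal.add_lt_top.2 ⟨ENNReal.mul_lt_top (by norm_num) h1,
    ENNReal.mul_lt_top (by norm_num) h2⟩

theorem AdmissibleCutoff.energy_mul_lt_top (hτ : AdmissibleCutoff K J B S S' Λ τ)
    (hK : Measurable (Function.uncurry K)) (hum : Measurable u) (hu : ∀ x, 0 ≤ u x) (hk : 0 ≤ k)
    (hV : normSqV K B u < ∞) :
    energy (symPart K) univ univ (fun x => τ x * max (u x - k) 0) < ∞ := by
  have hm := hτ.measurable
  refine hτ.energy_lt_top hK hum hu hk hV (by fun_prop)
    (fun x hx => by simp [hτ.eq_zero x hx]) fun x _ y => ?_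
  have h1 := sq_mul_sub_mul_le (s := τ x) (a := max (u x - k) 0) (b := max (u y - k) 0)
    (hτ.nonneg y) (hτ.le_one y)
  have h2 := sq_max_sub_max_le (u x) (u y) k
  have h3 : 0 ≤ max (u x - k) 0 ^ 2 * (τ x - τ y) ^ 2 := by positivity
  linarith

theorem AdmissibleCutoff.energy_sq_mul_lt_top (hτ : AdmissibleCutoff K J B S S' Λ τ)
    (hK : Measurable (Function.uncurry K)) (hum : Measurable u) (hu : ∀ x, 0 ≤ u x) (hk : 0 ≤ k)
    (hV : normSqV K B u < ∞) :
    energy (symPart K) univ univ (fun x => τ x ^ 2 * max (u x - k) 0) < ∞ := by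
  have hm := hτ.measurable
  refine hτ.energy_lt_top hK hum hu hk hV (by fun_prop)
    (fun x hx => by simp [hτ.eq_zero x hx]) fun x _ y => ?_
  have h0 := hτ.nonneg
  have h1' := hτ.le_one
  have h1 := sq_mul_sub_mul_le (s := τ x ^ 2) (t := τ y ^ 2) (a := max (u x - k) 0)
    (b := max (u y - k) 0) (by positivity) (pow_le_one₀ (h0 y) (h1' y))
  have h2 := sq_max_sub_max_le (u x) (u y) k
  have h3 : (τ x ^ 2 - τ y ^ 2) ^ 2 ≤ 4 * (τ x - τ y) ^ 2 := by
    rw [sq_sub_sq, mul_pow]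
    gcongr
    nlinarith [h0 x, h0 y, h1' x, h1' y]
  have h4 : max (u x - k) 0 ^ 2 * (τ x ^ 2 - τ y ^ 2) ^ 2 ≤
      max (u x - k) 0 ^ 2 * (4 * (τ x - τ y) ^ 2) := by gcongr
  linarith

theorem testFunction_sq_le (hτ : AdmissibleCutoff K J B S S' Λ τ) (hu : ∀ x, 0 ≤ u x)
    (hk : 0 ≤ k) (x : Eu d) : (τ x ^ 2 * max (u x - k) 0) ^ 2 ≤ B.indicator (fun x => u x ^ 2) x := by
  by_cases hx : x ∈ S
  · rw [indicator_of_mem (hτ.subset' (hτ.subset hx)), mul_pow]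
    refine (mul_le_of_le_one_left (sq_nonneg _) ?_).trans (sq_posPart_le (hu x) hk)
    exact pow_le_one₀ (by positivity) (pow_le_one₀ (hτ.nonneg x) (hτ.le_one x))
  · rw [hτ.eq_zero x hx]
    simp only [ne_eq, OfNat.ofNat_ne_zero, not_false_eq_true, zero_pow, zero_mul]
    exact indicator_nonneg (fun _ _ => sq_nonneg _) x

theorem AdmissibleCutoff.lintegral_testFunction_sq_lt_top (hτ : AdmissibleCutoff K J B S S' Λ τ)
    (hu : ∀ x, 0 ≤ u x) (hk : 0 ≤ k) (hV : normSqV K B u < ∞) :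
    ∫⁻ x, ENNReal.ofReal ((τ x ^ 2 * max (u x - k) 0) ^ 2) < ∞ := by
  refine lt_of_le_of_lt ?_ (lintegral_sq_lt_top_of_normSqV hV)
  rw [← lintegral_indicator hτ.measurableSet_B]
  refine lintegral_mono fun x => ?_
  refine (ENNReal.ofReal_le_ofReal (testFunction_sq_le hτ hu hk x)).trans (le_of_eq ?_)
  by_cases hx : x ∈ B <;> simp [hx]

theorem AdmissibleCutoff.memH (hτ : AdmissibleCutoff K J B S S' Λ τ)
    (hK : Measurable (Function.uncurry K)) (hum : Measurable u) (hu : ∀ x, 0 ≤ u x) (hk : 0 ≤ k)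
    (hV : normSqV K B u < ∞) : MemH K B (fun x => τ x ^ 2 * max (u x - k) 0) := by
  have hm := hτ.measurable
  refine ⟨⟨by fun_prop, ?_⟩, fun x hx => ?_⟩
  · rw [normSqV, Measure.restrict_univ, lintegral_sq_eq]
    exact ENNReal.add_lt_top.2 ⟨hτ.lintegral_testFunction_sq_lt_top hu hk hV,
      hτ.energy_sq_mul_lt_top hK hum hu hk hV⟩
  · simp [hτ.eq_zero x fun h => hx (hτ.subset' (hτ.subset h))]

theorem AdmissibleCutoff.memLp_mul (hτ : AdmissibleCutoff K J B S S' Λ τ)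
    (hum : Measurable u) (hu : ∀ x, 0 ≤ u x) (hk : 0 ≤ k) (hV : normSqV K B u < ∞) :
    MemLp (fun x => τ x * max (u x - k) 0) 2 (volume.restrict B) := by
  have hm := hτ.measurable
  have hmW : Measurable fun x => τ x * max (u x - k) 0 := by fun_prop
  refine ⟨hmW.aestronglyMeasurable, ?_⟩
  have h : eLpNorm (fun x => τ x * max (u x - k) 0) 2 (volume.restrict B) ^ 2 < ∞ := by
    rw [lintegral_sq_eq]
    refine lt_of_le_of_lt (lintegral_mono fun x => ENNReal.ofReal_le_ofReal ?_)
      (lintegral_sq_lt_top_of_normSqV hV)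
    rw [mul_pow]
    exact (mul_le_of_le_one_left (sq_nonneg _) (pow_le_one₀ (hτ.nonneg x) (hτ.le_one x))).trans
      (sq_posPart_le (hu x) hk)
  exact (ENNReal.pow_lt_top_iff.1 h).resolve_right (by norm_num)

/-! ### The form is well defined -/

theorem measurable_symIntegrand (hK : Measurable (Function.uncurry K)) {v w : Eu d → ℝ}
    (hv : Measurable v) (hw : Measurable w) : Measurable (symIntegrand K v w) := by
  have h : Measurable fun p : Eu d × Eu d => (symPart K p.1 p.2).toReal :=
    (measurable_symPart hK).ennreal_toReal
  unfold symIntegrand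
  exact Measurable.mul (by fun_prop) h

theorem measurable_antiIntegrand (hK : Measurable (Function.uncurry K)) {v w : Eu d → ℝ}
    (hv : Measurable v) (hw : Measurable w) : Measurable (antiIntegrand K v w) := by
  have h : Measurable fun p : Eu d × Eu d => antiPart K p.1 p.2 := measurable_antiPart hK
  unfold antiIntegrand
  exact Measurable.mul (by fun_prop) h

theorem enorm_mul_mul_le (X Y κ : ℝ) {J : ℝ≥0∞} :
    ‖X * Y * κ‖ₑ ≤ ENNReal.ofReal (X ^ 2) * J + ENNReal.ofReal (Y ^ 2) * (‖κ‖ₑ ^ 2 / J) := by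
  have h := ofReal_mul_abs_le (J := J) (κ := κ) (abs_nonneg X) (abs_nonneg Y) one_pos
  rw [one_mul, sq_abs, sq_abs, div_one] at h
  rwa [Real.enorm_eq_ofReal_abs, abs_mul, abs_mul]

theorem enorm_mul_mul_le' (X Y : ℝ) {κ : ℝ} {σ : ℝ≥0∞} (h : ‖κ‖ₑ ≤ σ) :
    ‖X * Y * κ‖ₑ ≤ ENNReal.ofReal (X ^ 2) * σ + ENNReal.ofReal (Y ^ 2) * σ := by
  rw [enorm_mul, ← add_mul, ← ENNReal.ofReal_add (by positivity) (by positivity)]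
  gcongr
  rw [Real.enorm_eq_ofReal_abs]
  apply ENNReal.ofReal_le_ofReal
  rw [abs_le]
  constructor <;> nlinarith [sq_nonneg (X - Y), sq_nonneg (X + Y)]

theorem enorm_toReal_le (a : ℝ≥0∞) : ‖a.toReal‖ₑ ≤ a := by
  rw [Real.enorm_eq_ofReal_abs, abs_of_nonneg ENNReal.toReal_nonneg]
  exact ENNReal.ofReal_toReal_le

theorem integrable_of_symm_bound {F : Eu d × Eu d → ℝ} (hF : Measurable F)
    {g : Eu d × Eu d → ℝ≥0∞} (hg : Measurable g) (h : ∀ p, ‖F p‖ₑ ≤ g p + g p.swap)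
    (hfin : ∫⁻ p, g p < ∞) : Integrable F :=
  ⟨hF.aestronglyMeasurable, (lintegral_prod_symm_le hg h).trans_lt
    (ENNReal.mul_lt_top (by norm_num) hfin)⟩

theorem integrable_symIntegrand (hK : Measurable (Function.uncurry K)) (hB : MeasurableSet B)
    {v : Eu d → ℝ} (hu : Measurable u) (hv : Measurable v)
    (hV : energy (symPart K) B univ u < ∞) (hv0 : ∀ x ∉ B, v x = 0)
    (hvE : energy (symPart K) univ univ v < ∞) : Integrable (symIntegrand K u v) := by
  have hs := measurable_symPart hK
  have m1 := measurable_energyIntegrand hs hu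
  have m2 := measurable_energyIntegrand hs hv
  refine integrable_of_symm_bound (measurable_symIntegrand hK hu hv)
    (g := fun p => (B ×ˢ univ).indicator (fun p : Eu d × Eu d =>
      ENNReal.ofReal ((u p.1 - u p.2) ^ 2) * symPart K p.1 p.2) p +
      ENNReal.ofReal ((v p.1 - v p.2) ^ 2) * symPart K p.1 p.2)
    ((m1.indicator (hB.prod MeasurableSet.univ)).add m2) ?_ ?_
  · rintro ⟨x, y⟩
    have key := enorm_mul_mul_le' (u x - u y) (v x - v y) (enorm_toReal_le (symPart K x y))
    simp only [symIntegrand, Prod.swap_prod_mk]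
    by_cases hx : x ∈ B
    · have hm : (x, y) ∈ B ×ˢ (univ : Set (Eu d)) := ⟨hx, mem_univ _⟩
      rw [indicator_of_mem hm]
      exact le_add_right key
    by_cases hy : y ∈ B
    · have hm : (y, x) ∈ B ×ˢ (univ : Set (Eu d)) := ⟨hy, mem_univ _⟩
      rw [indicator_of_mem hm]
      refine le_add_left (key.trans (le_of_eq ?_))
      rw [symPart_comm K y x, ← neg_sub (u x), neg_sq, ← neg_sub (v x), neg_sq]
    · simp [hv0 x hx, hv0 y hy]
  · rw [lintegral_add_right _ m2,
      lintegral_indicator (hB.prod MeasurableSet.univ), ← energy_eq_lintegral hs hu]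
    refine ENNReal.add_lt_top.2 ⟨hV, ?_⟩
    rw [energy_eq_lintegral hs hv, univ_prod_univ, Measure.restrict_univ] at hvE
    exact hvE

theorem symIntegrand_comm (K : Eu d → Eu d → ℝ≥0∞) (u v : Eu d → ℝ) :
    symIntegrand K u v = symIntegrand K v u := by
  funext p; simp only [symIntegrand]; ring

theorem lintegral_mul_driftDensity {f : Eu d → ℝ≥0∞} (hf : Measurable f)
    (hK : Measurable (Function.uncurry K)) (hJ : Measurable (Function.uncurry J))
    (B : Set (Eu d)) :
    ∫⁻ p in univ ×ˢ B, f p.1 * (‖antiPart K p.1 p.2‖ₑ ^ 2 / J p.1 p.2) =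
      ∫⁻ x, f x * driftDensity K J B x := by
  have hm : Measurable fun p : Eu d × Eu d => f p.1 * (‖antiPart K p.1 p.2‖ₑ ^ 2 / J p.1 p.2) :=
    (hf.comp measurable_fst).mul (measurable_drift hK hJ)
  rw [Measure.volume_eq_prod, ← Measure.prod_restrict, Measure.restrict_univ,
    lintegral_prod _ hm.aemeasurable]
  refine lintegral_congr fun x => ?_
  have h : Measurable fun y => ‖antiPart K x y‖ₑ ^ 2 / J x y :=
    ((measurable_antiPart hK).of_uncurry_left.enorm.pow_const 2).div hJ.of_uncurry_left
  exact lintegral_const_mul (f x) h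

theorem sq_add_le (a b : ℝ) : ENNReal.ofReal ((a + b) ^ 2) ≤
    2 * ENNReal.ofReal (a ^ 2) + 2 * ENNReal.ofReal (b ^ 2) := by
  rw [← ENNReal.ofReal_ofNat 2, ← ENNReal.ofReal_mul (by norm_num),
    ← ENNReal.ofReal_mul (by norm_num), ← ENNReal.ofReal_add (by positivity) (by positivity)]
  apply ENNReal.ofReal_le_ofReal
  nlinarith [sq_nonneg (a - b)]

theorem integrable_antiIntegrand_primal (hK : Measurable (Function.uncurry K))
    (hJ : Measurable (Function.uncurry J)) (hJs : ∀ x y, J x y = J y x) (hB : MeasurableSet B)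
    {v : Eu d → ℝ} (hu : Measurable u) (hv : Measurable v)
    (hV : energy (symPart K) B univ u < ∞) (hv0 : ∀ x ∉ B, v x = 0)
    (hvE : energy (symPart K) univ univ v < ∞) (huJ : energy J B B u < ∞)
    (hG : ∫⁻ x, ENNReal.ofReal (v x ^ 2) * driftDensity K J B x < ∞) :
    Integrable (antiIntegrand K u v) := by
  have hs := measurable_symPart hK
  have m1 := measurable_energyIntegrand hs hu
  have m2 := measurable_energyIntegrand hs hv
  have m3 := (measurable_energyIntegrand hJ hu).indicator (hB.prod hB)
  have m1' := m1.indicator (hB.prod MeasurableSet.univ)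
  have hD : Measurable fun p : Eu d × Eu d => ENNReal.ofReal (v p.1 ^ 2) *
      (‖antiPart K p.1 p.2‖ₑ ^ 2 / J p.1 p.2) := Measurable.mul (by fun_prop)
    (measurable_drift hK hJ)
  have m4 := (hD.const_mul 2).indicator (MeasurableSet.univ.prod hB)
  refine integrable_of_symm_bound (measurable_antiIntegrand hK hu hv)
    (g := fun p => (((B ×ˢ univ).indicator (fun p : Eu d × Eu d =>
      ENNReal.ofReal ((u p.1 - u p.2) ^ 2) * symPart K p.1 p.2) p +
      ENNReal.ofReal ((v p.1 - v p.2) ^ 2) * symPart K p.1 p.2) +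
      (B ×ˢ B).indicator (fun p : Eu d × Eu d =>
        ENNReal.ofReal ((u p.1 - u p.2) ^ 2) * J p.1 p.2) p) +
      (univ ×ˢ B).indicator (fun p : Eu d × Eu d => 2 * (ENNReal.ofReal (v p.1 ^ 2) *
        (‖antiPart K p.1 p.2‖ₑ ^ 2 / J p.1 p.2))) p)
    (((m1'.add m2).add m3).add m4) ?_ ?_
  · rintro ⟨x, y⟩
    simp only [antiIntegrand, Prod.swap_prod_mk]
    by_cases hx : x ∈ B <;> by_cases hy : y ∈ B
    · have hm1 : (x, y) ∈ B ×ˢ B := ⟨hx, hy⟩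
      have hm2 : (x, y) ∈ (univ : Set (Eu d)) ×ˢ B := ⟨mem_univ _, hy⟩
      have hm3 : (y, x) ∈ (univ : Set (Eu d)) ×ˢ B := ⟨mem_univ _, hx⟩
      rw [indicator_of_mem hm1, indicator_of_mem hm2, indicator_of_mem hm3]
      refine (enorm_mul_mul_le (J := J x y) (u x - u y) (v x + v y) _).trans ?_
      rw [antiPart_comm K y x, hJs y x, enorm_neg]
      calc _ ≤ ENNReal.ofReal ((u x - u y) ^ 2) * J x y + (2 * ENNReal.ofReal (v x ^ 2) +
            2 * ENNReal.ofReal (v y ^ 2)) * (‖antiPart K x y‖ₑ ^ 2 / J x y) := by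
            gcongr; exact sq_add_le _ _
        _ = (ENNReal.ofReal ((u x - u y) ^ 2) * J x y + 2 * (ENNReal.ofReal (v x ^ 2) *
              (‖antiPart K x y‖ₑ ^ 2 / J x y))) +
            2 * (ENNReal.ofReal (v y ^ 2) * (‖antiPart K x y‖ₑ ^ 2 / J x y)) := by ring
        _ ≤ _ := add_le_add (add_le_add le_add_self le_rfl) le_add_self
    · have key := enorm_mul_mul_le' (u x - u y) (v x - v y) (enorm_antiPart_le K x y)
      have hm : (x, y) ∈ B ×ˢ (univ : Set (Eu d)) := ⟨hx, mem_univ _⟩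
      rw [indicator_of_mem hm, show v x + v y = v x - v y by rw [hv0 y hy]; ring]
      exact le_add_right (le_add_right (le_add_right key))
    · have key := enorm_mul_mul_le' (u x - u y) (v y - v x) (enorm_antiPart_le K x y)
      have hm : (y, x) ∈ B ×ˢ (univ : Set (Eu d)) := ⟨hy, mem_univ _⟩
      rw [indicator_of_mem hm, show v x + v y = v y - v x by rw [hv0 x hx]; ring]
      refine le_add_left (le_add_right (le_add_right (key.trans (le_of_eq ?_))))
      rw [symPart_comm K y x, ← neg_sub (u x), neg_sq]
    · simp [hv0 x hx, hv0 y hy]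
  · rw [lintegral_add_right _ m4, lintegral_add_right _ m3,
      lintegral_add_right _ m2, lintegral_indicator (hB.prod MeasurableSet.univ),
      ← energy_eq_lintegral hs hu, lintegral_indicator (hB.prod hB), ← energy_eq_lintegral hJ hu,
      lintegral_indicator (MeasurableSet.univ.prod hB), lintegral_const_mul _ hD]
    rw [energy_eq_lintegral hs hv, univ_prod_univ, Measure.restrict_univ] at hvE
    rw [lintegral_mul_driftDensity (f := fun x => ENNReal.ofReal (v x ^ 2))
      (hv.pow_const 2).ennreal_ofReal hK hJ]
    exact ENNReal.add_lt_top.2 ⟨ENNReal.add_lt_top.2 ⟨ENNReal.add_lt_top.2 ⟨hV, hvE⟩, huJ⟩,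
      ENNReal.mul_lt_top (by norm_num) hG⟩

theorem integrable_antiIntegrand_dual (hK : Measurable (Function.uncurry K))
    (hJ : Measurable (Function.uncurry J)) (hJs : ∀ x y, J x y = J y x)
    {v : Eu d → ℝ} (hu : Measurable u) (hv : Measurable v)
    (hvE : energy J univ univ v < ∞)
    (hG : ∫⁻ x, ENNReal.ofReal (u x ^ 2) * driftDensity K J univ x < ∞) :
    Integrable (antiIntegrand K v u) := by
  have m2 := measurable_energyIntegrand hJ hv
  have hD : Measurable fun p : Eu d × Eu d => ENNReal.ofReal (u p.1 ^ 2) *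
      (‖antiPart K p.1 p.2‖ₑ ^ 2 / J p.1 p.2) := Measurable.mul (by fun_prop)
    (measurable_drift hK hJ)
  have m4 := hD.const_mul 2
  refine integrable_of_symm_bound (measurable_antiIntegrand hK hv hu)
    (g := fun p => ENNReal.ofReal ((v p.1 - v p.2) ^ 2) * J p.1 p.2 +
      2 * (ENNReal.ofReal (u p.1 ^ 2) * (‖antiPart K p.1 p.2‖ₑ ^ 2 / J p.1 p.2)))
    (m2.add m4) ?_ ?_
  · rintro ⟨x, y⟩
    simp only [antiIntegrand, Prod.swap_prod_mk]
    refine (enorm_mul_mul_le (J := J x y) (v x - v y) (u x + u y) _).trans ?_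
    rw [antiPart_comm K y x, hJs y x, enorm_neg]
    calc _ ≤ ENNReal.ofReal ((v x - v y) ^ 2) * J x y + (2 * ENNReal.ofReal (u x ^ 2) +
          2 * ENNReal.ofReal (u y ^ 2)) * (‖antiPart K x y‖ₑ ^ 2 / J x y) := by
          gcongr; exact sq_add_le _ _
      _ = (ENNReal.ofReal ((v x - v y) ^ 2) * J x y + 2 * (ENNReal.ofReal (u x ^ 2) *
            (‖antiPart K x y‖ₑ ^ 2 / J x y))) +
          2 * (ENNReal.ofReal (u y ^ 2) * (‖antiPart K x y‖ₑ ^ 2 / J x y)) := by ring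
      _ ≤ _ := add_le_add le_rfl le_add_self
  · rw [lintegral_add_right _ m4, lintegral_const_mul _ hD]
    rw [energy_eq_lintegral hJ hv, univ_prod_univ, Measure.restrict_univ] at hvE
    refine ENNReal.add_lt_top.2 ⟨hvE, ENNReal.mul_lt_top (by norm_num) ?_⟩
    have := lintegral_mul_driftDensity (f := fun x => ENNReal.ofReal (u x ^ 2))
      (hu.pow_const 2).ennreal_ofReal hK hJ univ
    rw [univ_prod_univ, Measure.restrict_univ] at this
    rw [this]
    exact hG

/-- The `J`-energy of the test function on the whole space. -/
theorem AdmissibleCutoff.energy_J_testFunction_lt_top (hτ : AdmissibleCutoff K J B S S' Λ τ)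
    (hJ : Measurable (Function.uncurry J)) (hJs : ∀ x y, J x y = J y x)
    (hum : Measurable u) (hu : ∀ x, 0 ≤ u x) (hk : 0 ≤ k) (hV : normSqV K B u < ∞)
    (hE : energy J B B (fun x => τ x ^ 2 * max (u x - k) 0) < ∞) :
    energy J univ univ (fun x => τ x ^ 2 * max (u x - k) 0) < ∞ := by
  have hm := hτ.measurable
  have hB := hτ.measurableSet_B
  have hS := hτ.measurableSet_S
  have hφ : Measurable fun x => τ x ^ 2 * max (u x - k) 0 := by fun_prop
  have m1 := (measurable_energyIntegrand hJ hφ).indicator (hB.prod hB)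
  have hw : Measurable fun x => max (u x - k) 0 := by fun_prop
  have m2' := measurable_weighted_energyIntegrand hJ hw hm
  have m2 := m2'.indicator (hS.prod MeasurableSet.univ)
  rw [energy_eq_lintegral hJ hφ, univ_prod_univ, Measure.restrict_univ]
  refine (lintegral_prod_symm_le (m1.add m2) ?_).trans_lt (ENNReal.mul_lt_top (by norm_num) ?_)
  · have key : ∀ x y, x ∈ S → y ∉ B → ENNReal.ofReal ((τ x ^ 2 * max (u x - k) 0 -
        τ y ^ 2 * max (u y - k) 0) ^ 2) * J x y ≤ ENNReal.ofReal (max (u x - k) 0 ^ 2) *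
          (ENNReal.ofReal ((τ x - τ y) ^ 2) * J x y) := by
      intro x y _ hy
      have hy0 : τ y = 0 := hτ.eq_zero y fun h => hy (hτ.subset' (hτ.subset h))
      rw [← mul_assoc, ← ENNReal.ofReal_mul (by positivity), hy0]
      gcongr
      have h1 : τ x ^ 2 * τ x ^ 2 ≤ 1 * τ x ^ 2 := by
        gcongr; exact pow_le_one₀ (hτ.nonneg x) (hτ.le_one x)
      nlinarith [mul_le_mul_of_nonneg_left h1 (sq_nonneg (max (u x - k) 0))]
    rintro ⟨x, y⟩
    simp only [Prod.swap_prod_mk, Pi.add_apply]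
    by_cases hxS : x ∉ S ∧ y ∉ S
    · simp [hτ.eq_zero x hxS.1, hτ.eq_zero y hxS.2]
    by_cases hB2 : x ∈ B ∧ y ∈ B
    · have hmem : (x, y) ∈ B ×ˢ B := hB2
      rw [indicator_of_mem hmem]
      exact le_add_right le_self_add
    by_cases hx : x ∈ S
    · have hy : y ∉ B := fun h => hB2 ⟨hτ.subset' (hτ.subset hx), h⟩
      have hmem : (x, y) ∈ S ×ˢ (univ : Set (Eu d)) := ⟨hx, mem_univ _⟩
      rw [indicator_of_mem hmem]
      exact le_add_right (le_add_left (key x y hx hy))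
    · have hy : y ∈ S := by_contra fun h => hxS ⟨hx, h⟩
      have hx' : x ∉ B := fun h => hB2 ⟨h, hτ.subset' (hτ.subset hy)⟩
      have hmem : (y, x) ∈ S ×ˢ (univ : Set (Eu d)) := ⟨hy, mem_univ _⟩
      rw [indicator_of_mem hmem]
      refine le_add_left (le_add_left (le_trans (le_of_eq ?_) (key y x hy hx')))
      rw [hJs, ← neg_sub, neg_sq]
  · simp only [Pi.add_apply]
    rw [lintegral_add_right _ m2, lintegral_indicator (hB.prod hB), ← energy_eq_lintegral hJ hφ]
    refine ENNReal.add_lt_top.2 ⟨hE, ?_⟩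
    rw [lintegral_indicator (hS.prod MeasurableSet.univ),
      lintegral_weighted_energyIntegrand hJ hw hm]
    calc _ ≤ ∫⁻ x in S, ENNReal.ofReal (u x ^ 2) * Λ := by
          refine setLIntegral_mono' hS fun x hx => ?_
          exact mul_le_mul' (ENNReal.ofReal_le_ofReal (sq_posPart_le (hu x) hk)) (hτ.gamma_le x hx)
      _ = (∫⁻ x in S, ENNReal.ofReal (u x ^ 2)) * Λ := lintegral_mul_const' _ _ hτ.ne_top
      _ ≤ (∫⁻ x in B, ENNReal.ofReal (u x ^ 2)) * Λ := by
          gcongr; exact hτ.subset.trans hτ.subset'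
      _ < ∞ := ENNReal.mul_lt_top (lintegral_sq_lt_top_of_normSqV hV) hτ.ne_top.lt_top

end TestFunction

/-! ### The Caccioppoli inequality at a fixed time -/

section Caccioppoli

variable {d : ℕ} {K J Kt : Eu d → Eu d → ℝ≥0∞} {B S S' : Set (Eu d)} {Λ : ℝ≥0∞} {τ u : Eu d → ℝ}
  {k kk ε : ℝ}

theorem AdmissibleCutoff.lintegral_errorDensity_le (hτ : AdmissibleCutoff K J B S S' Λ τ)
    (hK : Measurable (Function.uncurry K)) (hJ : Measurable (Function.uncurry J))
    (hum : Measurable u) (hu : ∀ x, 0 ≤ u x) (hk : 0 ≤ k) {T₁ T₂ : ℝ≥0∞}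
    (hT₁ : ∀ x ∈ S, ∫⁻ y in B \ S', ENNReal.ofReal (u y) * symPart K x y ≤ T₁)
    (hT₂ : ∀ x ∈ S, ∫⁻ y in Bᶜ, ENNReal.ofReal (u y) * Kt x y ≤ T₂) :
    ∫⁻ x, errorDensity K J Kt B S S' τ u k kk ε x ≤
      4 * Λ * (∫⁻ x in S', ENNReal.ofReal (max (u x - k) 0 ^ 2)) +
      ENNReal.ofReal (6 / ε) *
        (∫⁻ x, driftWeight kk (τ x * max (u x - k) 0) * driftDensity K J B x) +
      (2 * T₁ + T₂) * ∫⁻ x in S', ENNReal.ofReal (max (u x - k) 0) := by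
  have hm := hτ.measurable
  have hw2 : Measurable fun x => ENNReal.ofReal (max (u x - k) 0 ^ 2) := by fun_prop
  have hw1 : Measurable fun x => ENNReal.ofReal (max (u x - k) 0) := by fun_prop
  have hDW : Measurable fun x => driftWeight kk (τ x * max (u x - k) 0) * driftDensity K J B x :=
    ((measurable_driftWeight kk).comp (by fun_prop)).mul (measurable_driftDensity hK hJ B)
  calc _ ≤ ∫⁻ x, ((S'.indicator (fun x => 4 * Λ * ENNReal.ofReal (max (u x - k) 0 ^ 2)) x +
        ENNReal.ofReal (6 / ε) *
          (driftWeight kk (τ x * max (u x - k) 0) * driftDensity K J B x)) +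
        S'.indicator (fun x => (2 * T₁ + T₂) * ENNReal.ofReal (max (u x - k) 0)) x) := by
        refine lintegral_mono fun x => ?_
        have hφ : ENNReal.ofReal (τ x ^ 2 * max (u x - k) 0) ≤ ENNReal.ofReal (max (u x - k) 0) :=
          ENNReal.ofReal_le_ofReal (mul_le_of_le_one_left (le_max_right _ _)
            (pow_le_one₀ (hτ.nonneg x) (hτ.le_one x)))
        rw [errorDensity]
        by_cases hxS : x ∈ S
        · have hxS' := hτ.subset hxS
          simp only [indicator_of_mem hxS, indicator_of_mem hxS']
          have h1 := hτ.gamma_symPart_le x hxS'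
          have h2 := hτ.gamma_le x hxS
          have h3 : ∫⁻ y in B \ S', ENNReal.ofReal (max (u y - k) 0) * symPart K x y ≤ T₁ :=
            (lintegral_mono fun y => mul_le_mul' (ENNReal.ofReal_le_ofReal
              (max_le (by linarith) (hu y))) le_rfl).trans (hT₁ x hxS)
          calc _ ≤ 2 * (ENNReal.ofReal (max (u x - k) 0 ^ 2) * Λ) +
                2 * (ENNReal.ofReal (max (u x - k) 0 ^ 2) * Λ) +
                ENNReal.ofReal (6 / ε) * driftWeight kk (τ x * max (u x - k) 0) *
                  driftDensity K J B x + 2 * ENNReal.ofReal (max (u x - k) 0) * T₁ +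
                ENNReal.ofReal (max (u x - k) 0) * T₂ := by
                gcongr
                exact hT₂ x hxS
            _ = _ := by ring
        · simp only [indicator_of_notMem hxS, hτ.eq_zero x hxS]
          by_cases hxS' : x ∈ S'
          · simp only [indicator_of_mem hxS']
            have h1 := hτ.gamma_symPart_le x hxS'
            calc _ ≤ 2 * (ENNReal.ofReal (max (u x - k) 0 ^ 2) * Λ) +
                  ENNReal.ofReal (6 / ε) * driftWeight kk (0 * max (u x - k) 0) *
                    driftDensity K J B x := by
                  simp only [ne_eq, OfNat.ofNat_ne_zero, not_false_eq_true, zero_pow, zero_mul,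
                    ENNReal.ofReal_zero, mul_zero, add_zero]
                  gcongr
              _ ≤ 4 * Λ * ENNReal.ofReal (max (u x - k) 0 ^ 2) + ENNReal.ofReal (6 / ε) *
                    (driftWeight kk (0 * max (u x - k) 0) * driftDensity K J B x) := by
                  rw [mul_assoc, mul_assoc 4, mul_comm Λ]
                  gcongr
                  norm_num
              _ ≤ _ := le_self_add
          · simp only [indicator_of_notMem hxS']
            simp [mul_assoc]
    _ = _ := by
        rw [lintegral_add_right _ ((hw1.const_mul _).indicator hτ.measurableSet_S'),
          lintegral_add_right _ (hDW.const_mul _), lintegral_const_mul _ hDW,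
          lintegral_indicator hτ.measurableSet_S', lintegral_indicator hτ.measurableSet_S',
          lintegral_const_mul _ hw2, lintegral_const_mul _ hw1]

/-- Caccioppoli inequality: the form tested with `τ² (u - k)₊` controls the energy. -/
theorem IsFormIntegrand.caccioppoli {I : Eu d × Eu d → ℝ}
    (hI : IsFormIntegrand K Kt τ u k kk I) (hint : Integrable I)
    (hτ : AdmissibleCutoff K J B S S' Λ τ)
    (hK : Measurable (Function.uncurry K)) (hJ : Measurable (Function.uncurry J))
    (hKt : Measurable (Function.uncurry Kt)) (hJs : ∀ x y, J x y = J y x)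
    (hfin : ∀ᵐ p : Eu d × Eu d, K p.1 p.2 ≠ ∞ ∧ K p.2 p.1 ≠ ∞)
    (hum : Measurable u) (hu : ∀ x, 0 ≤ u x) (hk : 0 ≤ k) (hkk : 0 ≤ kk)
    (hV : normSqV K B u < ∞) (hε : 0 < ε) (hε1 : ε ≤ 1) {T₁ T₂ C c c' η N Q : ℝ≥0∞}
    (hT₁ : ∀ x ∈ S, ∫⁻ y in B \ S', ENNReal.ofReal (u y) * symPart K x y ≤ T₁)
    (hT₂ : ∀ x ∈ S, ∫⁻ y in Bᶜ, ENNReal.ofReal (u y) * Kt x y ≤ T₂)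
    (hE : energy J B B (fun x => τ x * max (u x - k) 0) ≤
      C * energy (symPart K) B B (fun x => τ x * max (u x - k) 0))
    (hC : 2 * ENNReal.ofReal ε * C ≤ 1 / 4)
    (hN : N ≤ c * energy (symPart K) B B (fun x => τ x * max (u x - k) 0) +
      c' * ∫⁻ x in S', ENNReal.ofReal (max (u x - k) 0 ^ 2))
    (hD : ∫⁻ x, driftWeight kk (τ x * max (u x - k) 0) * driftDensity K J B x ≤ η * N + Q)
    (hη : 2 * ENNReal.ofReal (6 / ε) * η * c ≤ 1 / 4) :
    1 / 2 * energy (symPart K) B B (fun x => τ x * max (u x - k) 0) +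
        ENNReal.ofReal (-∫ p, I p) ≤
      (8 * Λ + 2 * ENNReal.ofReal (6 / ε) * η * c') *
          (∫⁻ x in S', ENNReal.ofReal (max (u x - k) 0 ^ 2)) +
        2 * ENNReal.ofReal (6 / ε) * Q +
        (4 * T₁ + 2 * T₂) * (∫⁻ x in S', ENNReal.ofReal (max (u x - k) 0)) +
        ENNReal.ofReal (∫ p, I p) := by
  have h1 := hI.lintegral_le hint hK hJ hKt hfin hτ.measurableSet_B hτ.measurableSet_S
    hτ.measurableSet_S' hτ.measurable hum hJs hτ.subset hτ.subset' hτ.nonneg hτ.le_one hτ.eq_zero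
    hu hkk hε hε1
  have h2 := hτ.lintegral_errorDensity_le (kk := kk) (ε := ε) (Kt := Kt) hK hJ hum hu hk hT₁ hT₂
  have hfinE : energy (symPart K) B B (fun x => τ x * max (u x - k) 0) ≠ ∞ :=
    ((energy_mono (subset_univ B) (subset_univ B) _).trans_lt
      (hτ.energy_mul_lt_top hK hum hu hk hV)).ne
  generalize energy (symPart K) B B (fun x => τ x * max (u x - k) 0) = E at *
  generalize energy J B B (fun x => τ x * max (u x - k) 0) = EJ at *
  generalize ∫⁻ x, driftWeight kk (τ x * max (u x - k) 0) * driftDensity K J B x = D at *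
  generalize ∫⁻ x in S', ENNReal.ofReal (max (u x - k) 0 ^ 2) = w₂ at *
  generalize ∫⁻ x in S', ENNReal.ofReal (max (u x - k) 0) = w₁ at *
  generalize ∫⁻ x, errorDensity K J Kt B S S' τ u k kk ε x = err at *
  generalize ∫ p, I p = F at *
  have h3 : E + ENNReal.ofReal (-F) ≤ 1 / 2 * E + ((8 * Λ + 2 * ENNReal.ofReal (6 / ε) * η * c') *
      w₂ + 2 * ENNReal.ofReal (6 / ε) * Q + (4 * T₁ + 2 * T₂) * w₁ + ENNReal.ofReal F) := by
    calc _ ≤ 2 * ENNReal.ofReal ε * (C * E) + 2 * (4 * Λ * w₂ + ENNReal.ofReal (6 / ε) *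
          (η * (c * E + c' * w₂) + Q) + (2 * T₁ + T₂) * w₁) + ENNReal.ofReal F := by
          refine h1.trans ?_
          gcongr
          refine h2.trans ?_
          gcongr
          refine hD.trans ?_
          gcongr
      _ = (2 * ENNReal.ofReal ε * C + 2 * ENNReal.ofReal (6 / ε) * η * c) * E +
          ((8 * Λ + 2 * ENNReal.ofReal (6 / ε) * η * c') *
      w₂ + 2 * ENNReal.ofReal (6 / ε) * Q + (4 * T₁ + 2 * T₂) * w₁ + ENNReal.ofReal F) := by ring
      _ ≤ (1 / 4 + 1 / 4) * E + _ := by gcongr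
      _ = _ := by
          congr 2
          rw [← ENNReal.toReal_eq_toReal_iff' (by finiteness) (by finiteness),
            ENNReal.toReal_add (by finiteness) (by finiteness)]
          norm_num
  have h4 : E + ENNReal.ofReal (-F) = 1 / 2 * E + (1 / 2 * E + ENNReal.ofReal (-F)) := by
    rw [← add_assoc, ← add_mul, ENNReal.add_halves, one_mul]
  rw [h4] at h3
  exact (ENNReal.add_le_add_iff_left (ENNReal.mul_ne_top (by finiteness) hfinE)).1 h3

end Caccioppoli

/-! ### Cutoff functions, and absorption of the drift -/

section Drift

variable {d : ℕ} {K J : Eu d → Eu d → ℝ≥0∞} {Ω : Set (Eu d)} {α : ℝ}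

theorem carreDuChamp_add_le {k k' k'' : Eu d → Eu d → ℝ≥0∞}
    (hk' : Measurable (Function.uncurry k')) (h : ∀ x y, k x y ≤ k' x y + k'' x y) {τ : Eu d → ℝ}
    (hτ : Measurable τ) (x : Eu d) :
    carreDuChamp k τ x ≤ carreDuChamp k' τ x + carreDuChamp k'' τ x := by
  simp only [carreDuChamp]
  rw [← lintegral_add_left (measurable_energyIntegrand_slice hk' hτ x)]
  refine lintegral_mono fun y => ?_
  rw [← mul_add]
  gcongr
  exact h x y

theorem exists_admissibleCutoff (hd : 0 < d) (hα0 : 0 < α) (hα2 : α < 2)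
    (hUpper : KernelUpperLoc K Ω α) (hCutoff : CutoffCondition (symPart K) Ω α)
    (hJ : IsSymmetricCutoffKernel J Ω α) {J' : Eu d → Eu d → ℝ≥0∞}
    (hJ' : ∀ x y, J' x y ≤ J x y + symPart K x y) :
    ∃ c : ℝ, 0 < c ∧ ∀ (x₀ : Eu d) (R r ρ : ℝ), 0 < R → R ≤ 1 → Metric.ball x₀ (2 * R) ⊆ Ω →
      R / 2 ≤ r → 0 < ρ → r + 2 * ρ ≤ R → ∃ τ : Eu d → ℝ,
        AdmissibleCutoff K J' (Metric.ball x₀ (2 * R)) (Metric.ball x₀ (r + ρ))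
          (Metric.ball x₀ (r + 2 * ρ)) (ENNReal.ofReal (c * ρ ^ (-α))) τ ∧
        ∀ x ∈ Metric.ball x₀ r, τ x = 1 := by
  obtain ⟨c₁, hc₁, H₁⟩ := hJ.cutoff
  obtain ⟨c₂, hc₂, H₂⟩ := exists_carreDuChamp_symPart_le hd hα0 hα2 hUpper hCutoff
  refine ⟨c₁ + c₂, by positivity, ?_⟩
  intro x₀ R r ρ hR hR1 hsub hr hρ hrρ
  have hx₀ : x₀ ∈ Ω := hsub (Metric.mem_ball_self (by positivity))
  obtain ⟨τ, hτ, hΓ⟩ := H₁ r ρ x₀ hρ (by linarith) (by linarith) hx₀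
    ((Metric.ball_subset_ball (by linarith)).trans hsub)
  have hm : Measurable τ := hτ.lipschitz.continuous.measurable
  have hρα : 0 < ρ ^ (-α) := Real.rpow_pos_of_pos hρ _
  have hK' : ∀ x ∈ Metric.ball x₀ R, carreDuChamp (symPart K) τ x ≤
      ENNReal.ofReal (c₂ * ρ ^ (-α)) :=
    H₂ x₀ R ρ τ hR hR1 hsub hρ (by linarith) hτ.lipschitz hτ.nonneg hτ.le_one
  refine ⟨τ, ⟨hm, hτ.nonneg, hτ.le_one, fun x hx => hτ.eq_zero (by linarith) hx, measurableSet_ball,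
    measurableSet_ball, measurableSet_ball, Metric.ball_subset_ball (by linarith),
    Metric.ball_subset_ball (by linarith), ENNReal.ofReal_ne_top, fun x hx => ?_, fun x hx => ?_⟩,
    hτ.eq_one⟩
  · refine (hK' x (Metric.ball_subset_ball hrρ hx)).trans (ENNReal.ofReal_le_ofReal ?_)
    nlinarith
  · refine (carreDuChamp_add_le hJ.measurable hJ' hm x).trans ?_
    refine (add_le_add (hΓ x hx) (hK' x (Metric.ball_subset_ball (by linarith) hx))).trans ?_
    rw [← ENNReal.ofReal_add (by positivity) (by positivity), add_mul]

/-- The `L^P` norm of the part of `G` above the level `M`. -/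
noncomputable def excess {X : Type*} [MeasurableSpace X] (P : ℝ) (G : X → ℝ≥0∞) (M : ℝ≥0∞)
    (μ : Measure X) : ℝ≥0∞ :=
  (∫⁻ x, {x | M < G x}.indicator G x ^ P ∂μ) ^ (1 / P)

theorem lintegral_mul_le_excess {X : Type*} [MeasurableSpace X] {μ : Measure X} {P p : ℝ}
    (hPp : P.HolderConjugate p) {G v : X → ℝ≥0∞} (hG : Measurable G) (hv : Measurable v)
    (M : ℝ≥0∞) :
    ∫⁻ x, v x * G x ∂μ ≤ excess P G M μ * (∫⁻ x, v x ^ p ∂μ) ^ (1 / p) + M * ∫⁻ x, v x ∂μ := by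
  have hms : MeasurableSet {x | M < G x} := measurableSet_lt measurable_const hG
  have hmi : Measurable ({x | M < G x}.indicator G) := hG.indicator hms
  calc _ ≤ ∫⁻ x, ({x | M < G x}.indicator G x * v x + M * v x) ∂μ := by
        refine lintegral_mono fun x => ?_
        by_cases hx : M < G x
        · rw [indicator_of_mem (show x ∈ {x | M < G x} from hx), mul_comm]
          exact le_self_add
        · rw [mul_comm]
          exact le_add_left (mul_le_mul_left (not_lt.1 hx) _)
    _ = ∫⁻ x, ({x | M < G x}.indicator G * v) x ∂μ + M * ∫⁻ x, v x ∂μ := by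
        rw [lintegral_add_right _ (hv.const_mul M), lintegral_const_mul _ hv]
        rfl
    _ ≤ _ := by
        gcongr
        exact ENNReal.lintegral_mul_le_Lp_mul_Lq μ hPp hmi.aemeasurable hv.aemeasurable

theorem tendsto_excess {X : Type*} [MeasurableSpace X] {μ : Measure X} {P : ℝ} (hP : 0 < P)
    {G : X → ℝ≥0∞} (hG : Measurable G) (hfin : ∫⁻ x, G x ^ P ∂μ ≠ ∞) :
    Filter.Tendsto (fun n : ℕ => excess P G n μ) Filter.atTop (nhds 0) := by
  have h1 : Filter.Tendsto (fun n : ℕ => ∫⁻ x, {x | (n : ℝ≥0∞) < G x}.indicator G x ^ P ∂μ)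
      Filter.atTop (nhds (∫⁻ _, 0 ∂μ)) := by
    refine tendsto_lintegral_of_dominated_convergence (fun x => G x ^ P) ?_ ?_ hfin ?_
    · intro n
      exact (hG.indicator (measurableSet_lt measurable_const hG)).pow_const P
    · intro n
      refine Filter.Eventually.of_forall fun x => ?_
      exact ENNReal.rpow_le_rpow (indicator_le_self _ _ x) hP.le
    · filter_upwards [ae_lt_top (hG.pow_const P) hfin] with x hx
      have hGx : G x ≠ ∞ := by
        intro h; rw [h, ENNReal.top_rpow_of_pos hP] at hx; exact lt_irrefl _ hx
      obtain ⟨m, hm⟩ := ENNReal.exists_nat_gt hGx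
      refine tendsto_const_nhds.congr' ?_
      filter_upwards [Filter.eventually_ge_atTop m] with n hn
      have : x ∉ {x | (n : ℝ≥0∞) < G x} := by
        simp only [mem_ofPred_eq, not_lt]
        exact hm.le.trans (by exact_mod_cast hn)
      rw [indicator_of_notMem this, ENNReal.zero_rpow_of_pos hP]
  rw [lintegral_zero] at h1
  have h2 := (ENNReal.continuous_rpow_const (y := 1 / P)).tendsto 0
  rw [ENNReal.zero_rpow_of_pos (by positivity)] at h2
  exact h2.comp h1

theorem excess_le_of_eLpNorm_le {X : Type*} [MeasurableSpace X] {P C : ℝ} (hP : 0 < P)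
    (hC : 0 < C) {θ : ℝ≥0∞} (hθ : ENNReal.ofReal P < θ) {η : ℝ} (hη : 0 < η) :
    ∃ M : ℝ, 0 < M ∧ ∀ (μ : Measure X) (G : X → ℝ≥0∞),
      eLpNorm G θ μ ≤ ENNReal.ofReal C → excess P G (ENNReal.ofReal M) μ ≤ ENNReal.ofReal η := by
  rcases eq_or_ne θ ∞ with rfl | hθt
  · refine ⟨C, hC, fun μ G hG => ?_⟩
    have h0 : ∀ᵐ x ∂μ, {x | ENNReal.ofReal C < G x}.indicator G x ^ P = 0 := by
      rw [eLpNorm_exponent_top] at hG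
      filter_upwards [ae_le_eLpNormEssSup (f := G) (μ := μ)] with x hx
      have : x ∉ {x | ENNReal.ofReal C < G x} := by
        simp only [mem_ofPred_eq, not_lt]
        exact (by simpa using hx : G x ≤ _).trans hG
      rw [indicator_of_notMem this, ENNReal.zero_rpow_of_pos hP]
    rw [excess, lintegral_congr_ae h0, lintegral_zero, ENNReal.zero_rpow_of_pos (by positivity)]
    exact zero_le
  · obtain ⟨q, rfl⟩ : ∃ q : ℝ, θ = ENNReal.ofReal q :=
      ⟨θ.toReal, (ENNReal.ofReal_toReal hθt).symm⟩
    have hPq : P < q := (ENNReal.ofReal_lt_ofReal_iff_of_nonneg hP.le).1 hθ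
    have hq : 0 < q := hP.trans hPq
    have hlim : Filter.Tendsto (fun M : ℝ => M ^ (-(q - P)) * C ^ q) Filter.atTop (nhds 0) := by
      have := (tendsto_rpow_neg_atTop (sub_pos.2 hPq)).mul_const (C ^ q)
      rwa [zero_mul] at this
    have hev := (hlim.eventually (gt_mem_nhds (show 0 < η ^ P by positivity))).and
      (Filter.eventually_gt_atTop 0)
    obtain ⟨M, hM, hM0⟩ := hev.exists
    refine ⟨M, hM0, fun μ G hG => ?_⟩
    have hMtop : ENNReal.ofReal M ≠ ∞ := ENNReal.ofReal_ne_top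
    have hMz : ENNReal.ofReal M ≠ 0 := by rwa [Ne, ENNReal.ofReal_eq_zero, not_le]
    have hint : ∫⁻ x, G x ^ q ∂μ ≤ ENNReal.ofReal (C ^ q) := by
      rw [eLpNorm_eq_lintegral_rpow_enorm_toReal (by rwa [Ne, ENNReal.ofReal_eq_zero, not_le])
        ENNReal.ofReal_ne_top, ENNReal.toReal_ofReal hq.le] at hG
      have := ENNReal.rpow_le_rpow hG hq.le
      rw [← ENNReal.rpow_mul, one_div_mul_cancel hq.ne', ENNReal.rpow_one,
        ENNReal.ofReal_rpow_of_pos hC] at this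
      simpa using this
    have hpt : ∀ x, {x | ENNReal.ofReal M < G x}.indicator G x ^ P ≤
        ENNReal.ofReal (M ^ (-(q - P))) * G x ^ q := by
      intro x
      by_cases hx : ENNReal.ofReal M < G x
      · rw [indicator_of_mem (show x ∈ {x | ENNReal.ofReal M < G x} from hx)]
        by_cases hGt : G x = ∞
        · rw [hGt, ENNReal.top_rpow_of_pos hq, ENNReal.mul_top]
          · exact le_top
          · rw [Ne, ENNReal.ofReal_eq_zero, not_le]; positivity
        have hG0 : G x ≠ 0 := (lt_of_le_of_lt zero_le hx).ne'
        calc G x ^ P = G x ^ (-(q - P)) * G x ^ q := by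
              rw [← ENNReal.rpow_add _ _ hG0 hGt]; congr 1; ring
          _ ≤ ENNReal.ofReal M ^ (-(q - P)) * G x ^ q := by
              gcongr ?_ * _
              rw [ENNReal.rpow_neg, ENNReal.rpow_neg]
              gcongr
          _ = _ := by rw [ENNReal.ofReal_rpow_of_pos hM0]
      · rw [indicator_of_notMem (show x ∉ {x | ENNReal.ofReal M < G x} from hx),
          ENNReal.zero_rpow_of_pos hP]
        exact zero_le
    calc excess P G (ENNReal.ofReal M) μ
        ≤ (ENNReal.ofReal (M ^ (-(q - P))) * ENNReal.ofReal (C ^ q)) ^ (1 / P) := by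
          refine ENNReal.rpow_le_rpow ((lintegral_mono hpt).trans ?_) (by positivity)
          rw [lintegral_const_mul' _ _ ENNReal.ofReal_ne_top]
          gcongr
      _ ≤ ENNReal.ofReal (η ^ P) ^ (1 / P) := by
          refine ENNReal.rpow_le_rpow ?_ (by positivity)
          rw [← ENNReal.ofReal_mul (by positivity)]
          exact ENNReal.ofReal_le_ofReal hM.le
      _ = ENNReal.ofReal η := by
          rw [ENNReal.ofReal_rpow_of_pos (by positivity), ← Real.rpow_mul hη.le,
            mul_one_div_cancel hP.ne', Real.rpow_one]

/-- The kernel which is `J` near the diagonal and `K_s` away from it. -/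
noncomputable def nearKernel (K J : Eu d → Eu d → ℝ≥0∞) (l : ℝ) (x y : Eu d) : ℝ≥0∞ :=
  open Classical in if dist x y < l then J x y else symPart K x y

theorem measurable_nearKernel (hK : Measurable (Function.uncurry K))
    (hJ : Measurable (Function.uncurry J)) (l : ℝ) :
    Measurable (Function.uncurry (nearKernel K J l)) := by
  classical
  have hs : MeasurableSet {p : Eu d × Eu d | dist p.1 p.2 < l} :=
    measurableSet_lt (by fun_prop) measurable_const
  have e : Function.uncurry (nearKernel K J l) = {p : Eu d × Eu d | dist p.1 p.2 < l}.piecewise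
      (Function.uncurry J) (Function.uncurry (symPart K)) := by
    funext ⟨x, y⟩
    by_cases h : dist x y < l
    · simp [nearKernel, Function.uncurry, Set.piecewise, h]
    · simp [nearKernel, Function.uncurry, Set.piecewise, h]
  rw [e]
  exact Measurable.piecewise hs hJ (measurable_symPart hK)

theorem nearKernel_comm (hJs : ∀ x y, J x y = J y x) (l : ℝ) (x y : Eu d) :
    nearKernel K J l x y = nearKernel K J l y x := by
  simp only [nearKernel, dist_comm x y, hJs x y, symPart_comm K x y]

theorem nearKernel_le (K J : Eu d → Eu d → ℝ≥0∞) (l : ℝ) (x y : Eu d) :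
    nearKernel K J l x y ≤ J x y + symPart K x y := by
  simp only [nearKernel]
  split_ifs
  · exact le_self_add
  · exact le_add_self

theorem energy_nearKernel_le (hK : Measurable (Function.uncurry K))
    (hJ : Measurable (Function.uncurry J)) (l : ℝ) (B : Set (Eu d)) {C : ℝ} {v : Eu d → ℝ}
    (hv : Measurable v) (hC : 0 < C)
    (h : energy J B B v ≤ ENNReal.ofReal C * energy (symPart K) B B v) :
    energy (nearKernel K J l) B B v ≤ ENNReal.ofReal (C + 1) * energy (symPart K) B B v := by
  have hs := measurable_symPart hK
  rw [energy_eq_lintegral (measurable_nearKernel hK hJ l) hv]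
  calc _ ≤ ∫⁻ p in B ×ˢ B, (ENNReal.ofReal ((v p.1 - v p.2) ^ 2) * J p.1 p.2 +
        ENNReal.ofReal ((v p.1 - v p.2) ^ 2) * symPart K p.1 p.2) := by
        refine lintegral_mono fun p => ?_
        rw [← mul_add]
        gcongr
        exact nearKernel_le K J l _ _
    _ = energy J B B v + energy (symPart K) B B v := by
        rw [lintegral_add_left (measurable_energyIntegrand hJ hv), ← energy_eq_lintegral hJ hv,
          ← energy_eq_lintegral hs hv]
    _ ≤ _ := by
        rw [ENNReal.ofReal_add hC.le zero_le_one, add_mul, ENNReal.ofReal_one, one_mul]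
        gcongr

theorem enorm_sq_div_le {κ : ℝ} {σ : ℝ≥0∞} (h : ‖κ‖ₑ ≤ σ) : ‖κ‖ₑ ^ 2 / σ ≤ σ := by
  refine ENNReal.div_le_of_le_mul ?_
  rw [← sq]
  exact pow_le_pow_left' h 2

theorem driftDensity_nearKernel_le {c l R : ℝ} (hd : 0 < d) (hα0 : 0 < α) (hR1 : R ≤ 1) {x₀ : Eu d}
    (hc : ∀ x ∈ Metric.ball x₀ (2 * R), ∀ y ∈ Metric.ball x₀ (2 * R),
      K x y ≤ ENNReal.ofReal c * edist x y ^ (-(d : ℝ) - α)) {x : Eu d}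
    (hx : x ∈ Metric.ball x₀ (2 * R)) :
    driftDensity K (nearKernel K J l) (Metric.ball x₀ (2 * R)) x ≤
      driftDensity K J (Metric.ball x₀ (2 * R) ∩ Metric.ball x l) x +
        ENNReal.ofReal c * ENNReal.ofReal l ^ (-(d : ℝ) - α) *
          volume (Metric.ball (0 : Eu d) 2) := by
  have hexp : 0 ≤ (d : ℝ) + α := by positivity
  have hmb : MeasurableSet (Metric.ball x l) := measurableSet_ball
  rw [driftDensity, ← lintegral_inter_add_sdiff _ (Metric.ball x₀ (2 * R)) hmb]
  refine add_le_add ?_ ?_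
  · refine le_of_eq (setLIntegral_congr_fun (measurableSet_ball.inter hmb) fun y hy => ?_)
    have : dist x y < l := by rw [dist_comm]; exact hy.2
    simp only [nearKernel, if_pos this]
  · calc _ ≤ ∫⁻ y in Metric.ball x₀ (2 * R) \ Metric.ball x l,
          ENNReal.ofReal c * ENNReal.ofReal l ^ (-(d : ℝ) - α) := by
          refine setLIntegral_mono' (measurableSet_ball.diff hmb) fun y hy => ?_
          have hdist : l ≤ dist x y := by rw [dist_comm]; simpa using hy.2
          have hs : nearKernel K J l x y = symPart K x y := by
            simp only [nearKernel, if_neg (not_lt.2 hdist)]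
          rw [hs]
          refine (enorm_sq_div_le (enorm_antiPart_le K x y)).trans ?_
          have hk : symPart K x y ≤ ENNReal.ofReal c * edist x y ^ (-(d : ℝ) - α) := by
            rw [symPart, ENNReal.div_le_iff (by norm_num) (by norm_num), mul_two]
            refine add_le_add (hc x hx y hy.1) ?_
            rw [edist_comm]
            exact hc y hy.1 x hx
          refine hk.trans ?_
          refine mul_le_mul' le_rfl ?_
          rw [show -(d : ℝ) - α = -((d : ℝ) + α) by ring, ENNReal.rpow_neg, ENNReal.rpow_neg]
          gcongr
          rw [edist_dist]
          exact ENNReal.ofReal_le_ofReal hdist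
      _ ≤ _ := by
          rw [setLIntegral_const]
          refine mul_le_mul' le_rfl ((measure_mono sdiff_subset).trans ?_)
          rw [← Measure.addHaar_ball_center volume x₀ 2]
          exact measure_mono (Metric.ball_subset_ball (by linarith))

/-- The drift near the diagonal. -/
noncomputable def nearDrift (K J : Eu d → Eu d → ℝ≥0∞) (l : ℝ) (x : Eu d) : ℝ≥0∞ :=
  driftDensity K J (Metric.ball x l) x

theorem measurable_nearDrift (hK : Measurable (Function.uncurry K))
    (hJ : Measurable (Function.uncurry J)) (l : ℝ) : Measurable (nearDrift K J l) := by
  have hs : MeasurableSet {p : Eu d × Eu d | dist p.2 p.1 < l} :=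
    measurableSet_lt (by fun_prop) measurable_const
  have h := ((measurable_drift hK hJ).indicator hs).lintegral_prod_right' (ν := volume)
  convert h using 1
  funext x
  rw [nearDrift, driftDensity, ← lintegral_indicator measurableSet_ball]
  refine lintegral_congr fun y => ?_
  by_cases hy : dist y x < l
  · rw [indicator_of_mem (show y ∈ Metric.ball x l from hy),
      indicator_of_mem (show (x, y) ∈ {p : Eu d × Eu d | dist p.2 p.1 < l} from hy)]
  · rw [indicator_of_notMem (show y ∉ Metric.ball x l from hy),
      indicator_of_notMem (show (x, y) ∉ {p : Eu d × Eu d | dist p.2 p.1 < l} from hy)]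

/-- For a compact set of centres, the drift near the diagonal is in `L^{d/α}` on a set which
contains all the relevant balls. -/
theorem exists_nearDrift_lintegral_lt_top {A : Set (Eu d)}
    (hA : IsCompact A) (hAΩ : A ⊆ Ω) (hΩ : IsOpen Ω) {P C : ℝ} (hP : 0 < P)
    (hJ : ∀ (r : ℝ) (z : Eu d), 0 < r → r ≤ 1 → Metric.ball z (2 * r) ⊆ Ω →
      eLpNorm (driftDensity K J (Metric.ball z (2 * r))) (ENNReal.ofReal P)
          (volume.restrict (Metric.ball z (2 * r))) ≤ ENNReal.ofReal C) :
    ∃ l : ℝ, 0 < l ∧ ∃ U : Set (Eu d), MeasurableSet U ∧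
      (∀ (x₀ : Eu d) (R : ℝ), x₀ ∈ A → R ≤ 1 → Metric.ball x₀ (2 * R) ⊆ Ω →
        Metric.ball x₀ R ⊆ U) ∧ ∫⁻ x in U, nearDrift K J l x ^ P < ∞ := by
  obtain ⟨ε₁, hε₁, hthick⟩ := hA.exists_thickening_subset_open hΩ hAΩ
  set ε := min (ε₁ / 2) 1 with hε
  have hε0 : 0 < ε := by positivity
  set N : Set (Eu d) := {x | Metric.ball x ε ⊆ Ω} ∩ Metric.thickening 1 A with hN
  have htb : TotallyBounded N := by
    exact (hA.isBounded.thickening (δ := 1)).isCompact_closure.totallyBounded.subset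
      (inter_subset_right.trans subset_closure)
  obtain ⟨t, htN, htfin, hcov⟩ := Metric.finite_approx_of_totallyBounded htb (ε / 4) (by positivity)
  refine ⟨ε / 4, by positivity, ⋃ z ∈ t, Metric.ball z (ε / 4),
    htfin.measurableSet_biUnion fun z _ => measurableSet_ball, ?_, ?_⟩
  · intro x₀ R hx₀ hR1 hsub x hx
    refine hcov ⟨?_, ?_⟩
    · change Metric.ball x ε ⊆ Ω
      have hx' : dist x x₀ < R := hx
      rcases le_total R ε with h | h
      · refine Subset.trans ?_ hthick
        intro y hy
        refine Metric.mem_thickening_iff.2 ⟨x₀, hx₀, ?_⟩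
        have hy' : dist y x < ε := hy
        have := dist_triangle y x x₀
        have : ε ≤ ε₁ / 2 := min_le_left _ _
        linarith
      · refine Subset.trans ?_ hsub
        intro y hy
        have hy' : dist y x < ε := hy
        have := dist_triangle y x x₀
        rw [Metric.mem_ball]
        linarith
    · refine Metric.mem_thickening_iff.2 ⟨x₀, hx₀, ?_⟩
      have hx' : dist x x₀ < R := hx
      linarith
  · have hle : ∫⁻ x in ⋃ z ∈ t, Metric.ball z (ε / 4), nearDrift K J (ε / 4) x ^ P ≤
        ∑ z ∈ htfin.toFinset, ∫⁻ x in Metric.ball z (ε / 4), nearDrift K J (ε / 4) x ^ P := by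
      have : (⋃ z ∈ t, Metric.ball z (ε / 4)) = ⋃ z ∈ htfin.toFinset, Metric.ball z (ε / 4) := by
        simp
      rw [this]
      generalize htfin.toFinset = F
      classical
      induction F using Finset.induction_on with
      | empty => simp
      | insert a F ha ih =>
        rw [Finset.sum_insert ha, Finset.set_biUnion_insert]
        exact (lintegral_union_le _ _ _).trans (by gcongr)
    refine hle.trans_lt (ENNReal.sum_lt_top.2 fun z hz => ?_)
    have hzN := htN (htfin.mem_toFinset.1 hz)
    have hzΩ : Metric.ball z (2 * (ε / 4)) ⊆ Ω :=
      (Metric.ball_subset_ball (by linarith)).trans hzN.1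
    have h1 := hJ (ε / 4) z (by positivity) (by linarith [min_le_right (ε₁ / 2) 1]) hzΩ
    rw [eLpNorm_eq_lintegral_rpow_enorm_toReal (by rwa [Ne, ENNReal.ofReal_eq_zero, not_le])
        ENNReal.ofReal_ne_top, ENNReal.toReal_ofReal hP.le] at h1
    have h2 := ENNReal.rpow_lt_top_iff_of_pos (show 0 < 1 / P by positivity) |>.1
      (h1.trans_lt ENNReal.ofReal_lt_top)
    refine lt_of_le_of_lt ?_ h2
    calc _ ≤ ∫⁻ x in Metric.ball z (ε / 4),
          ‖driftDensity K J (Metric.ball z (2 * (ε / 4))) x‖ₑ ^ P := by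
          refine setLIntegral_mono' measurableSet_ball fun x hx => ?_
          refine ENNReal.rpow_le_rpow ?_ hP.le
          rw [enorm_eq_self, nearDrift]
          refine driftDensity_mono K J (Metric.ball_subset_ball' ?_) x
          have hx' : dist x z < ε / 4 := hx
          linarith
      _ ≤ _ := lintegral_mono_set (Metric.ball_subset_ball (by linarith))

end Drift

/-! ### The estimate at a fixed time -/

section FixedTime

variable {d : ℕ} {K J : Eu d → Eu d → ℝ≥0∞} {Ω : Set (Eu d)} {α : ℝ}

theorem holderConjugate_sobolev (hα0 : 0 < α) (hαd : α < d) :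
    (d / α : ℝ).HolderConjugate (d / (d - α)) := by
  have hd : (0 : ℝ) < d := hα0.trans hαd
  rw [Real.holderConjugate_iff]
  refine ⟨(one_lt_div hα0).2 hαd, ?_⟩
  rw [inv_div, inv_div]
  field_simp
  ring

theorem lintegral_mul_le_of_excess_le {X : Type*} [MeasurableSpace X] {μ : Measure X} {P p : ℝ}
    (hPp : P.HolderConjugate p) {D G v : X → ℝ≥0∞} (hG : Measurable G) (hv : Measurable v)
    {M c η : ℝ≥0∞} (hD : ∀ᵐ x ∂μ, D x ≤ G x + c) (hη : excess P G M μ ≤ η) :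
    ∫⁻ x, v x * D x ∂μ ≤ η * (∫⁻ x, v x ^ p ∂μ) ^ (1 / p) + (M + c) * ∫⁻ x, v x ∂μ := by
  calc _ ≤ ∫⁻ x, (v x * G x + c * v x) ∂μ := by
        refine lintegral_mono_ae (hD.mono fun x hx => ?_)
        rw [mul_comm c, ← mul_add]
        exact mul_le_mul' le_rfl hx
    _ = ∫⁻ x, v x * G x ∂μ + c * ∫⁻ x, v x ∂μ := by
        rw [lintegral_add_right _ (hv.const_mul c), lintegral_const_mul _ hv]
    _ ≤ _ := by
        rw [add_mul, ← add_assoc]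
        refine add_le_add ((lintegral_mul_le_excess hPp hG hv M).trans ?_) le_rfl
        exact add_le_add (mul_le_mul' hη le_rfl) le_rfl

theorem lintegral_mul_eq_setLIntegral {X : Type*} [MeasurableSpace X] {μ : Measure X}
    {s : Set X} (hs : MeasurableSet s) {v : X → ℝ≥0∞} (D : X → ℝ≥0∞) (hv : ∀ x ∉ s, v x = 0) :
    ∫⁻ x, v x * D x ∂μ = ∫⁻ x in s, v x * D x ∂μ := by
  rw [← lintegral_indicator hs]
  refine lintegral_congr fun x => ?_
  by_cases hx : x ∈ s
  · rw [indicator_of_mem hx]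
  · rw [indicator_of_notMem hx, hv x hx, zero_mul]

theorem exists_nearKernel_absorption (hα0 : 0 < α) (hαd : α < d)
    (hΩ : IsOpen Ω) (hK : Measurable (Function.uncurry K)) (hUpper : KernelUpperLoc K Ω α)
    {θ : ℝ≥0∞} (hθ : ENNReal.ofReal (d / α) ≤ θ) (hJ : Measurable (Function.uncurry J)) {C : ℝ}
    (hC : 0 < C) (hθJ : ∀ (r : ℝ) (z : Eu d), 0 < r → r ≤ 1 → Metric.ball z (2 * r) ⊆ Ω →
      eLpNorm (driftDensity K J (Metric.ball z (2 * r))) θ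
          (volume.restrict (Metric.ball z (2 * r))) ≤ ENNReal.ofReal C)
    {A : Set (Eu d)} (hAΩ : A ⊆ Ω) (hA : ENNReal.ofReal (d / α) < θ ∨ IsCompact A) :
    ∃ l : ℝ, ∀ η : ℝ, 0 < η → ∃ M : ℝ, 0 < M ∧ ∀ (x₀ : Eu d) (R : ℝ), x₀ ∈ A → 0 < R → R ≤ 1 →
      Metric.ball x₀ (2 * R) ⊆ Ω → ∀ v : Eu d → ℝ≥0∞, Measurable v →
      (∀ x ∉ Metric.ball x₀ R, v x = 0) →
      ∫⁻ x, v x * driftDensity K (nearKernel K J l) (Metric.ball x₀ (2 * R)) x ≤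
        ENNReal.ofReal η * (∫⁻ x in Metric.ball x₀ R, v x ^ (d / (d - α) : ℝ)) ^
          (1 / (d / (d - α) : ℝ)) + ENNReal.ofReal M * ∫⁻ x in Metric.ball x₀ R, v x := by
  have hd' : (0 : ℝ) < d := hα0.trans hαd
  have hd : 0 < d := by exact_mod_cast hd'
  have hPp := holderConjugate_sobolev hα0 hαd
  have hP : 0 < (d / α : ℝ) := by positivity
  obtain ⟨c, hc, Hc⟩ := hUpper
  have hsub : ∀ (x₀ : Eu d) (R : ℝ), 0 < R → Metric.ball x₀ R ⊆ Metric.ball x₀ (2 * R) :=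
    fun x₀ R hR => Metric.ball_subset_ball (by linarith)
  set c₀ : ℝ → ℝ≥0∞ := fun l => ENNReal.ofReal c * ENNReal.ofReal l ^ (-(d : ℝ) - α) *
    volume (Metric.ball (0 : Eu d) 2) with hc₀
  have hc₀t : ∀ l, 0 < l → c₀ l ≠ ∞ := by
    intro l hl
    have : ENNReal.ofReal l ^ (-(d : ℝ) - α) ≠ ∞ := by
      rw [ENNReal.ofReal_rpow_of_pos hl]; exact ENNReal.ofReal_ne_top
    exact ENNReal.mul_ne_top (ENNReal.mul_ne_top ENNReal.ofReal_ne_top this) measure_ball_lt_top.ne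
  have main : ∀ (l : ℝ) (_ : 0 < l) (G : Eu d → ℝ → Eu d → ℝ≥0∞),
      (∀ x₀ R, Measurable (G x₀ R)) →
      (∀ x₀ R x, driftDensity K J (Metric.ball x₀ (2 * R) ∩ Metric.ball x l) x ≤ G x₀ R x) →
      ∀ η : ℝ, ∀ M : ℝ, 0 < M →
      (∀ (x₀ : Eu d) (R : ℝ), x₀ ∈ A → 0 < R → R ≤ 1 → Metric.ball x₀ (2 * R) ⊆ Ω →
        excess (d / α) (G x₀ R) (ENNReal.ofReal M) (volume.restrict (Metric.ball x₀ R)) ≤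
          ENNReal.ofReal η) → ∃ M : ℝ, 0 < M ∧ ∀ (x₀ : Eu d) (R : ℝ), x₀ ∈ A → 0 < R → R ≤ 1 →
      Metric.ball x₀ (2 * R) ⊆ Ω → ∀ v : Eu d → ℝ≥0∞, Measurable v →
      (∀ x ∉ Metric.ball x₀ R, v x = 0) →
      ∫⁻ x, v x * driftDensity K (nearKernel K J l) (Metric.ball x₀ (2 * R)) x ≤
        ENNReal.ofReal η * (∫⁻ x in Metric.ball x₀ R, v x ^ (d / (d - α) : ℝ)) ^
          (1 / (d / (d - α) : ℝ)) + ENNReal.ofReal M * ∫⁻ x in Metric.ball x₀ R, v x := by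
    intro l hl G hG hle η M hM hex
    refine ⟨M + (c₀ l).toReal, by positivity, fun x₀ R hx₀ hR hR1 hsubΩ v hv hv0 => ?_⟩
    rw [lintegral_mul_eq_setLIntegral measurableSet_ball _ hv0,
      ENNReal.ofReal_add hM.le ENNReal.toReal_nonneg, ENNReal.ofReal_toReal (hc₀t l hl)]
    refine lintegral_mul_le_of_excess_le hPp (hG x₀ R) hv ?_ (hex x₀ R hx₀ hR hR1 hsubΩ)
    refine (ae_restrict_iff' measurableSet_ball).2 (Filter.Eventually.of_forall fun x hx => ?_)
    refine (driftDensity_nearKernel_le hd hα0 hR1 (Hc R x₀ hR hR1 hsubΩ)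
      (hsub x₀ R hR hx)).trans ?_
    exact add_le_add (hle x₀ R x) le_rfl
  by_cases hlt : ENNReal.ofReal (d / α) < θ
  · refine ⟨1, fun η hη => ?_⟩
    obtain ⟨M, hM, HM⟩ := excess_le_of_eLpNorm_le (X := Eu d) hP hC hlt hη
    refine main 1 one_pos (fun x₀ R => driftDensity K J (Metric.ball x₀ (2 * R)))
      (fun x₀ R => measurable_driftDensity hK hJ _)
      (fun x₀ R x => driftDensity_mono K J inter_subset_left x) η M hM ?_
    intro x₀ R hx₀ hR hR1 hsubΩ
    refine HM _ _ (le_trans ?_ (hθJ R x₀ hR hR1 hsubΩ))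
    exact eLpNorm_mono_measure _ (Measure.restrict_mono (hsub x₀ R hR) le_rfl)
  · have hθe : θ = ENNReal.ofReal (d / α) := le_antisymm (not_lt.1 hlt) hθ
    subst hθe
    obtain ⟨l, hl, U, hU, hAU, hfin⟩ :=
      exists_nearDrift_lintegral_lt_top (hA.resolve_left hlt) hAΩ hΩ hP hθJ
    refine ⟨l, fun η hη => ?_⟩
    have ht := tendsto_excess hP (measurable_nearDrift hK hJ l) hfin.ne
    obtain ⟨n, hn, hn1⟩ := ((ht.eventually (gt_mem_nhds (ENNReal.ofReal_pos.2 hη))).and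
      (Filter.eventually_ge_atTop 1)).exists
    refine main l hl (fun _ _ => nearDrift K J l) (fun _ _ => measurable_nearDrift hK hJ l)
      (fun x₀ R x => driftDensity_mono K J inter_subset_right x) η n (by exact_mod_cast hn1) ?_
    intro x₀ R hx₀ hR hR1 hsubΩ
    refine le_trans ?_ hn.le
    rw [ENNReal.ofReal_natCast]
    exact ENNReal.rpow_le_rpow (lintegral_mono_set (hAU x₀ R hx₀ hR1 hsubΩ)) (by positivity)

theorem lintegral_tail_near_le {c R r ρ : ℝ} (hd : 0 < d) (hα0 : 0 < α) (hR : 0 < R) {x₀ : Eu d}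
    (hc : ∀ x ∈ Metric.ball x₀ (2 * R), ∀ y ∈ Metric.ball x₀ (2 * R),
      K x y ≤ ENNReal.ofReal c * edist x y ^ (-(d : ℝ) - α))
    (hr : R / 2 ≤ r) (hρ : 0 < ρ) (hrρ : r + 2 * ρ ≤ R) (u : Eu d → ℝ) (Kt : Eu d → Eu d → ℝ≥0∞)
    {x : Eu d} (hx : x ∈ Metric.ball x₀ (r + ρ)) (hc0 : 0 ≤ c) :
    ∫⁻ y in Metric.ball x₀ (2 * R) \ Metric.ball x₀ (r + 2 * ρ),
        ENNReal.ofReal (u y) * symPart K x y ≤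
      ENNReal.ofReal (c * (R / ρ) ^ (d + α) * R ^ (-α)) * tail Kt α u R x₀ := by
  have he : 0 < (d : ℝ) + α := by positivity
  have hRρ : 0 < R / ρ := by positivity
  have hxB : x ∈ Metric.ball x₀ (2 * R) := Metric.ball_subset_ball (by linarith) hx
  have hpt : ∀ y ∈ Metric.ball x₀ (2 * R) \ Metric.ball x₀ (r + 2 * ρ),
      ENNReal.ofReal (u y) * symPart K x y ≤ ENNReal.ofReal (c * (R / ρ) ^ (d + α)) *
        (‖u y‖ₑ / edist x₀ y ^ ((d : ℝ) + α)) := by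
    intro y hy
    have hy1 : r + 2 * ρ ≤ dist y x₀ := by simpa using hy.2
    have hx1 : dist x x₀ < r + ρ := hx
    have htri := dist_triangle y x x₀
    have hlow : ρ / R * dist x₀ y ≤ dist x y := by
      have h1 : dist x₀ y - (r + ρ) ≤ dist x y := by
        rw [dist_comm x₀ y, dist_comm x y]; linarith
      refine le_trans ?_ h1
      rw [dist_comm y x₀] at hy1
      have h2 : ρ / R * (r + 2 * ρ) ≤ ρ := by
        rw [div_mul_eq_mul_div, div_le_iff₀ hR]; nlinarith
      have h3 : ρ / R ≤ 1 := by rw [div_le_one hR]; linarith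
      nlinarith
    have hk : symPart K x y ≤ ENNReal.ofReal c * edist x y ^ (-(d : ℝ) - α) := by
      rw [symPart, ENNReal.div_le_iff (by norm_num) (by norm_num), mul_two]
      refine add_le_add (hc x hxB y hy.1) ?_
      rw [edist_comm]
      exact hc y hy.1 x hxB
    have hD : 0 < dist x₀ y := by rw [dist_comm]; linarith
    have hxy : 0 < dist x y := lt_of_lt_of_le (by positivity) hlow
    have hpow : edist x y ^ (-(d : ℝ) - α) ≤
        ENNReal.ofReal ((R / ρ) ^ (d + α)) * (edist x₀ y ^ ((d : ℝ) + α))⁻¹ := by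
      rw [edist_dist, edist_dist, ENNReal.ofReal_rpow_of_pos hxy, ENNReal.ofReal_rpow_of_pos hD,
        ← ENNReal.ofReal_inv_of_pos (by positivity), ← ENNReal.ofReal_mul (by positivity)]
      refine ENNReal.ofReal_le_ofReal ?_
      rw [show -(d : ℝ) - α = -((d : ℝ) + α) by ring, Real.rpow_neg hxy.le,
        ← Real.inv_rpow hD.le, ← Real.mul_rpow hRρ.le (by positivity), ← Real.inv_rpow hxy.le]
      refine Real.rpow_le_rpow (by positivity) ?_ he.le
      rw [inv_le_comm₀ hxy (by positivity), mul_inv, inv_inv, inv_div]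
      exact hlow
    calc _ ≤ ‖u y‖ₑ * (ENNReal.ofReal c * (ENNReal.ofReal ((R / ρ) ^ (d + α)) *
          (edist x₀ y ^ ((d : ℝ) + α))⁻¹)) := by
          refine mul_le_mul' ?_ (hk.trans (mul_le_mul' le_rfl hpow))
          rw [← ofReal_norm]
          exact ENNReal.ofReal_le_ofReal (le_abs_self _)
      _ = _ := by
          rw [ENNReal.ofReal_mul hc0, div_eq_mul_inv ‖u y‖ₑ]; ring
  calc _ ≤ ∫⁻ y in Metric.ball x₀ (2 * R) \ Metric.ball x₀ (r + 2 * ρ),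
        ENNReal.ofReal (c * (R / ρ) ^ (d + α)) * (‖u y‖ₑ / edist x₀ y ^ ((d : ℝ) + α)) :=
        setLIntegral_mono' (measurableSet_ball.diff measurableSet_ball) hpt
    _ ≤ ∫⁻ y in Metric.ball x₀ (2 * R) \ Metric.ball x₀ (R / 2),
        ENNReal.ofReal (c * (R / ρ) ^ (d + α)) * (‖u y‖ₑ / edist x₀ y ^ ((d : ℝ) + α)) :=
        lintegral_mono_set (sdiff_subset_sdiff_right (Metric.ball_subset_ball (by linarith)))
    _ = ENNReal.ofReal (c * (R / ρ) ^ (d + α) * R ^ (-α)) * (ENNReal.ofReal (R ^ α) *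
        ∫⁻ y in Metric.ball x₀ (2 * R) \ Metric.ball x₀ (R / 2),
          ‖u y‖ₑ / edist x₀ y ^ ((d : ℝ) + α)) := by
        rw [lintegral_const_mul' _ _ ENNReal.ofReal_ne_top, ← mul_assoc,
          ← ENNReal.ofReal_mul (by positivity)]
        congr 2
        rw [mul_assoc, ← Real.rpow_add hR]
        simp
    _ ≤ _ := mul_le_mul' le_rfl le_self_add

theorem lintegral_tail_far_le {R r : ℝ} (hr : r ≤ R) (hR : 0 < R) (u : Eu d → ℝ) (x₀ : Eu d)
    (Kt : Eu d → Eu d → ℝ≥0∞) {x : Eu d} (hx : x ∈ Metric.ball x₀ r) :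
    ∫⁻ y in (Metric.ball x₀ (2 * R))ᶜ, ENNReal.ofReal (u y) * Kt x y ≤ tail Kt α u R x₀ := by
  have hx' : x ∈ Metric.ball x₀ (3 * R / 2) := Metric.ball_subset_ball (by linarith) hx
  refine le_trans ?_ le_add_self
  refine le_trans (lintegral_mono fun y => ?_)
    (le_iSup₂ (f := fun x (_ : x ∈ Metric.ball x₀ (3 * R / 2)) =>
      ∫⁻ y in (Metric.ball x₀ (2 * R))ᶜ, ‖u y‖ₑ * Kt x y) x hx')
  refine mul_le_mul' ?_ le_rfl
  rw [← ofReal_norm]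
  exact ENNReal.ofReal_le_ofReal (le_abs_self _)

/-- The `L^p` norm of `v²` on `A`. -/
noncomputable def sqNorm (p : ℝ) (A : Set (Eu d)) (v : Eu d → ℝ) : ℝ≥0∞ :=
  (∫⁻ x in A, ENNReal.ofReal (v x ^ 2) ^ p) ^ (1 / p)

theorem eLpNorm_sq_eq_sqNorm {p : ℝ} (hp : 0 < p) (A : Set (Eu d)) (v : Eu d → ℝ) :
    eLpNorm (fun x => v x ^ 2) (ENNReal.ofReal p) (volume.restrict A) = sqNorm p A v := by
  rw [eLpNorm_eq_lintegral_rpow_enorm_toReal (by rwa [Ne, ENNReal.ofReal_eq_zero, not_le])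
    ENNReal.ofReal_ne_top, ENNReal.toReal_ofReal hp.le, sqNorm]
  simp only [Real.enorm_of_nonneg (sq_nonneg _)]

theorem exists_sobolev (hα0 : 0 < α) (hαd : α < d) (hSob : SobolevCondition K Ω α) :
    ∃ c : ℝ, 0 < c ∧ ∀ (x₀ : Eu d) (R : ℝ), 0 < R → R ≤ 1 → Metric.ball x₀ (2 * R) ⊆ Ω →
      ∀ v : Eu d → ℝ, MemLp v 2 (volume.restrict (Metric.ball x₀ (2 * R))) →
      sqNorm (d / (d - α)) (Metric.ball x₀ R) v ≤ ENNReal.ofReal c *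
        energy (symPart K) (Metric.ball x₀ (2 * R)) (Metric.ball x₀ (2 * R)) v +
        ENNReal.ofReal (c * R ^ (-α)) *
          ∫⁻ x in Metric.ball x₀ (2 * R), ENNReal.ofReal (v x ^ 2) := by
  obtain ⟨c, hc, H⟩ := hSob
  refine ⟨c, hc, fun x₀ R hR hR1 hsub v hv => ?_⟩
  have hp : 0 < (d / (d - α) : ℝ) := div_pos (hα0.trans hαd) (sub_pos.2 hαd)
  have h := H R R x₀ hR le_rfl hR1 (by rwa [← two_mul]) v (by rwa [← two_mul])
  rw [← two_mul, eLpNorm_sq_eq_sqNorm hp, eLpNorm_one_eq_lintegral_enorm] at h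
  simpa only [Real.enorm_of_nonneg (sq_nonneg _)] using h

end FixedTime

section LevelSet

variable {d : ℕ} {K J Kt : Eu d → Eu d → ℝ≥0∞} {Ω : Set (Eu d)} {α : ℝ}

/-- The right-hand side of the Caccioppoli inequality at level `k`: the `L^q` norms over `A` of
`(u - k)₊²` and of `k²` on `{u > k}`. -/
noncomputable def levelMass (q : ℝ) (A : Set (Eu d)) (u : Eu d → ℝ) (k : ℝ) : ℝ≥0∞ :=
  sqNorm q A (fun x => max (u x - k) 0) +
    ENNReal.ofReal (k ^ 2) * volume (A ∩ {x | k < u x}) ^ (1 / q)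

/-- The Caccioppoli inequality for the form `F`, tested with `τ² (u - k)₊`, where `τ` is a cutoff
function between `B_r(x₀)` and `B_{r+ρ}(x₀)`. The functions `u` are those with `adm u`. -/
structure CaccioppoliEstimate (K : Eu d → Eu d → ℝ≥0∞) (adm : (Eu d → ℝ) → Prop)
    (Def : (Eu d → ℝ) → (Eu d → ℝ) → Prop) (F : (Eu d → ℝ) → (Eu d → ℝ) → ℝ)
    (T : (Eu d → ℝ) → ℝ≥0∞) (α β p q b C : ℝ) (x₀ : Eu d) (R r ρ : ℝ) (τ : Eu d → ℝ) :
    Prop where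
  measurable : Measurable τ
  nonneg : ∀ x, 0 ≤ τ x
  le_one : ∀ x, τ x ≤ 1
  eq_zero : ∀ x ∉ Metric.ball x₀ (r + ρ), τ x = 0
  eq_one : ∀ x ∈ Metric.ball x₀ r, τ x = 1
  memH : ∀ u k, adm u → 0 ≤ k →
    MemH K (Metric.ball x₀ (2 * R)) (fun x => τ x ^ 2 * max (u x - k) 0)
  defined : ∀ u k, adm u → 0 ≤ k → Def u (fun x => τ x ^ 2 * max (u x - k) 0)
  le : ∀ u k, adm u → 0 ≤ k →
    ENNReal.ofReal b * sqNorm p (Metric.ball x₀ R) (fun x => τ x * max (u x - k) 0) +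
        ENNReal.ofReal (-F u (fun x => τ x ^ 2 * max (u x - k) 0)) ≤
      ENNReal.ofReal (C * (R / ρ) ^ (d + α) * R ^ (-β)) *
          levelMass q (Metric.ball x₀ (r + 2 * ρ)) u k +
        ENNReal.ofReal (C * (R / ρ) ^ (d + α) * R ^ (-α)) * T u *
          (∫⁻ x in Metric.ball x₀ (r + 2 * ρ), ENNReal.ofReal (max (u x - k) 0)) +
        ENNReal.ofReal (F u (fun x => τ x ^ 2 * max (u x - k) 0))

/-- The functions to which the Caccioppoli inequality applies. -/
structure IsAdmissible (K : Eu d → Eu d → ℝ≥0∞) (B : Set (Eu d)) (u : Eu d → ℝ) : Prop where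
  measurable : Measurable u
  nonneg : ∀ x, 0 ≤ u x
  normSqV_lt_top : normSqV K B u < ∞

theorem le_mul_rpow_div {R ρ α e : ℝ} (hR : 0 < R) (hρ : 0 < ρ) (hρR : ρ ≤ R)
    (hαe : α ≤ e) : ρ ^ (-α) ≤ (R / ρ) ^ e * R ^ (-α) := by
  have h1 : 1 ≤ R / ρ := (one_le_div hρ).2 hρR
  have h2 : ρ ^ (-α) = (R / ρ) ^ α * R ^ (-α) := by
    rw [Real.div_rpow hR.le hρ.le, Real.rpow_neg hρ.le, Real.rpow_neg hR.le]
    have := (Real.rpow_pos_of_pos hR α).ne'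
    have := (Real.rpow_pos_of_pos hρ α).ne'
    field_simp
  rw [h2]
  gcongr

theorem sqNorm_one (A : Set (Eu d)) (v : Eu d → ℝ) :
    sqNorm 1 A v = ∫⁻ x in A, ENNReal.ofReal (v x ^ 2) := by
  simp [sqNorm]

theorem lintegral_sq_le_sqNorm {q : ℝ} (hq : 1 ≤ q) (A : Set (Eu d)) {v : Eu d → ℝ}
    (hv : Measurable v) :
    ∫⁻ x in A, ENNReal.ofReal (v x ^ 2) ≤ sqNorm q A v * volume A ^ (1 - 1 / q) := by
  have h := eLpNorm_le_eLpNorm_mul_rpow_measure_univ (μ := volume.restrict A)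
    (ENNReal.ofReal_le_ofReal hq) (f := fun x => v x ^ 2) (hv.pow_const 2).aestronglyMeasurable
  rw [eLpNorm_sq_eq_sqNorm one_pos, eLpNorm_sq_eq_sqNorm (by linarith), sqNorm_one] at h
  simpa [ENNReal.toReal_ofReal (show 0 ≤ q by linarith)] using h

theorem sqNorm_cutoff_le {p b c R : ℝ} (hc : 0 < c) (hb : b = 1 / (2 * c)) {N E X : ℝ≥0∞}
    (hN : N ≤ ENNReal.ofReal c * E + ENNReal.ofReal (c * R ^ (-p)) * X) :
    ENNReal.ofReal b * N ≤ 1 / 2 * E + ENNReal.ofReal (R ^ (-p)) * X := by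
  have hb0 : 0 < b := by rw [hb]; positivity
  have h1 : b * c = 1 / 2 := by rw [hb]; field_simp
  have h2 : ENNReal.ofReal (1 / 2) = 1 / 2 := by
    rw [ENNReal.ofReal_div_of_pos two_pos]; simp
  calc _ ≤ ENNReal.ofReal b *
        (ENNReal.ofReal c * E + ENNReal.ofReal (c * R ^ (-p)) * X) := mul_le_mul' le_rfl hN
    _ = ENNReal.ofReal (1 / 2) * E + ENNReal.ofReal (1 / 2 * R ^ (-p)) * X := by
        rw [mul_add, ← mul_assoc, ← mul_assoc, ← ENNReal.ofReal_mul hb0.le,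
          ← ENNReal.ofReal_mul hb0.le, ← mul_assoc, h1]
    _ ≤ _ := by
        rw [h2]
        refine add_le_add le_rfl (mul_le_mul' ?_ le_rfl)
        by_cases hx : 0 ≤ R ^ (-p)
        · exact ENNReal.ofReal_le_ofReal (by linarith)
        · rw [ENNReal.ofReal_of_nonpos (by linarith)]; exact zero_le

/-- The Caccioppoli inequality with explicit dependence on the radii. -/
theorem IsFormIntegrand.caccioppoli_balls {τ u : Eu d → ℝ} {k kk ε : ℝ} {I : Eu d × Eu d → ℝ}
    (hI : IsFormIntegrand K Kt τ u k kk I) (hint : Integrable I)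
    (hd : 0 < d) (hα0 : 0 < α) {x₀ : Eu d} {R r ρ c cU cS C M V η β q : ℝ}
    (hR : 0 < R) (hR1 : R ≤ 1) (hr : R / 2 ≤ r) (hρ : 0 < ρ)
    (hrρ : r + 2 * ρ ≤ R) (hc : 0 ≤ c) (hcU : 0 ≤ cU) (hcS : 0 < cS) (hM : 0 ≤ M) (hV : 0 ≤ V)
    (hη : 0 ≤ η)
    (hτ : AdmissibleCutoff K J (Metric.ball x₀ (2 * R)) (Metric.ball x₀ (r + ρ))
      (Metric.ball x₀ (r + 2 * ρ)) (ENNReal.ofReal (c * ρ ^ (-α))) τ)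
    (hK : Measurable (Function.uncurry K)) (hJ : Measurable (Function.uncurry J))
    (hKt : Measurable (Function.uncurry Kt)) (hJs : ∀ x y, J x y = J y x)
    (hfin : ∀ᵐ p : Eu d × Eu d, K p.1 p.2 ≠ ∞ ∧ K p.2 p.1 ≠ ∞)
    (hu : IsAdmissible K (Metric.ball x₀ (2 * R)) u) (hk : 0 ≤ k) (hkk : 0 ≤ kk)
    (hε : 0 < ε) (hε1 : ε ≤ 1)
    (hU : ∀ x ∈ Metric.ball x₀ (2 * R), ∀ y ∈ Metric.ball x₀ (2 * R),
      K x y ≤ ENNReal.ofReal cU * edist x y ^ (-(d : ℝ) - α))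
    (hE : energy J (Metric.ball x₀ (2 * R)) (Metric.ball x₀ (2 * R))
        (fun x => τ x * max (u x - k) 0) ≤ ENNReal.ofReal C *
      energy (symPart K) (Metric.ball x₀ (2 * R)) (Metric.ball x₀ (2 * R))
        (fun x => τ x * max (u x - k) 0))
    (hC : 2 * ENNReal.ofReal ε * ENNReal.ofReal C ≤ 1 / 4)
    (hS : sqNorm (d / (d - α)) (Metric.ball x₀ R) (fun x => τ x * max (u x - k) 0) ≤
      ENNReal.ofReal cS * energy (symPart K) (Metric.ball x₀ (2 * R)) (Metric.ball x₀ (2 * R))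
        (fun x => τ x * max (u x - k) 0) + ENNReal.ofReal (cS * R ^ (-α)) *
      ∫⁻ x in Metric.ball x₀ (2 * R), ENNReal.ofReal ((τ x * max (u x - k) 0) ^ 2))
    (hD : ∫⁻ x, driftWeight kk (τ x * max (u x - k) 0) *
        driftDensity K J (Metric.ball x₀ (2 * R)) x ≤
      ENNReal.ofReal η * sqNorm (d / (d - α)) (Metric.ball x₀ R)
        (fun x => τ x * max (u x - k) 0) +
      ENNReal.ofReal (M * R ^ (-β)) * levelMass q (Metric.ball x₀ (r + 2 * ρ)) u k)
    (hη' : 48 * η * cS ≤ ε)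
    (hX : ENNReal.ofReal (R ^ (-α)) *
        ∫⁻ x in Metric.ball x₀ (r + 2 * ρ), ENNReal.ofReal (max (u x - k) 0 ^ 2) ≤
      ENNReal.ofReal (V * R ^ (-β)) * levelMass q (Metric.ball x₀ (r + 2 * ρ)) u k)
    {C' : ℝ} (hC1 : (8 * c + 2) * V + 12 / ε * M ≤ C') (hC2 : 4 * cU + 2 ≤ C') :
    ENNReal.ofReal (1 / (2 * cS)) * sqNorm (d / (d - α)) (Metric.ball x₀ R)
        (fun x => τ x * max (u x - k) 0) + ENNReal.ofReal (-∫ p, I p) ≤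
      ENNReal.ofReal (C' * (R / ρ) ^ (d + α) * R ^ (-β)) *
          levelMass q (Metric.ball x₀ (r + 2 * ρ)) u k +
        ENNReal.ofReal (C' * (R / ρ) ^ (d + α) * R ^ (-α)) * tail Kt α u R x₀ *
          (∫⁻ x in Metric.ball x₀ (r + 2 * ρ), ENNReal.ofReal (max (u x - k) 0)) +
        ENNReal.ofReal (∫ p, I p) := by
  have hd' : (0 : ℝ) < d := by exact_mod_cast hd
  have hum := hu.measurable
  have hRα : 0 < R ^ (-α) := Real.rpow_pos_of_pos hR _
  have hRβ : 0 < R ^ (-β) := Real.rpow_pos_of_pos hR _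
  set Θ := (R / ρ) ^ (d + α) with hΘ
  have hΘ1 : 1 ≤ Θ := Real.one_le_rpow ((one_le_div hρ).2 (by linarith)) (by positivity)
  have hW2 : ∫⁻ x in Metric.ball x₀ (2 * R), ENNReal.ofReal ((τ x * max (u x - k) 0) ^ 2) ≤
      ∫⁻ x in Metric.ball x₀ (r + 2 * ρ), ENNReal.ofReal (max (u x - k) 0 ^ 2) := by
    rw [← lintegral_indicator measurableSet_ball, ← lintegral_indicator measurableSet_ball]
    refine lintegral_mono fun x => ?_
    by_cases hx : x ∈ Metric.ball x₀ (r + 2 * ρ)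
    · rw [indicator_of_mem hx, indicator_of_mem (hτ.subset' hx)]
      refine ENNReal.ofReal_le_ofReal ?_
      rw [mul_pow]
      exact mul_le_of_le_one_left (sq_nonneg _) (pow_le_one₀ (hτ.nonneg x) (hτ.le_one x))
    · have h0 : τ x = 0 := hτ.eq_zero x fun h => hx (hτ.subset h)
      refine le_trans (indicator_le_self _ _ x) ?_
      simp [h0]
  have hS' := hS.trans (add_le_add le_rfl (mul_le_mul' le_rfl hW2))
  have hηc : 2 * ENNReal.ofReal (6 / ε) * ENNReal.ofReal η * ENNReal.ofReal cS ≤ 1 / 4 := by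
    rw [← ENNReal.ofReal_ofNat 2, ← ENNReal.ofReal_mul (by norm_num),
      ← ENNReal.ofReal_mul (by positivity), ← ENNReal.ofReal_mul (by positivity)]
    have h2 : ENNReal.ofReal (1 / 4) = 1 / 4 := by
      rw [ENNReal.ofReal_div_of_pos (by norm_num)]; simp
    rw [← h2]
    refine ENNReal.ofReal_le_ofReal ?_
    have : 2 * (6 / ε) * η * cS = 12 * η * cS / ε := by ring
    rw [this, div_le_iff₀ hε]
    linarith
  have h1 := hI.caccioppoli hint hτ hK hJ hKt hJs hfin hum hu.nonneg hk hkk hu.normSqV_lt_top hε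
    hε1 (T₁ := ENNReal.ofReal (cU * Θ * R ^ (-α)) * tail Kt α u R x₀) (T₂ := tail Kt α u R x₀)
    (fun x hx => lintegral_tail_near_le hd hα0 hR hU hr hρ hrρ u Kt hx hcU)
    (fun x hx => lintegral_tail_far_le (by linarith) hR u x₀ Kt hx) hE hC hS' hD hηc
  have h2 := sqNorm_cutoff_le hcS rfl hS'
  generalize sqNorm (d / (d - α)) (Metric.ball x₀ R) (fun x => τ x * max (u x - k) 0) = N at *
  generalize energy (symPart K) (Metric.ball x₀ (2 * R)) (Metric.ball x₀ (2 * R))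
    (fun x => τ x * max (u x - k) 0) = E at *
  generalize levelMass q (Metric.ball x₀ (r + 2 * ρ)) u k = Ψ at *
  generalize ∫⁻ x in Metric.ball x₀ (r + 2 * ρ), ENNReal.ofReal (max (u x - k) 0 ^ 2) = X at *
  generalize ∫⁻ x in Metric.ball x₀ (r + 2 * ρ), ENNReal.ofReal (max (u x - k) 0) = Y at *
  generalize tail Kt α u R x₀ = T at *
  have hΛ : ρ ^ (-α) ≤ Θ * R ^ (-α) := le_mul_rpow_div hR hρ (by linarith) (by linarith)
  have hRα1 : 1 ≤ R ^ (-α) := Real.one_le_rpow_of_pos_of_le_one_of_nonpos hR hR1 (by linarith)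
  have e1 : ENNReal.ofReal (R ^ (-α)) * X + (8 * ENNReal.ofReal (c * ρ ^ (-α)) +
      2 * ENNReal.ofReal (6 / ε) * ENNReal.ofReal η * ENNReal.ofReal (cS * R ^ (-α))) * X ≤
      ENNReal.ofReal ((8 * c + 2) * Θ) * (ENNReal.ofReal (R ^ (-α)) * X) := by
    rw [← add_mul, ← mul_assoc]
    refine mul_le_mul' ?_ le_rfl
    have a1 : 2 * ENNReal.ofReal (6 / ε) * ENNReal.ofReal η * ENNReal.ofReal (cS * R ^ (-α)) ≤
        ENNReal.ofReal (R ^ (-α)) := by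
      rw [ENNReal.ofReal_mul hcS.le, ← mul_assoc]
      refine (mul_le_mul' hηc le_rfl).trans ?_
      refine (mul_le_mul' (b := 1) ?_ le_rfl).trans (one_mul _).le
      rw [one_div]; exact ENNReal.inv_le_one.2 (by norm_num)
    refine (add_le_add le_rfl (add_le_add le_rfl a1)).trans ?_
    rw [← ENNReal.ofReal_ofNat 8, ← ENNReal.ofReal_mul (by norm_num),
      ← ENNReal.ofReal_add (by positivity) (by positivity),
      ← ENNReal.ofReal_add (by positivity) (by positivity), ← ENNReal.ofReal_mul (by positivity)]
    refine ENNReal.ofReal_le_ofReal ?_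
    have b1 : 8 * (c * ρ ^ (-α)) ≤ 8 * c * Θ * R ^ (-α) := by
      have := mul_le_mul_of_nonneg_left hΛ hc
      linarith
    have b2 : R ^ (-α) ≤ Θ * R ^ (-α) := le_mul_of_one_le_left hRα.le hΘ1
    linarith
  have e2 : ENNReal.ofReal ((8 * c + 2) * Θ) * (ENNReal.ofReal (R ^ (-α)) * X) +
      2 * ENNReal.ofReal (6 / ε) * (ENNReal.ofReal (M * R ^ (-β)) * Ψ) ≤
      ENNReal.ofReal (C' * Θ * R ^ (-β)) * Ψ := by
    refine (add_le_add (mul_le_mul' le_rfl hX) le_rfl).trans ?_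
    rw [← mul_assoc, ← mul_assoc, ← add_mul]
    refine mul_le_mul' ?_ le_rfl
    rw [← ENNReal.ofReal_ofNat 2, ← ENNReal.ofReal_mul (by positivity),
      ← ENNReal.ofReal_mul (by positivity), ← ENNReal.ofReal_mul (by positivity),
      ← ENNReal.ofReal_add (by positivity) (by positivity)]
    refine ENNReal.ofReal_le_ofReal ?_
    have b1 : 12 / ε * M ≤ 12 / ε * M * Θ := le_mul_of_one_le_right (by positivity) hΘ1
    have b2 : ((8 * c + 2) * V + 12 / ε * M) * Θ ≤ C' * Θ := by gcongr
    calc _ = ((8 * c + 2) * V * Θ + 12 / ε * M) * R ^ (-β) := by ring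
      _ ≤ _ := by
        gcongr
        linarith
  have e3 : 4 * (ENNReal.ofReal (cU * Θ * R ^ (-α)) * T) + 2 * T ≤
      ENNReal.ofReal (C' * Θ * R ^ (-α)) * T := by
    rw [← mul_assoc, ← add_mul]
    refine mul_le_mul' ?_ le_rfl
    rw [← ENNReal.ofReal_ofNat 4, ← ENNReal.ofReal_ofNat 2, ← ENNReal.ofReal_mul (by norm_num),
      ← ENNReal.ofReal_add (by positivity) (by positivity)]
    refine ENNReal.ofReal_le_ofReal ?_
    have b1 : 1 ≤ Θ * R ^ (-α) := one_le_mul_of_one_le_of_one_le hΘ1 hRα1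
    have b2 : (4 * cU + 2) * (Θ * R ^ (-α)) ≤ C' * (Θ * R ^ (-α)) := by gcongr
    linarith
  calc _ ≤ 1 / 2 * E + ENNReal.ofReal (R ^ (-α)) * X + ENNReal.ofReal (-∫ p, I p) :=
        add_le_add h2 le_rfl
    _ = ENNReal.ofReal (R ^ (-α)) * X + (1 / 2 * E + ENNReal.ofReal (-∫ p, I p)) := by ring
    _ ≤ _ := add_le_add le_rfl h1
    _ = (ENNReal.ofReal (R ^ (-α)) * X + (8 * ENNReal.ofReal (c * ρ ^ (-α)) +
          2 * ENNReal.ofReal (6 / ε) * ENNReal.ofReal η * ENNReal.ofReal (cS * R ^ (-α))) * X) +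
        2 * ENNReal.ofReal (6 / ε) * (ENNReal.ofReal (M * R ^ (-β)) * Ψ) +
        (4 * (ENNReal.ofReal (cU * Θ * R ^ (-α)) * T) + 2 * T) * Y +
        ENNReal.ofReal (∫ p, I p) := by ring
    _ ≤ _ := by
        refine add_le_add (add_le_add ((add_le_add e1 le_rfl).trans e2) ?_) le_rfl
        exact mul_le_mul' e3 le_rfl

end LevelSet

section Existence

variable {d : ℕ} {K J Kt : Eu d → Eu d → ℝ≥0∞} {Ω : Set (Eu d)} {α : ℝ}

theorem toReal_inv_add_inv_conjExponent {θ : ℝ≥0∞} (hθ : 1 < θ) :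
    θ.conjExponent ≠ ∞ ∧ 1 ≤ θ.conjExponent.toReal ∧
      1 / θ.conjExponent.toReal = 1 - θ⁻¹.toReal := by
  have hne : θ.conjExponent ≠ ∞ := by
    rw [ENNReal.conjExponent]
    exact ENNReal.add_ne_top.2 ⟨ENNReal.one_ne_top, ENNReal.inv_ne_top.2 (tsub_pos_of_lt hθ).ne'⟩
  have h1 : 1 ≤ θ.conjExponent := by rw [ENNReal.conjExponent]; exact le_self_add
  have hθ0 : θ ≠ 0 := (zero_lt_one.trans hθ).ne'
  refine ⟨hne, ?_, ?_⟩
  · rw [← ENNReal.toReal_one]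
    exact ENNReal.toReal_mono hne h1
  · have h := (ENNReal.HolderConjugate.conjExponent hθ.le)
    have h2 : θ⁻¹ + θ.conjExponent⁻¹ = 1 := by
      have := h.inv_add_inv_eq_inv
      simpa using this
    have h3 := congrArg ENNReal.toReal h2
    rw [ENNReal.toReal_add (ENNReal.inv_ne_top.2 hθ0)
      (ENNReal.inv_ne_top.2 (zero_lt_one.trans_le h1).ne'), ENNReal.toReal_inv θ.conjExponent,
      ENNReal.toReal_one] at h3
    rw [one_div]; linarith

theorem lintegral_mul_le_conjExponent {X : Type*} [MeasurableSpace X] {μ : Measure X} {θ : ℝ≥0∞}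
    (hθ : 1 < θ) {f g : X → ℝ≥0∞} (hf : Measurable f) (hg : Measurable g) :
    ∫⁻ x, f x * g x ∂μ ≤ (∫⁻ x, f x ^ θ.conjExponent.toReal ∂μ) ^ (1 / θ.conjExponent.toReal) *
      eLpNorm g θ μ := by
  rcases eq_or_ne θ ∞ with rfl | hθt
  · have : (∞ : ℝ≥0∞).conjExponent = 1 := by simp [ENNReal.conjExponent]
    rw [this, eLpNorm_exponent_top]
    simp only [ENNReal.toReal_one, ENNReal.rpow_one, div_one]
    rw [← lintegral_mul_const _ hf]
    refine lintegral_mono_ae ?_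
    filter_upwards [ae_le_eLpNormEssSup (f := g) (μ := μ)] with x hx
    exact mul_le_mul' le_rfl (by simpa using hx)
  · obtain ⟨h1, h2, h3⟩ := toReal_inv_add_inv_conjExponent hθ
    have ht : 1 < θ.toReal := by
      rw [← ENNReal.toReal_one]
      exact (ENNReal.toReal_lt_toReal ENNReal.one_ne_top hθt).2 hθ
    have hc : θ.toReal.HolderConjugate θ.conjExponent.toReal := by
      rw [Real.holderConjugate_iff]
      refine ⟨ht, ?_⟩
      rw [← one_div θ.conjExponent.toReal, h3, ENNReal.toReal_inv]; ring
    rw [eLpNorm_eq_lintegral_rpow_enorm_toReal (by positivity) hθt]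
    simp only [enorm_eq_self]
    exact ENNReal.lintegral_mul_le_Lp_mul_Lq μ hc.symm hf.aemeasurable hg.aemeasurable

theorem lintegral_driftWeight_rpow_le {q : ℝ} (hq : 1 ≤ q) {S' : Set (Eu d)}
    {τ u : Eu d → ℝ} {k : ℝ} (hτ0 : ∀ x, 0 ≤ τ x)
    (hτ1 : ∀ x, τ x ≤ 1) (hS : ∀ x ∉ S', τ x = 0) (hum : Measurable u) (hS' : MeasurableSet S') :
    (∫⁻ x, driftWeight k (τ x * max (u x - k) 0) ^ q) ^ (1 / q) ≤ levelMass q S' u k := by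
  have hq0 : 0 < q := by linarith
  have hmk : MeasurableSet {x | k < u x} := measurableSet_lt measurable_const hum
  have hf : Measurable (S'.indicator fun x => ENNReal.ofReal (max (u x - k) 0 ^ 2)) :=
    Measurable.indicator (by fun_prop) hS'
  have hg : Measurable ((S' ∩ {x | k < u x}).indicator fun _ => ENNReal.ofReal (k ^ 2)) :=
    measurable_const.indicator (hS'.inter hmk)
  calc _ ≤ (∫⁻ x, ((S'.indicator fun x => ENNReal.ofReal (max (u x - k) 0 ^ 2)) +
        (S' ∩ {x | k < u x}).indicator fun _ => ENNReal.ofReal (k ^ 2)) x ^ q) ^ (1 / q) := by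
        refine ENNReal.rpow_le_rpow (lintegral_mono fun x => ENNReal.rpow_le_rpow ?_ hq0.le)
          (by positivity)
        rw [Pi.add_apply, driftWeight]
        by_cases hx : x ∈ S'
        · rw [indicator_of_mem hx]
          refine add_le_add (ENNReal.ofReal_le_ofReal ?_) ?_
          · rw [mul_pow]
            exact mul_le_of_le_one_left (sq_nonneg _) (pow_le_one₀ (hτ0 x) (hτ1 x))
          · by_cases hku : k < u x
            · rw [indicator_of_mem (show x ∈ S' ∩ {x | k < u x} from ⟨hx, hku⟩)]
              split_ifs
              · exact zero_le
              · exact le_rfl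
            · have : max (u x - k) 0 = 0 := max_eq_right (by linarith)
              rw [this, mul_zero, if_pos rfl]
              exact zero_le
        · rw [hS x hx]; simp
    _ ≤ (∫⁻ x, (S'.indicator fun x => ENNReal.ofReal (max (u x - k) 0 ^ 2)) x ^ q) ^ (1 / q) +
        (∫⁻ x, ((S' ∩ {x | k < u x}).indicator fun _ => ENNReal.ofReal (k ^ 2)) x ^ q) ^ (1 / q) :=
        ENNReal.lintegral_Lp_add_le hf.aemeasurable hg.aemeasurable hq
    _ = _ := by
        rw [levelMass, sqNorm]
        congr 1
        · rw [← lintegral_indicator hS']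
          congr 1
          refine lintegral_congr fun x => ?_
          by_cases hx : x ∈ S'
          · rw [indicator_of_mem hx, indicator_of_mem hx]
          · rw [indicator_of_notMem hx, indicator_of_notMem hx, ENNReal.zero_rpow_of_pos hq0]
        · have : ∀ x, ((S' ∩ {x | k < u x}).indicator fun _ => ENNReal.ofReal (k ^ 2)) x ^ q =
              (S' ∩ {x | k < u x}).indicator (fun _ => ENNReal.ofReal (k ^ 2) ^ q) x := by
            intro x
            by_cases hx : x ∈ S' ∩ {x | k < u x}
            · rw [indicator_of_mem hx, indicator_of_mem hx]
            · rw [indicator_of_notMem hx, indicator_of_notMem hx, ENNReal.zero_rpow_of_pos hq0]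
          rw [lintegral_congr this, lintegral_indicator_const (hS'.inter hmk),
            ENNReal.mul_rpow_of_nonneg _ _ (by positivity), ← ENNReal.rpow_mul,
            mul_one_div_cancel hq0.ne', ENNReal.rpow_one]

theorem memLp_two_of_lintegral {B : Set (Eu d)} {v : Eu d → ℝ} (hv : Measurable v)
    (h : ∫⁻ x, ENNReal.ofReal (v x ^ 2) < ∞) : MemLp v 2 (volume.restrict B) := by
  refine ⟨hv.aestronglyMeasurable, ?_⟩
  have h : eLpNorm v 2 (volume.restrict B) ^ 2 < ∞ := by
    rw [lintegral_sq_eq]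
    exact (lintegral_mono' Measure.restrict_le_self le_rfl).trans_lt h
  exact (ENNReal.pow_lt_top_iff.1 h).resolve_right (by norm_num)

theorem volume_ball_le {x₀ : Eu d} {r R : ℝ} (hr : r ≤ R) (hR : 0 < R) :
    volume (Metric.ball x₀ r) ≤ ENNReal.ofReal (R ^ d) * volume (Metric.ball (0 : Eu d) 1) := by
  refine (measure_mono (Metric.ball_subset_ball hr)).trans ?_
  rw [Measure.addHaar_ball_of_pos _ _ hR, finrank_euclideanSpace_fin]

theorem exists_caccioppoliEstimate_primal (hα0 : 0 < α) (hα2 : α < 2) (hαd : α < d)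
    (hΩ : IsOpen Ω) (hK : Measurable (Function.uncurry K)) (hLevy : LevyIntegrable K)
    (hUpper : KernelUpperLoc K Ω α) (hCutoff : CutoffCondition (symPart K) Ω α)
    (hSob : SobolevCondition K Ω α) {θ : ℝ≥0∞} (hθ : ENNReal.ofReal (d / α) ≤ θ)
    (hK1 : K1Loc K Ω α θ) {A : Set (Eu d)} (hAΩ : A ⊆ Ω)
    (hA : ENNReal.ofReal (d / α) < θ ∨ IsCompact A) :
    ∃ b C : ℝ, 0 < b ∧ 0 < C ∧ ∀ (x₀ : Eu d) (R r ρ : ℝ), x₀ ∈ A → 0 < R → R ≤ 1 →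
      Metric.ball x₀ (2 * R) ⊆ Ω → R / 2 ≤ r → 0 < ρ → r + 2 * ρ ≤ R →
      ∃ τ, CaccioppoliEstimate K (IsAdmissible K (Metric.ball x₀ (2 * R))) (FormDefined K) (form K)
        (fun u => tail K α u R x₀) α α (d / (d - α)) 1 b C x₀ R r ρ τ := by
  have hd' : (0 : ℝ) < d := hα0.trans hαd
  have hd : 0 < d := by exact_mod_cast hd'
  obtain ⟨J, hJ, C₁, hC₁, HJ⟩ := hK1
  obtain ⟨l, Hl⟩ := exists_nearKernel_absorption hα0 hαd hΩ hK hUpper hθ hJ.measurable hC₁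
    (fun r z hr hr1 hsub => (HJ r z hr hr1 hsub).1) hAΩ hA
  obtain ⟨c, hc, Hc⟩ := exists_admissibleCutoff hd hα0 hα2 hUpper hCutoff hJ (nearKernel_le K J l)
  obtain ⟨cS, hcS, HS⟩ := exists_sobolev hα0 hαd hSob
  obtain ⟨cU, hcU, HU⟩ := hUpper
  set ε : ℝ := min 1 (1 / (8 * (C₁ + 1))) with hε
  have hε0 : 0 < ε := by positivity
  have hε1 : ε ≤ 1 := min_le_left _ _
  set η : ℝ := ε / (48 * cS) with hη
  have hη0 : 0 < η := by positivity
  obtain ⟨M, hM, HM⟩ := Hl η hη0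
  refine ⟨1 / (2 * cS), (8 * c + 2) * 1 + 12 / ε * M + (4 * cU + 2), by positivity, by positivity,
    ?_⟩
  intro x₀ R r ρ hx₀ hR hR1 hsub hr hρ hrρ
  obtain ⟨τ, hτ, hτ1⟩ := Hc x₀ R r ρ hR hR1 hsub hr hρ hrρ
  have hJm := measurable_nearKernel hK hJ.measurable l
  have hJs := nearKernel_comm (K := K) hJ.symm l
  have hτm := hτ.measurable
  have hfin := hLevy.ae_ne_top hd hK
  have hEn : ∀ v : Eu d → ℝ, Measurable v → MemLp v 2 (volume.restrict (Metric.ball x₀ (2 * R))) →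
      energy (nearKernel K J l) (Metric.ball x₀ (2 * R)) (Metric.ball x₀ (2 * R)) v ≤
      ENNReal.ofReal (C₁ + 1) *
        energy (symPart K) (Metric.ball x₀ (2 * R)) (Metric.ball x₀ (2 * R)) v :=
    fun v hv hvL => energy_nearKernel_le hK hJ.measurable l _ hv hC₁
      ((HJ R x₀ hR hR1 hsub).2 v hvL)
  have hdef : ∀ u k, IsAdmissible K (Metric.ball x₀ (2 * R)) u → 0 ≤ k →
      FormDefined K u (fun x => τ x ^ 2 * max (u x - k) 0) := by
    intro u k hu hk
    have hum := hu.measurable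
    have hφ : Measurable fun x => τ x ^ 2 * max (u x - k) 0 := by fun_prop
    have hφ0 : ∀ x ∉ Metric.ball x₀ (2 * R), τ x ^ 2 * max (u x - k) 0 = 0 := fun x hx => by
      rw [hτ.eq_zero x fun h => hx (hτ.subset' (hτ.subset h))]; simp
    have hφE := hτ.energy_sq_mul_lt_top hK hum hu.nonneg hk hu.normSqV_lt_top
    have hφ2 := hτ.lintegral_testFunction_sq_lt_top hu.nonneg hk hu.normSqV_lt_top
    have hφL := memLp_two_of_lintegral (B := Metric.ball x₀ (2 * R)) hφ hφ2
    have huE := energy_lt_top_of_normSqV hu.normSqV_lt_top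
    have huL : MemLp u 2 (volume.restrict (Metric.ball x₀ (2 * R))) := by
      refine ⟨hum.aestronglyMeasurable, ?_⟩
      have h := lintegral_sq_lt_top_of_normSqV hu.normSqV_lt_top
      rw [← lintegral_sq_eq] at h
      exact (ENNReal.pow_lt_top_iff.1 h).resolve_right (by norm_num)
    refine ⟨integrable_symIntegrand hK measurableSet_ball hum hφ huE hφ0 hφE,
      integrable_antiIntegrand_primal hK hJm hJs measurableSet_ball hum hφ huE hφ0 hφE
        ((hEn u hum huL).trans_lt (ENNReal.mul_lt_top ENNReal.ofReal_lt_top ?_)) ?_⟩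
    · exact (energy_mono le_rfl (subset_univ _) u).trans_lt huE
    · have h1 := HM x₀ R hx₀ hR hR1 hsub (fun x => ENNReal.ofReal ((τ x ^ 2 * max (u x - k) 0) ^ 2))
        (by fun_prop) (fun x hx => by
          rw [hτ.eq_zero x fun h => hx (Metric.ball_subset_ball (by linarith) h)]; simp)
      refine h1.trans_lt (ENNReal.add_lt_top.2 ⟨ENNReal.mul_lt_top ENNReal.ofReal_lt_top ?_,
        ENNReal.mul_lt_top ENNReal.ofReal_lt_top ?_⟩)
      · refine (HS x₀ R hR hR1 hsub _ hφL).trans_lt (ENNReal.add_lt_top.2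
          ⟨ENNReal.mul_lt_top ENNReal.ofReal_lt_top ?_,
            ENNReal.mul_lt_top ENNReal.ofReal_lt_top ?_⟩)
        · exact (energy_mono (subset_univ _) (subset_univ _) _).trans_lt hφE
        · exact (lintegral_mono' Measure.restrict_le_self le_rfl).trans_lt hφ2
      · exact (lintegral_mono' Measure.restrict_le_self le_rfl).trans_lt hφ2
  refine ⟨τ, hτm, hτ.nonneg, hτ.le_one, hτ.eq_zero, hτ1,
    fun u k hu hk => hτ.memH hK hu.measurable hu.nonneg hk hu.normSqV_lt_top, hdef, ?_⟩
  intro u k hu hk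
  have hum := hu.measurable
  obtain ⟨i1, i2⟩ := hdef u k hu hk
  have hW : Measurable fun x => τ x * max (u x - k) 0 := by fun_prop
  have hWL := hτ.memLp_mul hum hu.nonneg hk hu.normSqV_lt_top
  have key := (isFormIntegrand_primal (K := K) (k := k) hτ.nonneg hu.nonneg).caccioppoli_balls
    (i1.add i2) hd hα0 (V := 1) (β := α) (q := 1) (C' := (8 * c + 2) * 1 + 12 / ε * M +
    (4 * cU + 2)) hR hR1 hr hρ hrρ hc.le hcU.le hcS hM.le zero_le_one hη0.le hτ hK hJm hK hJs hfin hu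
    hk le_rfl hε0 hε1 (HU R x₀ hR hR1 hsub) (hEn _ hW hWL) ?_ (HS x₀ R hR hR1 hsub _ hWL) ?_ ?_ ?_
    (by linarith) (le_add_of_nonneg_left (by positivity))
  · have e : form K u (fun x => τ x ^ 2 * max (u x - k) 0) =
        ∫ p, (symIntegrand K u (fun x => τ x ^ 2 * max (u x - k) 0) p +
          antiIntegrand K u (fun x => τ x ^ 2 * max (u x - k) 0) p) := by
      rw [integral_add i1 i2, form]
    rw [e]
    exact key
  · rw [← ENNReal.ofReal_ofNat 2, ← ENNReal.ofReal_mul (by norm_num),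
      ← ENNReal.ofReal_mul (by positivity)]
    have h2 : ENNReal.ofReal (1 / 4) = 1 / 4 := by
      rw [ENNReal.ofReal_div_of_pos (by norm_num)]; simp
    rw [← h2]
    refine ENNReal.ofReal_le_ofReal ?_
    have : ε ≤ 1 / (8 * (C₁ + 1)) := min_le_right _ _
    rw [le_div_iff₀ (by positivity)] at this
    linarith
  · have h1 := HM x₀ R hx₀ hR hR1 hsub (fun x => ENNReal.ofReal ((τ x * max (u x - k) 0) ^ 2))
        (by fun_prop) (fun x hx => by
          rw [hτ.eq_zero x fun h => hx (Metric.ball_subset_ball (by linarith) h)]; simp)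
    have h0 : ∀ x, driftWeight 0 (τ x * max (u x - k) 0) =
        ENNReal.ofReal ((τ x * max (u x - k) 0) ^ 2) := by
      intro x; simp [driftWeight]
    simp only [h0]
    refine h1.trans (add_le_add le_rfl ?_)
    have hRα1 : 1 ≤ R ^ (-α) := Real.one_le_rpow_of_pos_of_le_one_of_nonpos hR hR1 (by linarith)
    refine mul_le_mul' (ENNReal.ofReal_le_ofReal (le_mul_of_one_le_right hM.le hRα1)) ?_
    refine le_trans ?_ le_self_add
    rw [sqNorm_one, ← lintegral_indicator measurableSet_ball,
      ← lintegral_indicator measurableSet_ball]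
    refine lintegral_mono fun x => ?_
    by_cases hx : x ∈ Metric.ball x₀ (r + 2 * ρ)
    · rw [indicator_of_mem hx]
      refine (indicator_le_self _ _ x).trans (ENNReal.ofReal_le_ofReal ?_)
      rw [mul_pow]
      exact mul_le_of_le_one_left (sq_nonneg _) (pow_le_one₀ (hτ.nonneg x) (hτ.le_one x))
    · refine (indicator_le_self _ _ x).trans ?_
      simp [hτ.eq_zero x fun h => hx (hτ.subset h)]
  · rw [hη]; field_simp; norm_num
  · rw [one_mul]
    refine mul_le_mul' le_rfl ?_
    rw [levelMass, sqNorm_one]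
    exact le_self_add

/-- The functions to which the Caccioppoli inequality for the dual form applies. -/
structure IsAdmissibleDual (K : Eu d → Eu d → ℝ≥0∞) (θ : ℝ≥0∞) (B : Set (Eu d)) (u : Eu d → ℝ) :
    Prop extends IsAdmissible K B u where
  eLpNorm_lt_top : eLpNorm u (2 * θ.conjExponent) volume < ∞

theorem exists_caccioppoliEstimate_dual (hα0 : 0 < α) (hα2 : α < 2) (hαd : α < d)
    (hK : Measurable (Function.uncurry K)) (hLevy : LevyIntegrable K)
    (hUpper : KernelUpperLoc K Ω α) (hCutoff : CutoffCondition (symPart K) Ω α)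
    (hSob : SobolevCondition K Ω α) {θ : ℝ≥0∞} (hθ : ENNReal.ofReal (d / α) < θ)
    (hK1 : K1Glob K Ω α θ) :
    ∃ b C : ℝ, 0 < b ∧ 0 < C ∧ ∀ (x₀ : Eu d) (R r ρ : ℝ), 0 < R → R ≤ 1 →
      Metric.ball x₀ (2 * R) ⊆ Ω → R / 2 ≤ r → 0 < ρ → r + 2 * ρ ≤ R →
      ∃ τ, CaccioppoliEstimate K (IsAdmissibleDual K θ (Metric.ball x₀ (2 * R)))
        (fun u φ => FormDefined K φ u) (fun u φ => form K φ u)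
        (fun u => tail (fun x y => K y x) α u R x₀) α
        (α - d * (1 - 1 / θ.conjExponent.toReal)) (d / (d - α)) θ.conjExponent.toReal
        b C x₀ R r ρ τ := by
  have hd' : (0 : ℝ) < d := hα0.trans hαd
  have hd : 0 < d := by exact_mod_cast hd'
  have hθ1 : 1 < θ := by
    refine lt_of_le_of_lt ?_ hθ
    rw [← ENNReal.ofReal_one]
    exact ENNReal.ofReal_le_ofReal ((one_le_div hα0).2 hαd.le)
  obtain ⟨hq_top, hq1, hqθ⟩ := toReal_inv_add_inv_conjExponent hθ1
  set q := θ.conjExponent.toReal with hq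
  have hq0 : 0 < q := by linarith
  obtain ⟨J, hJ, C₁, hC₁, HJ⟩ := hK1
  obtain ⟨c, hc, Hc⟩ := exists_admissibleCutoff hd hα0 hα2 hUpper hCutoff hJ (J' := J)
    (fun x y => le_self_add)
  obtain ⟨cS, hcS, HS⟩ := exists_sobolev hα0 hαd hSob
  obtain ⟨cU, hcU, HU⟩ := hUpper
  set ε : ℝ := min 1 (1 / (8 * C₁)) with hε
  have hε0 : 0 < ε := by positivity
  have hε1 : ε ≤ 1 := min_le_left _ _
  set β := α - d * (1 - 1 / q) with hβ
  have hβ0 : 0 ≤ β := by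
    have h1 : θ⁻¹.toReal ≤ α / d := by
      have h2 : θ⁻¹ ≤ ENNReal.ofReal (α / d) := by
        rw [← inv_div, ENNReal.ofReal_inv_of_pos (by positivity)]
        exact ENNReal.inv_le_inv.2 hθ.le
      exact ENNReal.toReal_le_of_le_ofReal (by positivity) h2
    rw [hβ, hqθ]
    rw [le_div_iff₀ hd'] at h1
    linarith
  set V : ℝ := (volume (Metric.ball (0 : Eu d) 1) ^ (1 - 1 / q)).toReal with hV
  have hexp : 0 ≤ 1 - 1 / q := by
    have : 1 / q ≤ 1 := by rw [div_le_one hq0]; exact hq1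
    linarith
  refine ⟨1 / (2 * cS), (8 * c + 2) * V + 12 / ε * C₁ + (4 * cU + 2), by positivity, by positivity,
    ?_⟩
  intro x₀ R r ρ hR hR1 hsub hr hρ hrρ
  obtain ⟨τ, hτ, hτ1⟩ := Hc x₀ R r ρ hR hR1 hsub hr hρ hrρ
  have hJm := hJ.measurable
  have hJs := hJ.symm
  have hτm := hτ.measurable
  have hKt : Measurable (Function.uncurry fun x y => K y x) := measurable_swap_kernel hK
  have hfin := hLevy.ae_ne_top hd hK
  obtain ⟨hDθ, hEn⟩ := HJ R x₀ hR hR1 hsub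
  have hdef : ∀ u k, IsAdmissibleDual K θ (Metric.ball x₀ (2 * R)) u → 0 ≤ k →
      FormDefined K (fun x => τ x ^ 2 * max (u x - k) 0) u := by
    intro u k hu hk
    have hum := hu.measurable
    have hφ : Measurable fun x => τ x ^ 2 * max (u x - k) 0 := by fun_prop
    have hφ0 : ∀ x ∉ Metric.ball x₀ (2 * R), τ x ^ 2 * max (u x - k) 0 = 0 := fun x hx => by
      rw [hτ.eq_zero x fun h => hx (hτ.subset' (hτ.subset h))]; simp
    have hφE := hτ.energy_sq_mul_lt_top hK hum hu.nonneg hk hu.normSqV_lt_top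
    have hφ2 := hτ.lintegral_testFunction_sq_lt_top hu.nonneg hk hu.normSqV_lt_top
    have hφL := memLp_two_of_lintegral (B := Metric.ball x₀ (2 * R)) hφ hφ2
    have huE := energy_lt_top_of_normSqV hu.normSqV_lt_top
    refine ⟨?_, integrable_antiIntegrand_dual hK hJm hJs hum hφ
      (hτ.energy_J_testFunction_lt_top hJm hJs hum hu.nonneg hk hu.normSqV_lt_top
        ((hEn _ hφL).trans_lt (ENNReal.mul_lt_top ENNReal.ofReal_lt_top ?_))) ?_⟩
    · rw [symIntegrand_comm]
      exact integrable_symIntegrand hK measurableSet_ball hum hφ huE hφ0 hφE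
    · exact (energy_mono (subset_univ _) (subset_univ _) _).trans_lt hφE
    · refine (lintegral_mul_le_conjExponent hθ1 (by fun_prop)
        (measurable_driftDensity hK hJm _)).trans_lt (ENNReal.mul_lt_top ?_
        (hDθ.trans_lt ENNReal.ofReal_lt_top))
      have h := hu.eLpNorm_lt_top
      rw [eLpNorm_lt_top_iff_lintegral_rpow_enorm_lt_top
        (mul_ne_zero two_ne_zero (by rw [ENNReal.conjExponent]; simp))
        (ENNReal.mul_ne_top (by norm_num) hq_top), ENNReal.toReal_mul, ENNReal.toReal_ofNat] at h
      refine ENNReal.rpow_lt_top_of_nonneg (by positivity) (ne_of_lt (lt_of_eq_of_lt ?_ h))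
      refine lintegral_congr fun x => ?_
      rw [ENNReal.rpow_mul, ← Real.enorm_of_nonneg (sq_nonneg _), enorm_pow, ENNReal.rpow_ofNat]
  refine ⟨τ, hτm, hτ.nonneg, hτ.le_one, hτ.eq_zero, hτ1,
    fun u k hu hk => hτ.memH hK hu.measurable hu.nonneg hk hu.normSqV_lt_top, hdef, ?_⟩
  intro u k hu hk
  have hum := hu.measurable
  obtain ⟨i1, i2⟩ := hdef u k hu hk
  have hW : Measurable fun x => τ x * max (u x - k) 0 := by fun_prop
  have hWL := hτ.memLp_mul hum hu.nonneg hk hu.normSqV_lt_top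
  have hRβ1 : 1 ≤ R ^ (-β) := Real.one_le_rpow_of_pos_of_le_one_of_nonpos hR hR1 (by linarith)
  have key := (isFormIntegrand_dual (K := K) (k := k) hτ.nonneg hu.nonneg hk).caccioppoli_balls
    (i1.add i2) hd hα0 (V := V) (β := β) (q := q) (C := C₁) (M := C₁) (η := 0)
    (C' := (8 * c + 2) * V + 12 / ε * C₁ + (4 * cU + 2)) hR hR1 hr hρ hrρ hc.le hcU.le hcS hC₁.le
    ENNReal.toReal_nonneg le_rfl hτ hK hJm hKt hJs hfin hu.toIsAdmissible
    hk hk hε0 hε1 (HU R x₀ hR hR1 hsub) (hEn _ hWL) ?_ (HS x₀ R hR hR1 hsub _ hWL) ?_ ?_ ?_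
    (by linarith) (le_add_of_nonneg_left (by positivity))
  · have e : form K (fun x => τ x ^ 2 * max (u x - k) 0) u =
        ∫ p, (symIntegrand K (fun x => τ x ^ 2 * max (u x - k) 0) u p +
          antiIntegrand K (fun x => τ x ^ 2 * max (u x - k) 0) u p) := by
      rw [integral_add i1 i2, form]
    rw [e]
    exact key
  · rw [← ENNReal.ofReal_ofNat 2, ← ENNReal.ofReal_mul (by norm_num),
      ← ENNReal.ofReal_mul (by positivity)]
    have h2 : ENNReal.ofReal (1 / 4) = 1 / 4 := by
      rw [ENNReal.ofReal_div_of_pos (by norm_num)]; simp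
    rw [← h2]
    refine ENNReal.ofReal_le_ofReal ?_
    have : ε ≤ 1 / (8 * C₁) := min_le_right _ _
    rw [le_div_iff₀ (by positivity)] at this
    linarith
  · rw [ENNReal.ofReal_zero, zero_mul, zero_add]
    calc _ ≤ ∫⁻ x, driftWeight k (τ x * max (u x - k) 0) * driftDensity K J univ x :=
          lintegral_mono fun x => mul_le_mul' le_rfl (driftDensity_mono K J (subset_univ _) x)
      _ ≤ levelMass q (Metric.ball x₀ (r + 2 * ρ)) u k * ENNReal.ofReal C₁ := by
          refine (lintegral_mul_le_conjExponent hθ1 ((measurable_driftWeight k).comp hW)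
            (measurable_driftDensity hK hJm _)).trans (mul_le_mul' ?_ hDθ)
          exact lintegral_driftWeight_rpow_le hq1 hτ.nonneg hτ.le_one
            (fun x hx => hτ.eq_zero x fun h => hx (hτ.subset h)) hum measurableSet_ball
      _ ≤ _ := by
          rw [mul_comm]
          exact mul_le_mul' (ENNReal.ofReal_le_ofReal (le_mul_of_one_le_right hC₁.le hRβ1)) le_rfl
  · simpa using hε0.le
  · have hw : Measurable fun x => max (u x - k) 0 := by fun_prop
    have h1 := lintegral_sq_le_sqNorm hq1 (Metric.ball x₀ (r + 2 * ρ)) hw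
    have h2 : volume (Metric.ball x₀ (r + 2 * ρ)) ^ (1 - 1 / q) ≤
        ENNReal.ofReal (V * R ^ (d * (1 - 1 / q))) := by
      refine (ENNReal.rpow_le_rpow (volume_ball_le hrρ hR) hexp).trans (le_of_eq ?_)
      rw [ENNReal.mul_rpow_of_nonneg _ _ hexp, ENNReal.ofReal_rpow_of_pos (by positivity),
        ENNReal.ofReal_mul ENNReal.toReal_nonneg, ENNReal.ofReal_toReal, mul_comm,
        ← Real.rpow_natCast, ← Real.rpow_mul hR.le]
      exact ENNReal.rpow_ne_top_of_nonneg hexp measure_ball_lt_top.ne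
    calc _ ≤ ENNReal.ofReal (R ^ (-α)) * (sqNorm q (Metric.ball x₀ (r + 2 * ρ))
          (fun x => max (u x - k) 0) * ENNReal.ofReal (V * R ^ (d * (1 - 1 / q)))) :=
          mul_le_mul' le_rfl (h1.trans (mul_le_mul' le_rfl h2))
      _ = ENNReal.ofReal (V * R ^ (-β)) * sqNorm q (Metric.ball x₀ (r + 2 * ρ))
          (fun x => max (u x - k) 0) := by
          have : R ^ (-β) = R ^ (-α) * R ^ (d * (1 - 1 / q)) := by
            rw [← Real.rpow_add hR, hβ]; congr 1; ring
          rw [this, mul_left_comm V,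
            ENNReal.ofReal_mul (p := R ^ (-α)) (Real.rpow_pos_of_pos hR _).le, mul_assoc,
            mul_comm (sqNorm q _ _)]
      _ ≤ _ := mul_le_mul' le_rfl le_self_add

end Existence

/-! ### Weak derivatives in one variable -/

section WeakDerivative

open Filter Topology

theorem exists_smooth_approx_indicator (p r : ℝ) : ∃ ζ : ℕ → ℝ → ℝ,
    (∀ n, ContDiff ℝ (⊤ : ℕ∞) (ζ n) ∧ (∀ t, 0 ≤ ζ n t ∧ ζ n t ≤ 1) ∧ ∀ t ∉ Ioo p r, ζ n t = 0) ∧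
    ∀ t, Tendsto (fun n => ζ n t) atTop (𝓝 ((Ioo p r).indicator 1 t)) := by
  obtain ⟨f, hf, hfs, hfr⟩ := (isOpen_Ioo (a := p) (b := r)).exists_contDiff_support_eq (n := ⊤)
  have hf0 : ∀ t, 0 ≤ f t := fun t => (hfr (mem_range_self t)).1
  have hz : ∀ t ∉ Ioo p r, f t = 0 := fun t ht => by
    rw [← hf] at ht; simpa using ht
  refine ⟨fun n t => Real.smoothTransition (n * f t), fun n => ⟨?_, fun t => ?_, fun t ht => ?_⟩,
    fun t => ?_⟩
  · exact Real.smoothTransition.contDiff.comp (contDiff_const.mul hfs)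
  · exact ⟨Real.smoothTransition.nonneg _, Real.smoothTransition.le_one _⟩
  · simp only [hz t ht, mul_zero, Real.smoothTransition.zero]
  · by_cases ht : t ∈ Ioo p r
    · have hpos : 0 < f t := lt_of_le_of_ne (hf0 t) (by rw [← hf] at ht; exact Ne.symm ht)
      rw [indicator_of_mem ht]
      refine tendsto_const_nhds.congr' ?_
      obtain ⟨m, hm⟩ := exists_nat_ge (1 / f t)
      filter_upwards [eventually_ge_atTop m] with n hn
      refine (Real.smoothTransition.one_of_one_le ?_).symm
      rw [div_le_iff₀ hpos] at hm
      refine hm.trans ?_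
      gcongr
    · rw [indicator_of_notMem ht]
      simp only [hz t ht, mul_zero, Real.smoothTransition.zero]
      exact tendsto_const_nhds

theorem contDiff_primitive {ξ : ℝ → ℝ} (hξ : ContDiff ℝ (⊤ : ℕ∞) ξ) (p : ℝ) :
    ContDiff ℝ (⊤ : ℕ∞) (fun t => ∫ r in p..t, ξ r) := by
  have hd : ∀ t, HasDerivAt (fun t => ∫ r in p..t, ξ r) (ξ t) t := fun t =>
    intervalIntegral.integral_hasDerivAt_right (hξ.continuous.intervalIntegrable _ _)
      (hξ.continuous.stronglyMeasurableAtFilter _ _) hξ.continuous.continuousAt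
  rw [contDiff_infty_iff_deriv]
  refine ⟨fun t => (hd t).differentiableAt, ?_⟩
  rw [show deriv (fun t => ∫ r in p..t, ξ r) = ξ from funext fun t => (hd t).deriv]
  exact hξ

theorem intervalIntegral_primitive_mul {p q : ℝ} {ξ g : ℝ → ℝ}
    (hξ : ContDiff ℝ (⊤ : ℕ∞) ξ) (hξ0 : ∫ r in p..q, ξ r = 0)
    (hg : IntervalIntegrable g volume p q) :
    ∫ t in p..q, (∫ r in p..t, ξ r) * g t = -∫ t in p..q, ξ t * ∫ r in p..t, g r := by
  have h1 : AbsolutelyContinuousOnInterval (fun t => ∫ r in p..t, ξ r) p q :=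
    (hξ.continuous.intervalIntegrable p q).absolutelyContinuousOnInterval_intervalIntegral
      left_mem_uIcc
  have h2 : AbsolutelyContinuousOnInterval (fun t => ∫ r in p..t, g r) p q :=
    hg.absolutelyContinuousOnInterval_intervalIntegral left_mem_uIcc
  have h3 := h1.integral_mul_deriv_eq_deriv_mul h2
  have hd : ∀ t, deriv (fun t => ∫ r in p..t, ξ r) t = ξ t := fun t =>
    (intervalIntegral.integral_hasDerivAt_right (hξ.continuous.intervalIntegrable _ _)
      (hξ.continuous.stronglyMeasurableAtFilter _ _) hξ.continuous.continuousAt).deriv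
  simp only [hd, hξ0, intervalIntegral.integral_same, zero_mul, sub_zero, zero_sub] at h3
  rw [← h3]
  refine intervalIntegral.integral_congr_ae ?_
  filter_upwards [hg.ae_hasDerivAt_integral] with t ht hmem
  have := ht (uIoc_subset_uIcc hmem) p left_mem_uIcc
  rw [this.deriv]

/-- The lemma of du Bois-Reymond, with a countable family of test functions. -/
theorem exists_test_family {p q : ℝ} (hpq : p < q) :
    ∃ η : ℚ × ℕ → ℝ → ℝ, (∀ i, ContDiff ℝ (⊤ : ℕ∞) (η i) ∧ ∀ t ∉ Icc p q, η i t = 0) ∧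
    ∃ χ : ℝ → ℝ, Continuous χ ∧ ∀ h g : ℝ → ℝ, IntervalIntegrable h volume p q →
      IntervalIntegrable g volume p q →
      (∀ i, ∫ t in p..q, deriv (η i) t * h t = -∫ t in p..q, η i t * g t) →
      ∀ᵐ t, t ∈ Ioo p q →
        h t = (∫ r in p..q, χ r * (h r - ∫ z in p..r, g z)) + ∫ r in p..t, g r := by
  obtain ⟨f, hf, hfs, hfr⟩ := (isOpen_Ioo (a := p) (b := q)).exists_contDiff_support_eq (n := ⊤)
  have hf0 : ∀ t, 0 ≤ f t := fun t => (hfr (mem_range_self t)).1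
  have hfz : ∀ t ∉ Ioo p q, f t = 0 := fun t ht => by rw [← hf] at ht; simpa using ht
  have hM : 0 < ∫ t in p..q, f t := by
    refine intervalIntegral.intervalIntegral_pos_of_pos_on (hfs.continuous.intervalIntegrable _ _)
      (fun t ht => lt_of_le_of_ne (hf0 t) ?_) hpq
    rw [← hf] at ht; exact Ne.symm ht
  set M := ∫ t in p..q, f t with hMdef
  choose ζ hζ hζlim using fun r : ℚ => exists_smooth_approx_indicator p (min (r : ℝ) q)
  have hζs : ∀ i : ℚ × ℕ, ∀ t ∉ Ioo p q, ζ i.1 i.2 t = 0 := fun i t ht =>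
    (hζ i.1 i.2).2.2 t fun h => ht ⟨h.1, h.2.trans_le (min_le_right _ _)⟩
  set ξ : ℚ × ℕ → ℝ → ℝ := fun i t => ζ i.1 i.2 t - (∫ r in p..q, ζ i.1 i.2 r) / M * f t with hξ
  have hζc : ∀ i : ℚ × ℕ, ContDiff ℝ (⊤ : ℕ∞) (ζ i.1 i.2) := fun i => (hζ i.1 i.2).1
  have hξs : ∀ i, ContDiff ℝ (⊤ : ℕ∞) (ξ i) := fun i =>
    (hζc i).sub (contDiff_const.mul hfs)
  have hξ0 : ∀ i, ∫ r in p..q, ξ i r = 0 := by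
    intro i
    have c1 : IntervalIntegrable (fun t => (∫ r in p..q, ζ i.1 i.2 r) / M * f t) volume p q :=
      (continuous_const.mul hfs.continuous).intervalIntegrable _ _
    rw [hξ]
    simp only
    rw [intervalIntegral.integral_sub ((hζc i).continuous.intervalIntegrable _ _) c1,
      intervalIntegral.integral_const_mul, ← hMdef, div_mul_cancel₀ _ hM.ne', sub_self]
  have hξz : ∀ i, ∀ t ∉ Ioo p q, ξ i t = 0 := by
    intro i t ht
    simp only [hξ, hζs i t ht, hfz t ht, mul_zero, sub_zero]
  have hd : ∀ i t, deriv (fun t => ∫ r in p..t, ξ i r) t = ξ i t := fun i t =>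
    (intervalIntegral.integral_hasDerivAt_right ((hξs i).continuous.intervalIntegrable _ _)
      ((hξs i).continuous.stronglyMeasurableAtFilter _ _) (hξs i).continuous.continuousAt).deriv
  refine ⟨fun i t => ∫ r in p..t, ξ i r, fun i => ⟨contDiff_primitive (hξs i) p, ?_⟩,
    fun t => f t / M, hfs.continuous.div_const M, ?_⟩
  · intro t ht
    change ∫ r in p..t, ξ i r = 0
    rcases lt_or_ge t p with h | h
    · refine (intervalIntegral.integral_congr fun r hr => ?_).trans
        (intervalIntegral.integral_zero (a := p) (b := t))
      rw [uIcc_of_ge h.le] at hr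
      exact hξz i r fun h' => not_le.2 h'.1 hr.2
    · have h' : q < t := by
        by_contra! hc; exact ht ⟨h, hc⟩
      rw [← intervalIntegral.integral_add_adjacent_intervals
        ((hξs i).continuous.intervalIntegrable p q) ((hξs i).continuous.intervalIntegrable q t),
        hξ0, zero_add]
      refine (intervalIntegral.integral_congr fun r hr => ?_).trans
        (intervalIntegral.integral_zero (a := q) (b := t))
      rw [uIcc_of_le h'.le] at hr
      exact hξz i r fun h'' => not_le.2 h''.2 hr.1
  · intro h g hh hg hweak
    set G : ℝ → ℝ := fun t => ∫ r in p..t, g r with hG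
    have hGc : ContinuousOn G (uIcc p q) :=
      (hg.absolutelyContinuousOnInterval_intervalIntegral left_mem_uIcc).continuousOn
    have hw : IntervalIntegrable (fun t => h t - G t) volume p q := hh.sub hGc.intervalIntegrable
    set C := ∫ r in p..q, f r / M * (h r - G r) with hC
    have hmul : ∀ φ : ℝ → ℝ, Continuous φ →
        IntervalIntegrable (fun t => φ t * (h t - G t)) volume p q := fun φ hφ =>
      hw.continuousOn_mul hφ.continuousOn
    have key : ∀ i : ℚ × ℕ, ∫ t in p..q, ζ i.1 i.2 t * (h t - G t - C) = 0 := by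
      intro i
      have h1 := hweak i
      simp only [hd] at h1
      rw [intervalIntegral_primitive_mul (hξs i) (hξ0 i) hg, neg_neg] at h1
      have h2 : ∫ t in p..q, ξ i t * (h t - G t) = 0 := by
        simp only [mul_sub]
        rw [intervalIntegral.integral_sub, h1, sub_self]
        · exact hh.continuousOn_mul (hξs i).continuous.continuousOn
        · exact hGc.intervalIntegrable.continuousOn_mul (hξs i).continuous.continuousOn
      have h3 : ∫ t in p..q, ξ i t * (h t - G t) = (∫ t in p..q, ζ i.1 i.2 t * (h t - G t)) -
          (∫ r in p..q, ζ i.1 i.2 r) * C := by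
        rw [hC, ← intervalIntegral.integral_const_mul, ← intervalIntegral.integral_sub
          (hmul _ (hζc i).continuous)
          ((hmul (fun r => f r / M) (hfs.continuous.div_const M)).const_mul _)]
        congr 1
        funext t
        simp only [hξ]; ring
      simp only [mul_sub _ _ C]
      have c1 : IntervalIntegrable (fun t => ζ i.1 i.2 t * C) volume p q :=
        ((hζc i).continuous.mul continuous_const).intervalIntegrable _ _
      rw [intervalIntegral.integral_sub (hmul _ (hζc i).continuous) c1,
        intervalIntegral.integral_mul_const]
      linarith
    set w : ℝ → ℝ := fun t => h t - G t - C with hwdef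
    have hwi : IntervalIntegrable w volume p q := hw.sub intervalIntegrable_const
    have hrat : ∀ r : ℚ, (r : ℝ) ∈ Ioo p q → ∫ t in p..r, w t = 0 := by
      intro r hr
      have hmin : min (r : ℝ) q = r := min_eq_left hr.2.le
      have hlim : Tendsto (fun n => ∫ t in p..q, ζ r n t * w t) atTop
          (𝓝 (∫ t in p..q, (Ioo p (r : ℝ)).indicator 1 t * w t)) := by
        refine intervalIntegral.tendsto_integral_filter_of_dominated_convergence (fun t => ‖w t‖)
          (Eventually.of_forall fun n => ?_) (Eventually.of_forall fun n => ?_) hwi.norm ?_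
        · exact ((hζc (r, n)).continuous.aestronglyMeasurable).mul
            hwi.def'.aestronglyMeasurable
        · refine Eventually.of_forall fun t _ => ?_
          rw [norm_mul]
          refine mul_le_of_le_one_left (norm_nonneg _) ?_
          rw [Real.norm_of_nonneg ((hζ r n).2.1 t).1]
          exact ((hζ r n).2.1 t).2
        · refine Eventually.of_forall fun t _ => ?_
          have := hζlim r t
          rw [hmin] at this
          exact this.mul_const _
      have h0 : (fun n => ∫ t in p..q, ζ r n t * w t) = fun _ => 0 := funext fun n => key (r, n)
      rw [h0] at hlim
      have h1 := tendsto_nhds_unique hlim tendsto_const_nhds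
      rw [intervalIntegral.integral_of_le hpq.le] at h1
      rw [intervalIntegral.integral_of_le hr.1.le, integral_Ioc_eq_integral_Ioo,
        ← integral_indicator measurableSet_Ioo]
      rw [← h1, ← integral_indicator measurableSet_Ioc]
      congr 1
      funext t
      by_cases ht : t ∈ Ioo p (r : ℝ)
      · rw [indicator_of_mem ht, indicator_of_mem (show t ∈ Ioc p q from
          ⟨ht.1, (ht.2.trans hr.2).le⟩), indicator_of_mem ht]; simp
      · rw [indicator_of_notMem ht]
        by_cases ht' : t ∈ Ioc p q
        · rw [indicator_of_mem ht', indicator_of_notMem ht, zero_mul]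
        · rw [indicator_of_notMem ht']
    have hcont : ContinuousOn (fun t => ∫ r in p..t, w r) (uIcc p q) :=
      (hwi.absolutelyContinuousOnInterval_intervalIntegral left_mem_uIcc).continuousOn
    rw [uIcc_of_le hpq.le] at hcont
    have hzero : ∀ t ∈ Ioo p q, ∫ r in p..t, w r = 0 := by
      intro t ht
      by_contra hne
      have hnhd : {t | ∫ r in p..t, w r ≠ 0} ∈ 𝓝 t :=
        (hcont.continuousAt (Icc_mem_nhds ht.1 ht.2)).eventually_ne hne
      obtain ⟨ε, hε, hball⟩ := Metric.mem_nhds_iff.1 (inter_mem hnhd (Ioo_mem_nhds ht.1 ht.2))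
      obtain ⟨r, hr1, hr2⟩ := exists_rat_btwn (show t < t + ε by linarith)
      have hrb : (r : ℝ) ∈ Metric.ball t ε := by
        rw [Metric.mem_ball, Real.dist_eq, abs_of_pos (by linarith)]; linarith
      exact (hball hrb).1 (hrat r (hball hrb).2)
    filter_upwards [hwi.ae_hasDerivAt_integral] with t ht htm
    have h1 := ht (by rw [uIcc_of_le hpq.le]; exact Ioo_subset_Icc_self htm) p left_mem_uIcc
    have h2 : HasDerivAt (fun x => ∫ r in p..x, w r) 0 t := by
      refine (hasDerivAt_const t (0 : ℝ)).congr_of_eventuallyEq ?_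
      filter_upwards [Ioo_mem_nhds htm.1 htm.2] with x hx using hzero x hx
    have h3 : w t = 0 := h1.unique h2
    simp only [hwdef] at h3
    change h t = C + G t
    linarith

theorem hasDerivAt_posPart_sq (y : ℝ) :
    HasDerivAt (fun y : ℝ => max y 0 * max y 0) (2 * max y 0) y := by
  rcases lt_trichotomy y 0 with h | h | h
  · rw [max_eq_right h.le, mul_zero]
    refine (hasDerivAt_const y (0 : ℝ)).congr_of_eventuallyEq ?_
    filter_upwards [Iio_mem_nhds h] with x hx
    rw [max_eq_right (le_of_lt hx), mul_zero]
  · subst h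
    rw [max_self, mul_zero, hasDerivAt_iff_isLittleO_nhds_zero]
    simp only [zero_add, max_self, mul_zero, sub_zero, smul_zero]
    refine Asymptotics.IsBigO.trans_isLittleO (g := fun x : ℝ => x * x) ?_ ?_
    · refine Asymptotics.IsBigO.of_bound 1 (Eventually.of_forall fun x => ?_)
      rw [one_mul, Real.norm_of_nonneg (mul_self_nonneg _), Real.norm_of_nonneg (mul_self_nonneg _),
        ← abs_mul_abs_self x]
      have h1 : max x 0 ≤ |x| := max_le (le_abs_self x) (abs_nonneg x)
      have h2 : 0 ≤ max x 0 := le_max_right _ _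
      exact mul_le_mul h1 h1 h2 (abs_nonneg x)
    · have := (Asymptotics.isLittleO_id_const one_ne_zero :
        (fun x : ℝ => x) =o[𝓝 0] fun _ => (1 : ℝ)).mul_isBigO
        (Asymptotics.isBigO_refl (fun x : ℝ => x) (𝓝 0))
      simpa using this
  · rw [max_eq_left h.le]
    have h1 : HasDerivAt (fun y : ℝ => y * y) (2 * y) y := by
      have := (hasDerivAt_id' y).fun_mul (hasDerivAt_id' y)
      simpa [two_mul] using this
    refine h1.congr_of_eventuallyEq ?_
    filter_upwards [Ioi_mem_nhds h] with x hx
    rw [max_eq_left (le_of_lt hx)]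

theorem AbsolutelyContinuousOnInterval.posPart {v : ℝ → ℝ} {p q : ℝ}
    (hv : AbsolutelyContinuousOnInterval v p q) :
    AbsolutelyContinuousOnInterval (fun t => max (v t) 0) p q := by
  rw [absolutelyContinuousOnInterval_iff] at hv ⊢
  intro ε hε
  obtain ⟨δ, hδ, H⟩ := hv ε hε
  refine ⟨δ, hδ, fun E hE hE' => lt_of_le_of_lt ?_ (H E hE hE')⟩
  refine Finset.sum_le_sum fun i _ => ?_
  rw [Real.dist_eq, Real.dist_eq]
  simpa using abs_max_sub_max_le_abs (v (E.2 i).1) (v (E.2 i).2) 0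

theorem posPart_sq_primitive_sub {p q C k : ℝ} {g : ℝ → ℝ} (hpq : p ≤ q)
    (hg : IntervalIntegrable g volume p q) {s t : ℝ} (hs : s ∈ Icc p q) (ht : t ∈ Icc p q) :
    max (C + (∫ r in p..t, g r) - k) 0 ^ 2 - max (C + (∫ r in p..s, g r) - k) 0 ^ 2 =
      ∫ r in s..t, 2 * (max (C + (∫ z in p..r, g z) - k) 0 * g r) := by
  have hsub : uIcc s t ⊆ uIcc p q := by
    rw [uIcc_of_le hpq]; exact uIcc_subset_Icc hs ht
  have h0 : AbsolutelyContinuousOnInterval (fun t => ∫ r in p..t, g r) p q :=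
    hg.absolutelyContinuousOnInterval_intervalIntegral left_mem_uIcc
  have hc : AbsolutelyContinuousOnInterval (fun _ : ℝ => C - k) p q :=
    (LipschitzWith.const' (C - k)).lipschitzOnWith.absolutelyContinuousOnInterval (K := 0)
  have h1 := AbsolutelyContinuousOnInterval.posPart (h0.fun_add hc)
  have h2 := ((h1.fun_mul h1).mono hsub).integral_deriv_eq_sub
  have e : ∀ t, (∫ r in p..t, g r) + (C - k) = C + (∫ r in p..t, g r) - k := fun t => by ring
  simp only [e] at h2
  rw [sq, sq, ← h2]
  refine intervalIntegral.integral_congr_ae ?_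
  filter_upwards [hg.ae_hasDerivAt_integral] with r hr hmem
  have h3 := hr (hsub (uIoc_subset_uIcc hmem)) p left_mem_uIcc
  have h4 : HasDerivAt (fun t => C + (∫ r in p..t, g r) - k) (g r) r := by
    simpa using (h3.const_add C).sub_const k
  have h5 := (hasDerivAt_posPart_sq (C + (∫ z in p..r, g z) - k)).comp r h4
  rw [show (fun t => max (C + (∫ r in p..t, g r) - k) 0 * max (C + (∫ r in p..t, g r) - k) 0) =
    (fun y : ℝ => max y 0 * max y 0) ∘ fun t => C + (∫ r in p..t, g r) - k from rfl, h5.deriv]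
  ring

end WeakDerivative

/-! ### The chain rule in time -/

section ChainRule

open Filter Topology

variable {d : ℕ} {a b : ℝ} {D : Set (Eu d)} {u g : ℝ → Eu d → ℝ}

/-- `g` is the weak time derivative of `u` on `(a, b)`, with values in `L²(D)`. -/
structure HasWeakTimeDeriv (a b : ℝ) (D : Set (Eu d)) (u g : ℝ → Eu d → ℝ) : Prop where
  measurable_u : Measurable (Function.uncurry u)
  measurable_g : Measurable (Function.uncurry g)
  volume_ne_top : volume D ≠ ∞
  lintegral_u : ∀ p q, a < p → q < b →
    ∫⁻ t in Icc p q, ∫⁻ x in D, ENNReal.ofReal (u t x ^ 2) < ∞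
  lintegral_g : ∀ p q, a < p → q < b →
    ∫⁻ t in Icc p q, (∫⁻ x in D, ‖g t x‖ₑ ^ 2) ^ (1 / 2 : ℝ) < ∞
  weak : ∀ η : ℝ → ℝ, ContDiff ℝ (⊤ : ℕ∞) η → HasCompactSupport η → tsupport η ⊆ Ioo a b →
    ∀ᵐ x ∂(volume.restrict D), ∫ t in Ioo a b, deriv η t * u t x = - ∫ t in Ioo a b, η t * g t x

theorem lintegral_sq_lintegral_le {T X : Type*} [MeasurableSpace T] [MeasurableSpace X]
    {μ : Measure T} {ν : Measure X} [SFinite μ] [SFinite ν] {f : T → X → ℝ≥0∞}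
    (hf : Measurable (Function.uncurry f)) :
    ∫⁻ x, (∫⁻ t, f t x ∂μ) ^ 2 ∂ν ≤ (∫⁻ t, (∫⁻ x, f t x ^ 2 ∂ν) ^ (1 / 2 : ℝ) ∂μ) ^ 2 := by
  have hS : Measurable fun x => ∫⁻ t, f t x ∂μ := hf.lintegral_prod_left'
  have hft : ∀ t, Measurable (f t) := fun t => hf.of_uncurry_left
  have hfx : ∀ x, Measurable fun t => f t x := fun x => hf.of_uncurry_right
  have hN : Measurable fun t => (∫⁻ x, f t x ^ 2 ∂ν) ^ (1 / 2 : ℝ) :=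
    ((hf.pow_const 2).lintegral_prod_right').pow_const _
  calc ∫⁻ x, (∫⁻ t, f t x ∂μ) ^ 2 ∂ν = ∫⁻ x, ∫⁻ t, f t x * ∫⁻ t', f t' x ∂μ ∂μ ∂ν := by
        refine lintegral_congr fun x => ?_
        rw [lintegral_mul_const _ (hfx x), sq]
    _ = ∫⁻ t, ∫⁻ x, f t x * ∫⁻ t', f t' x ∂μ ∂ν ∂μ := by
        refine (lintegral_lintegral_swap ?_).symm
        exact (hf.mul (hS.comp measurable_snd)).aemeasurable
    _ = ∫⁻ t, ∫⁻ t', ∫⁻ x, f t x * f t' x ∂ν ∂μ ∂μ := by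
        refine lintegral_congr fun t => ?_
        calc _ = ∫⁻ x, ∫⁻ t', f t x * f t' x ∂μ ∂ν :=
              lintegral_congr fun x => (lintegral_const_mul _ (hfx x)).symm
          _ = _ := by
              refine (lintegral_lintegral_swap ?_).symm
              exact (((hft t).comp measurable_snd).mul hf).aemeasurable
    _ ≤ ∫⁻ t, ∫⁻ t', (∫⁻ x, f t x ^ 2 ∂ν) ^ (1 / 2 : ℝ) * (∫⁻ x, f t' x ^ 2 ∂ν) ^ (1 / 2 : ℝ)
          ∂μ ∂μ := by
        refine lintegral_mono fun t => lintegral_mono fun t' => ?_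
        have := ENNReal.lintegral_mul_le_Lp_mul_Lq ν Real.HolderConjugate.two_two
          (hft t).aemeasurable (hft t').aemeasurable
        simpa using this
    _ = _ := by
        simp_rw [lintegral_const_mul _ hN]
        rw [lintegral_mul_const _ hN, sq]

theorem ennreal_add_sq_le (A B : ℝ≥0∞) : (A + B) ^ 2 ≤ 2 * (A ^ 2 + B ^ 2) := by
  have := ENNReal.rpow_add_le_mul_rpow_add_rpow A B (p := 2) (by norm_num)
  norm_num at this
  exact this

theorem ennreal_mul_le_add_sq (A B : ℝ≥0∞) : A * B ≤ A ^ 2 + B ^ 2 := by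
  rcases le_total A B with h | h
  · exact (mul_le_mul' h le_rfl).trans (by rw [← sq]; exact le_add_self)
  · exact (mul_le_mul' le_rfl h).trans (by rw [← sq]; exact le_self_add)

theorem measurable_primitive (hg : Measurable (Function.uncurry g)) (p : ℝ) :
    Measurable (Function.uncurry fun (t : ℝ) (x : Eu d) => ∫ r in Ioc p t, g r x) := by
  have hs : MeasurableSet {z : (ℝ × Eu d) × ℝ | p < z.2 ∧ z.2 ≤ z.1.1} :=
    (measurableSet_lt measurable_const measurable_snd).inter
      (measurableSet_le measurable_snd (by fun_prop))
  have hm : Measurable ({z : (ℝ × Eu d) × ℝ | p < z.2 ∧ z.2 ≤ z.1.1}.indicator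
      fun z => g z.2 z.1.2) :=
    (hg.comp (measurable_snd.prodMk (measurable_snd.comp measurable_fst))).indicator hs
  have h := (hm.stronglyMeasurable.integral_prod_right' (ν := (volume : Measure ℝ))).measurable
  convert h using 1
  funext ⟨t, x⟩
  simp only [Function.uncurry]
  rw [← integral_indicator measurableSet_Ioc]
  congr 1

theorem HasWeakTimeDeriv.lintegral_sq_lt_top (h : HasWeakTimeDeriv a b D u g) {p q : ℝ}
    (hp : a < p) (hq : q < b) : ∫⁻ x in D, (∫⁻ t in Icc p q, ‖g t x‖ₑ) ^ 2 < ∞ := by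
  refine (lintegral_sq_lintegral_le (f := fun t x => ‖g t x‖ₑ) h.measurable_g.enorm).trans_lt ?_
  exact ENNReal.pow_lt_top (h.lintegral_g p q hp hq)

theorem HasWeakTimeDeriv.ae_intervalIntegrable_g (h : HasWeakTimeDeriv a b D u g) {p q : ℝ}
    (hp : a < p) (hpq : p < q) (hq : q < b) :
    ∀ᵐ x ∂volume.restrict D, IntervalIntegrable (fun t => g t x) volume p q := by
  have hm : Measurable fun x => ∫⁻ t in Icc p q, ‖g t x‖ₑ := h.measurable_g.enorm.lintegral_prod_left'
  filter_upwards [ae_lt_top (hm.pow_const 2) (h.lintegral_sq_lt_top hp hq).ne] with x hx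
  rw [intervalIntegrable_iff_integrableOn_Icc_of_le hpq.le]
  exact ⟨h.measurable_g.of_uncurry_right.aestronglyMeasurable,
    (ENNReal.pow_lt_top_iff.1 hx).resolve_right (by norm_num)⟩

theorem HasWeakTimeDeriv.ae_intervalIntegrable_u (h : HasWeakTimeDeriv a b D u g) {p q : ℝ}
    (hp : a < p) (hpq : p < q) (hq : q < b) :
    ∀ᵐ x ∂volume.restrict D, IntervalIntegrable (fun t => u t x) volume p q := by
  have hm : Measurable (Function.uncurry fun t x => ENNReal.ofReal (u t x ^ 2)) :=
    (h.measurable_u.pow_const 2).ennreal_ofReal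
  have hfin := h.lintegral_u p q hp hq
  rw [lintegral_lintegral_swap hm.aemeasurable] at hfin
  have hm' : Measurable fun x => ∫⁻ t in Icc p q, ENNReal.ofReal (u t x ^ 2) :=
    hm.lintegral_prod_left'
  filter_upwards [ae_lt_top hm' hfin.ne] with x hx
  rw [intervalIntegrable_iff_integrableOn_Icc_of_le hpq.le]
  have hux : Measurable fun t => u t x := h.measurable_u.of_uncurry_right
  have hL : MemLp (fun t => u t x) 2 (volume.restrict (Icc p q)) := by
    refine ⟨hux.aestronglyMeasurable, ?_⟩
    rw [eLpNorm_lt_top_iff_lintegral_rpow_enorm_lt_top (by norm_num) (by norm_num)]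
    refine lt_of_eq_of_lt (lintegral_congr fun t => ?_) hx
    rw [ENNReal.toReal_ofNat, ENNReal.rpow_ofNat, ← enorm_pow,
      Real.enorm_of_nonneg (sq_nonneg _)]
  exact hL.integrable (by norm_num)

/-- The continuous representative of `u`. -/
theorem HasWeakTimeDeriv.exists_primitive (h : HasWeakTimeDeriv a b D u g) {p q : ℝ}
    (hp : a < p) (hpq : p < q) (hq : q < b) : ∃ C : Eu d → ℝ, Measurable C ∧
      ∀ᵐ t ∂volume.restrict (Ioo p q), ∀ᵐ x ∂volume.restrict D,
        u t x = C x + ∫ r in Ioc p t, g r x := by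
  obtain ⟨η, hη, χ, hχ, H⟩ := exists_test_family hpq
  set G : ℝ → Eu d → ℝ := fun t x => ∫ r in Ioc p t, g r x with hG
  have hGm : Measurable (Function.uncurry G) := measurable_primitive h.measurable_g p
  have hCm : Measurable fun x => ∫ r in Ioc p q, χ r * (u r x - G r x) := by
    have h1 : Measurable fun z : Eu d × ℝ => χ z.2 * (u z.2 z.1 - G z.2 z.1) :=
      (hχ.measurable.comp measurable_snd).mul
        ((h.measurable_u.comp measurable_swap).sub (hGm.comp measurable_swap))
    exact (h1.stronglyMeasurable.integral_prod_right
      (ν := volume.restrict (Ioc p q))).measurable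
  refine ⟨_, hCm, ?_⟩
  have hsub : Icc p q ⊆ Ioo a b := fun t ht => ⟨hp.trans_le ht.1, ht.2.trans_lt hq⟩
  have hweak : ∀ᵐ x ∂volume.restrict D, ∀ i,
      ∫ t in p..q, deriv (η i) t * u t x = -∫ t in p..q, η i t * g t x := by
    rw [ae_all_iff]
    intro i
    have hsupp : Function.support (η i) ⊆ Icc p q := fun t ht => by
      by_contra hc; exact ht ((hη i).2 t hc)
    have hts : tsupport (η i) ⊆ Icc p q := closure_minimal hsupp isClosed_Icc
    have hcs : HasCompactSupport (η i) := HasCompactSupport.of_support_subset_isCompact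
      isCompact_Icc hsupp
    filter_upwards [h.weak (η i) (hη i).1 hcs (hts.trans hsub)] with x hx
    have hd0 : ∀ t ∉ Icc p q, deriv (η i) t = 0 := fun t ht => by
      by_contra hc
      exact ht (hts (support_deriv_subset hc))
    rw [intervalIntegral.integral_of_le hpq.le, intervalIntegral.integral_of_le hpq.le,
      ← integral_Icc_eq_integral_Ioc, ← integral_Icc_eq_integral_Ioc,
      ← setIntegral_eq_of_subset_of_forall_sdiff_eq_zero measurableSet_Ioo hsub
        (fun t ht => by rw [hd0 t ht.2, zero_mul]),
      ← setIntegral_eq_of_subset_of_forall_sdiff_eq_zero measurableSet_Ioo hsub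
        (fun t ht => by rw [(hη i).2 t ht.2, zero_mul])]
    exact hx
  have hms : MeasurableSet {z : Eu d × ℝ |
      u z.2 z.1 = (∫ r in Ioc p q, χ r * (u r z.1 - G r z.1)) + G z.2 z.1} :=
    measurableSet_eq_fun (h.measurable_u.comp measurable_swap)
      ((hCm.comp measurable_fst).add (hGm.comp measurable_swap))
  have key : ∀ᵐ x ∂volume.restrict D, ∀ᵐ t ∂volume.restrict (Ioo p q),
      u t x = (∫ r in Ioc p q, χ r * (u r x - G r x)) + G t x := by
    filter_upwards [hweak, h.ae_intervalIntegrable_g hp hpq hq,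
      h.ae_intervalIntegrable_u hp hpq hq] with x h1 h2 h3
    rw [ae_restrict_iff' measurableSet_Ioo]
    filter_upwards [H (fun t => u t x) (fun t => g t x) h3 h2 h1] with t ht htm
    rw [ht htm, intervalIntegral.integral_of_le htm.1.le, intervalIntegral.integral_of_le hpq.le]
    congr 1
    refine setIntegral_congr_fun measurableSet_Ioc fun r hr => ?_
    simp only [intervalIntegral.integral_of_le hr.1.le, hG]
  exact (Measure.ae_ae_comm hms).1 key

theorem HasWeakTimeDeriv.energy_identity (h : HasWeakTimeDeriv a b D u g) {p q : ℝ}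
    (hp : a < p) (hpq : p < q) (hq : q < b) {ψ : Eu d → ℝ} (hψ : Measurable ψ)
    (hψ0 : ∀ x, 0 ≤ ψ x) (hψ1 : ∀ x, ψ x ≤ 1) (k : ℝ) :
    ∀ᵐ s ∂volume.restrict (Ioo p q), ∀ᵐ t ∂volume.restrict (Ioo p q), s ≤ t →
      IntervalIntegrable (fun r => ∫ x in D, g r x * (ψ x * max (u r x - k) 0)) volume s t ∧
      Integrable (fun x => ψ x * max (u s x - k) 0 ^ 2) (volume.restrict D) ∧
      Integrable (fun x => ψ x * max (u t x - k) 0 ^ 2) (volume.restrict D) ∧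
      (∫ x in D, ψ x * max (u t x - k) 0 ^ 2) - ∫ x in D, ψ x * max (u s x - k) 0 ^ 2 =
        2 * ∫ r in s..t, ∫ x in D, g r x * (ψ x * max (u r x - k) 0) := by
  obtain ⟨C, hC, hCu⟩ := h.exists_primitive hp hpq hq
  set U : ℝ → Eu d → ℝ := fun t x => C x + ∫ r in Ioc p t, g r x with hU
  have hUm : Measurable (Function.uncurry U) :=
    (hC.comp measurable_snd).add (measurable_primitive h.measurable_g p)
  have hgm := h.measurable_g
  set S : Eu d → ℝ≥0∞ := fun x => ∫⁻ t in Icc p q, ‖g t x‖ₑ with hS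
  have hSm : Measurable S := hgm.enorm.lintegral_prod_left'
  have hS2 : ∫⁻ x in D, S x ^ 2 < ∞ := h.lintegral_sq_lt_top hp hq
  have hu2 : ∀ᵐ t ∂volume.restrict (Ioo p q), ∫⁻ x in D, ENNReal.ofReal (u t x ^ 2) < ∞ := by
    have hm : Measurable fun t => ∫⁻ x in D, ENNReal.ofReal (u t x ^ 2) :=
      (h.measurable_u.pow_const 2).ennreal_ofReal.lintegral_prod_right'
    exact ae_restrict_of_ae_restrict_of_subset Ioo_subset_Icc_self
      (ae_lt_top hm (h.lintegral_u p q hp hq).ne)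
  have hne : (ae (volume.restrict (Ioo p q))).NeBot := by
    rw [ae_neBot, Ne, Measure.restrict_eq_zero]; simp [hpq]
  obtain ⟨s₀, hs₀u, hs₀2, hs₀⟩ :=
    (hCu.and (hu2.and (ae_restrict_mem measurableSet_Ioo))).exists
  set m : Eu d → ℝ≥0∞ := fun x => ‖u s₀ x‖ₑ + S x + ‖k‖ₑ with hm
  have hus₀ : Measurable (u s₀) := h.measurable_u.of_uncurry_left
  have hmm : Measurable m := (hus₀.enorm.add hSm).add_const _
  have hm2 : ∫⁻ x in D, m x ^ 2 < ∞ := by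
    calc _ ≤ ∫⁻ x in D, 2 * (2 * (ENNReal.ofReal (u s₀ x ^ 2) + S x ^ 2) + ‖k‖ₑ ^ 2) := by
          refine lintegral_mono fun x => (ennreal_add_sq_le _ _).trans ?_
          refine mul_le_mul' le_rfl (add_le_add ((ennreal_add_sq_le _ _).trans ?_) le_rfl)
          rw [← enorm_pow, Real.enorm_of_nonneg (sq_nonneg _)]
      _ = 2 * (2 * ((∫⁻ x in D, ENNReal.ofReal (u s₀ x ^ 2)) + ∫⁻ x in D, S x ^ 2) +
          ‖k‖ₑ ^ 2 * volume D) := by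
          have m1 : Measurable fun x => ENNReal.ofReal (u s₀ x ^ 2) :=
            (hus₀.pow_const 2).ennreal_ofReal
          have m2 : Measurable fun x => ENNReal.ofReal (u s₀ x ^ 2) + S x ^ 2 :=
            m1.add (hSm.pow_const 2)
          rw [lintegral_const_mul _ ((m2.const_mul 2).add_const _),
            lintegral_add_right _ measurable_const, lintegral_const_mul _ m2,
            lintegral_add_right _ (hSm.pow_const 2), setLIntegral_const]
      _ < ∞ := by
          have := h.volume_ne_top
          have := hs₀2.ne
          have := hS2.ne
          have : ‖k‖ₑ ≠ ∞ := enorm_ne_top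
          rw [lt_top_iff_ne_top]
          finiteness
  have hUle : ∀ᵐ x ∂volume.restrict D, ∀ r ∈ Icc p q, ‖max (U r x - k) 0‖ₑ ≤ m x := by
    filter_upwards [hs₀u, h.ae_intervalIntegrable_g hp hpq hq] with x hx hgx r hr
    have h1 : U r x - u s₀ x = ∫ z in s₀..r, g z x := by
      rw [hx]
      simp only [hU]
      rw [← intervalIntegral.integral_of_le hr.1, ← intervalIntegral.integral_of_le hs₀.1.le,
        ← intervalIntegral.integral_interval_sub_left (a := p) (b := r) (c := s₀)]
      · ring
      · exact hgx.mono_set (uIcc_subset_uIcc left_mem_uIcc (by rwa [uIcc_of_le hpq.le]))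
      · refine hgx.mono_set (uIcc_subset_uIcc left_mem_uIcc ?_)
        rw [uIcc_of_le hpq.le]; exact Ioo_subset_Icc_self hs₀
    have h2 : ‖U r x - u s₀ x‖ₑ ≤ S x := by
      rw [h1, ← ofReal_norm, intervalIntegral.norm_integral_eq_norm_integral_uIoc, ofReal_norm]
      refine (enorm_integral_le_lintegral_enorm _).trans (lintegral_mono_set ?_)
      exact uIoc_subset_uIcc.trans (uIcc_subset_Icc (Ioo_subset_Icc_self hs₀) hr)
    have h3 : ‖max (U r x - k) 0‖ₑ ≤ ‖U r x - k‖ₑ := by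
      rw [← ofReal_norm, ← ofReal_norm]
      refine ENNReal.ofReal_le_ofReal ?_
      rw [Real.norm_of_nonneg (le_max_right _ _)]
      exact max_le (le_abs_self _) (abs_nonneg _)
    refine h3.trans ?_
    rw [show U r x - k = u s₀ x + (U r x - u s₀ x) - k by ring]
    refine (enorm_sub_le).trans (add_le_add ((enorm_add_le _ _).trans ?_) le_rfl)
    exact add_le_add le_rfl h2
  set F : ℝ → Eu d → ℝ := fun r x => g r x * (ψ x * max (U r x - k) 0) with hF
  have hFm : Measurable (Function.uncurry F) :=
    hgm.mul ((hψ.comp measurable_snd).mul ((hUm.sub_const k).max measurable_const))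
  have hFint : Integrable (Function.uncurry F)
      ((volume.restrict (Icc p q)).prod (volume.restrict D)) := by
    refine ⟨hFm.aestronglyMeasurable, ?_⟩
    rw [HasFiniteIntegral, lintegral_prod_symm _ hFm.enorm.aemeasurable]
    refine lt_of_le_of_lt (b := ∫⁻ x in D, (m x ^ 2 + S x ^ 2)) ?_ ?_
    · refine lintegral_mono_ae ?_
      filter_upwards [hUle] with x hx
      refine le_trans ?_ (ennreal_mul_le_add_sq _ _)
      rw [hS, ← lintegral_const_mul _ (hgm.of_uncurry_right (y := x)).enorm]
      refine setLIntegral_mono' measurableSet_Icc fun r hr => ?_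
      simp only [Function.uncurry, hF, enorm_mul]
      rw [mul_comm]
      refine mul_le_mul' ?_ le_rfl
      have : ‖ψ x‖ₑ ≤ 1 := by
        rw [Real.enorm_of_nonneg (hψ0 x), ENNReal.ofReal_le_one]; exact hψ1 x
      exact (mul_le_mul' this (hx r hr)).trans (one_mul _).le
    · rw [lintegral_add_left (hmm.pow_const 2)]
      exact ENNReal.add_lt_top.2 ⟨hm2, hS2⟩
  have hint : ∀ s ∈ Ioo p q, (∀ᵐ x ∂volume.restrict D, u s x = U s x) →
      Integrable (fun x => ψ x * max (u s x - k) 0 ^ 2) (volume.restrict D) := by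
    intro s hs hus
    have hum : Measurable (u s) := h.measurable_u.of_uncurry_left
    refine ⟨Measurable.aestronglyMeasurable (by fun_prop), lt_of_le_of_lt ?_ hm2⟩
    refine lintegral_mono_ae ?_
    filter_upwards [hus, hUle] with x hx hx'
    rw [hx, enorm_mul, enorm_pow]
    have : ‖ψ x‖ₑ ≤ 1 := by
      rw [Real.enorm_of_nonneg (hψ0 x), ENNReal.ofReal_le_one]; exact hψ1 x
    refine (mul_le_mul' this (pow_le_pow_left' (hx' s (Ioo_subset_Icc_self hs)) 2)).trans ?_
    rw [one_mul]
  have hX : ∀ᵐ r ∂volume.restrict (Ioo p q),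
      ∫ x in D, g r x * (ψ x * max (u r x - k) 0) = ∫ x in D, F r x := by
    filter_upwards [hCu] with r hr
    refine integral_congr_ae ?_
    filter_upwards [hr] with x hx
    rw [hx]
  have hgood : ∀ᵐ t ∂volume.restrict (Ioo p q), t ∈ Ioo p q ∧
      ∀ᵐ x ∂volume.restrict D, u t x = U t x :=
    (ae_restrict_mem measurableSet_Ioo).and hCu
  filter_upwards [hgood] with s ⟨hs, hus⟩
  filter_upwards [hgood] with t ⟨ht, hut⟩ hst
  have hsub : Ioc s t ⊆ Ioo p q := fun r hr => ⟨hs.1.trans hr.1, hr.2.trans_lt ht.2⟩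
  have hXst : ∀ᵐ r ∂volume.restrict (Ioc s t),
      ∫ x in D, g r x * (ψ x * max (u r x - k) 0) = ∫ x in D, F r x :=
    ae_restrict_of_ae_restrict_of_subset hsub hX
  have hFst : Integrable (Function.uncurry F)
      ((volume.restrict (Ioc s t)).prod (volume.restrict D)) :=
    hFint.mono_measure (Measure.prod_mono
      (Measure.restrict_mono (hsub.trans Ioo_subset_Icc_self) le_rfl) le_rfl)
  refine ⟨?_, hint s hs hus, hint t ht hut, ?_⟩
  · rw [intervalIntegrable_iff_integrableOn_Ioc_of_le hst]
    exact hFst.integral_prod_left.congr (hXst.mono fun r hr => hr.symm)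
  · rw [← integral_sub (hint t ht hut) (hint s hs hus), intervalIntegral.integral_of_le hst,
      integral_congr_ae hXst, integral_integral_swap hFst, ← integral_const_mul]
    refine integral_congr_ae ?_
    filter_upwards [hus, hut, h.ae_intervalIntegrable_g hp hpq hq] with x hxs hxt hgx
    have h1 := posPart_sq_primitive_sub (C := C x) (k := k) hpq.le hgx (Ioo_subset_Icc_self hs)
      (Ioo_subset_Icc_self ht)
    rw [intervalIntegral.integral_of_le hs.1.le, intervalIntegral.integral_of_le ht.1.le,
      intervalIntegral.integral_of_le hst] at h1
    rw [hxs, hxt, ← mul_sub]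
    simp only [hU]
    rw [h1, ← integral_const_mul, ← integral_const_mul]
    refine setIntegral_congr_fun measurableSet_Ioc fun r hr => ?_
    simp only [hF, hU]
    rw [intervalIntegral.integral_of_le (hsub hr).1.le]
    ring

end ChainRule

/-! ### The energy inequality -/

section EnergyInequality

open Filter Topology

variable {d : ℕ} {K : Eu d → Eu d → ℝ≥0∞} {a b : ℝ} {D : Set (Eu d)} {u g f : ℝ → Eu d → ℝ}
  {adm : (Eu d → ℝ) → Prop} {Def : (Eu d → ℝ) → (Eu d → ℝ) → Prop}
  {F : (Eu d → ℝ) → (Eu d → ℝ) → ℝ} {T : (Eu d → ℝ) → ℝ≥0∞}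

theorem HasWeakTimeDeriv.ae_energy_identity (h : HasWeakTimeDeriv a b D u g) {ψ : Eu d → ℝ}
    (hψ : Measurable ψ) (hψ0 : ∀ x, 0 ≤ ψ x) (hψ1 : ∀ x, ψ x ≤ 1) (k : ℝ) :
    ∀ᵐ s ∂volume.restrict (Ioo a b), ∀ᵐ t ∂volume.restrict (Ioo a b), s ≤ t →
      IntervalIntegrable (fun r => ∫ x in D, g r x * (ψ x * max (u r x - k) 0)) volume s t ∧
      Integrable (fun x => ψ x * max (u s x - k) 0 ^ 2) (volume.restrict D) ∧
      Integrable (fun x => ψ x * max (u t x - k) 0 ^ 2) (volume.restrict D) ∧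
      (∫ x in D, ψ x * max (u t x - k) 0 ^ 2) - ∫ x in D, ψ x * max (u s x - k) 0 ^ 2 =
        2 * ∫ r in s..t, ∫ x in D, g r x * (ψ x * max (u r x - k) 0) := by
  rcases le_or_gt b a with hba | hab
  · simp [Ioo_eq_empty_of_le hba]
  have hc : ∀ n : ℕ, 0 < (b - a) / (n + 3) := fun n => div_pos (by linarith) (by positivity)
  have hc3 : ∀ n : ℕ, (b - a) / (n + 3) ≤ (b - a) / 3 := fun n => by
    refine div_le_div_of_nonneg_left (by linarith) (by norm_num) ?_
    have : (0 : ℝ) ≤ n := n.cast_nonneg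
    linarith
  have H : ∀ n : ℕ, _ := fun n => h.energy_identity (p := a + (b - a) / (n + 3))
    (q := b - (b - a) / (n + 3)) (by linarith [hc n]) (by linarith [hc3 n]) (by linarith [hc n])
    hψ hψ0 hψ1 k
  have hlim : Tendsto (fun n : ℕ => (b - a) / ((n : ℝ) + 3)) atTop (𝓝 0) :=
    tendsto_const_nhds.div_atTop (tendsto_natCast_atTop_atTop.atTop_add tendsto_const_nhds)
  have H1 : ∀ᵐ s, ∀ n : ℕ, s ∈ Ioo (a + (b - a) / (n + 3)) (b - (b - a) / (n + 3)) → _ :=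
    ae_all_iff.2 fun n => (ae_restrict_iff' measurableSet_Ioo).1 (H n)
  filter_upwards [ae_restrict_of_ae H1, ae_restrict_mem measurableSet_Ioo] with s hs hsI
  have H2 : ∀ᵐ t, ∀ n : ℕ, s ∈ Ioo (a + (b - a) / (n + 3)) (b - (b - a) / (n + 3)) →
      t ∈ Ioo (a + (b - a) / (n + 3)) (b - (b - a) / (n + 3)) → _ :=
    ae_all_iff.2 fun n => by
      by_cases hn : s ∈ Ioo (a + (b - a) / (n + 3)) (b - (b - a) / (n + 3))
      · filter_upwards [(ae_restrict_iff' measurableSet_Ioo).1 (hs n hn)] with t ht _ using ht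
      · exact Eventually.of_forall fun t h => absurd h hn
  filter_upwards [ae_restrict_of_ae H2, ae_restrict_mem measurableSet_Ioo] with t ht htI hst
  obtain ⟨n, hn⟩ := (hlim.eventually (gt_mem_nhds
    (show 0 < min (s - a) (b - t) from lt_min (by linarith [hsI.1]) (by linarith [htI.2])))).exists
  have h1 := hn.trans_le (min_le_left _ _)
  have h2 := hn.trans_le (min_le_right _ _)
  exact ht n ⟨by linarith, by linarith⟩ ⟨by linarith, by linarith⟩ hst

/-- A nonnegative function with a weak time derivative which satisfies the subsolution inequality
for the form `F`. -/
structure IsFormSubsolution (K : Eu d → Eu d → ℝ≥0∞) (a b : ℝ) (D : Set (Eu d))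
    (adm : (Eu d → ℝ) → Prop) (Def : (Eu d → ℝ) → (Eu d → ℝ) → Prop)
    (F : (Eu d → ℝ) → (Eu d → ℝ) → ℝ) (f u g : ℝ → Eu d → ℝ) : Prop
    extends HasWeakTimeDeriv a b D u g where
  adm : ∀ᵐ t ∂volume.restrict (Ioo a b), adm (u t)
  le : ∀ᵐ t ∂volume.restrict (Ioo a b), ∀ φ, MemH K D φ → (∀ x, 0 ≤ φ x) → Def (u t) φ →
    (∫ x in D, g t x * φ x) + F (u t) φ ≤ ∫ x in D, f t x * φ x

theorem add_ofReal_le_of_form {P M Z : ℝ≥0∞} {x y z : ℝ}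
    (h : P + ENNReal.ofReal (-y) ≤ M + ENNReal.ofReal y) (hxyz : x + y ≤ z)
    (hz : ENNReal.ofReal z ≤ Z) : P + ENNReal.ofReal x ≤ M + Z + ENNReal.ofReal (-x) := by
  refine le_trans ?_ (add_le_add (add_le_add le_rfl hz) le_rfl)
  by_cases hM : M = ∞
  · simp [hM]
  have hP : P ≠ ∞ := by
    intro hP
    rw [hP, top_add, top_le_iff] at h
    exact ENNReal.add_ne_top.2 ⟨hM, ENNReal.ofReal_ne_top⟩ h
  lift P to ℝ≥0 using hP
  lift M to ℝ≥0 using hM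
  have h' := ENNReal.toReal_mono (by finiteness) h
  rw [ENNReal.toReal_add (by finiteness) (by finiteness),
    ENNReal.toReal_add (by finiteness) (by finiteness), ENNReal.toReal_ofReal',
    ENNReal.toReal_ofReal'] at h'
  rw [← ENNReal.toReal_le_toReal (by finiteness) (by finiteness),
    ENNReal.toReal_add (by finiteness) (by finiteness),
    ENNReal.toReal_add (by finiteness) (by finiteness),
    ENNReal.toReal_add (by finiteness) (by finiteness), ENNReal.toReal_ofReal',
    ENNReal.toReal_ofReal', ENNReal.toReal_ofReal']
  have e1 : max y 0 - max (-y) 0 = y := by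
    rcases le_total y 0 with h | h
    · rw [max_eq_right h, max_eq_left (by linarith)]; ring
    · rw [max_eq_left h, max_eq_right (by linarith)]; ring
  have e2 : max x 0 - max (-x) 0 = x := by
    rcases le_total x 0 with h | h
    · rw [max_eq_right h, max_eq_left (by linarith)]; ring
    · rw [max_eq_left h, max_eq_right (by linarith)]; ring
  linarith [le_max_left z 0]

theorem ofReal_integral_mul_le {X : Type*} [MeasurableSpace X] {μ : Measure X} {f φ : X → ℝ}
    {Fm : ℝ≥0∞} (hφ : Measurable φ) (hφ0 : ∀ x, 0 ≤ φ x) (hf : ∀ᵐ x ∂μ, ‖f x‖ₑ ≤ Fm) :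
    ENNReal.ofReal (∫ x, f x * φ x ∂μ) ≤ Fm * ∫⁻ x, ENNReal.ofReal (φ x) ∂μ := by
  calc _ ≤ ‖∫ x, f x * φ x ∂μ‖ₑ := by
        rw [← ofReal_norm]; exact ENNReal.ofReal_le_ofReal (le_abs_self _)
    _ ≤ ∫⁻ x, ‖f x * φ x‖ₑ ∂μ := enorm_integral_le_lintegral_enorm _
    _ ≤ ∫⁻ x, Fm * ENNReal.ofReal (φ x) ∂μ := by
        refine lintegral_mono_ae (hf.mono fun x hx => ?_)
        rw [enorm_mul, Real.enorm_of_nonneg (hφ0 x)]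
        exact mul_le_mul' hx le_rfl
    _ = _ := lintegral_const_mul _ hφ.ennreal_ofReal

/-- The right-hand side of the energy inequality. -/
noncomputable def energyBound (q A₁ : ℝ) (A₂ : ℝ≥0∞) (S : Set (Eu d)) (v : Eu d → ℝ) (k : ℝ) :
    ℝ≥0∞ :=
  ENNReal.ofReal A₁ * levelMass q S v k + A₂ * ∫⁻ x in S, ENNReal.ofReal (max (v x - k) 0)

theorem IsFormSubsolution.energy_le {x₀ : Eu d} {α β p q b₀ C R r ρ : ℝ} {τ : Eu d → ℝ}
    (hu : IsFormSubsolution K a b (Metric.ball x₀ (2 * R)) adm Def F f u g)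
    (hC : CaccioppoliEstimate K adm Def F T α β p q b₀ C x₀ R r ρ τ) (hρ : 0 < ρ)
    {k : ℝ} (hk : 0 ≤ k) {Tm Fm : ℝ≥0∞}
    (hT : ∀ᵐ t ∂volume.restrict (Ioo a b), T (u t) ≤ Tm)
    (hf : ∀ᵐ t ∂volume.restrict (Ioo a b), ∀ᵐ x ∂volume.restrict (Metric.ball x₀ (2 * R)),
      ‖f t x‖ₑ ≤ Fm) :
    ∀ᵐ s ∂volume.restrict (Ioo a b), ∀ᵐ t ∂volume.restrict (Ioo a b), s ≤ t →
      (∫⁻ x in Metric.ball x₀ (2 * R), ENNReal.ofReal ((τ x * max (u t x - k) 0) ^ 2)) +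
        2 * ∫⁻ z in Ioc s t, ENNReal.ofReal b₀ *
          sqNorm p (Metric.ball x₀ R) (fun x => τ x * max (u z x - k) 0) ≤
      (∫⁻ x in Metric.ball x₀ (2 * R), ENNReal.ofReal ((τ x * max (u s x - k) 0) ^ 2)) +
        2 * ∫⁻ z in Ioc s t, energyBound q (C * (R / ρ) ^ (d + α) * R ^ (-β))
          (ENNReal.ofReal (C * (R / ρ) ^ (d + α) * R ^ (-α)) * Tm + Fm)
          (Metric.ball x₀ (r + 2 * ρ)) (u z) k := by
  have hτm := hC.measurable
  have hτ2 : ∀ x, τ x ^ 2 ≤ 1 := fun x => pow_le_one₀ (hC.nonneg x) (hC.le_one x)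
  set X : ℝ → ℝ := fun r => ∫ x in Metric.ball x₀ (2 * R), g r x * (τ x ^ 2 * max (u r x - k) 0)
    with hX
  have hpt : ∀ᵐ z ∂volume.restrict (Ioo a b),
      ENNReal.ofReal b₀ * sqNorm p (Metric.ball x₀ R) (fun x => τ x * max (u z x - k) 0) +
        ENNReal.ofReal (X z) ≤ energyBound q (C * (R / ρ) ^ (d + α) * R ^ (-β))
          (ENNReal.ofReal (C * (R / ρ) ^ (d + α) * R ^ (-α)) * Tm + Fm)
          (Metric.ball x₀ (r + 2 * ρ)) (u z) k + ENNReal.ofReal (-X z) := by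
    filter_upwards [hu.adm, hu.le, hT, hf] with z h1 h2 h3 h4
    have huz : Measurable (u z) := hu.measurable_u.of_uncurry_left
    have hφ : Measurable fun x => τ x ^ 2 * max (u z x - k) 0 := by fun_prop
    have hφ0 : ∀ x, 0 ≤ τ x ^ 2 * max (u z x - k) 0 := fun x =>
      mul_nonneg (sq_nonneg _) (le_max_right _ _)
    have h5 := h2 _ (hC.memH _ k h1 hk) hφ0 (hC.defined _ k h1 hk)
    have h6 := ofReal_integral_mul_le hφ hφ0 h4
    have hφle : ∫⁻ x in Metric.ball x₀ (2 * R), ENNReal.ofReal (τ x ^ 2 * max (u z x - k) 0) ≤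
        ∫⁻ x in Metric.ball x₀ (r + 2 * ρ), ENNReal.ofReal (max (u z x - k) 0) := by
      refine (lintegral_mono' Measure.restrict_le_self le_rfl).trans ?_
      rw [← lintegral_indicator measurableSet_ball]
      refine lintegral_mono fun x => ?_
      by_cases hx : x ∈ Metric.ball x₀ (r + 2 * ρ)
      · rw [indicator_of_mem hx]
        exact ENNReal.ofReal_le_ofReal (mul_le_of_le_one_left (le_max_right _ _) (hτ2 x))
      · rw [hC.eq_zero x fun h => hx (Metric.ball_subset_ball (by linarith) h)]
        simp
    refine (add_ofReal_le_of_form (hC.le _ k h1 hk) h5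
      (h6.trans (mul_le_mul' le_rfl hφle))).trans (add_le_add (le_of_eq_of_le ?_
      (add_le_add le_rfl (mul_le_mul' (add_le_add (mul_le_mul' le_rfl h3) le_rfl) le_rfl))) le_rfl)
    rw [add_mul, ← add_assoc]
  have hid := hu.ae_energy_identity (ψ := fun x => τ x ^ 2) (hτm.pow_const 2)
    (fun x => sq_nonneg _) hτ2 k
  filter_upwards [hid, ae_restrict_mem measurableSet_Ioo] with s hs hsI
  filter_upwards [hs, ae_restrict_mem measurableSet_Ioo] with t ht htI hst
  obtain ⟨iX, is, it, hid⟩ := ht hst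
  have hsub : Ioc s t ⊆ Ioo a b := fun r hr => ⟨hsI.1.trans hr.1, hr.2.trans_lt htI.2⟩
  rw [intervalIntegrable_iff_integrableOn_Ioc_of_le hst] at iX
  rw [intervalIntegral.integral_of_le hst] at hid
  replace iX : IntegrableOn X (Ioc s t) := iX
  have mX : AEMeasurable (fun z => ENNReal.ofReal (X z)) (volume.restrict (Ioc s t)) :=
    iX.1.aemeasurable.ennreal_ofReal
  have mX' : AEMeasurable (fun z => ENNReal.ofReal (-X z)) (volume.restrict (Ioc s t)) :=
    iX.1.aemeasurable.neg.ennreal_ofReal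
  have hmain : (∫⁻ z in Ioc s t, ENNReal.ofReal b₀ *
        sqNorm p (Metric.ball x₀ R) (fun x => τ x * max (u z x - k) 0)) +
        ∫⁻ z in Ioc s t, ENNReal.ofReal (X z) ≤
      (∫⁻ z in Ioc s t, energyBound q (C * (R / ρ) ^ (d + α) * R ^ (-β))
          (ENNReal.ofReal (C * (R / ρ) ^ (d + α) * R ^ (-α)) * Tm + Fm)
          (Metric.ball x₀ (r + 2 * ρ)) (u z) k) + ∫⁻ z in Ioc s t, ENNReal.ofReal (-X z) := by
    rw [← lintegral_add_right' _ mX, ← lintegral_add_right' _ mX']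
    exact lintegral_mono_ae (ae_restrict_of_ae_restrict_of_subset hsub hpt)
  have hx1 : ∫⁻ z in Ioc s t, ENNReal.ofReal (X z) ≠ ∞ := iX.lintegral_lt_top.ne
  have hx2 : ∫⁻ z in Ioc s t, ENNReal.ofReal (-X z) ≠ ∞ := iX.neg.lintegral_lt_top.ne
  have hXint := integral_eq_lintegral_pos_part_sub_lintegral_neg_part iX
  have hΦ : ∀ y : ℝ, Integrable (fun x => τ x ^ 2 * max (u y x - k) 0 ^ 2)
      (volume.restrict (Metric.ball x₀ (2 * R))) →
      ∫⁻ x in Metric.ball x₀ (2 * R), ENNReal.ofReal ((τ x * max (u y x - k) 0) ^ 2) =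
      ENNReal.ofReal (∫ x in Metric.ball x₀ (2 * R), τ x ^ 2 * max (u y x - k) 0 ^ 2) := by
    intro y hy
    rw [ofReal_integral_eq_lintegral_ofReal hy (Eventually.of_forall fun x => by positivity)]
    simp only [mul_pow]
  rw [hΦ s is, hΦ t it]
  have hs0 : 0 ≤ ∫ x in Metric.ball x₀ (2 * R), τ x ^ 2 * max (u s x - k) 0 ^ 2 :=
    integral_nonneg fun x => by positivity
  have ht0 : 0 ≤ ∫ x in Metric.ball x₀ (2 * R), τ x ^ 2 * max (u t x - k) 0 ^ 2 :=
    integral_nonneg fun x => by positivity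
  generalize (∫ x in Metric.ball x₀ (2 * R), τ x ^ 2 * max (u s x - k) 0 ^ 2) = Φs at *
  generalize (∫ x in Metric.ball x₀ (2 * R), τ x ^ 2 * max (u t x - k) 0 ^ 2) = Φt at *
  generalize (∫⁻ z in Ioc s t, energyBound q (C * (R / ρ) ^ (d + α) * R ^ (-β))
    (ENNReal.ofReal (C * (R / ρ) ^ (d + α) * R ^ (-α)) * Tm + Fm)
    (Metric.ball x₀ (r + 2 * ρ)) (u z) k) = A at *
  generalize (∫⁻ z in Ioc s t, ENNReal.ofReal b₀ *
    sqNorm p (Metric.ball x₀ R) (fun x => τ x * max (u z x - k) 0)) = P at *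
  change Φt - Φs = 2 * ∫ z in Ioc s t, X z at hid
  rw [hXint] at hid
  generalize (∫⁻ z in Ioc s t, ENNReal.ofReal (X z)) = X₁ at *
  generalize (∫⁻ z in Ioc s t, ENNReal.ofReal (-X z)) = X₂ at *
  have hid' : ENNReal.ofReal Φt + 2 * X₂ = ENNReal.ofReal Φs + 2 * X₁ := by
    lift X₁ to ℝ≥0 using hx1
    lift X₂ to ℝ≥0 using hx2
    rw [← ENNReal.toReal_eq_toReal_iff' (by finiteness) (by finiteness),
      ENNReal.toReal_add (by finiteness) (by finiteness),
      ENNReal.toReal_add (by finiteness) (by finiteness), ENNReal.toReal_ofReal hs0,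
      ENNReal.toReal_ofReal ht0]
    simp only [ENNReal.toReal_mul, ENNReal.toReal_ofNat, ENNReal.coe_toReal] at hid ⊢
    linarith
  have hcancel : 2 * X₁ + 2 * X₂ ≠ ∞ := by finiteness
  refine (ENNReal.add_le_add_iff_right hcancel).1 ?_
  calc _ = (ENNReal.ofReal Φt + 2 * X₂) + 2 * (P + X₁) := by ring
    _ ≤ (ENNReal.ofReal Φs + 2 * X₁) + 2 * (A + X₂) := by
        rw [hid']; exact add_le_add le_rfl (mul_le_mul' le_rfl hmain)
    _ = _ := by ring

end EnergyInequality

/-! ### The De Giorgi step -/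

section DeGiorgiStep

open Filter Topology

variable {d : ℕ} {K : Eu d → Eu d → ℝ≥0∞} {a b : ℝ} {u g f : ℝ → Eu d → ℝ}
  {adm : (Eu d → ℝ) → Prop} {Def : (Eu d → ℝ) → (Eu d → ℝ) → Prop}
  {F : (Eu d → ℝ) → (Eu d → ℝ) → ℝ} {T : (Eu d → ℝ) → ℝ≥0∞}

theorem sqNorm_mono {p : ℝ} (hp : 0 ≤ p) {A B : Set (Eu d)} (hAB : A ⊆ B) {v w : Eu d → ℝ}
    (h : ∀ x ∈ A, v x ^ 2 ≤ w x ^ 2) (hA : MeasurableSet A) : sqNorm p A v ≤ sqNorm p B w := by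
  refine ENNReal.rpow_le_rpow ?_ (by positivity)
  refine (setLIntegral_mono' hA fun x hx => ?_).trans (lintegral_mono_set hAB)
  exact ENNReal.rpow_le_rpow (ENNReal.ofReal_le_ofReal (h x hx)) hp

theorem sq_posPart_mono {v k l : ℝ} (hkl : k ≤ l) : max (v - l) 0 ^ 2 ≤ max (v - k) 0 ^ 2 :=
  pow_le_pow_left₀ (le_max_right _ _) (max_le_max (by linarith) le_rfl) 2

theorem sqNorm_posPart_mono {p : ℝ} (hp : 0 ≤ p) {A B : Set (Eu d)} (hAB : A ⊆ B) {v : Eu d → ℝ}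
    {k l : ℝ} (hkl : k ≤ l) (hA : MeasurableSet A) :
    sqNorm p A (fun x => max (v x - l) 0) ≤ sqNorm p B (fun x => max (v x - k) 0) :=
  sqNorm_mono hp hAB (fun _ _ => sq_posPart_mono hkl) hA

theorem volume_superlevel_rpow_le {q : ℝ} (hq : 0 < q) {A : Set (Eu d)} (hA : MeasurableSet A)
    {v : Eu d → ℝ} (hv : Measurable v) {k h : ℝ} (hh : 0 < h) :
    ENNReal.ofReal (h ^ 2) * volume (A ∩ {x | k + h < v x}) ^ (1 / q) ≤
      sqNorm q A (fun x => max (v x - k) 0) := by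
  have hm : MeasurableSet {x | k + h < v x} := measurableSet_lt measurable_const hv
  rw [← ENNReal.rpow_le_rpow_iff hq, ENNReal.mul_rpow_of_nonneg _ _ hq.le, sqNorm,
    ← ENNReal.rpow_mul, ← ENNReal.rpow_mul, one_div_mul_cancel hq.ne', ENNReal.rpow_one,
    ENNReal.rpow_one, ← setLIntegral_const]
  refine (setLIntegral_mono' (hA.inter hm) fun x hx => ?_).trans
    (lintegral_mono_set inter_subset_left)
  have hx : k + h < v x := hx.2
  refine ENNReal.rpow_le_rpow (ENNReal.ofReal_le_ofReal (pow_le_pow_left₀ hh.le ?_ 2)) hq.le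
  exact le_max_of_le_left (by linarith)

theorem levelMass_le {q : ℝ} (hq : 0 < q) {A : Set (Eu d)} (hA : MeasurableSet A)
    {v : Eu d → ℝ} (hv : Measurable v) {k h : ℝ} (hh : 0 < h) :
    levelMass q A v (k + h) ≤
      ENNReal.ofReal (1 + ((k + h) / h) ^ 2) * sqNorm q A (fun x => max (v x - k) 0) := by
  rw [ENNReal.ofReal_add zero_le_one (sq_nonneg _), ENNReal.ofReal_one, add_mul, one_mul]
  refine add_le_add (sqNorm_posPart_mono hq.le subset_rfl (by linarith) hA) ?_
  calc _ = ENNReal.ofReal (((k + h) / h) ^ 2) * (ENNReal.ofReal (h ^ 2) *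
        volume (A ∩ {x | k + h < v x}) ^ (1 / q)) := by
        rw [← mul_assoc, ← ENNReal.ofReal_mul (sq_nonneg _)]
        congr 2
        field_simp
    _ ≤ _ := mul_le_mul' le_rfl (volume_superlevel_rpow_le hq hA hv hh)

theorem lintegral_posPart_le {q : ℝ} (hq : 1 ≤ q) {A : Set (Eu d)}
    {v : Eu d → ℝ} (hv : Measurable v) {k h : ℝ} (hh : 0 < h) :
    ∫⁻ x in A, ENNReal.ofReal (max (v x - (k + h)) 0) ≤
      ENNReal.ofReal h⁻¹ * volume A ^ (1 - 1 / q) * sqNorm q A (fun x => max (v x - k) 0) := by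
  have hw : Measurable fun x => max (v x - k) 0 := by fun_prop
  calc _ ≤ ∫⁻ x in A, ENNReal.ofReal h⁻¹ * ENNReal.ofReal (max (v x - k) 0 ^ 2) := by
        refine lintegral_mono fun x => ?_
        rw [← ENNReal.ofReal_mul (by positivity)]
        refine ENNReal.ofReal_le_ofReal ?_
        rw [inv_mul_eq_div, le_div_iff₀ hh]
        rcases le_total (v x) (k + h) with hx | hx
        · rw [max_eq_right (by linarith : v x - (k + h) ≤ 0)]
          simp only [zero_mul]; positivity
        · rw [max_eq_left (by linarith : 0 ≤ v x - (k + h)),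
            max_eq_left (by linarith : 0 ≤ v x - k), sq]
          exact mul_le_mul (by linarith) (by linarith) hh.le (by linarith)
    _ = ENNReal.ofReal h⁻¹ * ∫⁻ x in A, ENNReal.ofReal (max (v x - k) 0 ^ 2) :=
        lintegral_const_mul _ (by fun_prop)
    _ ≤ _ := by
        rw [mul_assoc]
        refine mul_le_mul' le_rfl ((lintegral_sq_le_sqNorm hq A hw).trans_eq (mul_comm _ _))

theorem energyBound_le {q A₁ : ℝ} {A₂ : ℝ≥0∞} (hq : 1 ≤ q) {S : Set (Eu d)}
    (hS : MeasurableSet S) {v : Eu d → ℝ} (hv : Measurable v) {k h : ℝ} (hh : 0 < h) :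
    energyBound q A₁ A₂ S v (k + h) ≤
      (ENNReal.ofReal A₁ * ENNReal.ofReal (1 + ((k + h) / h) ^ 2) +
        A₂ * (ENNReal.ofReal h⁻¹ * volume S ^ (1 - 1 / q))) *
        sqNorm q S (fun x => max (v x - k) 0) := by
  rw [add_mul, mul_assoc, mul_assoc A₂]
  exact add_le_add (mul_le_mul' le_rfl (levelMass_le (by linarith) hS hv hh))
    (mul_le_mul' le_rfl (lintegral_posPart_le hq hv hh))

theorem sqNorm_posPart_le_mul {p q κ : ℝ} (hp : 0 < p) (hq : 0 < q) (hκ : 1 ≤ κ)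
    (hpq : κ - 1 + 1 / p = 1 / q) {A : Set (Eu d)} {v : Eu d → ℝ} (hv : Measurable v)
    {m h : ℝ} (hh : 0 < h) :
    sqNorm q A (fun x => max (v x - (m + h)) 0) ≤ ENNReal.ofReal (h ^ (-2 * (κ - 1))) *
      (∫⁻ x in A, ENNReal.ofReal (max (v x - m) 0 ^ 2)) ^ (κ - 1) *
      sqNorm p A (fun x => max (v x - m) 0) := by
  have hκ' : 0 ≤ κ - 1 := by linarith
  set X : Eu d → ℝ≥0∞ := fun x => ENNReal.ofReal (max (v x - m) 0 ^ 2) with hX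
  have hXm : Measurable X := by fun_prop
  set c := ENNReal.ofReal (h ^ (-2 * (κ - 1)))
  have hsum : (κ - 1) * q + q / p = 1 := by
    rw [div_eq_mul_one_div, mul_comm q, ← add_mul, hpq, one_div_mul_cancel hq.ne']
  have hpt : ∀ x, ENNReal.ofReal (max (v x - (m + h)) 0 ^ 2) ^ q ≤
      c ^ q * (X x ^ ((κ - 1) * q) * (X x ^ p) ^ (q / p)) := by
    intro x
    rw [← ENNReal.rpow_mul, mul_div_cancel₀ _ hp.ne', ENNReal.rpow_mul,
      ← ENNReal.mul_rpow_of_nonneg _ _ hq.le, ← ENNReal.mul_rpow_of_nonneg _ _ hq.le]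
    refine ENNReal.rpow_le_rpow ?_ hq.le
    rcases le_or_gt (v x) (m + h) with hx | hx
    · rw [max_eq_right (by linarith : v x - (m + h) ≤ 0)]; simp
    rw [← mul_assoc]
    refine (ENNReal.ofReal_le_ofReal (sq_posPart_mono (by linarith))).trans
      (le_mul_of_one_le_left' ?_)
    simp only [hX, c]
    rw [max_eq_left (by linarith : 0 ≤ v x - m), ENNReal.ofReal_rpow_of_pos (by nlinarith),
      ← ENNReal.ofReal_mul (by positivity), ENNReal.one_le_ofReal,
      show -2 * (κ - 1) = (2 : ℕ) * -(κ - 1) by push_cast; ring, Real.rpow_natCast_mul hh.le,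
      Real.rpow_neg (by positivity), inv_mul_eq_div, one_le_div (by positivity)]
    exact Real.rpow_le_rpow (by positivity) (pow_le_pow_left₀ hh.le (by linarith) 2) hκ'
  calc _ ≤ (∫⁻ x in A, c ^ q * (X x ^ ((κ - 1) * q) * (X x ^ p) ^ (q / p))) ^ (1 / q) :=
        ENNReal.rpow_le_rpow (lintegral_mono hpt) (by positivity)
    _ = (c ^ q * ∫⁻ x in A, X x ^ ((κ - 1) * q) * (X x ^ p) ^ (q / p)) ^ (1 / q) := by
        rw [lintegral_const_mul _ (by fun_prop)]
    _ ≤ (c ^ q * ((∫⁻ x in A, X x) ^ ((κ - 1) * q) * (∫⁻ x in A, X x ^ p) ^ (q / p))) ^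
          (1 / q) := by
        refine ENNReal.rpow_le_rpow (mul_le_mul' le_rfl ?_) (by positivity)
        exact ENNReal.lintegral_mul_norm_pow_le hXm.aemeasurable (hXm.pow_const p).aemeasurable
          (by positivity) (by positivity) hsum
    _ = _ := by
        rw [ENNReal.mul_rpow_of_nonneg _ _ (by positivity),
          ENNReal.mul_rpow_of_nonneg _ _ (by positivity), ← ENNReal.rpow_mul, ← ENNReal.rpow_mul,
          ← ENNReal.rpow_mul, mul_one_div_cancel hq.ne', ENNReal.rpow_one, mul_assoc (κ - 1),
          mul_one_div_cancel hq.ne', mul_one, sqNorm, mul_assoc,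
          show q / p * (1 / q) = 1 / p by field_simp]

theorem measurable_sqNorm {w : ℝ → Eu d → ℝ} (hw : Measurable (Function.uncurry w)) (p : ℝ)
    (A : Set (Eu d)) : Measurable fun t => sqNorm p A (w t) := by
  have : Measurable fun z : ℝ × Eu d => ENNReal.ofReal (w z.1 z.2 ^ 2) ^ p :=
    ((hw.pow_const 2).ennreal_ofReal).pow_const p
  exact this.lintegral_prod_right'.pow_const _

theorem setLIntegral_Ioo_le_of_forall_Ioc {F : ℝ → ℝ≥0∞} {σ b : ℝ} {M : ℝ≥0∞}
    (h : ∀ t ∈ Ioo σ b, ∫⁻ z in Ioc σ t, F z ≤ M) : ∫⁻ z in Ioo σ b, F z ≤ M := by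
  rcases le_or_gt b σ with hb | hb
  · simp [Ioo_eq_empty_of_le hb]
  have hU : Ioo σ b ⊆ ⋃ n : ℕ, Ioc σ (b - (b - σ) / (n + 2)) := by
    intro z hz
    have hlim : Tendsto (fun n : ℕ => (b - σ) / ((n : ℝ) + 2)) atTop (𝓝 0) :=
      tendsto_const_nhds.div_atTop (tendsto_natCast_atTop_atTop.atTop_add tendsto_const_nhds)
    obtain ⟨n, hn⟩ := (hlim.eventually (gt_mem_nhds
      (show 0 < b - z by linarith [hz.2]))).exists
    exact mem_iUnion.2 ⟨n, hz.1, by linarith⟩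
  refine (lintegral_mono_set hU).trans ?_
  rw [setLIntegral_iUnion_of_directed]
  · refine iSup_le fun n => h _ ⟨?_, ?_⟩
    · have : (b - σ) / ((n : ℝ) + 2) < b - σ := by
        rw [div_lt_iff₀ (by positivity)]
        have : (0 : ℝ) ≤ n := n.cast_nonneg
        nlinarith
      linarith
    · have : 0 < (b - σ) / ((n : ℝ) + 2) := div_pos (by linarith) (by positivity)
      linarith
  · refine directed_of_isDirected_le fun i j hij => Ioc_subset_Ioc_right ?_
    have hij' : (i : ℝ) ≤ j := by exact_mod_cast hij
    have : (b - σ) / ((j : ℝ) + 2) ≤ (b - σ) / (i + 2) :=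
      div_le_div_of_nonneg_left (by linarith) (by positivity) (by linarith)
    linarith

theorem IsFormSubsolution.deGiorgi_step {x₀ : Eu d} {α β p q κ b₀ C R r ρ : ℝ} {τ : Eu d → ℝ}
    (hu : IsFormSubsolution K a b (Metric.ball x₀ (2 * R)) adm Def F f u g)
    (hC : CaccioppoliEstimate K adm Def F T α β p q b₀ C x₀ R r ρ τ) (hb₀ : 0 < b₀)
    (hρ : 0 < ρ) (hR : 0 < R) (hrR : r + 2 * ρ ≤ R) (hp : 0 < p) (hq : 1 ≤ q) (hκ : 1 ≤ κ)
    (hpq : κ - 1 + 1 / p = 1 / q) {k h : ℝ} (hk : 0 ≤ k) (hh : 0 < h) {Tm Fm : ℝ≥0∞}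
    (hT : ∀ᵐ t ∂volume.restrict (Ioo a b), T (u t) ≤ Tm)
    (hf : ∀ᵐ t ∂volume.restrict (Ioo a b), ∀ᵐ x ∂volume.restrict (Metric.ball x₀ (2 * R)),
      ‖f t x‖ₑ ≤ Fm) {σ₀ σ₁ : ℝ} (hσ₀ : a ≤ σ₀) (hσ : σ₀ < σ₁) (hσ₁ : σ₁ < b) {Γ : ℝ≥0∞}
    (hΓ : (ENNReal.ofReal (σ₁ - σ₀))⁻¹ * volume (Metric.ball x₀ (r + 2 * ρ)) ^ (1 - 1 / q) +
      2 * (ENNReal.ofReal (C * (R / ρ) ^ (d + α) * R ^ (-β)) *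
        ENNReal.ofReal (1 + ((k + h) / h) ^ 2) +
        (ENNReal.ofReal (C * (R / ρ) ^ (d + α) * R ^ (-α)) * Tm + Fm) *
          (ENNReal.ofReal h⁻¹ * volume (Metric.ball x₀ (r + 2 * ρ)) ^ (1 - 1 / q))) ≤ Γ) :
    ∫⁻ t in Ioo σ₁ b, sqNorm q (Metric.ball x₀ r) (fun x => max (u t x - (k + h + h)) 0) ≤
      ENNReal.ofReal (h ^ (-2 * (κ - 1))) * (2 * ENNReal.ofReal b₀)⁻¹ *
        (Γ * ∫⁻ t in Ioo σ₀ b, sqNorm q (Metric.ball x₀ (r + 2 * ρ))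
          (fun x => max (u t x - k) 0)) ^ κ := by
  have hum : ∀ t, Measurable (u t) := fun t => hu.measurable_u.of_uncurry_left
  have hwm : ∀ l : ℝ, Measurable (Function.uncurry fun t x => max (u t x - l) 0) := fun l =>
    (hu.measurable_u.sub_const l).max measurable_const
  have hq0 : 0 < q := by linarith
  set S := Metric.ball x₀ (r + 2 * ρ) with hS
  set V := volume S ^ (1 - 1 / q) with hV
  set A := ENNReal.ofReal (C * (R / ρ) ^ (d + α) * R ^ (-β)) *
        ENNReal.ofReal (1 + ((k + h) / h) ^ 2) +
        (ENNReal.ofReal (C * (R / ρ) ^ (d + α) * R ^ (-α)) * Tm + Fm) *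
          (ENNReal.ofReal h⁻¹ * V) with hA
  set N : ℝ → ℝ≥0∞ := fun t => sqNorm q S (fun x => max (u t x - k) 0) with hN
  have hNm : Measurable N := measurable_sqNorm (hwm k) q S
  set Y := ∫⁻ t in Ioo σ₀ b, N t with hY
  set M := Γ * Y with hM
  have hrS : Metric.ball x₀ r ⊆ S := Metric.ball_subset_ball (by linarith)
  have hSR : S ⊆ Metric.ball x₀ R := Metric.ball_subset_ball hrR
  set P : ℝ → ℝ≥0∞ := fun t => sqNorm p (Metric.ball x₀ r) (fun x => max (u t x - (k + h)) 0)
    with hP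
  have hPm : Measurable P := measurable_sqNorm (hwm (k + h)) p _
  set E : ℝ → ℝ≥0∞ := fun t => ∫⁻ x in S, ENNReal.ofReal (max (u t x - (k + h)) 0 ^ 2) with hE
  have hEm : Measurable E := by
    have : Measurable fun z : ℝ × Eu d => ENNReal.ofReal (max (u z.1 z.2 - (k + h)) 0 ^ 2) :=
      ((hwm (k + h)).pow_const 2).ennreal_ofReal
    exact this.lintegral_prod_right'
  have hEN : ∀ t, E t ≤ V * N t := fun t => by
    have hw : Measurable fun x => max (u t x - (k + h)) 0 := (hwm (k + h)).of_uncurry_left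
    refine (lintegral_sq_le_sqNorm hq S hw).trans ?_
    rw [mul_comm]
    exact mul_le_mul' le_rfl
      (sqNorm_posPart_mono hq0.le subset_rfl (by linarith) measurableSet_ball)
  set L : ℝ → ℝ≥0∞ := fun t => ∫⁻ x in Metric.ball x₀ (2 * R),
    ENNReal.ofReal ((τ x * max (u t x - (k + h)) 0) ^ 2) with hL
  have hLE : ∀ t, L t ≤ E t := fun t => by
    refine (lintegral_mono' Measure.restrict_le_self le_rfl).trans ?_
    simp only [hE]
    rw [← lintegral_indicator (s := S) measurableSet_ball]
    refine lintegral_mono fun x => ?_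
    by_cases hx : x ∈ S
    · rw [indicator_of_mem hx, mul_pow]
      exact ENNReal.ofReal_le_ofReal (mul_le_of_le_one_left (sq_nonneg _)
        (pow_le_one₀ (hC.nonneg x) (hC.le_one x)))
    · rw [hC.eq_zero x fun h => hx (Metric.ball_subset_ball (by linarith) h)]
      simp
  have hEL : ∀ t, ∫⁻ x in Metric.ball x₀ r, ENNReal.ofReal (max (u t x - (k + h)) 0 ^ 2) ≤ L t :=
    fun t => by
    refine (setLIntegral_mono' measurableSet_ball fun x hx => ?_).trans (lintegral_mono_set
      (Metric.ball_subset_ball (by linarith : r ≤ 2 * R)))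
    rw [hC.eq_one x hx, one_mul]
  have hPτ : ∀ t, P t ≤ sqNorm p (Metric.ball x₀ R) (fun x => τ x * max (u t x - (k + h)) 0) :=
    fun t => sqNorm_mono hp.le (hrS.trans hSR)
      (fun x hx => by rw [hC.eq_one x hx, one_mul]) measurableSet_ball
  have hen := hu.energy_le hC hρ (add_nonneg hk hh.le) hT hf
  have hsub : Ioo σ₀ σ₁ ⊆ Ioo a b := Ioo_subset_Ioo hσ₀ hσ₁.le
  have hμ : volume.restrict (Ioo σ₀ σ₁) ≠ 0 := by
    rw [Ne, Measure.restrict_eq_zero, Real.volume_Ioo, ENNReal.ofReal_eq_zero]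
    linarith
  obtain ⟨s, hs, hsE⟩ := exists_notMem_null_le_laverage hμ hEm.aemeasurable
    ((ae_restrict_mem measurableSet_Ioo).and (ae_restrict_of_ae_restrict_of_subset hsub hen))
  obtain ⟨hsI, hs⟩ := not_not.1 hs
  have hEs : E s ≤ (ENNReal.ofReal (σ₁ - σ₀))⁻¹ * V * Y := by
    refine hsE.trans ?_
    rw [laverage_eq, Measure.restrict_apply_univ, Real.volume_Ioo, ENNReal.div_eq_inv_mul,
      mul_assoc]
    refine mul_le_mul' le_rfl ?_
    calc _ ≤ ∫⁻ t in Ioo σ₀ σ₁, V * N t := lintegral_mono hEN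
      _ = V * ∫⁻ t in Ioo σ₀ σ₁, N t := lintegral_const_mul _ hNm
      _ ≤ _ := mul_le_mul' le_rfl (lintegral_mono_set (Ioo_subset_Ioo_right hσ₁.le))
  have hgood : ∀ᵐ t ∂volume.restrict (Ioo a b), s ≤ t →
      L t + 2 * ENNReal.ofReal b₀ * ∫⁻ z in Ioc s t, P z ≤ M := by
    filter_upwards [hs, ae_restrict_mem measurableSet_Ioo] with t ht htI hst
    calc _ ≤ L t + 2 * ∫⁻ z in Ioc s t, ENNReal.ofReal b₀ *
          sqNorm p (Metric.ball x₀ R) (fun x => τ x * max (u z x - (k + h)) 0) := by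
          refine add_le_add le_rfl ?_
          rw [mul_assoc, ← lintegral_const_mul _ hPm]
          exact mul_le_mul' le_rfl (lintegral_mono fun z => mul_le_mul' le_rfl (hPτ z))
      _ ≤ _ := ht hst
      _ ≤ (ENNReal.ofReal (σ₁ - σ₀))⁻¹ * V * Y + 2 * (A * Y) := by
          refine add_le_add ((hLE s).trans hEs) (mul_le_mul' le_rfl ?_)
          refine (lintegral_mono fun z =>
            energyBound_le hq measurableSet_ball (hum z) hh).trans ?_
          rw [lintegral_const_mul _ hNm]
          exact mul_le_mul' le_rfl (lintegral_mono_set fun z hz =>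
            ⟨hsI.1.trans hz.1, hz.2.trans_lt htI.2⟩)
      _ = ((ENNReal.ofReal (σ₁ - σ₀))⁻¹ * V + 2 * A) * Y := by ring
      _ ≤ M := mul_le_mul' hΓ le_rfl
  have hb2 : 2 * ENNReal.ofReal b₀ ≠ 0 := by simp [hb₀]
  have hb2' : 2 * ENNReal.ofReal b₀ ≠ ∞ := by finiteness
  have hPM : ∫⁻ z in Ioo σ₁ b, P z ≤ (2 * ENNReal.ofReal b₀)⁻¹ * M := by
    refine setLIntegral_Ioo_le_of_forall_Ioc fun t ht => ?_
    have hsub' : Ioo t b ⊆ Ioo a b := Ioo_subset_Ioo_left (by linarith [ht.1])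
    have hμ' : volume.restrict (Ioo t b) ≠ 0 := by
      rw [Ne, Measure.restrict_eq_zero, Real.volume_Ioo, ENNReal.ofReal_eq_zero]
      linarith [ht.2]
    have := ae_neBot.2 hμ'
    obtain ⟨t', ht'I, ht'⟩ := ((ae_restrict_mem measurableSet_Ioo).and
      (ae_restrict_of_ae_restrict_of_subset hsub' hgood)).exists
    have h1 := le_add_self.trans (ht' (by linarith [ht'I.1, hsI.2, ht.1]))
    rw [ENNReal.mul_le_iff_le_inv hb2 hb2'] at h1
    exact (lintegral_mono_set (Ioc_subset_Ioc hsI.2.le ht'I.1.le)).trans h1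
  have hLM : ∀ᵐ t ∂volume.restrict (Ioo σ₁ b), L t ≤ M := by
    filter_upwards [ae_restrict_of_ae_restrict_of_subset (Ioo_subset_Ioo_left
      (by linarith : a ≤ σ₁)) hgood, ae_restrict_mem measurableSet_Ioo] with t ht htI
    exact le_self_add.trans (ht (by linarith [htI.1, hsI.2]))
  calc _ ≤ ∫⁻ t in Ioo σ₁ b, ENNReal.ofReal (h ^ (-2 * (κ - 1))) * M ^ (κ - 1) * P t := by
        refine lintegral_mono_ae (hLM.mono fun t ht => ?_)
        refine (sqNorm_posPart_le_mul hp hq0 hκ hpq (hum t) hh).trans ?_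
        exact mul_le_mul' (mul_le_mul' le_rfl (ENNReal.rpow_le_rpow ((hEL t).trans ht)
          (by linarith))) le_rfl
    _ = ENNReal.ofReal (h ^ (-2 * (κ - 1))) * M ^ (κ - 1) * ∫⁻ t in Ioo σ₁ b, P t :=
        lintegral_const_mul _ hPm
    _ ≤ ENNReal.ofReal (h ^ (-2 * (κ - 1))) * M ^ (κ - 1) * ((2 * ENNReal.ofReal b₀)⁻¹ * M) :=
        mul_le_mul' le_rfl hPM
    _ = ENNReal.ofReal (h ^ (-2 * (κ - 1))) * (2 * ENNReal.ofReal b₀)⁻¹ *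
          (M ^ (κ - 1) * M ^ (1 : ℝ)) := by rw [ENNReal.rpow_one]; ring
    _ = _ := by
        rw [← ENNReal.rpow_add_of_nonneg _ _ (by linarith) zero_le_one, sub_add_cancel]

end DeGiorgiStep

/-! ### The De Giorgi iteration -/

section DeGiorgiIteration

open Filter Topology

variable {d : ℕ}

theorem le_mul_pow_of_fast_recursion {Y : ℕ → ℝ≥0∞} {G B Λ : ℝ≥0∞} {κ : ℝ} (hκ : 1 ≤ κ)
    (hY : ∀ j, Y (j + 1) ≤ G * B ^ j * Y j ^ κ) (hΛ : B * Λ ^ (κ - 1) ≤ 1)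
    (h0 : G * Y 0 ^ (κ - 1) ≤ Λ) (j : ℕ) : Y j ≤ Y 0 * Λ ^ j := by
  have hκ' : 0 ≤ κ - 1 := by linarith
  induction j with
  | zero => simp
  | succ j ih =>
    calc Y (j + 1) ≤ G * B ^ j * Y j ^ (κ - 1 + 1) := by rw [sub_add_cancel]; exact hY j
      _ = G * B ^ j * (Y j ^ (κ - 1) * Y j) := by
          rw [ENNReal.rpow_add_of_nonneg _ _ hκ' zero_le_one, ENNReal.rpow_one]
      _ ≤ G * B ^ j * ((Y 0 * Λ ^ j) ^ (κ - 1) * (Y 0 * Λ ^ j)) :=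
          mul_le_mul' le_rfl (mul_le_mul' (ENNReal.rpow_le_rpow ih hκ') ih)
      _ = G * Y 0 ^ (κ - 1) * (B * Λ ^ (κ - 1)) ^ j * (Y 0 * Λ ^ j) := by
          rw [ENNReal.mul_rpow_of_nonneg _ _ hκ', mul_pow, ← ENNReal.rpow_natCast Λ j,
            ← ENNReal.rpow_natCast (Λ ^ (κ - 1)), ← ENNReal.rpow_mul, ← ENNReal.rpow_mul,
            mul_comm (j : ℝ)]
          ring
      _ ≤ Λ * 1 * (Y 0 * Λ ^ j) :=
          mul_le_mul' (mul_le_mul' h0 (pow_le_one₀ (zero_le) hΛ)) le_rfl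
      _ = _ := by rw [pow_succ]; ring

theorem eq_zero_of_fast_recursion {Y : ℕ → ℝ≥0∞} {G B Λ : ℝ≥0∞} {κ : ℝ} (hκ : 1 ≤ κ)
    (hY : ∀ j, Y (j + 1) ≤ G * B ^ j * Y j ^ κ) (hΛ : B * Λ ^ (κ - 1) ≤ 1) (hΛ1 : Λ < 1)
    (h0 : G * Y 0 ^ (κ - 1) ≤ Λ) (hY0 : Y 0 ≠ ∞) {Z : ℝ≥0∞} (hZ : ∀ j, Z ≤ Y j) : Z = 0 := by
  have h1 : Tendsto (fun j : ℕ => Y 0 * Λ ^ j) atTop (𝓝 (Y 0 * 0)) :=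
    ENNReal.Tendsto.const_mul (ENNReal.tendsto_pow_atTop_nhds_zero_of_lt_one hΛ1) (Or.inr hY0)
  rw [mul_zero] at h1
  exact le_antisymm (ge_of_tendsto' h1 fun j =>
    (hZ j).trans (le_mul_pow_of_fast_recursion hκ hY hΛ h0 j)) (zero_le)

theorem volume_ball_rpow_le {x₀ : Eu d} {r R e : ℝ} (hr : r ≤ R) (hR : 0 < R) (he : 0 ≤ e) :
    volume (Metric.ball x₀ r) ^ e ≤ ENNReal.ofReal
      ((volume (Metric.ball (0 : Eu d) 1) ^ e).toReal * R ^ (d * e)) := by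
  have hfin : volume (Metric.ball (0 : Eu d) 1) ^ e ≠ ∞ :=
    ENNReal.rpow_ne_top_of_nonneg he measure_ball_lt_top.ne
  refine (ENNReal.rpow_le_rpow (volume_ball_le hr hR) he).trans_eq ?_
  rw [ENNReal.mul_rpow_of_nonneg _ _ he, ENNReal.ofReal_mul ENNReal.toReal_nonneg,
    ENNReal.ofReal_toReal hfin, mul_comm, ENNReal.ofReal_rpow_of_pos (by positivity),
    Real.rpow_natCast_mul hR.le]

theorem deGiorgi_factor_le {α β C v R δ k s c : ℝ} (hα : 0 < α) (hC : 0 < C) (hv : 0 ≤ v)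
    (hR : 0 < R) (hδ : 0 < δ) (hδ1 : δ ≤ 1) (hk : 0 < k) (hs : 1 ≤ s) (hc : 0 < c) :
    ((2 * s)⁻¹ * (c * R ^ α))⁻¹ * (v * R ^ (α - β)) +
      2 * (C * (8 * s) ^ (d + α) * R ^ (-β) * (1 + (4 * s) ^ 2) +
        (C * (8 * s) ^ (d + α) * R ^ (-α) * (k / δ) + k / (δ * R ^ α)) *
          ((k / (4 * s))⁻¹ * (v * R ^ (α - β)))) ≤
      (2 * v / c + 34 * C * 8 ^ (d + α) + 8 * (C * 8 ^ (d + α) + 1) * v) * s ^ (d + α + 2) *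
        (R ^ (-β) * δ⁻¹) := by
  have hs0 : 0 < s := by linarith
  have hda : 0 ≤ (d : ℝ) + α := by positivity
  have e1 : R ^ (α - β) = R ^ α * R ^ (-β) := by rw [← Real.rpow_add hR, sub_eq_add_neg]
  rw [e1, Real.rpow_neg hR.le α, Real.mul_rpow (by norm_num) hs0.le,
    Real.rpow_add hs0 (d + α) 2, show s ^ (2 : ℝ) = s ^ 2 by norm_cast]
  have hP := Real.rpow_pos_of_pos hR α
  have hX := Real.rpow_pos_of_pos hR (-β)
  have hS : 1 ≤ s ^ ((d : ℝ) + α) := Real.one_le_rpow hs hda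
  have h8 : (0 : ℝ) < 8 ^ ((d : ℝ) + α) := by positivity
  generalize R ^ α = P at *
  generalize R ^ (-β) = X at *
  generalize s ^ ((d : ℝ) + α) = S at *
  generalize (8 : ℝ) ^ ((d : ℝ) + α) = E at *
  have hδi : 1 ≤ δ⁻¹ := (one_le_inv₀ hδ).2 hδ1
  have t1 : ((2 * s)⁻¹ * (c * P))⁻¹ * (v * (P * X)) = 2 * v / c * s * X := by field_simp
  have t2 : (C * (E * S) * P⁻¹ * (k / δ) + k / (δ * P)) * ((k / (4 * s))⁻¹ * (v * (P * X))) =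
      4 * (C * E * S + 1) * v * s * (X * δ⁻¹) := by field_simp
  rw [t1, t2]
  have hvc : 0 ≤ 2 * v / c := by positivity
  have hXd : X ≤ X * δ⁻¹ := le_mul_of_one_le_right hX.le hδi
  have hs2 : s ≤ s ^ 2 := by nlinarith
  have hSs : s ≤ S * s ^ 2 := by nlinarith
  have hS2 : 1 ≤ s ^ 2 := by nlinarith
  have b1 : 2 * v / c * s * X ≤ 2 * v / c * (S * s ^ 2) * (X * δ⁻¹) := by gcongr
  have b2 : C * (E * S) * X * (1 + (4 * s) ^ 2) ≤ 17 * C * E * (S * s ^ 2) * (X * δ⁻¹) := by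
    calc _ ≤ C * (E * S) * (X * δ⁻¹) * (17 * s ^ 2) := by gcongr; nlinarith
      _ = _ := by ring
  have b3 : 4 * (C * E * S + 1) * v * s * (X * δ⁻¹) ≤
      4 * (C * E + 1) * v * (S * s ^ 2) * (X * δ⁻¹) := by
    have : (C * E * S + 1) * s ≤ (C * E + 1) * (S * s ^ 2) := by
      have h1 : 0 ≤ C * E * S := by positivity
      nlinarith
    calc _ = 4 * v * (X * δ⁻¹) * ((C * E * S + 1) * s) := by ring
      _ ≤ 4 * v * (X * δ⁻¹) * ((C * E + 1) * (S * s ^ 2)) := by gcongr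
      _ = _ := by ring
  linarith

theorem deGiorgi_constant_eq {κ m b₀ C₂ k s x : ℝ} (hC₂ : 0 < C₂) (hk : 0 < k)
    (hs : 0 < s) (hx : 0 < x) :
    (k / (4 * s)) ^ (-2 * (κ - 1)) * (2 * b₀)⁻¹ * (C₂ * s ^ m * x) ^ κ =
      16 ^ (κ - 1) * (2 * b₀)⁻¹ * C₂ ^ κ * k ^ (-2 * (κ - 1)) * x ^ κ *
        s ^ (2 * (κ - 1) + κ * m) := by
  have h16 : (16 : ℝ) ^ (κ - 1) = 4 ^ (2 * (κ - 1)) := by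
    rw [show (16 : ℝ) = 4 ^ (2 : ℝ) by norm_num, ← Real.rpow_mul (by norm_num)]
  rw [Real.div_rpow hk.le (by positivity), Real.mul_rpow (by norm_num) hs.le,
    Real.mul_rpow (by positivity) hx.le, Real.mul_rpow hC₂.le (by positivity),
    ← Real.rpow_mul hs.le, Real.rpow_add hs, neg_mul, Real.rpow_neg (by norm_num : (0 : ℝ) ≤ 4),
    Real.rpow_neg hs.le, h16, mul_comm m κ]
  field_simp

theorem deGiorgi_threshold_eq {D κ G Λ k R δ : ℝ} (hκ : 0 < κ - 1) (hG : 0 < G) (hΛ : 0 < Λ)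
    (hk : 0 < k) (hR : 0 < R) (hδ : 0 < δ) :
    G * k ^ (-2 * (κ - 1)) * (R ^ (-(D * (κ - 1))) * δ⁻¹) ^ κ *
      ((Λ / G) ^ (1 / (κ - 1)) * (δ ^ (κ / (κ - 1)) * R ^ (D * κ) * k ^ 2)) ^ (κ - 1) = Λ := by
  have h1 : ((Λ / G) ^ (1 / (κ - 1))) ^ (κ - 1) = Λ / G := by
    rw [← Real.rpow_mul (by positivity), one_div_mul_cancel hκ.ne', Real.rpow_one]
  have h2 : (δ ^ (κ / (κ - 1))) ^ (κ - 1) = δ ^ κ := by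
    rw [← Real.rpow_mul hδ.le, div_mul_cancel₀ _ hκ.ne']
  have h3 : (R ^ (D * κ)) ^ (κ - 1) = R ^ (D * (κ - 1) * κ) := by
    rw [← Real.rpow_mul hR.le]; ring_nf
  have h4 : (R ^ (-(D * (κ - 1)))) ^ κ = (R ^ (D * (κ - 1) * κ))⁻¹ := by
    rw [← Real.rpow_mul hR.le, neg_mul, Real.rpow_neg hR.le]
  have h5 : (k ^ 2) ^ (κ - 1) = k ^ (2 * (κ - 1)) := by
    rw [← Real.rpow_natCast_mul hk.le]; norm_num
  rw [Real.mul_rpow (by positivity) (by positivity), Real.mul_rpow (by positivity)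
    (by positivity), Real.mul_rpow (by positivity) (by positivity), Real.mul_rpow (by positivity)
    (by positivity), h1, h2, h3, h4, h5, Real.inv_rpow hδ.le, neg_mul, Real.rpow_neg hk.le]
  have := Real.rpow_pos_of_pos hδ κ
  have := Real.rpow_pos_of_pos hR (D * (κ - 1) * κ)
  have := Real.rpow_pos_of_pos hk (2 * (κ - 1))
  field_simp

theorem ofReal_deGiorgi_factor {a v A m B T F h : ℝ} (ha : 0 < a) (hv : 0 ≤ v) (hA : 0 ≤ A)
    (hm : 0 ≤ m) (hB : 0 ≤ B) (hT : 0 ≤ T) (hF : 0 ≤ F) (hh : 0 ≤ h) :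
    (ENNReal.ofReal a)⁻¹ * ENNReal.ofReal v + 2 * (ENNReal.ofReal A * ENNReal.ofReal m +
      (ENNReal.ofReal B * ENNReal.ofReal T + ENNReal.ofReal F) *
        (ENNReal.ofReal h * ENNReal.ofReal v)) =
      ENNReal.ofReal (a⁻¹ * v + 2 * (A * m + (B * T + F) * (h * v))) := by
  rw [ENNReal.ofReal_add (by positivity) (by positivity), ENNReal.ofReal_mul (by positivity),
    ENNReal.ofReal_mul zero_le_two, ENNReal.ofReal_add (by positivity) (by positivity),
    ENNReal.ofReal_mul hA, ENNReal.ofReal_mul (by positivity),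
    ENNReal.ofReal_add (by positivity) hF, ENNReal.ofReal_mul hB, ENNReal.ofReal_mul hh,
    ENNReal.ofReal_inv_of_pos ha, ENNReal.ofReal_ofNat]

theorem IsFormSubsolution.deGiorgi_step_geometric {K : Eu d → Eu d → ℝ≥0∞}
    {adm : (Eu d → ℝ) → Prop} {Def : (Eu d → ℝ) → (Eu d → ℝ) → Prop}
    {F : (Eu d → ℝ) → (Eu d → ℝ) → ℝ} {T : (Eu d → ℝ) → ℝ≥0∞} {f u g : ℝ → Eu d → ℝ} {x₀ : Eu d}
    {α β p q κ b₀ C R δ b k cα s : ℝ} {Tm Fm : ℝ≥0∞}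
    (hu : IsFormSubsolution K (b - (R / 4) ^ α) b (Metric.ball x₀ (2 * R)) adm Def F f u g)
    (hα : 0 < α) (hβ : β = α - d * (1 - 1 / q)) (hb₀ : 0 < b₀) (hC : 0 < C)
    (hp : 0 < p) (hq : 1 ≤ q) (hκ : 1 ≤ κ) (hpq : κ - 1 + 1 / p = 1 / q) (hR : 0 < R) (hδ : 0 < δ)
    (hδ1 : δ ≤ 1) (hk : 0 < k)
    (hCac : ∀ r ρ, R / 2 ≤ r → 0 < ρ → r + 2 * ρ ≤ R →
      ∃ τ, CaccioppoliEstimate K adm Def F T α β p q b₀ C x₀ R r ρ τ)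
    (hT : ∀ᵐ t ∂volume.restrict (Ioo (b - (R / 4) ^ α) b), T (u t) ≤ Tm)
    (hf : ∀ᵐ t ∂volume.restrict (Ioo (b - (R / 4) ^ α) b),
      ∀ᵐ x ∂volume.restrict (Metric.ball x₀ (2 * R)), ‖f t x‖ₑ ≤ Fm)
    (hTm : Tm ≤ ENNReal.ofReal (k / δ)) (hFm : Fm ≤ ENNReal.ofReal (k / (δ * R ^ α)))
    (hcα : (R / 4) ^ α = (R / 8) ^ α + cα * R ^ α) (hcα0 : 0 < cα) (hs : 1 ≤ s) :
    ∫⁻ t in Ioo (b - (R / 8) ^ α - s⁻¹ / 2 * (cα * R ^ α)) b,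
      sqNorm q (Metric.ball x₀ (R / 2 + s⁻¹ * (R / 4)))
        (fun x => max (u t x - (1 - s⁻¹ / 2) * k) 0) ≤
      ENNReal.ofReal ((k / (4 * s)) ^ (-2 * (κ - 1)) * (2 * b₀)⁻¹ *
        ((2 * (volume (Metric.ball (0 : Eu d) 1) ^ (1 - 1 / q)).toReal / cα +
          34 * C * 8 ^ (d + α) + 8 * (C * 8 ^ (d + α) + 1) *
          (volume (Metric.ball (0 : Eu d) 1) ^ (1 - 1 / q)).toReal) * s ^ (d + α + 2) *
          (R ^ (-β) * δ⁻¹)) ^ κ) *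
      (∫⁻ t in Ioo (b - (R / 8) ^ α - s⁻¹ * (cα * R ^ α)) b,
        sqNorm q (Metric.ball x₀ (R / 2 + s⁻¹ * (R / 2)))
          (fun x => max (u t x - (1 - s⁻¹) * k) 0)) ^ κ := by
  have hs0 : 0 < s := by linarith
  have hP : 0 < cα * R ^ α := by positivity
  have hR8 : 0 < (R / 8) ^ α := by positivity
  have hRα : 0 < R ^ α := by positivity
  have hq1 : 0 ≤ 1 - 1 / q := by
    rw [sub_nonneg, div_le_one (by linarith)]; exact hq
  have hv0 : 0 ≤ (volume (Metric.ball (0 : Eu d) 1) ^ (1 - 1 / q)).toReal :=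
    ENNReal.toReal_nonneg
  have hh : 0 < k / (4 * s) := by positivity
  have hRρ : R / (s⁻¹ * R / 8) = 8 * s := by field_simp
  have hhs : k / (4 * s) = s⁻¹ * k / 4 := by field_simp
  have hσ : b - (R / 8) ^ α - s⁻¹ / 2 * (cα * R ^ α) - (b - (R / 8) ^ α - s⁻¹ * (cα * R ^ α)) =
      (2 * s)⁻¹ * (cα * R ^ α) := by field_simp; ring
  have hs1 : s⁻¹ ≤ 1 := inv_le_one_of_one_le₀ hs
  have hsi : 0 < s⁻¹ := by positivity
  generalize s⁻¹ = e at *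
  have hρ : 0 < e * R / 8 := by positivity
  have hrr : R / 2 + e * (R / 4) + 2 * (e * R / 8) = R / 2 + e * (R / 2) := by ring
  have heR : e * R ≤ R := mul_le_of_le_one_left hR.le hs1
  have heR0 : 0 < e * R := by positivity
  have heP : e * (cα * R ^ α) ≤ cα * R ^ α := mul_le_of_le_one_left hP.le hs1
  have heP0 : 0 < e * (cα * R ^ α) := by positivity
  have hek : e * k ≤ k := mul_le_of_le_one_left hk.le hs1
  have hek0 : 0 < e * k := by positivity
  have hrR : R / 2 + e * (R / 2) ≤ R := by linarith
  obtain ⟨τ, hτ⟩ := hCac (R / 2 + e * (R / 4)) (e * R / 8) (by linarith) hρ (hrr.trans_le hrR)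
  have hvol : volume (Metric.ball x₀ (R / 2 + e * (R / 4) + 2 * (e * R / 8))) ^
      (1 - 1 / q) ≤ ENNReal.ofReal
        ((volume (Metric.ball (0 : Eu d) 1) ^ (1 - 1 / q)).toReal * R ^ (α - β)) := by
    rw [hrr, show α - β = d * (1 - 1 / q) by rw [hβ]; ring]
    exact volume_ball_rpow_le hrR hR hq1
  have hΓ := deGiorgi_factor_le (d := d) (β := β) hα hC hv0 hR hδ hδ1 hk hs hcα0
  generalize (volume (Metric.ball (0 : Eu d) 1) ^ (1 - 1 / q)).toReal = v at *
  have hC₂0 : 0 < 2 * v / cα + 34 * C * 8 ^ (d + α) + 8 * (C * 8 ^ (d + α) + 1) * v := by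
    positivity
  generalize 2 * v / cα + 34 * C * 8 ^ (d + α) + 8 * (C * 8 ^ (d + α) + 1) * v = C₂ at *
  have key := hu.deGiorgi_step hτ hb₀ hρ hR (hrr.trans_le hrR) hp hq hκ hpq
    (k := (1 - e) * k) (h := k / (4 * s)) (mul_nonneg (by linarith) hk.le) hh hT hf
    (σ₀ := b - (R / 8) ^ α - e * (cα * R ^ α))
    (σ₁ := b - (R / 8) ^ α - e / 2 * (cα * R ^ α))
    (by rw [hcα]; linarith) (by linarith) (by linarith)
    (Γ := ENNReal.ofReal (C₂ * s ^ (d + α + 2) * (R ^ (-β) * δ⁻¹))) ?_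
  · rw [hrr, show (1 - e) * k + k / (4 * s) + k / (4 * s) = (1 - e / 2) * k by
      rw [hhs]; ring] at key
    refine key.trans_eq ?_
    rw [ENNReal.mul_rpow_of_nonneg _ _ (by linarith), ENNReal.ofReal_rpow_of_pos (by positivity),
      ENNReal.ofReal_mul (q := (_ : ℝ) ^ κ) (by positivity),
      ENNReal.ofReal_mul (q := (2 * b₀)⁻¹) (by positivity),
      ENNReal.ofReal_inv_of_pos (by positivity), ENNReal.ofReal_mul zero_le_two,
      ENNReal.ofReal_ofNat, mul_assoc]
    simp only [mul_assoc]
  · rw [hσ, hRρ]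
    refine le_trans (add_le_add (mul_le_mul' le_rfl hvol) (mul_le_mul' le_rfl
      (add_le_add (mul_le_mul' le_rfl (ENNReal.ofReal_le_ofReal
        (show 1 + (((1 - e) * k + k / (4 * s)) / (k / (4 * s))) ^ 2 ≤
          1 + (4 * s) ^ 2 from ?_))) (mul_le_mul' (add_le_add (mul_le_mul' le_rfl hTm) hFm)
        (mul_le_mul' le_rfl hvol))))) ?_
    · refine add_le_add le_rfl (pow_le_pow_left₀ ?_ ?_ 2)
      · exact div_nonneg (add_nonneg (mul_nonneg (by linarith) hk.le) hh.le) hh.le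
      · rw [div_le_iff₀ hh, mul_div_cancel₀ _ (by positivity), hhs]
        linarith
    · rw [ofReal_deGiorgi_factor (by positivity) (by positivity) (by positivity) (by positivity)
        (by positivity) (by positivity) (by positivity) (by positivity)]
      exact ENNReal.ofReal_le_ofReal hΓ

theorem exists_pointwise_le_of_small_energy {α β p q κ b₀ C : ℝ} (hα : 0 < α)
    (hβ : β = d * (κ - 1)) (hβ' : β = α - d * (1 - 1 / q)) (hb₀ : 0 < b₀) (hC : 0 < C)
    (hp : 0 < p) (hq : 1 ≤ q) (hκ : 1 < κ) (hpq : κ - 1 + 1 / p = 1 / q) :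
    ∃ c : ℝ, 0 < c ∧ ∀ (K : Eu d → Eu d → ℝ≥0∞) (adm : (Eu d → ℝ) → Prop)
      (Def : (Eu d → ℝ) → (Eu d → ℝ) → Prop) (F : (Eu d → ℝ) → (Eu d → ℝ) → ℝ)
      (T : (Eu d → ℝ) → ℝ≥0∞) (f u g : ℝ → Eu d → ℝ) (x₀ : Eu d) (R δ b k : ℝ) (Tm Fm : ℝ≥0∞),
      0 < R → 0 < δ → δ ≤ 1 → 0 < k →
      (∀ r ρ, R / 2 ≤ r → 0 < ρ → r + 2 * ρ ≤ R →
        ∃ τ, CaccioppoliEstimate K adm Def F T α β p q b₀ C x₀ R r ρ τ) →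
      IsFormSubsolution K (b - (R / 4) ^ α) b (Metric.ball x₀ (2 * R)) adm Def F f u g →
      (∀ᵐ t ∂volume.restrict (Ioo (b - (R / 4) ^ α) b), T (u t) ≤ Tm) →
      (∀ᵐ t ∂volume.restrict (Ioo (b - (R / 4) ^ α) b),
        ∀ᵐ x ∂volume.restrict (Metric.ball x₀ (2 * R)), ‖f t x‖ₑ ≤ Fm) →
      Tm ≤ ENNReal.ofReal (k / δ) → Fm ≤ ENNReal.ofReal (k / (δ * R ^ α)) →
      ∫⁻ t in Ioo (b - (R / 4) ^ α) b, sqNorm q (Metric.ball x₀ R) (u t) ≤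
        ENNReal.ofReal (c * (δ ^ (κ / (κ - 1)) * R ^ (d * κ) * k ^ 2)) →
      ∀ᵐ t ∂volume.restrict (Ioo (b - (R / 8) ^ α) b),
        ∀ᵐ x ∂volume.restrict (Metric.ball x₀ (R / 2)), u t x ≤ k := by
  set v := (volume (Metric.ball (0 : Eu d) 1) ^ (1 - 1 / q)).toReal with hv
  have hv0 : 0 ≤ v := ENNReal.toReal_nonneg
  set cα : ℝ := (1 / 4) ^ α - (1 / 8) ^ α with hcα
  have hcα0 : 0 < cα :=
    sub_pos.2 (Real.rpow_lt_rpow (by norm_num) (by norm_num) hα)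
  set C₂ := 2 * v / cα + 34 * C * 8 ^ (d + α) + 8 * (C * 8 ^ (d + α) + 1) * v with hC₂
  have hC₂0 : 0 < C₂ := by positivity
  set N := 2 * (κ - 1) + κ * (d + α + 2) with hN
  have hκ1 : 0 < κ - 1 := by linarith
  have hκ0 : 0 < κ := by linarith
  have hN0 : 0 < N := by positivity
  set G₀ := 16 ^ (κ - 1) * (2 * b₀)⁻¹ * C₂ ^ κ with hG₀
  have hG₀0 : 0 < G₀ := by positivity
  set Λ : ℝ := 2 ^ (-N / (κ - 1)) with hΛ
  have hΛ0 : 0 < Λ := by positivity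
  refine ⟨(Λ / G₀) ^ (1 / (κ - 1)), by positivity, ?_⟩
  intro K adm Def F T f u g x₀ R δ b k Tm Fm hR hδ hδ1 hk hCac hu hT hf hTm hFm hY0
  have hum : ∀ t, Measurable (u t) := fun t => hu.measurable_u.of_uncurry_left
  have hq0 : 0 < q := by linarith
  have hq1 : 0 ≤ 1 - 1 / q := by
    rw [sub_nonneg, div_le_one hq0]; exact hq
  have hR4 : (R / 4) ^ α = (R / 8) ^ α + cα * R ^ α := by
    rw [hcα, sub_mul, ← Real.mul_rpow (by norm_num) hR.le, ← Real.mul_rpow (by norm_num) hR.le,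
      one_div_mul_eq_div, one_div_mul_eq_div]
    ring
  have hP := Real.rpow_pos_of_pos hR α
  set e : ℕ → ℝ := fun j => ((2 : ℝ) ^ j)⁻¹ with he
  have he0 : ∀ j, 0 < e j := fun j => by positivity
  have he1 : ∀ j, e j ≤ 1 := fun j => inv_le_one_of_one_le₀ (one_le_pow₀ (by norm_num))
  have hes : ∀ j, e (j + 1) = e j / 2 := fun j => by
    simp only [he, pow_succ]; field_simp
  set Y : ℕ → ℝ≥0∞ := fun j => ∫⁻ t in Ioo (b - (R / 8) ^ α - e j * (cα * R ^ α)) b,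
    sqNorm q (Metric.ball x₀ (R / 2 + e j * (R / 2))) (fun x => max (u t x - (1 - e j) * k) 0)
    with hY
  set x := R ^ (-β) * δ⁻¹ with hx
  have hx0 : 0 < x := by positivity
  have hstep : ∀ j, Y (j + 1) ≤ ENNReal.ofReal (G₀ * k ^ (-2 * (κ - 1)) * x ^ κ) *
      ENNReal.ofReal (2 ^ N) ^ j * Y j ^ κ := by
    intro j
    have hrr : R / 2 + e (j + 1) * (R / 2) = R / 2 + e j * (R / 4) := by rw [hes]; ring
    have hkk : (1 - e (j + 1)) * k = (1 - e j / 2) * k := by rw [hes]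
    have hσσ : e (j + 1) * (cα * R ^ α) = e j / 2 * (cα * R ^ α) := by rw [hes]
    have key := hu.deGiorgi_step_geometric hα hβ' hb₀ hC hp hq hκ.le hpq hR hδ hδ1 hk hCac hT hf
      hTm hFm hR4 hcα0 (one_le_pow₀ (by norm_num) : (1 : ℝ) ≤ 2 ^ j)
    simp only [hY, hrr, hkk, hσσ]
    refine key.trans_eq (congrArg₂ _ ?_ rfl)
    rw [deGiorgi_constant_eq hC₂0 hk (by positivity) hx0, ENNReal.ofReal_mul (by positivity),
      ← ENNReal.ofReal_pow (by positivity), ← Real.rpow_natCast_mul (by norm_num),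
      ← Real.rpow_mul_natCast (by norm_num), mul_comm (j : ℝ)]
  have e0 : e 0 = 1 := by simp [he]
  have hY0' : Y 0 ≤ ENNReal.ofReal ((Λ / G₀) ^ (1 / (κ - 1)) *
      (δ ^ (κ / (κ - 1)) * R ^ (d * κ) * k ^ 2)) := by
    refine le_trans ?_ hY0
    simp only [hY, e0]
    rw [hR4, show b - (R / 8) ^ α - 1 * (cα * R ^ α) = b - ((R / 8) ^ α + cα * R ^ α) by ring,
      show R / 2 + 1 * (R / 2) = R by ring]
    refine lintegral_mono fun t => sqNorm_mono hq0.le subset_rfl (fun x _ => ?_)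
      measurableSet_ball
    simp only [sub_self, zero_mul, sub_zero]
    rw [← sq_abs (u t x)]
    exact pow_le_pow_left₀ (le_max_right _ _) (max_le (le_abs_self _) (abs_nonneg _)) 2
  set Z := ∫⁻ t in Ioo (b - (R / 8) ^ α) b,
    sqNorm q (Metric.ball x₀ (R / 2)) (fun x => max (u t x - k) 0) with hZ
  have hZ0 : Z = 0 := by
    refine eq_zero_of_fast_recursion (Λ := ENNReal.ofReal Λ) hκ.le hstep ?_ ?_ ?_
      (hY0'.trans_lt ENNReal.ofReal_lt_top).ne fun j => ?_
    · rw [ENNReal.ofReal_rpow_of_pos hΛ0, ← ENNReal.ofReal_mul (by positivity), hΛ,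
        ← Real.rpow_mul (by norm_num), div_mul_cancel₀ _ hκ1.ne', ← Real.rpow_add (by norm_num)]
      simp
    · rw [ENNReal.ofReal_lt_one]
      exact Real.rpow_lt_one_of_one_lt_of_neg (by norm_num)
        (div_neg_of_neg_of_pos (by linarith) hκ1)
    · refine (mul_le_mul' le_rfl (ENNReal.rpow_le_rpow hY0' hκ1.le)).trans ?_
      rw [ENNReal.ofReal_rpow_of_pos (by positivity), ← ENNReal.ofReal_mul (by positivity)]
      refine ENNReal.ofReal_le_ofReal (le_of_eq ?_)
      rw [hx, hβ]
      exact deGiorgi_threshold_eq hκ1 hG₀0 hΛ0 hk hR hδ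
    · refine (lintegral_mono_set (Ioo_subset_Ioo_left ?_)).trans (lintegral_mono fun t =>
        sqNorm_posPart_mono hq0.le (Metric.ball_subset_ball ?_) ?_ measurableSet_ball)
      · have := he0 j
        have : 0 ≤ e j * (cα * R ^ α) := by positivity
        linarith
      · have := he0 j
        nlinarith
      · nlinarith [he0 j]
  have hwm : Measurable (Function.uncurry fun t x => max (u t x - k) 0) :=
    (hu.measurable_u.sub_const k).max measurable_const
  rw [hZ, lintegral_eq_zero_iff (measurable_sqNorm hwm q _)] at hZ0
  filter_upwards [hZ0] with t ht
  have ht : sqNorm q (Metric.ball x₀ (R / 2)) (fun x => max (u t x - k) 0) = 0 := ht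
  have hm : Measurable fun x => ENNReal.ofReal (max (u t x - k) 0 ^ 2) ^ q :=
    (((hwm.of_uncurry_left).pow_const 2).ennreal_ofReal).pow_const q
  rw [sqNorm, ENNReal.rpow_eq_zero_iff_of_pos (by positivity), lintegral_eq_zero_iff hm] at ht
  filter_upwards [ht] with y hy
  have hy : ENNReal.ofReal (max (u t y - k) 0 ^ 2) ^ q = 0 := hy
  rw [ENNReal.rpow_eq_zero_iff_of_pos hq0, ENNReal.ofReal_eq_zero] at hy
  by_contra hlt
  rw [not_le] at hlt
  rw [max_eq_left (by linarith)] at hy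
  have : 0 < (u t y - k) ^ 2 := pow_pos (by linarith) 2
  linarith

end DeGiorgiIteration

/-! ### Measurable representatives of weak subsolutions -/

section Representatives

open Filter Topology

variable {d : ℕ} {K : Eu d → Eu d → ℝ≥0∞} {v w φ : Eu d → ℝ}

theorem energy_congr_ae (h : v =ᵐ[volume] w) (k : Eu d → Eu d → ℝ≥0∞) (A B : Set (Eu d)) :
    energy k A B v = energy k A B w := by
  refine lintegral_congr_ae ((ae_restrict_of_ae h).mono fun x hx => ?_)
  refine lintegral_congr_ae ((ae_restrict_of_ae h).mono fun y hy => ?_)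
  simp only [hx, hy]

theorem normSqV_congr_ae (h : v =ᵐ[volume] w) (D : Set (Eu d)) :
    normSqV K D v = normSqV K D w := by
  rw [normSqV, normSqV, energy_congr_ae h, eLpNorm_congr_ae (ae_restrict_of_ae h)]

theorem ae_prod_of_ae_eq (h : v =ᵐ[volume] w) :
    ∀ᵐ z : Eu d × Eu d, v z.1 = w z.1 ∧ v z.2 = w z.2 :=
  (Measure.quasiMeasurePreserving_fst.ae h).and (Measure.quasiMeasurePreserving_snd.ae h)

theorem symIntegrand_congr_left (h : v =ᵐ[volume] w) (φ : Eu d → ℝ) :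
    symIntegrand K v φ =ᵐ[volume] symIntegrand K w φ :=
  (ae_prod_of_ae_eq h).mono fun z hz => by simp only [symIntegrand, hz.1, hz.2]

theorem antiIntegrand_congr_left (h : v =ᵐ[volume] w) (φ : Eu d → ℝ) :
    antiIntegrand K v φ =ᵐ[volume] antiIntegrand K w φ :=
  (ae_prod_of_ae_eq h).mono fun z hz => by simp only [antiIntegrand, hz.1, hz.2]

theorem symIntegrand_congr_right (h : v =ᵐ[volume] w) (φ : Eu d → ℝ) :
    symIntegrand K φ v =ᵐ[volume] symIntegrand K φ w :=
  (ae_prod_of_ae_eq h).mono fun z hz => by simp only [symIntegrand, hz.1, hz.2]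

theorem antiIntegrand_congr_right (h : v =ᵐ[volume] w) (φ : Eu d → ℝ) :
    antiIntegrand K φ v =ᵐ[volume] antiIntegrand K φ w :=
  (ae_prod_of_ae_eq h).mono fun z hz => by simp only [antiIntegrand, hz.1, hz.2]

theorem tail_congr_ae (h : v =ᵐ[volume] w) (α R : ℝ) (x₀ : Eu d) :
    tail K α v R x₀ = tail K α w R x₀ := by
  have h1 : ∫⁻ y in Metric.ball x₀ (2 * R) \ Metric.ball x₀ (R / 2),
        ‖v y‖ₑ / edist x₀ y ^ ((d : ℝ) + α) =
      ∫⁻ y in Metric.ball x₀ (2 * R) \ Metric.ball x₀ (R / 2),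
        ‖w y‖ₑ / edist x₀ y ^ ((d : ℝ) + α) :=
    lintegral_congr_ae ((ae_restrict_of_ae h).mono fun y hy => by simp only [hy])
  have h2 : ∀ x, ∫⁻ y in (Metric.ball x₀ (2 * R))ᶜ, ‖v y‖ₑ * K x y =
      ∫⁻ y in (Metric.ball x₀ (2 * R))ᶜ, ‖w y‖ₑ * K x y := fun x =>
    lintegral_congr_ae ((ae_restrict_of_ae h).mono fun y hy => by simp only [hy])
  rw [tail, tail, h1]
  simp only [h2]

theorem measurable_normSqV (hK : Measurable (Function.uncurry K)) {u : ℝ → Eu d → ℝ}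
    (hu : Measurable (Function.uncurry u)) (D : Set (Eu d)) :
    Measurable fun t => normSqV K D (u t) := by
  have h1 : Measurable fun t => ∫⁻ x in D, ENNReal.ofReal (u t x ^ 2) := by
    have : Measurable fun z : ℝ × Eu d => ENNReal.ofReal (u z.1 z.2 ^ 2) :=
      (hu.pow_const 2).ennreal_ofReal
    exact this.lintegral_prod_right'
  have h2 : Measurable fun t => energy (symPart K) D univ (u t) := by
    have h3 : Measurable fun z : (ℝ × Eu d) × Eu d => ENNReal.ofReal
        ((u z.1.1 z.1.2 - u z.1.1 z.2) ^ 2) * symPart K z.1.2 z.2 := by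
      have e1 : Measurable fun z : (ℝ × Eu d) × Eu d => u z.1.1 z.1.2 := hu.comp measurable_fst
      have e2 : Measurable fun z : (ℝ × Eu d) × Eu d => u z.1.1 z.2 :=
        hu.comp (measurable_fst.fst.prodMk measurable_snd)
      have e3 : Measurable fun z : (ℝ × Eu d) × Eu d => symPart K z.1.2 z.2 :=
        (measurable_symPart hK).comp (measurable_fst.snd.prodMk measurable_snd)
      exact ((e1.sub e2).pow_const 2).ennreal_ofReal.mul e3
    have h4 : Measurable fun z : ℝ × Eu d => ∫⁻ y in univ, ENNReal.ofReal
        ((u z.1 z.2 - u z.1 y) ^ 2) * symPart K z.2 y := h3.lintegral_prod_right'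
    exact h4.lintegral_prod_right'
  simp only [normSqV, lintegral_sq_eq]
  exact h1.add h2

theorem ae_lt_top_of_lintegral_Icc {N : ℝ → ℝ≥0∞} (hN : Measurable N) {a b : ℝ}
    (h : ∀ q, q < b → ∫⁻ t in Icc a q, N t < ∞) :
    ∀ᵐ t ∂volume.restrict (Ioo a b), N t < ∞ := by
  have hU : Ioo a b ⊆ ⋃ n : ℕ, Icc a (b - 1 / (n + 1)) := by
    intro t ht
    obtain ⟨n, hn⟩ := exists_nat_one_div_lt (show 0 < b - t by linarith [ht.2])
    exact mem_iUnion.2 ⟨n, ht.1.le, by linarith⟩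
  refine ae_restrict_of_ae_restrict_of_subset hU ((ae_restrict_iUnion_iff _ _).2 fun n => ?_)
  refine ae_lt_top hN (h _ ?_).ne
  have : (0 : ℝ) < 1 / (n + 1) := by positivity
  linarith

theorem ae_ae_swap_of_ae_prod {X Y : Type*} [MeasurableSpace X] [MeasurableSpace Y]
    {μ : Measure X} {ν : Measure Y} [SFinite μ] [SFinite ν] {P : X → Y → Prop}
    (h : ∀ᵐ z ∂μ.prod ν, P z.1 z.2) : ∀ᵐ y ∂ν, ∀ᵐ x ∂μ, P x y :=
  Measure.ae_ae_of_ae_prod (p := fun z => P z.2 z.1)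
    (Measure.measurePreserving_swap.quasiMeasurePreserving.ae h)

theorem setIntegral_Ioo_eq_of_tsupport {a' a b : ℝ} (ha : a' ≤ a) {η F : ℝ → ℝ}
    (hη : tsupport η ⊆ Ioo a b) (hF : ∀ t, t ∉ tsupport η → F t = 0) :
    ∫ t in Ioo a' b, F t = ∫ t in Ioo a b, F t :=
  setIntegral_eq_of_subset_of_forall_sdiff_eq_zero measurableSet_Ioo
    (Ioo_subset_Ioo_left ha) fun t ht => hF t fun h => ht.2 (hη h)

theorem exists_isFormSubsolution {a' a b : ℝ} (ha : a' < a) {D : Set (Eu d)}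
    (hDt : volume D ≠ ∞) (hK : Measurable (Function.uncurry K))
    {Def : (Eu d → ℝ) → (Eu d → ℝ) → Prop} {F : (Eu d → ℝ) → (Eu d → ℝ) → ℝ}
    (hDef : ∀ v w φ, v =ᵐ[volume] w → Def w φ → Def v φ)
    (hF : ∀ v w φ, v =ᵐ[volume] w → F v φ = F w φ) {f u g : ℝ → Eu d → ℝ}
    (hu : MemL2locV K (Ioo a' b) D u) (hg : IsWeakTimeDeriv (Ioo a' b) D u g)
    (hle : ∀ᵐ t ∂volume.restrict (Ioo a' b), ∀ φ, MemH K D φ → (∀ x, 0 ≤ φ x) → Def (u t) φ →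
      (∫ x in D, g t x * φ x) + F (u t) φ ≤ ∫ x in D, f t x * φ x)
    (hpos : ∀ᵐ z ∂(volume.restrict (Ioo a' b)).prod (volume : Measure (Eu d)), 0 ≤ u z.1 z.2) :
    ∃ u' g' : ℝ → Eu d → ℝ,
      (∀ᵐ z ∂(volume.restrict (Ioo a' b)).prod (volume : Measure (Eu d)),
        u z.1 z.2 = u' z.1 z.2) ∧
      IsFormSubsolution K a b D (IsAdmissible K D) Def F f u' g' := by
  obtain ⟨hum, hul⟩ := hu
  obtain ⟨hgm, hgl, hw⟩ := hg
  set u' : ℝ → Eu d → ℝ := fun t x => max (hum.mk _ (t, x)) 0 with hu'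
  set g' : ℝ → Eu d → ℝ := fun t x => hgm.mk _ (t, x) with hg'
  have hum' : Measurable (Function.uncurry u') := hum.measurable_mk.max measurable_const
  have hgm' : Measurable (Function.uncurry g') := hgm.measurable_mk
  have huu : ∀ᵐ z ∂(volume.restrict (Ioo a' b)).prod (volume : Measure (Eu d)),
      u z.1 z.2 = u' z.1 z.2 := by
    filter_upwards [hum.ae_eq_mk, hpos] with z h1 h2
    have h1 : u z.1 z.2 = hum.mk _ z := h1
    simp only [hu', ← h1, max_eq_left h2]
  have hgg : ∀ᵐ z ∂(volume.restrict (Ioo a' b)).prod (volume.restrict D),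
      g z.1 z.2 = g' z.1 z.2 := hgm.ae_eq_mk
  have hut : ∀ᵐ t ∂volume.restrict (Ioo a' b), u t =ᵐ[volume] u' t :=
    Measure.ae_ae_of_ae_prod huu
  have hgt : ∀ᵐ t ∂volume.restrict (Ioo a' b), g t =ᵐ[volume.restrict D] g' t :=
    Measure.ae_ae_of_ae_prod hgg
  have hux : ∀ᵐ x ∂volume.restrict D, ∀ᵐ t ∂volume.restrict (Ioo a' b), u t x = u' t x :=
    ae_restrict_of_ae (ae_ae_swap_of_ae_prod huu)
  have hgx : ∀ᵐ x ∂volume.restrict D, ∀ᵐ t ∂volume.restrict (Ioo a' b), g t x = g' t x :=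
    ae_ae_swap_of_ae_prod hgg
  have hsub : Ioo a b ⊆ Ioo a' b := Ioo_subset_Ioo_left ha.le
  have hIcc : ∀ q, q < b → Icc a q ⊆ Ioo a' b := fun q hq t ht =>
    ⟨ha.trans_le ht.1, ht.2.trans_lt hq⟩
  have hN : ∀ q, q < b → ∫⁻ t in Icc a q, normSqV K D (u' t) < ∞ := fun q hq => by
    refine lt_of_eq_of_lt (lintegral_congr_ae ?_) (hul _ isCompact_Icc (hIcc q hq))
    exact (ae_restrict_of_ae_restrict_of_subset (hIcc q hq) hut).mono fun t ht =>
      (normSqV_congr_ae ht D).symm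
  refine ⟨u', g', huu, ⟨hum', hgm', hDt, fun p q hp hq => ?_, fun p q hp hq => ?_,
    fun η hη hηc hηs => ?_⟩, ?_, ?_⟩
  · refine lt_of_le_of_lt ?_ (hN q hq)
    refine (lintegral_mono fun t => ?_).trans (lintegral_mono_set (Icc_subset_Icc_left hp.le))
    rw [normSqV, lintegral_sq_eq]
    exact le_self_add
  · refine lt_of_le_of_lt ?_ (hgl _ isCompact_Icc (hIcc q hq))
    refine le_trans (le_of_eq (lintegral_congr_ae ?_))
      (lintegral_mono_set (Icc_subset_Icc_left hp.le))
    refine (ae_restrict_of_ae_restrict_of_subset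
      ((Icc_subset_Icc_left hp.le).trans (hIcc q hq)) hgt).mono fun t ht => ?_
    simp only [eLpNorm_congr_ae ht]
    rw [eLpNorm_eq_lintegral_rpow_enorm_toReal (by norm_num) (by norm_num)]
    simp
  · filter_upwards [hw η hη hηc (hηs.trans hsub), hux, hgx] with x h1 h2 h3
    rw [setIntegral_Ioo_eq_of_tsupport ha.le hηs fun t ht => by
        rw [image_eq_zero_of_notMem_tsupport fun h => ht (tsupport_deriv_subset h), zero_mul],
      setIntegral_Ioo_eq_of_tsupport ha.le hηs fun t ht => by
        rw [image_eq_zero_of_notMem_tsupport ht, zero_mul]] at h1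
    have e1 : ∫ t in Ioo a b, deriv η t * u' t x = ∫ t in Ioo a b, deriv η t * u t x :=
      integral_congr_ae ((ae_restrict_of_ae_restrict_of_subset hsub h2).mono fun t ht => by
        simp only [ht])
    have e2 : ∫ t in Ioo a b, η t * g' t x = ∫ t in Ioo a b, η t * g t x :=
      integral_congr_ae ((ae_restrict_of_ae_restrict_of_subset hsub h3).mono fun t ht => by
        simp only [ht])
    rw [e1, e2, h1]
  · filter_upwards [ae_lt_top_of_lintegral_Icc (measurable_normSqV hK hum' D) hN] with t ht
    exact ⟨hum'.of_uncurry_left, fun x => le_max_right _ _, ht⟩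
  · filter_upwards [ae_restrict_of_ae_restrict_of_subset hsub hle,
      ae_restrict_of_ae_restrict_of_subset hsub hut,
      ae_restrict_of_ae_restrict_of_subset hsub hgt] with t h1 h2 h3 φ hφ hφ0 hd
    have h4 := h1 φ hφ hφ0 (hDef _ _ _ h2 hd)
    rw [hF _ _ _ h2] at h4
    have e1 : ∫ x in D, g' t x * φ x = ∫ x in D, g t x * φ x :=
      integral_congr_ae (h3.mono fun x hx => by simp only [hx])
    rwa [e1]

end Representatives

/-! ### Local boundedness -/

section LocalBoundedness

open Filter Topology

variable {d : ℕ}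

theorem le_ofReal_div_of_ofReal_mul_le {s k : ℝ} (hs : 0 < s) {X : ℝ≥0∞}
    (h : ENNReal.ofReal s * X ≤ ENNReal.ofReal k) : X ≤ ENNReal.ofReal (k / s) := by
  rw [ENNReal.ofReal_div_of_pos hs, ENNReal.le_div_iff_mul_le (Or.inl (by simpa using hs))
    (Or.inl ENNReal.ofReal_ne_top), mul_comm]
  exact h

theorem ofReal_sq_mul_le {s k : ℝ} (hs : 0 < s) (hk : 0 < k) {X : ℝ≥0∞}
    (h : ENNReal.ofReal s * X ^ (1 / 2 : ℝ) ≤ ENNReal.ofReal k) :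
    ENNReal.ofReal (s ^ 2) * X ≤ ENNReal.ofReal (k ^ 2) := by
  have h2 := ENNReal.rpow_le_rpow h zero_le_two
  rwa [ENNReal.mul_rpow_of_nonneg _ _ zero_le_two, ← ENNReal.rpow_mul,
    ENNReal.ofReal_rpow_of_pos hs, ENNReal.ofReal_rpow_of_pos hk,
    show (1 / 2 : ℝ) * 2 = 1 by norm_num, ENNReal.rpow_one, Real.rpow_two, Real.rpow_two] at h2

theorem essSup_le_of_forall_pos {X : Type*} [MeasurableSpace X] {μ : Measure X} {v : X → ℝ}
    {M : ℝ≥0∞} (h : ∀ k : ℝ, 0 < k → M ≤ ENNReal.ofReal k → ∀ᵐ x ∂μ, v x ≤ k) :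
    essSup (fun x => ENNReal.ofReal (v x)) μ ≤ M := by
  by_cases hM : M = ∞
  · simp [hM]
  refine ENNReal.le_of_forall_pos_le_add fun ε hε _ => ?_
  have hk : M + ε = ENNReal.ofReal (M.toReal + ε) := by
    rw [ENNReal.ofReal_add ENNReal.toReal_nonneg ε.coe_nonneg, ENNReal.ofReal_toReal hM]
    simp
  have hpos : 0 < M.toReal + (ε : ℝ) := add_pos_of_nonneg_of_pos ENNReal.toReal_nonneg hε
  refine essSup_le_of_ae_le _ ((h _ hpos (hk ▸ le_self_add)).mono fun x hx => ?_)
  rw [hk]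
  exact ENNReal.ofReal_le_ofReal hx

theorem lintegral_sqNorm_eq_laverage {q α R a b : ℝ} (hq : 0 < q) (hR : 0 < R)
    (hab : b - a = (R / 4) ^ α) (u : ℝ → Eu d → ℝ) (x₀ : Eu d) :
    ∫⁻ t in Ioo a b, sqNorm q (Metric.ball x₀ R) (u t) =
      ENNReal.ofReal ((1 / 4) ^ α * (volume (Metric.ball (0 : Eu d) 1)).toReal ^ (1 / q) *
        R ^ (α + d / q)) *
        ⨍⁻ t in Ioo a b, (⨍⁻ x in Metric.ball x₀ R, ‖u t x‖ₑ ^ (2 * q) ∂volume) ^ (1 / q)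
          ∂volume := by
  have hV : 0 < (volume (Metric.ball (0 : Eu d) 1)).toReal :=
    ENNReal.toReal_pos (Metric.measure_ball_pos _ _ one_pos).ne' measure_ball_lt_top.ne
  have hB : volume (Metric.ball x₀ R) ^ (1 / q) = ENNReal.ofReal
      ((volume (Metric.ball (0 : Eu d) 1)).toReal ^ (1 / q) * R ^ (d / q)) := by
    rw [Measure.addHaar_ball_of_pos _ _ hR, finrank_euclideanSpace_fin,
      ENNReal.mul_rpow_of_nonneg _ _ (by positivity), ENNReal.ofReal_mul (by positivity),
      ← ENNReal.ofReal_rpow_of_pos hV, ENNReal.ofReal_toReal measure_ball_lt_top.ne,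
      ENNReal.ofReal_rpow_of_pos (by positivity), ← Real.rpow_natCast_mul hR.le,
      mul_one_div, mul_comm]
  have hX : ∀ t, (⨍⁻ x in Metric.ball x₀ R, ‖u t x‖ₑ ^ (2 * q) ∂volume) ^ (1 / q) =
      sqNorm q (Metric.ball x₀ R) (u t) * (volume (Metric.ball x₀ R) ^ (1 / q))⁻¹ := fun t => by
    rw [setLAverage_eq, ENNReal.div_rpow_of_nonneg _ _ (by positivity), ENNReal.div_eq_inv_mul,
      mul_comm, sqNorm]
    congr 2
    refine lintegral_congr fun x => ?_
    rw [ENNReal.rpow_mul, ← sq_abs, ← Real.norm_eq_abs, ENNReal.ofReal_pow (norm_nonneg _),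
      ofReal_norm, ENNReal.rpow_two]
  have hβ : 0 < (volume (Metric.ball (0 : Eu d) 1)).toReal ^ (1 / q) * R ^ (d / q) := by
    positivity
  simp only [hX]
  rw [setLAverage_eq, hB, ← ENNReal.ofReal_inv_of_pos hβ,
    lintegral_mul_const' _ _ ENNReal.ofReal_ne_top, Real.volume_Ioo, hab,
    ENNReal.div_eq_inv_mul, ← ENNReal.ofReal_inv_of_pos (by positivity),
    mul_comm (lintegral _ _), ← mul_assoc, ← mul_assoc, ← ENNReal.ofReal_mul (by positivity),
    ← ENNReal.ofReal_mul (by positivity)]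
  have : R / 4 = 1 / 4 * R := by ring
  rw [Real.rpow_add hR, this, Real.mul_rpow (by norm_num) hR.le]
  have h1 := Real.rpow_pos_of_pos hR α
  have h2 := Real.rpow_pos_of_pos hR (d / q)
  have h3 := Real.rpow_pos_of_pos hV (1 / q)
  have h4 := Real.rpow_pos_of_pos (by norm_num : (0 : ℝ) < 1 / 4) α
  generalize R ^ α = P at *
  generalize R ^ (d / q) = Q at *
  generalize (volume (Metric.ball (0 : Eu d) 1)).toReal ^ (1 / q) = W at *
  generalize (1 / 4 : ℝ) ^ α = Z at *
  rw [show Z * W * (P * Q) * (Z * P)⁻¹ * (W * Q)⁻¹ = 1 by field_simp, ENNReal.ofReal_one, one_mul]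

theorem exists_essSup_le_of_caccioppoli {α β p q κ b₀ C : ℝ} (hα : 0 < α)
    (hβ : β = d * (κ - 1)) (hβ' : β = α - d * (1 - 1 / q)) (hb₀ : 0 < b₀) (hC : 0 < C)
    (hp : 0 < p) (hq : 1 ≤ q) (hκ : 1 < κ) (hpq : κ - 1 + 1 / p = 1 / q) :
    ∃ c : ℝ, 0 < c ∧ ∀ (K : Eu d → Eu d → ℝ≥0∞) (adm : (Eu d → ℝ) → Prop)
      (Def : (Eu d → ℝ) → (Eu d → ℝ) → Prop) (F : (Eu d → ℝ) → (Eu d → ℝ) → ℝ)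
      (T : (Eu d → ℝ) → ℝ≥0∞) (f u u' g' : ℝ → Eu d → ℝ) (x₀ : Eu d) (t₀ R δ : ℝ),
      0 < R → 0 < δ → δ ≤ 1 →
      (∀ r ρ, R / 2 ≤ r → 0 < ρ → r + 2 * ρ ≤ R →
        ∃ τ, CaccioppoliEstimate K adm Def F T α β p q b₀ C x₀ R r ρ τ) →
      (∀ v w, v =ᵐ[volume] w → T v = T w) →
      (∀ᵐ z ∂(volume.restrict (pastInterval α t₀ R)).prod (volume : Measure (Eu d)),
        u z.1 z.2 = u' z.1 z.2) →
      IsFormSubsolution K (t₀ - (R / 4) ^ α) t₀ (Metric.ball x₀ (2 * R)) adm Def F f u' g' →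
      essSup (fun z : ℝ × Eu d => ENNReal.ofReal (u z.1 z.2))
          (volume.restrict (pastInterval α t₀ (R / 8) ×ˢ Metric.ball x₀ (R / 2))) ≤
        ENNReal.ofReal (c * δ ^ (-(κ / (κ - 1) / 2))) *
            (⨍⁻ t in pastInterval α t₀ (R / 4), (⨍⁻ x in Metric.ball x₀ R,
              ‖u t x‖ₑ ^ (2 * q) ∂volume) ^ (1 / q) ∂volume) ^ (1 / 2 : ℝ) +
          ENNReal.ofReal δ * essSup (fun t => T (u t))
            (volume.restrict (pastInterval α t₀ (R / 4))) +
          ENNReal.ofReal (δ * R ^ α) * eLpNorm (Function.uncurry f) ∞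
            (volume.restrict (pastInterval α t₀ R ×ˢ Metric.ball x₀ (2 * R))) := by
  obtain ⟨c₁, hc₁, H⟩ := exists_pointwise_le_of_small_energy hα hβ hβ' hb₀ hC hp hq hκ hpq
  set m : ℝ := (1 / 4) ^ α * (volume (Metric.ball (0 : Eu d) 1)).toReal ^ (1 / q) with hm
  have hV : 0 < (volume (Metric.ball (0 : Eu d) 1)).toReal :=
    ENNReal.toReal_pos (Metric.measure_ball_pos _ _ one_pos).ne' measure_ball_lt_top.ne
  have hm0 : 0 < m := by positivity
  refine ⟨(m / c₁) ^ (1 / 2 : ℝ), by positivity, ?_⟩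
  intro K adm Def F T f u u' g' x₀ t₀ R δ hR hδ hδ1 hCac hT huu hu
  have hq0 : 0 < q := by linarith
  have hsub4 : Ioo (t₀ - (R / 4) ^ α) t₀ ⊆ pastInterval α t₀ R :=
    Ioo_subset_Ioo_left (sub_le_sub_left (Real.rpow_le_rpow (by positivity) (by linarith) hα.le) _)
  have hsub8 : pastInterval α t₀ (R / 8) ⊆ pastInterval α t₀ R :=
    Ioo_subset_Ioo_left (sub_le_sub_left (Real.rpow_le_rpow (by positivity) (by linarith) hα.le) _)
  have hut : ∀ᵐ t ∂volume.restrict (Ioo (t₀ - (R / 4) ^ α) t₀), u t =ᵐ[volume] u' t :=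
    ae_restrict_of_ae_restrict_of_subset hsub4 (Measure.ae_ae_of_ae_prod huu)
  have hprod : ∀ (s : Set ℝ) (B : Set (Eu d)), (volume : Measure (ℝ × Eu d)).restrict (s ×ˢ B) =
      (volume.restrict s).prod (volume.restrict B) := fun s B => by
    rw [Measure.volume_eq_prod, Measure.prod_restrict]
  have hT' : ∀ᵐ t ∂volume.restrict (Ioo (t₀ - (R / 4) ^ α) t₀), T (u' t) ≤
      essSup (fun t => T (u t)) (volume.restrict (pastInterval α t₀ (R / 4))) := by
    filter_upwards [hut, ae_le_essSup (f := fun t => T (u t))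
      (μ := volume.restrict (pastInterval α t₀ (R / 4)))] with t h1 h2
    rwa [← hT _ _ h1]
  have hf : ∀ᵐ t ∂volume.restrict (Ioo (t₀ - (R / 4) ^ α) t₀),
      ∀ᵐ x ∂volume.restrict (Metric.ball x₀ (2 * R)), ‖f t x‖ₑ ≤
        eLpNorm (Function.uncurry f) ∞
            (volume.restrict (pastInterval α t₀ R ×ˢ Metric.ball x₀ (2 * R))) := by
    have h := ae_le_eLpNormEssSup (f := Function.uncurry f)
      (μ := (volume.restrict (pastInterval α t₀ R)).prod
        (volume.restrict (Metric.ball x₀ (2 * R))))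
    rw [eLpNorm_exponent_top, hprod]
    exact ae_restrict_of_ae_restrict_of_subset hsub4 (Measure.ae_ae_of_ae_prod h)
  have hY : ∫⁻ t in Ioo (t₀ - (R / 4) ^ α) t₀, sqNorm q (Metric.ball x₀ R) (u' t) =
      ENNReal.ofReal (m * R ^ (d * κ)) * ⨍⁻ t in pastInterval α t₀ (R / 4),
        (⨍⁻ x in Metric.ball x₀ R, ‖u t x‖ₑ ^ (2 * q) ∂volume) ^ (1 / q) ∂volume := by
    rw [show (d : ℝ) * κ = α + d / q by rw [div_eq_mul_one_div]; linarith, hm]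
    refine Eq.trans ?_ (lintegral_sqNorm_eq_laverage (α := α) hq0 hR (sub_sub_cancel _ _) u x₀)
    refine lintegral_congr_ae (hut.mono fun t ht => ?_)
    simp only [sqNorm]
    congr 1
    exact lintegral_congr_ae ((ae_restrict_of_ae ht).mono fun x hx => by simp only [hx])
  generalize essSup (fun t => T (u t)) (volume.restrict (pastInterval α t₀ (R / 4))) = Tm at *
  generalize eLpNorm (Function.uncurry f) ∞
    (volume.restrict (pastInterval α t₀ R ×ˢ Metric.ball x₀ (2 * R))) = Fm at *
  generalize (⨍⁻ t in pastInterval α t₀ (R / 4),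
    (⨍⁻ x in Metric.ball x₀ R, ‖u t x‖ₑ ^ (2 * q) ∂volume) ^ (1 / q) ∂volume) = Av at *
  refine essSup_le_of_forall_pos fun k hk hM => ?_
  have hM1 := (le_self_add.trans le_self_add).trans hM
  have hM2 := (le_add_self.trans le_self_add).trans hM
  have hM3 := le_add_self.trans hM
  have hκ1 : κ - 1 ≠ 0 := by linarith
  have hYk : ∫⁻ t in Ioo (t₀ - (R / 4) ^ α) t₀, sqNorm q (Metric.ball x₀ R) (u' t) ≤
      ENNReal.ofReal (c₁ * (δ ^ (κ / (κ - 1)) * R ^ (d * κ) * k ^ 2)) := by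
    have h1 := ofReal_sq_mul_le (by positivity) hk hM1
    have h2 : ((m / c₁) ^ (1 / 2 : ℝ)) ^ 2 = m / c₁ := by
      rw [← Real.rpow_mul_natCast (by positivity)]; norm_num
    have h3 : (δ ^ (-(κ / (κ - 1) / 2))) ^ 2 = (δ ^ (κ / (κ - 1)))⁻¹ := by
      rw [← Real.rpow_mul_natCast hδ.le, ← Real.rpow_neg hδ.le]
      congr 1
      push_cast
      ring
    rw [mul_pow, h2, h3] at h1
    have hδκ : 0 < δ ^ (κ / (κ - 1)) := by positivity
    have hRκ : 0 < R ^ (d * κ) := by positivity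
    rw [hY]
    calc _ = ENNReal.ofReal (c₁ * (δ ^ (κ / (κ - 1)) * R ^ (d * κ))) *
          (ENNReal.ofReal (m / c₁ * (δ ^ (κ / (κ - 1)))⁻¹) * Av) := by
          rw [← mul_assoc, ← ENNReal.ofReal_mul (by positivity)]
          congr 2
          field_simp
      _ ≤ ENNReal.ofReal (c₁ * (δ ^ (κ / (κ - 1)) * R ^ (d * κ))) * ENNReal.ofReal (k ^ 2) :=
          mul_le_mul' le_rfl h1
      _ = _ := by
          rw [← ENNReal.ofReal_mul (by positivity)]
          congr 1
          ring
  have key := H K adm Def F T f u' g' x₀ R δ t₀ k Tm Fm hR hδ hδ1 hk hCac hu hT' hf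
    (le_ofReal_div_of_ofReal_mul_le hδ hM2) (le_ofReal_div_of_ofReal_mul_le (by positivity) hM3)
    hYk
  have hmeas : MeasurableSet {z : ℝ × Eu d | u' z.1 z.2 ≤ k} :=
    measurableSet_le hu.measurable_u measurable_const
  have h1 : ∀ᵐ z ∂(volume.restrict (pastInterval α t₀ (R / 8))).prod
      (volume.restrict (Metric.ball x₀ (R / 2))), u' z.1 z.2 ≤ k :=
    (Measure.ae_prod_iff_ae_ae hmeas).2 key
  have h2 : ∀ᵐ z ∂(volume.restrict (pastInterval α t₀ (R / 8))).prod
      (volume.restrict (Metric.ball x₀ (R / 2))), u z.1 z.2 = u' z.1 z.2 :=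
    (Measure.absolutelyContinuous_of_le (Measure.prod_mono
      (Measure.restrict_mono hsub8 le_rfl) Measure.restrict_le_self)).ae_le huu
  rw [hprod]
  filter_upwards [h1, h2] with z h3 h4
  rwa [h4]

end LocalBoundedness

/-! ### Weak subsolutions to the primal and to the dual equation -/

section WeakSubsolutions

variable {d : ℕ} {K : Eu d → Eu d → ℝ≥0∞} {Ω : Set (Eu d)} {α : ℝ}

theorem isFormSubsolution_dual {θ : ℝ≥0∞} (hθ : 1 < θ) {a' a b : ℝ} (ha : a' < a)
    {D : Set (Eu d)} {Def : (Eu d → ℝ) → (Eu d → ℝ) → Prop}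
    {F : (Eu d → ℝ) → (Eu d → ℝ) → ℝ} {f u u' g' : ℝ → Eu d → ℝ}
    (hu : ∀ I' : Set ℝ, IsCompact I' → I' ⊆ Ioo a' b →
      ∫⁻ t in I', eLpNorm (u t) (2 * θ.conjExponent) volume ^ 2 < ∞)
    (huu : ∀ᵐ z ∂(volume.restrict (Ioo a' b)).prod (volume : Measure (Eu d)),
      u z.1 z.2 = u' z.1 z.2)
    (h : IsFormSubsolution K a b D (IsAdmissible K D) Def F f u' g') :
    IsFormSubsolution K a b D (IsAdmissibleDual K θ D) Def F f u' g' := by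
  obtain ⟨hq_top, hq1, -⟩ := toReal_inv_add_inv_conjExponent hθ
  have hIcc : ∀ q, q < b → Icc a q ⊆ Ioo a' b := fun q hq t ht =>
    ⟨ha.trans_le ht.1, ht.2.trans_lt hq⟩
  have hm : Measurable fun t => eLpNorm (u' t) (2 * θ.conjExponent) volume := by
    have h0 : 2 * θ.conjExponent ≠ 0 := mul_ne_zero two_ne_zero fun h => by
      rw [h, ENNReal.toReal_zero] at hq1; norm_num at hq1
    simp only [eLpNorm_eq_lintegral_rpow_enorm_toReal h0
      (ENNReal.mul_ne_top ENNReal.ofNat_ne_top hq_top)]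
    have h1 : Measurable fun z : ℝ × Eu d => ‖u' z.1 z.2‖ₑ ^ (2 * θ.conjExponent).toReal :=
      h.measurable_u.enorm.pow_const _
    exact h1.lintegral_prod_right'.pow_const _
  have hut : ∀ᵐ t ∂volume.restrict (Ioo a' b), u t =ᵐ[volume] u' t :=
    Measure.ae_ae_of_ae_prod huu
  have hfin := ae_lt_top_of_lintegral_Icc (a := a) (b := b) (hm.pow_const 2) fun q hq =>
    lt_of_eq_of_lt (lintegral_congr_ae
      ((ae_restrict_of_ae_restrict_of_subset (hIcc q hq) hut).mono fun t ht => by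
        simp only [eLpNorm_congr_ae ht])) (hu _ isCompact_Icc (hIcc q hq))
  refine ⟨h.toHasWeakTimeDeriv, ?_, h.le⟩
  filter_upwards [h.adm, hfin] with t h1 h2
  exact ⟨h1, (ENNReal.pow_lt_top_iff.1 h2).resolve_right two_ne_zero⟩

theorem exists_essSup_le_primal (hα0 : 0 < α) (hα2 : α < 2) (hαd : α < d)
    (hΩ : IsOpen Ω) (hK : Measurable (Function.uncurry K)) (hLevy : LevyIntegrable K)
    (hUpper : KernelUpperLoc K Ω α) (hCutoff : CutoffCondition (symPart K) Ω α)
    (hSob : SobolevCondition K Ω α) {θ : ℝ≥0∞} (hθ : ENNReal.ofReal (d / α) ≤ θ)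
    (hK1 : K1Loc K Ω α θ) {A : Set (Eu d)} (hAΩ : A ⊆ Ω)
    (hA : ENNReal.ofReal (d / α) < θ ∨ IsCompact A) :
    ∃ c : ℝ, 0 < c ∧
        ∀ (x₀ : Eu d) (t₀ R δ : ℝ), x₀ ∈ A → 0 < R → R ≤ 1 → Metric.ball x₀ (2 * R) ⊆ Ω →
          0 < δ → δ ≤ 1 →
        ∀ f u : ℝ → Eu d → ℝ,
          IsWeakSubsolution K (pastInterval α t₀ R) (Metric.ball x₀ (2 * R)) f u →
          (∀ᵐ p ∂((volume.restrict (pastInterval α t₀ R)).prod (volume : Measure (Eu d))),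
            0 ≤ u p.1 p.2) →
          essSup (fun p : ℝ × Eu d => ENNReal.ofReal (u p.1 p.2))
              (volume.restrict (pastInterval α t₀ (R / 8) ×ˢ Metric.ball x₀ (R / 2))) ≤
            ENNReal.ofReal (c * δ ^ (-((d + α) / (2 * α)))) *
                (⨍⁻ t in pastInterval α t₀ (R / 4), ⨍⁻ x in Metric.ball x₀ R,
                  ‖u t x‖ₑ ^ 2 ∂volume ∂volume) ^ (1 / 2 : ℝ) +
              ENNReal.ofReal δ *
                essSup (fun t => tail K α (u t) R x₀)
                  (volume.restrict (pastInterval α t₀ (R / 4))) +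
              ENNReal.ofReal (δ * R ^ α) *
                eLpNorm (Function.uncurry f) ∞
                  (volume.restrict (pastInterval α t₀ R ×ˢ Metric.ball x₀ (2 * R))) := by
  have hd : (0 : ℝ) < d := hα0.trans hαd
  obtain ⟨b₀, C, hb₀, hC, HC⟩ := exists_caccioppoliEstimate_primal hα0 hα2 hαd hΩ hK hLevy hUpper
    hCutoff hSob hθ hK1 hAΩ hA
  obtain ⟨c, hc, H⟩ := exists_essSup_le_of_caccioppoli (d := d) (α := α) (β := α)
    (p := d / (d - α)) (q := 1) (κ := 1 + α / d) hα0 (by field_simp; ring) (by ring) hb₀ hC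
    (div_pos hd (by linarith)) le_rfl (by have := div_pos hα0 hd; linarith)
    (by field_simp; ring)
  refine ⟨c, hc, fun x₀ t₀ R δ hx₀ hR hR1 hsub hδ hδ1 f u ⟨hu, g, hg, hle⟩ hpos => ?_⟩
  have ha : t₀ - R ^ α < t₀ - (R / 4) ^ α := by
    have : (R / 4) ^ α < R ^ α := Real.rpow_lt_rpow (by positivity) (by linarith) hα0
    linarith
  obtain ⟨u', g', huu, hu'⟩ := exists_isFormSubsolution (Def := FormDefined K) (F := form K) ha
    measure_ball_lt_top.ne hK
    (fun v w φ h hd => ⟨hd.1.congr (symIntegrand_congr_left h φ).symm,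
      hd.2.congr (antiIntegrand_congr_left h φ).symm⟩)
    (fun v w φ h => by
      rw [form, form, integral_congr_ae (symIntegrand_congr_left h φ),
        integral_congr_ae (antiIntegrand_congr_left h φ)]) hu hg hle hpos
  have key := H K _ _ _ _ f u u' g' x₀ t₀ R δ hR hδ hδ1
    (fun r ρ hr hρ hrρ => HC x₀ R r ρ hx₀ hR hR1 hsub hr hρ hrρ)
    (fun v w h => tail_congr_ae h α R x₀) huu hu'
  rw [show (1 + α / d) / (1 + α / d - 1) / 2 = (d + α) / (2 * α) by
    rw [add_sub_cancel_left]; field_simp] at key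
  simpa using key

theorem exists_essSup_le_dual (hα0 : 0 < α) (hα2 : α < 2) (hαd : α < d)
    (hK : Measurable (Function.uncurry K)) (hLevy : LevyIntegrable K)
    (hUpper : KernelUpperLoc K Ω α) (hCutoff : CutoffCondition (symPart K) Ω α)
    (hSob : SobolevCondition K Ω α) {θ : ℝ≥0∞} (hθ : ENNReal.ofReal (d / α) < θ)
    (hK1 : K1Glob K Ω α θ) {θ' κ κ' : ℝ} (hθ' : θ' = θ.conjExponent.toReal)
    (hκ : κ = 1 + α / d - θ⁻¹.toReal) (hκ' : κ' = κ / (κ - 1)) :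
    ∃ c : ℝ, 0 < c ∧
        ∀ (x₀ : Eu d) (t₀ R δ : ℝ), 0 < R → R ≤ 1 → Metric.ball x₀ (2 * R) ⊆ Ω →
          0 < δ → δ ≤ 1 →
        ∀ f u : ℝ → Eu d → ℝ,
          IsWeakSubsolutionDual K θ (pastInterval α t₀ R) (Metric.ball x₀ (2 * R)) f u →
          (∀ᵐ p ∂((volume.restrict (pastInterval α t₀ R)).prod (volume : Measure (Eu d))),
            0 ≤ u p.1 p.2) →
          essSup (fun p : ℝ × Eu d => ENNReal.ofReal (u p.1 p.2))
              (volume.restrict (pastInterval α t₀ (R / 8) ×ˢ Metric.ball x₀ (R / 2))) ≤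
            ENNReal.ofReal (c * δ ^ (-(κ' / 2))) *
                (⨍⁻ t in pastInterval α t₀ (R / 4), (⨍⁻ x in Metric.ball x₀ R,
                  ‖u t x‖ₑ ^ (2 * θ') ∂volume) ^ (1 / θ') ∂volume) ^ (1 / 2 : ℝ) +
              ENNReal.ofReal δ *
                essSup (fun t => tail (fun x y => K y x) α (u t) R x₀)
                  (volume.restrict (pastInterval α t₀ (R / 4))) +
              ENNReal.ofReal (δ * R ^ α) *
                eLpNorm (Function.uncurry f) ∞
                  (volume.restrict (pastInterval α t₀ R ×ˢ Metric.ball x₀ (2 * R))) := by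
  have hd : (0 : ℝ) < d := hα0.trans hαd
  have hθ1 : 1 < θ := by
    refine lt_of_le_of_lt ?_ hθ
    rw [← ENNReal.ofReal_one]
    exact ENNReal.ofReal_le_ofReal ((one_le_div hα0).2 hαd.le)
  obtain ⟨-, hq1, hqθ⟩ := toReal_inv_add_inv_conjExponent hθ1
  rw [← hθ'] at hq1 hqθ
  have hq0 : θ' ≠ 0 := by linarith
  have hκθ : κ - 1 = α / d - θ⁻¹.toReal := by rw [hκ]; ring
  have hκ1 : 1 < κ := by
    have h1 : θ⁻¹ < ENNReal.ofReal (α / d) := by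
      rw [← inv_div, ENNReal.ofReal_inv_of_pos (div_pos hd hα0)]
      exact ENNReal.inv_lt_inv.2 hθ
    have h2 := (ENNReal.lt_ofReal_iff_toReal_lt h1.ne_top).1 h1
    linarith
  obtain ⟨b₀, C, hb₀, hC, HC⟩ := exists_caccioppoliEstimate_dual hα0 hα2 hαd hK hLevy hUpper
    hCutoff hSob hθ hK1
  rw [← hθ'] at HC
  obtain ⟨c, hc, H⟩ := exists_essSup_le_of_caccioppoli (d := d) (α := α)
    (β := α - d * (1 - 1 / θ')) (p := d / (d - α)) (q := θ') (κ := κ) hα0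
    (by rw [hqθ, hκθ]; field_simp; ring) rfl hb₀ hC (div_pos hd (by linarith)) hq1 hκ1
    (by rw [hqθ, hκθ]; field_simp; ring)
  refine ⟨c, hc, fun x₀ t₀ R δ hR hR1 hsub hδ hδ1 f u ⟨hu, hul, g, hg, hle⟩ hpos => ?_⟩
  have ha : t₀ - R ^ α < t₀ - (R / 4) ^ α := by
    have : (R / 4) ^ α < R ^ α := Real.rpow_lt_rpow (by positivity) (by linarith) hα0
    linarith
  obtain ⟨u', g', huu, hu'⟩ := exists_isFormSubsolution (Def := fun u φ => FormDefined K φ u)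
    (F := fun u φ => form K φ u) ha
    measure_ball_lt_top.ne hK
    (fun v w φ h hd => ⟨hd.1.congr (symIntegrand_congr_right h φ).symm,
      hd.2.congr (antiIntegrand_congr_right h φ).symm⟩)
    (fun v w φ h => by
      simp only [form, integral_congr_ae (symIntegrand_congr_right (K := K) h φ),
        integral_congr_ae (antiIntegrand_congr_right (K := K) h φ)]) hu hg hle hpos
  have key := H K _ _ _ _ f u u' g' x₀ t₀ R δ hR hδ hδ1
    (fun r ρ hr hρ hrρ => HC x₀ R r ρ hR hR1 hsub hr hρ hrρ)
    (fun v w h => tail_congr_ae h α R x₀) huu (isFormSubsolution_dual hθ1 ha hul huu hu')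
  rwa [← hκ'] at key

end WeakSubsolutions

end NonlocalParabolic

open NonlocalParabolic in
theorem mainTheorem3 (d : ℕ) (α : ℝ) (hα0 : 0 < α) (hα2 : α < 2) (hαd : α < d)
    (Ω : Set (Eu d)) (hΩ : IsOpen Ω)
    (K : Eu d → Eu d → ℝ≥0∞) (hK : Measurable (Function.uncurry K))
    (hLevy : LevyIntegrable K)
    (hUpper : KernelUpperLoc K Ω α)
    (hCutoff : CutoffCondition (symPart K) Ω α)
    (hSob : SobolevCondition K Ω α) :
    -- (i) subsolutions to the primal equation
    (∀ θ : ℝ≥0∞, ENNReal.ofReal (d / α) ≤ θ → K1Loc K Ω α θ →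
      ∀ A : Set (Eu d), A ⊆ Ω → (ENNReal.ofReal (d / α) < θ ∨ IsCompact A) →
      ∃ c : ℝ, 0 < c ∧
        ∀ (x₀ : Eu d) (t₀ R δ : ℝ), x₀ ∈ A → 0 < R → R ≤ 1 → Metric.ball x₀ (2 * R) ⊆ Ω →
          0 < δ → δ ≤ 1 →
        ∀ f u : ℝ → Eu d → ℝ,
          MemLp (Function.uncurry f) ∞
            (volume.restrict (pastInterval α t₀ R ×ˢ Metric.ball x₀ (2 * R))) →
          IsWeakSubsolution K (pastInterval α t₀ R) (Metric.ball x₀ (2 * R)) f u →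
          (∀ᵐ p ∂((volume.restrict (pastInterval α t₀ R)).prod (volume : Measure (Eu d))),
            0 ≤ u p.1 p.2) →
          essSup (fun p : ℝ × Eu d => ENNReal.ofReal (u p.1 p.2))
              (volume.restrict (pastInterval α t₀ (R / 8) ×ˢ Metric.ball x₀ (R / 2))) ≤
            ENNReal.ofReal (c * δ ^ (-((d + α) / (2 * α)))) *
                (⨍⁻ t in pastInterval α t₀ (R / 4), ⨍⁻ x in Metric.ball x₀ R,
                  ‖u t x‖ₑ ^ 2 ∂volume ∂volume) ^ (1 / 2 : ℝ) +
              ENNReal.ofReal δ *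
                essSup (fun t => tail K α (u t) R x₀)
                  (volume.restrict (pastInterval α t₀ (R / 4))) +
              ENNReal.ofReal (δ * R ^ α) *
                eLpNorm (Function.uncurry f) ∞
                  (volume.restrict (pastInterval α t₀ R ×ˢ Metric.ball x₀ (2 * R)))) ∧
    -- (ii) subsolutions to the dual equation
    (∀ θ : ℝ≥0∞, ENNReal.ofReal (d / α) < θ → K1Glob K Ω α θ →
      ∀ θ' κ κ' : ℝ, θ' = θ.conjExponent.toReal → κ = 1 + α / d - θ⁻¹.toReal →
        κ' = κ / (κ - 1) →
      ∃ c : ℝ, 0 < c ∧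
        ∀ (x₀ : Eu d) (t₀ R δ : ℝ), 0 < R → R ≤ 1 → Metric.ball x₀ (2 * R) ⊆ Ω →
          0 < δ → δ ≤ 1 →
        ∀ f u : ℝ → Eu d → ℝ,
          MemLp (Function.uncurry f) ∞
            (volume.restrict (pastInterval α t₀ R ×ˢ Metric.ball x₀ (2 * R))) →
          IsWeakSubsolutionDual K θ (pastInterval α t₀ R) (Metric.ball x₀ (2 * R)) f u →
          (∀ᵐ p ∂((volume.restrict (pastInterval α t₀ R)).prod (volume : Measure (Eu d))),
            0 ≤ u p.1 p.2) →
          essSup (fun p : ℝ × Eu d => ENNReal.ofReal (u p.1 p.2))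
              (volume.restrict (pastInterval α t₀ (R / 8) ×ˢ Metric.ball x₀ (R / 2))) ≤
            ENNReal.ofReal (c * δ ^ (-(κ' / 2))) *
                (⨍⁻ t in pastInterval α t₀ (R / 4),
                  (⨍⁻ x in Metric.ball x₀ R, ‖u t x‖ₑ ^ (2 * θ') ∂volume) ^ (1 / θ') ∂volume) ^ (1 / 2 : ℝ) +
              ENNReal.ofReal δ *
                essSup (fun t => tail (fun x y => K y x) α (u t) R x₀)
                  (volume.restrict (pastInterval α t₀ (R / 4))) +
              ENNReal.ofReal (δ * R ^ α) *
                eLpNorm (Function.uncurry f) ∞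
                  (volume.restrict (pastInterval α t₀ R ×ˢ Metric.ball x₀ (2 * R)))) := by
  refine ⟨fun θ hθ hK1 A hAΩ hA => ?_, fun θ hθ hK1 θ' κ κ' hθ' hκ hκ' => ?_⟩
  · obtain ⟨c, hc, H⟩ := exists_essSup_le_primal hα0 hα2 hαd hΩ hK hLevy hUpper hCutoff hSob hθ
      hK1 hAΩ hA
    exact ⟨c, hc, fun x₀ t₀ R δ hx₀ hR hR1 hsub hδ hδ1 f u _ hu hpos =>
      H x₀ t₀ R δ hx₀ hR hR1 hsub hδ hδ1 f u hu hpos⟩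
  · obtain ⟨c, hc, H⟩ := exists_essSup_le_dual hα0 hα2 hαd hK hLevy hUpper hCutoff hSob hθ
      hK1 hθ' hκ hκ'
    exact ⟨c, hc, fun x₀ t₀ R δ hR hR1 hsub hδ hδ1 f u _ hu hpos =>
      H x₀ t₀ R δ hR hR1 hsub hδ hδ1 f u hu hpos⟩
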